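/- Setting. Let $X$ be a smooth vector field on a three-dimensional manifold. A connection $\Gamma$ from $p$ to $q$ is the closure of an orbit of $X$ that tends to $p$ in negative time and to $q$ in positive time, where $p\neq q$ are hyperbolic saddles near each of which there are $C^1$ coordinates in which $X$ is linear. It is of type $(i\text{-}j)$ if $DX(p)$ has $i$ and $DX(q)$ has $j$ eigenvalues of negative real part (stable eigenvalues), counted with multiplicity; eigenvalues of positive real part are called unstable. A connection of type $(1\text{-}1)$ belongs to $(1\text{-}1)^g_{\mathbb C}$ if the two unstable eigenvalues at $q$ are non-real. It belongs to $(1\text{-}1)^g_{\mathbb R}$ if these are real and distinct and, in $C^1$ linearizing coordinates at $q$, the unstable manifold of $p$ is transverse along $\Gamma$, near $q$, to both invariant planes spanned by the stable direction at $q$ and by the weak, respectively the strong, unstable direction at $q$. Put $(1\text{-}1)^g=(1\text{-}1)^g_{\mathbb R}\cup(1\text{-}1)^g_{\mathbb C}$. A connection of type $(2\text{-}2)$ belongs to $(2\text{-}2)^g_{\mathbb C}$ if the two stable eigenvalues at $p$ are non-real. It belongs to $(2\text{-}2)^g_{\mathbb R}$ if these are real and distinct and, in $C^1$ linearizing coordinates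 at $p$, the stable manifold of $q$ is transverse along $\Gamma$, near $p$, to both invariant planes spanned by the unstable direction at $p$ and by the weak, respectively the strong, stable direction at $p$. Put $(2\text{-}2)^g=(2\text{-}2)^g_{\mathbb R}\cup(2\text{-}2)^g_{\mathbb C}$. Two connections $\Gamma$ and $\tilde\Gamma$ (possibly of vector fields on different manifolds) are topologically equivalent if there is a homeomorphism from a neighbourhood of $\Gamma$ onto a neighbourhood of $\tilde\Gamma$ that maps $\Gamma$ onto $\tilde\Gamma$ and maps orbits to orbits, preserving their orientation by time. Theorem. Two connections of $(1\text{-}1)^g$ are topologically equivalent if and only if they are in the same subset $(1\text{-}1)^g_{\mathbb R}$ or $(1\text{-}1)^g_{\mathbb C}$. Two connections of $(2\text{-}2)^g$ are topologically equivalent if and only if they are in the same subset $(2\text{-}2)^g_{\mathbb R}$ or $(2\text{-}2)^g_{\mathbb C}$. -/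

import Mathlib

open Set Filter Topology
open scoped Manifold ContDiff

noncomputable section

namespace SaddleConn

/-- The model space `ℝ³` with its Euclidean norm. -/
abbrev E3 : Type := EuclideanSpace ℝ (Fin 3)

variable {M : Type*} [TopologicalSpace M] [ChartedSpace E3 M]
variable {N : Type*} [TopologicalSpace N] [ChartedSpace E3 N]

/-- The linear part `DX(p)` of a vector field `X` at a point `p`: the derivative at `p` of the
expression of `X` in the preferred chart at `p`.  At a zero of `X` it is the intrinsic
endomorphism `DX(p)` of `T_p M` (which Mathlib identifies with `ℝ³` through that chart). -/
def linearPart (X : (x : M) → TangentSpace (𝓡 3) x) (p : M) : E3 →L[ℝ] E3 :=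
  fderiv ℝ
    (fun y : E3 =>
      (mfderiv (𝓡 3) 𝓘(ℝ, E3) (extChartAt (𝓡 3) p) ((extChartAt (𝓡 3) p).symm y)
        (X ((extChartAt (𝓡 3) p).symm y)) : E3))
    (extChartAt (𝓡 3) p p)

/-- The complex eigenvalues of `DX(p)`, counted with algebraic multiplicity. -/
def eigenvaluesAt (X : (x : M) → TangentSpace (𝓡 3) x) (p : M) : Multiset ℂ :=
  (LinearMap.charpoly (linearPart X p : E3 →ₗ[ℝ] E3)).aroots ℂ

/-- The stable eigenvalues of `X` at `p`, with multiplicity. -/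
def stableEigenvalues (X : (x : M) → TangentSpace (𝓡 3) x) (p : M) : Multiset ℂ :=
  (eigenvaluesAt X p).filter (fun z => z.re < 0)

/-- The unstable eigenvalues of `X` at `p`, with multiplicity. -/
def unstableEigenvalues (X : (x : M) → TangentSpace (𝓡 3) x) (p : M) : Multiset ℂ :=
  (eigenvaluesAt X p).filter (fun z => 0 < z.re)

/-- The Morse index of `X` at `p`: the number of stable eigenvalues (`= dim W^s(p)`). -/
def morseIndex (X : (x : M) → TangentSpace (𝓡 3) x) (p : M) : ℕ :=
  Multiset.card (stableEigenvalues X p)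

/-- `p` is a hyperbolic saddle of `X`. -/
structure IsHyperbolicSaddle (X : (x : M) → TangentSpace (𝓡 3) x) (p : M) : Prop where
  zero : X p = 0
  hyperbolic : ∀ z ∈ eigenvaluesAt X p, z.re ≠ 0
  exists_stable : stableEigenvalues X p ≠ 0
  exists_unstable : unstableEigenvalues X p ≠ 0

/-- The derivative at `x` of a coordinate system `φ`. -/
def coordDeriv (φ : OpenPartialHomeomorph M E3) (x : M) : E3 →L[ℝ] E3 :=
  mfderiv (𝓡 3) 𝓘(ℝ, E3) φ x

/-- `φ` is a `C¹` coordinate system on a neighbourhood of `p`, centred at `p`, in which the vector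
field `X` is linear, equal to its linear part `DX(p)`. -/
structure IsLinearizingChart (X : (x : M) → TangentSpace (𝓡 3) x) (p : M)
    (φ : OpenPartialHomeomorph M E3) : Prop where
  mem_source : p ∈ φ.source
  map_base : φ p = 0
  contMDiffOn : ContMDiffOn (𝓡 3) 𝓘(ℝ, E3) 1 φ φ.source
  contMDiffOn_symm : ContMDiffOn 𝓘(ℝ, E3) (𝓡 3) 1 φ.symm φ.target
  map_field : ∀ x ∈ φ.source, coordDeriv φ x (X x) = linearPart X p (φ x)

/-- The points whose backward orbit stays in `U` and tends to `p`:
the unstable manifold of `p` for the restriction of `X` to `U`. -/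
def unstableSet (X : (x : M) → TangentSpace (𝓡 3) x) (U : Set M) (p : M) : Set M :=
  {x | ∃ c : ℝ → M, c 0 = x ∧ IsMIntegralCurveOn c X (Iic 0) ∧ (∀ t ≤ 0, c t ∈ U) ∧
    Tendsto c atBot (𝓝 p)}

/-- The points whose forward orbit stays in `U` and tends to `q`:
the stable manifold of `q` for the restriction of `X` to `U`. -/
def stableSet (X : (x : M) → TangentSpace (𝓡 3) x) (U : Set M) (q : M) : Set M :=
  {x | ∃ c : ℝ → M, c 0 = x ∧ IsMIntegralCurveOn c X (Ici 0) ∧ (∀ t ≥ 0, c t ∈ U) ∧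
    Tendsto c atTop (𝓝 q)}

/-- The velocities at `x` of curves that run in `S`; for an embedded submanifold `S` this is its
tangent space at `x`. -/
def velocities (S : Set M) (x : M) : Set E3 :=
  {v | ∃ c : ℝ → M, c 0 = x ∧ (∀ᶠ s in 𝓝 (0 : ℝ), c s ∈ S) ∧
    HasMFDerivAt 𝓘(ℝ, ℝ) (𝓡 3) c 0 ((1 : ℝ →L[ℝ] ℝ).smulRight v)}

variable (M) in
/-- A connection between two distinct hyperbolic saddles `p` and `q`, both `C¹`-linearisable, of a
smooth vector field `X`: `orbit` is an orbit of `X` that tends to `p` in negative time and to `q`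
in positive time.  The manifold `M` on which `X` is defined may be any neighbourhood of the
connection. -/
structure SaddleConnection [IsManifold (𝓡 3) ∞ M] where
  X : (x : M) → TangentSpace (𝓡 3) x
  smooth : ContMDiff (𝓡 3) (𝓡 3).tangent ∞
    (fun x => (⟨x, X x⟩ : TangentBundle (𝓡 3) M))
  p : M
  q : M
  p_ne_q : p ≠ q
  saddle_p : IsHyperbolicSaddle X p
  saddle_q : IsHyperbolicSaddle X q
  linearizable_p : ∃ φ : OpenPartialHomeomorph M E3, IsLinearizingChart X p φ
  linearizable_q : ∃ φ : OpenPartialHomeomorph M E3, IsLinearizingChart X q φ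
  orbit : ℝ → M
  isMIntegralCurve : IsMIntegralCurve orbit X
  tendsto_p : Tendsto orbit atBot (𝓝 p)
  tendsto_q : Tendsto orbit atTop (𝓝 q)

/-- `h`, a homeomorphism between open sets, maps every arc of orbit of `X` contained in its source
into an orbit of `Y` contained in its target, preserving the orientation by time. -/
def MapsOrbits (X : (x : M) → TangentSpace (𝓡 3) x) (Y : (x : N) → TangentSpace (𝓡 3) x)
    (h : OpenPartialHomeomorph M N) : Prop :=
  ∀ (c : ℝ → M) (a b : ℝ), a < b → IsMIntegralCurveOn c X (Icc a b) →
    (∀ t ∈ Icc a b, c t ∈ h.source) →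
    ∃ (d : ℝ → N) (σ : ℝ → ℝ), StrictMonoOn σ (Icc a b) ∧ ContinuousOn σ (Icc a b) ∧
      IsMIntegralCurveOn d Y (Icc (σ a) (σ b)) ∧
      (∀ t ∈ Icc (σ a) (σ b), d t ∈ h.target) ∧
      ∀ t ∈ Icc a b, h (c t) = d (σ t)

namespace SaddleConnection

variable [IsManifold (𝓡 3) ∞ M] [IsManifold (𝓡 3) ∞ N]

/-- The connection as a subset of `M`: the closure of the orbit. -/
def carrier (Γ : SaddleConnection M) : Set M := closure (range Γ.orbit)

/-- Topological equivalence of two connections: a homeomorphism from a neighbourhood of `Γ` to a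
neighbourhood of `Γ'`, with image of `Γ` equal to `Γ'`, that maps oriented orbits to oriented
orbits, as does its inverse. -/
def TopEquiv (Γ : SaddleConnection M) (Γ' : SaddleConnection N) : Prop :=
  ∃ h : OpenPartialHomeomorph M N, Γ.carrier ⊆ h.source ∧ h '' Γ.carrier = Γ'.carrier ∧
    MapsOrbits Γ.X Γ'.X h ∧ MapsOrbits Γ'.X Γ.X h.symm

/-- The tangent space at `x ∈ Γ` of the unstable manifold of `p` in small neighbourhoods of `Γ`. -/
def unstableTangent (Γ : SaddleConnection M) (x : M) : Set E3 :=
  {v | ∀ U : Set M, IsOpen U → Γ.carrier ⊆ U → v ∈ velocities (unstableSet Γ.X U Γ.p) x}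

/-- The tangent space at `x ∈ Γ` of the stable manifold of `q` in small neighbourhoods of `Γ`. -/
def stableTangent (Γ : SaddleConnection M) (x : M) : Set E3 :=
  {v | ∀ U : Set M, IsOpen U → Γ.carrier ⊆ U → v ∈ velocities (stableSet Γ.X U Γ.q) x}

/-- The subspace of `T_q M` spanned by the stable directions and the eigendirection of the
unstable eigenvalue `μ`.  If `q` has Morse index one and real unstable eigenvalues `μ < μ'`, this
is the plane `F_q^{u,s}` for `μ` and the plane `F_q^{uu,s}` for `μ'`. -/
def planeF (Γ : SaddleConnection M) (μ : ℝ) : Submodule ℝ E3 :=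
  (⨆ ν : {ν : ℝ // ν < 0}, Module.End.eigenspace (linearPart Γ.X Γ.q : E3 →ₗ[ℝ] E3) ν) ⊔
    Module.End.eigenspace (linearPart Γ.X Γ.q : E3 →ₗ[ℝ] E3) μ

/-- The subspace of `T_p M` spanned by the unstable directions and the eigendirection of the
stable eigenvalue `μ`.  If `p` has Morse index two and real stable eigenvalues `μ' < μ`, this
is the plane `E_p^{s,u}` for `μ` and the plane `E_p^{ss,u}` for `μ'`. -/
def planeE (Γ : SaddleConnection M) (μ : ℝ) : Submodule ℝ E3 :=
  (⨆ ν : {ν : ℝ // 0 < ν}, Module.End.eigenspace (linearPart Γ.X Γ.p : E3 →ₗ[ℝ] E3) ν) ⊔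
    Module.End.eigenspace (linearPart Γ.X Γ.p : E3 →ₗ[ℝ] E3) μ

/-- Transversality of the unstable manifold of `p`, along the end of `Γ` at `q`, to the invariant
surface which is the plane `P` in the linearizing chart `φ` at `q`. -/
def UnstableTransverse (Γ : SaddleConnection M) (φ : OpenPartialHomeomorph M E3)
    (P : Submodule ℝ E3) : Prop :=
  ∀ᶠ t in atTop, Submodule.span ℝ (Γ.unstableTangent (Γ.orbit t)) ⊔
    P.comap (coordDeriv φ (Γ.orbit t) : E3 →ₗ[ℝ] E3) = ⊤

/-- Transversality of the stable manifold of `q`, along the end of `Γ` at `p`, to the invariant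
surface which is the plane `P` in the linearizing chart `φ` at `p`. -/
def StableTransverse (Γ : SaddleConnection M) (φ : OpenPartialHomeomorph M E3)
    (P : Submodule ℝ E3) : Prop :=
  ∀ᶠ t in atBot, Submodule.span ℝ (Γ.stableTangent (Γ.orbit t)) ⊔
    P.comap (coordDeriv φ (Γ.orbit t) : E3 →ₗ[ℝ] E3) = ⊤

/-- `Γ` is of type `(i-j)`: `p` has Morse index `i` and `q` has Morse index `j`. -/
def HasType (Γ : SaddleConnection M) (i j : ℕ) : Prop :=
  morseIndex Γ.X Γ.p = i ∧ morseIndex Γ.X Γ.q = j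

/-- The generic connections of type `(1-1)` whose unstable eigenvalues at `q` are real: these are
distinct and, in some `C¹` linearizing coordinates at `q`, the unstable manifold of `p` is
transverse to the weak and the strong plane at `q`. -/
def Generic11Real (Γ : SaddleConnection M) : Prop :=
  Γ.HasType 1 1 ∧ (∀ z ∈ unstableEigenvalues Γ.X Γ.q, z.im = 0) ∧
    (unstableEigenvalues Γ.X Γ.q).Nodup ∧
    ∃ φ : OpenPartialHomeomorph M E3, IsLinearizingChart Γ.X Γ.q φ ∧
      ∀ μ : ℝ, (μ : ℂ) ∈ unstableEigenvalues Γ.X Γ.q → Γ.UnstableTransverse φ (Γ.planeF μ)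

/-- The generic connections of type `(1-1)` whose unstable eigenvalues at `q` are non-real. -/
def Generic11Complex (Γ : SaddleConnection M) : Prop :=
  Γ.HasType 1 1 ∧ ∀ z ∈ unstableEigenvalues Γ.X Γ.q, z.im ≠ 0

/-- The generic connections of type `(1-1)`. -/
def Generic11 (Γ : SaddleConnection M) : Prop := Γ.Generic11Real ∨ Γ.Generic11Complex

/-- The generic connections of type `(2-2)` whose stable eigenvalues at `p` are real: these are
distinct and, in some `C¹` linearizing coordinates at `p`, the stable manifold of `q` is
transverse to the weak and the strong plane at `p`. -/
def Generic22Real (Γ : SaddleConnection M) : Prop :=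
  Γ.HasType 2 2 ∧ (∀ z ∈ stableEigenvalues Γ.X Γ.p, z.im = 0) ∧
    (stableEigenvalues Γ.X Γ.p).Nodup ∧
    ∃ φ : OpenPartialHomeomorph M E3, IsLinearizingChart Γ.X Γ.p φ ∧
      ∀ μ : ℝ, (μ : ℂ) ∈ stableEigenvalues Γ.X Γ.p → Γ.StableTransverse φ (Γ.planeE μ)

/-- The generic connections of type `(2-2)` whose stable eigenvalues at `p` are non-real. -/
def Generic22Complex (Γ : SaddleConnection M) : Prop :=
  Γ.HasType 2 2 ∧ ∀ z ∈ stableEigenvalues Γ.X Γ.p, z.im ≠ 0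

/-- The generic connections of type `(2-2)`. -/
def Generic22 (Γ : SaddleConnection M) : Prop := Γ.Generic22Real ∨ Γ.Generic22Complex

end SaddleConnection

end SaddleConn

end

/-! Time reversal exchanges the types (2-2) and (1-1), so everything rests on connections of type
(1-1). There `q` has a one-dimensional stable and a two-dimensional unstable manifold, and the
question is how the unstable manifold of `p`, a surface containing the orbit of `Γ`, leaves a
neighbourhood of `q`.

The two classes are told apart by accumulation. With real eigenvalues at `q`, transversality to the
plane of the stable and the weak direction makes the surface near `q` a graph over the strong
direction, and the flow then presses it onto the strong line: its orbits accumulate on the unstable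
plane of `q` only along that line (`NormalForm.not_accumulation`). With non-real eigenvalues the
surface spirals and its orbits accumulate at every point of the plane near `q`
(`NormalForm.accumulation`). To make this a topological statement, unstable manifolds and
accumulation are expressed through arcs of orbits inside a neighbourhood of `Γ` (`reachSet`,
`accumulationSet`). An equivalence respects these sets, together with both saddles and the order of
the orbit, whence `not_topEquiv_of_accumulation`.

Within one class all connections have a common normal form. `Γ` is cut at a point `Γ(s)`. A chart
around the head, the half from `p` to the cut, turns the flow into `(e^{-ct} x, e^{ct} y)`; a chart
around the tail, the half from the cut to `q`, turns it into `(e^{-ct} x, e^{(1+ib)ct} y)` with `b =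
0` or `b = 1`. All rates can be reached because odd powers, radial powers and a Lyapunov function
provide the topological conjugacies. What remains is the transition between the charts. The `C¹`
hypotheses enter exactly here: the trace of the unstable manifold of `p` on the section `x = 1` is a
graph tangent to the imaginary axis, in suitable coordinates (`Generic11Real.exists_graphForm`,
`Generic11Complex.exists_graphForm`). Tangency is what allows a homeomorphism commuting with the
flow to straighten the graph (`continuous_relabel`). Time along orbits and angle along the trace are
then normalised as well, which gives `NormalForm`.

For two connections in the same normal form, the tails are matched by the identity of the charts. In
the head charts this prescribes a germ at `(0, 1)` that preserves the modulus of `y` and the sign of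
`x` and fixes the plane `x = 0`. Such a germ extends to an orbit-preserving homeomorphism around the
whole head: it is first extended on the space of orbits, cut off to the identity away from the given
direction (`orbitMap`), and then lifted by preserving a function that decreases along orbits
(`cutExt`). The two maps are glued in `NormalForm.topEquiv`. -/

noncomputable section

set_option linter.unusedSectionVars false

namespace SaddleConn

/-! ### Differentiable dependence of local flows on the initial point -/

section LocalFlow

variable {E : Type*} [NormedAddCommGroup E] [NormedSpace ℝ E]

/-- First order Taylor estimate along two solutions of an autonomous equation, forward in time. -/
lemma variational_estimate {f : E → E} {f' : E → E →L[ℝ] E} {x₀ : E} {ρ T : ℝ} {K L : NNReal}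
    (hf : ∀ y ∈ Metric.ball x₀ ρ, HasFDerivAt f (f' y) y)
    (hK : LipschitzOnWith K f (Metric.ball x₀ ρ)) (hL : LipschitzOnWith L f' (Metric.ball x₀ ρ))
    {A B : ℝ → E} {V : ℝ → E →L[ℝ] E} {h : E}
    (hA : ∀ t ∈ Icc 0 T, HasDerivWithinAt A (f (A t)) (Icc 0 T) t)
    (hB : ∀ t ∈ Icc 0 T, HasDerivWithinAt B (f (B t)) (Icc 0 T) t)
    (hV : ∀ t ∈ Icc 0 T, HasDerivWithinAt V ((f' (B t)).comp (V t)) (Icc 0 T) t)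
    (hA' : ∀ t ∈ Icc 0 T, A t ∈ Metric.ball x₀ ρ)
    (hB' : ∀ t ∈ Icc 0 T, B t ∈ Metric.ball x₀ (ρ / 2))
    (hV' : ∀ t ∈ Icc 0 T, ‖V t‖ ≤ 2) (hh : ‖h‖ < ρ / 4)
    (h0 : A 0 = B 0 + h) (hV0 : V 0 = ContinuousLinearMap.id ℝ E) :
    ∀ t ∈ Icc 0 T, ‖A t - B t - V t h‖ ≤ (4 * L * ‖h‖ ^ 2) * gronwallBound 0 K 1 t := by
  have hVh : ∀ t ∈ Icc 0 T, ‖V t h‖ ≤ 2 * ‖h‖ := fun t ht =>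
    ((V t).le_opNorm h).trans (by gcongr; exact hV' t ht)
  have hBV : ∀ t ∈ Icc 0 T, ∀ θ : ℝ, ‖θ‖ ≤ 2 * ‖h‖ → ∀ k : E, ‖k‖ ≤ 2 * ‖h‖ →
      B t + k ∈ Metric.ball x₀ ρ := by
    intro t ht θ _ k hk
    have h1 := hB' t ht
    rw [Metric.mem_ball, dist_eq_norm] at h1 ⊢
    calc ‖B t + k - x₀‖ = ‖(B t - x₀) + k‖ := by congr 1; abel
      _ ≤ ‖B t - x₀‖ + ‖k‖ := norm_add_le _ _
      _ < ρ := by linarith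
  have hnz : ‖(0:ℝ)‖ ≤ 2 * ‖h‖ := by simp
  -- Gronwall's inequality between the exact solution `A` and the approximate solution `B + V h`.
  -- The defect of the latter is the Taylor remainder of `f` at `B`, bounded through the Lipschitz
  -- constant of `f'` by `L (2‖h‖)²`.
  have key := dist_le_of_approx_trajectories_ODE_of_mem (v := fun _ => f) (K := K)
    (s := fun _ => Metric.ball x₀ ρ) (f := A) (g := fun t => B t + V t h)
    (f' := fun t => f (A t)) (g' := fun t => f (B t) + (f' (B t)) (V t h)) (a := 0) (b := T)
    (εf := 0) (εg := 4 * L * ‖h‖ ^ 2) (δ := 0) (fun t _ => hK)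
    (fun t ht => (hA t ht).continuousWithinAt)
    (fun t ht => (hA t (Ico_subset_Icc_self ht)).mono_of_mem_nhdsWithin
      (Icc_mem_nhdsGE_of_mem ht)) (fun t _ => by simp)
    (fun t ht => hA' t (Ico_subset_Icc_self ht))
    (fun t ht => ((hB t ht).continuousWithinAt).add
      (((hV t ht).continuousWithinAt).clm_apply continuousWithinAt_const))
    (fun t ht => by
      have h1 := (hB t (Ico_subset_Icc_self ht)).mono_of_mem_nhdsWithin
        (Icc_mem_nhdsGE_of_mem ht)
      have h2 := (hV t (Ico_subset_Icc_self ht)).mono_of_mem_nhdsWithin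
        (Icc_mem_nhdsGE_of_mem ht)
      have h3 := h2.clm_apply (hasDerivWithinAt_const (x := t) (s := Ici t) (c := h))
      simpa using h1.fun_add h3)
    (fun t ht => ?_)
    (fun t ht => hBV t (Ico_subset_Icc_self ht) 0 hnz _ (hVh t (Ico_subset_Icc_self ht)))
    (by simp [h0, hV0])
  · intro t ht
    have h1 := key t ht
    rw [zero_add, dist_eq_norm] at h1
    have h2 : gronwallBound 0 K (4 * L * ‖h‖ ^ 2) (t - 0)
        = (4 * L * ‖h‖ ^ 2) * gronwallBound 0 K 1 t := by
      rw [sub_zero]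
      by_cases hK0 : (K : ℝ) = 0
      · rw [hK0]; simp [gronwallBound_K0]
      · simp only [gronwallBound_of_K_ne_0 hK0]; ring
    rw [h2] at h1
    simpa [sub_sub] using h1
  · have ht' := Ico_subset_Icc_self ht
    rw [dist_eq_norm]
    have hconv : Convex ℝ (Metric.closedBall (B t) (2 * ‖h‖)) := convex_closedBall _ _
    have hsub : Metric.closedBall (B t) (2 * ‖h‖) ⊆ Metric.ball x₀ ρ := by
      intro y hy
      have := hBV t ht' 0 hnz (y - B t) (by rwa [Metric.mem_closedBall, dist_eq_norm] at hy)
      simpa using this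
    have := hconv.norm_image_sub_le_of_norm_hasFDerivWithin_le' (f := f) (f' := f')
      (φ := f' (B t)) (C := L * (2 * ‖h‖)) (x := B t) (y := B t + V t h)
      (fun y hy => (hf y (hsub hy)).hasFDerivWithinAt)
      (fun y hy => by
        have h1 := hL.dist_le_mul y (hsub hy) (B t)
          (hsub (Metric.mem_closedBall_self (by positivity)))
        rw [dist_eq_norm] at h1
        refine h1.trans ?_
        gcongr
        exact hy)
      (Metric.mem_closedBall_self (by positivity))
      (by rw [Metric.mem_closedBall, dist_eq_norm]; simpa using hVh t ht')
    have e : B t + V t h - B t = V t h := by abel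
    rw [e] at this
    calc ‖f (B t) + (f' (B t)) (V t h) - f (B t + V t h)‖
        = ‖f (B t + V t h) - f (B t) - (f' (B t)) (V t h)‖ := by
          rw [← norm_neg]; congr 1; abel
      _ ≤ L * (2 * ‖h‖) * ‖V t h‖ := this
      _ ≤ L * (2 * ‖h‖) * (2 * ‖h‖) := by gcongr; exact hVh t ht'
      _ = 4 * L * ‖h‖ ^ 2 := by ring

lemma hasDerivWithinAt_comp_neg {F : Type*} [NormedAddCommGroup F] [NormedSpace ℝ F]
    {g : ℝ → F} {g' : F} {u : ℝ} (h : HasDerivAt g g' (-u)) (s : Set ℝ) :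
    HasDerivWithinAt (fun t => g (-t)) (-g') s u := by
  have := h.scomp u (hasDerivAt_neg u)
  rw [neg_one_smul] at this
  exact this.hasDerivWithinAt

lemma hasFDerivAt_of_quadratic {g : E → E} {g' : E →L[ℝ] E} {x : E} {C r : ℝ} (hr : 0 < r)
    (h : ∀ k : E, ‖k‖ < r → ‖g (x + k) - g x - g' k‖ ≤ C * ‖k‖ ^ 2) : HasFDerivAt g g' x := by
  rw [hasFDerivAt_iff_isLittleO_nhds_zero]
  have h1 : (fun k : E => g (x + k) - g x - g' k) =O[𝓝 0] fun k : E => ‖k‖ ^ 2 := by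
    refine Asymptotics.IsBigO.of_bound C ?_
    filter_upwards [Metric.ball_mem_nhds (0 : E) hr] with k hk
    simpa using h k (by simpa using hk)
  refine h1.trans_isLittleO ?_
  have h2 : (fun k : E => ‖k‖ ^ 2) =o[𝓝 0] fun k : E => ‖k‖ ^ 1 :=
    (Asymptotics.isLittleO_pow_pow (𝕜 := ℝ) one_lt_two).comp_tendsto
      (by simpa using (continuous_norm (E := E)).tendsto 0)
  simpa using h2.trans_isBigO (Asymptotics.IsBigO.of_bound 1 (by simp))

/-- A `C²` vector field has a local flow that is `C¹` in the initial point. -/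
lemma exists_local_flow [CompleteSpace E] {f : E → E} {x₀ : E} (hf : ContDiffAt ℝ 2 f x₀)
    {W : Set E} (hW : W ∈ 𝓝 x₀) :
    ∃ ε > 0, ∃ r > 0, ∃ Φ : ℝ → E → E, (∀ x ∈ Metric.ball x₀ r, Φ 0 x = x ∧
      ∀ t ∈ Ioo (-ε) ε, HasDerivAt (fun s => Φ s x) (f (Φ t x)) t ∧ Φ t x ∈ W) ∧
      ∀ t ∈ Ioo (-ε) ε, ContDiffOn ℝ 1 (Φ t) (Metric.ball x₀ r) := by
  have hf' : ContDiffAt ℝ 1 (fderiv ℝ f) x₀ := hf.fderiv_right (by norm_num)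
  -- The equation is solved together with its variational equation `V' = f'(Φ) V`, `V(0) = id`. The
  -- joint field is `C¹`, so Picard–Lindelöf gives solutions jointly continuous in time and initial
  -- value; `V` is identified with the derivative of `Φ` afterwards.
  set G : E × (E →L[ℝ] E) → E × (E →L[ℝ] E) := fun z => (f z.1, (fderiv ℝ f z.1).comp z.2)
  have hG : ContDiffAt ℝ 1 G (x₀, ContinuousLinearMap.id ℝ E) := by
    refine ContDiffAt.prodMk ?_ ?_
    · exact ContDiffAt.comp _ (hf.of_le (by norm_num)) contDiffAt_fst
    · exact ContDiffAt.clm_comp (ContDiffAt.comp _ hf' contDiffAt_fst) contDiffAt_snd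
  obtain ⟨K, s, hs, hK⟩ := (hf.of_le (by norm_num : (1 : WithTop ℕ∞) ≤ 2)).exists_lipschitzOnWith
  obtain ⟨L, s', hs', hL⟩ := hf'.exists_lipschitzOnWith
  have hd : ∀ᶠ y in 𝓝 x₀, DifferentiableAt ℝ f y := by
    filter_upwards [hf.eventually (by simp)] with y hy
    exact hy.differentiableAt (by norm_num)
  obtain ⟨ρ, hρ, hρs⟩ := Metric.mem_nhds_iff.1 (inter_mem (inter_mem hs hs') (inter_mem hd hW))
  obtain ⟨ε, hε, a, r, L₀, K₀, hr, hpl⟩ := IsPicardLindelof.of_contDiffAt_one hG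
  obtain ⟨α, hα, hαc⟩ :=
    (hpl 0).exists_forall_mem_closedBall_eq_hasDerivWithinAt_continuousOn
  simp only [zero_sub, zero_add] at hα hαc
  have hr' : (0 : ℝ) < r := hr
  have hc0 : Metric.closedBall (x₀, ContinuousLinearMap.id ℝ E) (r : ℝ) ×ˢ Icc (-ε) ε ∈
      𝓝 ((x₀, ContinuousLinearMap.id ℝ E), (0 : ℝ)) :=
    prod_mem_nhds (Metric.closedBall_mem_nhds _ hr') (Icc_mem_nhds (by linarith) hε)
  have hα0 := (hα _ (Metric.mem_closedBall_self hr'.le)).1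
  have hev : ∀ᶠ z in 𝓝 ((x₀, ContinuousLinearMap.id ℝ E), (0 : ℝ)),
      (α z).1 ∈ Metric.ball x₀ (ρ / 2) ∧
      (α z).2 ∈ Metric.ball (ContinuousLinearMap.id ℝ E) 1 := by
    have hca : ContinuousAt α ((x₀, ContinuousLinearMap.id ℝ E), (0 : ℝ)) :=
      hαc.continuousAt hc0
    have hm : Metric.ball x₀ (ρ / 2) ×ˢ Metric.ball (ContinuousLinearMap.id ℝ E) 1 ∈
        𝓝 (α ((x₀, ContinuousLinearMap.id ℝ E), (0 : ℝ))) := by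
      rw [hα0]
      exact prod_mem_nhds (Metric.ball_mem_nhds _ (by positivity))
        (Metric.ball_mem_nhds _ one_pos)
    exact hca.eventually_mem hm
  obtain ⟨δ, hδ, hδs⟩ := Metric.mem_nhds_iff.1 (inter_mem hev hc0)
  have hmem : ∀ x ∈ Metric.ball x₀ δ, ∀ t ∈ Ioo (-δ) δ,
      (α ((x, ContinuousLinearMap.id ℝ E), t)).1 ∈ Metric.ball x₀ (ρ / 2) ∧
      (α ((x, ContinuousLinearMap.id ℝ E), t)).2 ∈ Metric.ball (ContinuousLinearMap.id ℝ E) 1 ∧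
      (x, ContinuousLinearMap.id ℝ E) ∈
        Metric.closedBall (x₀, ContinuousLinearMap.id ℝ E) (r : ℝ) ∧ t ∈ Icc (-ε) ε := by
    intro x hx t ht
    have : ((x, ContinuousLinearMap.id ℝ E), t) ∈
        Metric.ball ((x₀, ContinuousLinearMap.id ℝ E), (0 : ℝ)) δ := by
      rw [Metric.mem_ball, Prod.dist_eq, Prod.dist_eq, dist_self]
      simp only [Metric.mem_ball] at hx
      have h2 : dist t 0 < δ := by rw [Real.dist_eq, sub_zero]; exact abs_lt.2 ht
      exact max_lt (max_lt hx hδ) h2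
    have h3 := hδs this
    exact ⟨h3.1.1, h3.1.2, h3.2.1, h3.2.2⟩
  have hball : Metric.ball x₀ (ρ / 2) ⊆ Metric.ball x₀ ρ := Metric.ball_subset_ball (by linarith)
  set Φ : ℝ → E → E := fun t x => (α ((x, ContinuousLinearMap.id ℝ E), t)).1
  set V : ℝ → E → E →L[ℝ] E := fun t x => (α ((x, ContinuousLinearMap.id ℝ E), t)).2
  have hderiv : ∀ x ∈ Metric.ball x₀ δ, ∀ t ∈ Ioo (-δ) δ,
      HasDerivAt (fun s => α ((x, ContinuousLinearMap.id ℝ E), s))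
        (G (α ((x, ContinuousLinearMap.id ℝ E), t))) t := by
    intro x hx t ht
    obtain ⟨ε', hε', htε'⟩ : ∃ ε', ε' < δ ∧ |t| < ε' := exists_between (abs_lt.2 ht) |>.imp
      fun _ h => ⟨h.2, h.1⟩
    have hε'2 : Icc (-ε') ε' ⊆ Icc (-ε) ε := by
      have h0 := abs_nonneg t
      have h1 := (hmem x hx ε' ⟨by linarith, hε'⟩).2.2.2
      intro u hu
      exact ⟨by linarith [hu.1, h1.2], by linarith [hu.2, h1.2]⟩
    refine ((hα _ (hmem x hx t ht).2.2.1).2 t (hmem x hx t ht).2.2.2).hasDerivAt ?_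
    have := abs_lt.1 htε'
    exact mem_of_superset (Icc_mem_nhds this.1 this.2) hε'2
  have hΦd : ∀ x ∈ Metric.ball x₀ δ, ∀ t ∈ Ioo (-δ) δ,
      HasDerivAt (fun s => Φ s x) (f (Φ t x)) t := fun x hx t ht => by
    have := (ContinuousLinearMap.fst ℝ E (E →L[ℝ] E)).hasFDerivAt.comp_hasDerivAt t
      (hderiv x hx t ht)
    exact this
  have hVd : ∀ x ∈ Metric.ball x₀ δ, ∀ t ∈ Ioo (-δ) δ,
      HasDerivAt (fun s => V s x) ((fderiv ℝ f (Φ t x)).comp (V t x)) t := fun x hx t ht => by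
    have := (ContinuousLinearMap.snd ℝ E (E →L[ℝ] E)).hasFDerivAt.comp_hasDerivAt t
      (hderiv x hx t ht)
    exact this
  have hz : (0:ℝ) ∈ Ioo (-δ) δ := ⟨by linarith, hδ⟩
  have hinit : ∀ x ∈ Metric.ball x₀ δ, Φ 0 x = x ∧ V 0 x = ContinuousLinearMap.id ℝ E := by
    intro x hx
    have := (hα _ (hmem x hx 0 hz).2.2.1).1
    exact ⟨congrArg Prod.fst this, congrArg Prod.snd this⟩
  have hVn : ∀ x ∈ Metric.ball x₀ δ, ∀ t ∈ Ioo (-δ) δ, ‖V t x‖ ≤ 2 := by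
    intro x hx t ht
    have h1 := (hmem x hx t ht).2.1
    rw [Metric.mem_ball, dist_eq_norm] at h1
    calc ‖V t x‖ = ‖(V t x - ContinuousLinearMap.id ℝ E) + ContinuousLinearMap.id ℝ E‖ := by
          rw [sub_add_cancel]
      _ ≤ ‖V t x - ContinuousLinearMap.id ℝ E‖ + ‖ContinuousLinearMap.id ℝ E‖ := norm_add_le _ _
      _ ≤ 1 + 1 := add_le_add h1.le ContinuousLinearMap.norm_id_le
      _ = 2 := by norm_num
  have hfd : ∀ y ∈ Metric.ball x₀ ρ, HasFDerivAt f (fderiv ℝ f y) y := fun y hy =>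
    (hρs hy).2.1.hasFDerivAt
  have hKρ : LipschitzOnWith K f (Metric.ball x₀ ρ) := hK.mono fun y hy => (hρs hy).1.1
  have hLρ : LipschitzOnWith L (fderiv ℝ f) (Metric.ball x₀ ρ) := hL.mono fun y hy => (hρs hy).1.2
  have hF : ∀ x ∈ Metric.ball x₀ δ, ∀ t ∈ Ioo (-δ) δ, HasFDerivAt (Φ t) (V t x) x := by
    intro x hx t ht
    obtain ⟨η, hη, hηs⟩ := Metric.isOpen_iff.1 Metric.isOpen_ball x hx
    refine hasFDerivAt_of_quadratic (r := min η (ρ / 4)) (C := 4 * L * gronwallBound 0 K 1 |t|)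
      (by positivity) fun k hk => ?_
    have hxk : x + k ∈ Metric.ball x₀ δ := hηs (by
      simpa using hk.trans_le (min_le_left _ _))
    have hkρ : ‖k‖ < ρ / 4 := hk.trans_le (min_le_right _ _)
    rcases le_total 0 t with h0 | h0
    · have hsub : ∀ u ∈ Icc 0 t, u ∈ Ioo (-δ) δ := fun u hu =>
        ⟨by linarith [hu.1], by linarith [hu.2, ht.2]⟩
      have := variational_estimate (T := t) hfd hKρ hLρ (A := fun s => Φ s (x + k))
        (B := fun s => Φ s x) (V := fun s => V s x) (h := k)
        (fun u hu => (hΦd _ hxk u (hsub u hu)).hasDerivWithinAt)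
        (fun u hu => (hΦd _ hx u (hsub u hu)).hasDerivWithinAt)
        (fun u hu => (hVd _ hx u (hsub u hu)).hasDerivWithinAt)
        (fun u hu => hball (hmem _ hxk u (hsub u hu)).1)
        (fun u hu => (hmem _ hx u (hsub u hu)).1)
        (fun u hu => hVn x hx u (hsub u hu)) hkρ
        (by rw [(hinit _ hxk).1, (hinit _ hx).1]) (hinit _ hx).2 t ⟨h0, le_rfl⟩
      rw [abs_of_nonneg h0]
      calc _ ≤ _ := this
        _ = _ := by ring
    -- The estimate runs forward in time; negative times use the field `-f`.
    · have hsub : ∀ u ∈ Icc 0 (-t), -u ∈ Ioo (-δ) δ := fun u hu =>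
        ⟨by linarith [hu.2, ht.1], by linarith [hu.1]⟩
      have := variational_estimate (T := -t) (f := fun y => -f y) (f' := fun y => -fderiv ℝ f y)
        (x₀ := x₀) (ρ := ρ) (K := K) (L := L)
        (fun y hy => (hfd y hy).neg) hKρ.neg hLρ.neg
        (A := fun s => Φ (-s) (x + k)) (B := fun s => Φ (-s) x) (V := fun s => V (-s) x) (h := k)
        (fun u hu => by
          simpa using hasDerivWithinAt_comp_neg (hΦd _ hxk (-u) (hsub u hu)) _)
        (fun u hu => by
          simpa using hasDerivWithinAt_comp_neg (hΦd _ hx (-u) (hsub u hu)) _)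
        (fun u hu => by
          simpa using hasDerivWithinAt_comp_neg (hVd _ hx (-u) (hsub u hu)) _)
        (fun u hu => hball (hmem _ hxk (-u) (hsub u hu)).1)
        (fun u hu => (hmem _ hx (-u) (hsub u hu)).1)
        (fun u hu => hVn x hx (-u) (hsub u hu)) hkρ
        (by simp only [neg_zero]; rw [(hinit _ hxk).1, (hinit _ hx).1])
        (by simpa using (hinit _ hx).2) (-t) ⟨by linarith, le_rfl⟩
      rw [abs_of_nonpos h0]
      simp only [neg_neg] at this
      calc _ ≤ _ := this
        _ = _ := by ring
  refine ⟨δ, hδ, δ, hδ, Φ, fun x hx => ⟨(hinit x hx).1, fun t ht =>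
    ⟨hΦd x hx t ht, (hρs (hball (hmem x hx t ht).1)).2.2⟩⟩, fun t ht => ?_⟩
  have hVc : ContinuousOn (V t) (Metric.ball x₀ δ) := by
    have h1 : ContinuousOn (fun x => α ((x, ContinuousLinearMap.id ℝ E), t))
        (Metric.ball x₀ δ) :=
      hαc.comp (by fun_prop) fun x hx => ⟨(hmem x hx t ht).2.2.1, (hmem x hx t ht).2.2.2⟩
    exact continuous_snd.comp_continuousOn h1
  intro x hx
  exact (contDiffAt_one_iff.2 ⟨V t, Metric.ball x₀ δ, Metric.isOpen_ball.mem_nhds hx, hVc,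
    fun y hy => hF y hy t ht⟩).contDiffWithinAt

end LocalFlow

end SaddleConn

/-! ### Integral curves and local flows on a manifold -/

namespace SaddleConn

variable {M : Type*} [TopologicalSpace M] [ChartedSpace E3 M]

section Concatenation

variable {X : (x : M) → TangentSpace (𝓡 3) x}

lemma isMIntegralCurveOn_congr {γ γ' : ℝ → M} {s : Set ℝ} (h : IsMIntegralCurveOn γ X s)
    (e : EqOn γ' γ s) : IsMIntegralCurveOn γ' X s := by
  intro t ht
  have := (h t ht).congr_of_eventuallyEq (f₁ := γ')
    (by filter_upwards [self_mem_nhdsWithin] with u hu using e hu) (e ht)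
  rwa [← e ht] at this

lemma isMIntegralCurveOn_concat {γ₁ γ₂ : ℝ → M} {a b c : ℝ} (hab : a ≤ b) (hbc : b ≤ c)
    (h₁ : IsMIntegralCurveOn γ₁ X (Icc a b)) (h₂ : IsMIntegralCurveOn γ₂ X (Icc b c))
    (e : γ₁ b = γ₂ b) :
    IsMIntegralCurveOn (fun t => if t ≤ b then γ₁ t else γ₂ t) X (Icc a c) := by
  set γ : ℝ → M := fun t => if t ≤ b then γ₁ t else γ₂ t with hγ
  have e₁ : EqOn γ γ₁ (Icc a b) := fun t ht => by simp [hγ, ht.2]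
  have e₂ : EqOn γ γ₂ (Icc b c) := fun t ht => by
    rcases ht.1.eq_or_lt with h | h
    · subst h; simpa [hγ] using e
    · simp [hγ, not_le.2 h]
  have g₁ := isMIntegralCurveOn_congr h₁ e₁
  have g₂ := isMIntegralCurveOn_congr h₂ e₂
  intro t ht
  rcases lt_trichotomy t b with h | h | h
  · refine (g₁ t ⟨ht.1, h.le⟩).mono_of_mem_nhdsWithin ?_
    filter_upwards [self_mem_nhdsWithin, mem_nhdsWithin_of_mem_nhds (Iio_mem_nhds h)] with u hu hu'
    exact ⟨hu.1, le_of_lt hu'⟩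
  · subst h
    have := (g₁ t ⟨hab, le_rfl⟩).union (g₂ t ⟨le_rfl, hbc⟩)
    rwa [Icc_union_Icc_eq_Icc hab hbc] at this
  · refine (g₂ t ⟨h.le, ht.2⟩).mono_of_mem_nhdsWithin ?_
    filter_upwards [self_mem_nhdsWithin, mem_nhdsWithin_of_mem_nhds (Ioi_mem_nhds h)] with u hu hu'
    exact ⟨le_of_lt hu', hu.2⟩

lemma isMIntegralCurveOn_shift {γ : ℝ → M} {s s' : Set ℝ} (h : IsMIntegralCurveOn γ X s) (d : ℝ)
    (hs : ∀ t ∈ s', t + d ∈ s) : IsMIntegralCurveOn (fun t => γ (t + d)) X s' :=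
  (h.comp_add d).mono fun t ht => hs t ht

end Concatenation

variable [IsManifold (𝓡 3) ∞ M] {X : (x : M) → TangentSpace (𝓡 3) x}

/-- `X` is a smooth vector field. -/
abbrev SmoothField (X : (x : M) → TangentSpace (𝓡 3) x) : Prop :=
  ContMDiff (𝓡 3) (𝓡 3).tangent ∞ (fun x => (⟨x, X x⟩ : TangentBundle (𝓡 3) M))

/-- A smooth vector field on a manifold has a local flow that is `C¹` in the initial point. -/
lemma exists_local_flow_manifold
    (hX : SmoothField X)
    (x₀ : M) : ∃ ε > 0, ∃ V : Set M, IsOpen V ∧ x₀ ∈ V ∧ ∃ Φ : ℝ → M → M,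
      (∀ z ∈ V, Φ 0 z = z ∧ IsMIntegralCurveOn (fun t => Φ t z) X (Ioo (-ε) ε)) ∧
      ∀ t ∈ Ioo (-ε) ε, ContMDiffOn (𝓡 3) (𝓡 3) 1 (Φ t) V := by
  have hv := hX.contMDiffAt (x := x₀)
  rw [contMDiffAt_iff] at hv
  obtain ⟨_, hv⟩ := hv
  have hx : (𝓡 3).IsInteriorPoint x₀ := BoundarylessManifold.isInteriorPoint
  have hf := (hv.contDiffAt (range_mem_nhds_isInteriorPoint hx)).snd
  have hW : interior (extChartAt (𝓡 3) x₀).target ∈ 𝓝 (extChartAt (𝓡 3) x₀ x₀) :=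
    isOpen_interior.mem_nhds ((𝓡 3).isInteriorPoint_iff.mp hx)
  obtain ⟨ε, hε, r, hr, Φ, hΦ, hΦC⟩ := exists_local_flow
    (hf.of_le (WithTop.coe_le_coe.2 le_top)) hW
  set φ := extChartAt (𝓡 3) x₀ with hφ
  refine ⟨ε, hε, φ.source ∩ φ ⁻¹' Metric.ball (φ x₀) r,
    isOpen_extChartAt_preimage' x₀ Metric.isOpen_ball,
    ⟨mem_extChartAt_source x₀, Metric.mem_ball_self hr⟩,
    fun t z => φ.symm (Φ t (φ z)), fun z hz => ⟨?_, ?_⟩, fun t ht => ?_⟩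
  · change φ.symm (Φ 0 (φ z)) = z
    rw [(hΦ _ hz.2).1, φ.left_inv hz.1]
  · intro t ht
    obtain ⟨hd, hw⟩ := (hΦ _ hz.2).2 t ht
    set f : ℝ → E3 := fun s => Φ s (φ z) with hfdef
    let xₜ : M := φ.symm (f t)
    have h : HasDerivAt f (x := t) <| fderivWithin ℝ (extChartAt (𝓡 3) x₀ ∘ (extChartAt (𝓡 3) xₜ).symm)
      (range (𝓡 3)) (extChartAt (𝓡 3) xₜ xₜ) (X xₜ) := hd
    -- The flow is computed in the chart at `x₀`, whereas the vector `X xₜ` refers to the preferred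
    -- chart at `xₜ`. The tangent coordinate change between these charts converts one derivative
    -- into the other.
    rw [← tangentCoordChange_def] at h
    have hf3 : f t ∈ interior φ.target := hw
    have hf3' := interior_subset hf3
    have hft1 := mem_preimage.mp <|
      mem_of_mem_of_subset hf3' (extChartAt (𝓡 3) x₀).target_subset_preimage_source
    have hft2 := mem_extChartAt_source (I := 𝓡 3) xₜ
    have hk : HasFDerivAt (𝕜 := ℝ) (E := E3) (F := E3)
        (extChartAt (𝓡 3) xₜ ∘ (extChartAt (𝓡 3) x₀).symm)
        (tangentCoordChange (𝓡 3) x₀ xₜ xₜ) (f t) := by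
      apply HasFDerivWithinAt.hasFDerivAt (s := range (𝓡 3)) _ <|
        mem_nhds_iff.mpr ⟨interior (extChartAt (𝓡 3) x₀).target,
          subset_trans interior_subset (extChartAt_target_subset_range ..),
          isOpen_interior, hf3⟩
      rw [← (extChartAt (𝓡 3) x₀).right_inv hf3']
      exact hasFDerivWithinAt_tangentCoordChange ⟨hft1, hft2⟩
    have hX' : tangentCoordChange (𝓡 3) x₀ xₜ xₜ (tangentCoordChange (𝓡 3) xₜ x₀ xₜ (X xₜ)) =
        X xₜ :=
      (tangentCoordChange_comp ⟨⟨hft2, hft1⟩, hft2⟩).trans (tangentCoordChange_self hft2)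
    have key : HasDerivAt (F := E3) ((extChartAt (𝓡 3) xₜ ∘ (extChartAt (𝓡 3) x₀).symm) ∘ f)
        (X xₜ) t := (hk.comp_hasDerivAt t h).congr_deriv hX'
    have e : (1 : ℝ →L[ℝ] ℝ).smulRight (X xₜ : E3) =
        ContinuousLinearMap.toSpanSingleton ℝ (X xₜ : E3) := by
      ext; simp
    apply HasMFDerivAt.hasMFDerivWithinAt
    exact ⟨(continuousAt_extChartAt_symm'' hf3').comp (f := f) h.continuousAt,
      (key.hasFDerivAt.congr_fderiv e.symm).hasFDerivWithinAt⟩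
  · have h1 : ContMDiffOn (𝓡 3) 𝓘(ℝ, E3) 1 φ φ.source := by
      rw [hφ, extChartAt_source]; exact contMDiffOn_extChartAt
    have h2 : ContMDiffOn 𝓘(ℝ, E3) (𝓡 3) 1 φ.symm φ.target := contMDiffOn_extChartAt_symm x₀
    refine (h2.comp ((hΦC t ht).contMDiffOn) fun y hy => ?_).comp
      (h1.mono inter_subset_left) fun z hz => hz.2
    exact interior_subset (s := φ.target) ((hΦ _ hy).2 t ht).2

lemma exists_integralCurve_at (hX : SmoothField X) (x₀ : M) (t₀ : ℝ) :
    ∃ ε > 0, ∃ γ : ℝ → M, γ t₀ = x₀ ∧ IsMIntegralCurveOn γ X (Icc (t₀ - ε) (t₀ + ε)) := by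
  obtain ⟨ε, hε, V, -, hxV, Φ, hΦ, -⟩ := exists_local_flow_manifold hX x₀
  obtain ⟨h0, h1⟩ := hΦ x₀ hxV
  refine ⟨ε / 2, by positivity, fun t => Φ (t + -t₀) x₀, by simpa using h0,
    isMIntegralCurveOn_shift h1 _ fun t ht => ?_⟩
  constructor <;> linarith [ht.1, ht.2]

/-- Uniqueness is invoked on open intervals, so a curve on a compact interval is first prolonged
past its ends by short local solutions. -/
lemma exists_extension (hX : SmoothField X) {γ : ℝ → M} {a b : ℝ} (hab : a ≤ b)
    (h : IsMIntegralCurveOn γ X (Icc a b)) :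
    ∃ ε > 0, ∃ γ' : ℝ → M, IsMIntegralCurveOn γ' X (Icc (a - ε) (b + ε)) ∧
      EqOn γ' γ (Icc a b) := by
  obtain ⟨ε₁, h₁, δ₁, e₁, i₁⟩ := exists_integralCurve_at hX (γ a) a
  obtain ⟨ε₂, h₂, δ₂, e₂, i₂⟩ := exists_integralCurve_at hX (γ b) b
  have hA := isMIntegralCurveOn_concat (by linarith) hab
    (i₁.mono (Icc_subset_Icc_right (by linarith))) h e₁
  set γ₁ : ℝ → M := fun t => if t ≤ a then δ₁ t else γ t with hγ₁
  have hγ₁e : EqOn γ₁ γ (Icc a b) := fun t ht => by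
    rcases ht.1.eq_or_lt with h | h
    · subst h; simpa [hγ₁] using e₁
    · simp [hγ₁, not_le.2 h]
  have hB := isMIntegralCurveOn_concat (by linarith) (by linarith : b ≤ b + ε₂) hA
    (i₂.mono (Icc_subset_Icc_left (by linarith))) (by rw [hγ₁e ⟨hab, le_rfl⟩, e₂])
  refine ⟨min ε₁ ε₂, by positivity, _, hB.mono (Icc_subset_Icc ?_ ?_), fun t ht => ?_⟩
  · linarith [min_le_left ε₁ ε₂]
  · linarith [min_le_right ε₁ ε₂]
  · simp only [ht.2, if_true]
    exact hγ₁e ht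

lemma smoothField_one (hX : SmoothField X) :
    ContMDiff (𝓡 3) (𝓡 3).tangent 1 (fun x => (⟨x, X x⟩ : TangentBundle (𝓡 3) M)) :=
  hX.of_le (WithTop.coe_le_coe.2 le_top)

variable [T2Space M]

lemma integralCurve_unique_Icc (hX : SmoothField X) {γ γ' : ℝ → M} {a b t₀ : ℝ}
    (ht₀ : t₀ ∈ Icc a b) (h : IsMIntegralCurveOn γ X (Icc a b))
    (h' : IsMIntegralCurveOn γ' X (Icc a b)) (e : γ t₀ = γ' t₀) : EqOn γ γ' (Icc a b) := by
  have hab : a ≤ b := ht₀.1.trans ht₀.2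
  obtain ⟨ε, hε, δ, hδ, eδ⟩ := exists_extension hX hab h
  obtain ⟨ε', hε', δ', hδ', eδ'⟩ := exists_extension hX hab h'
  have hm : 0 < min ε ε' := by positivity
  have := isMIntegralCurveOn_Ioo_eqOn_of_contMDiff_boundaryless (I := 𝓡 3) (γ := δ) (γ' := δ')
    (a := a - min ε ε') (b := b + min ε ε') (t₀ := t₀)
    ⟨by linarith [ht₀.1], by linarith [ht₀.2]⟩ (smoothField_one hX)
    (hδ.mono fun t ht => ⟨by linarith [ht.1, min_le_left ε ε'],
      by linarith [ht.2, min_le_left ε ε']⟩)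
    (hδ'.mono fun t ht => ⟨by linarith [ht.1, min_le_right ε ε'],
      by linarith [ht.2, min_le_right ε ε']⟩) (by rw [eδ ht₀, eδ' ht₀, e])
  intro t ht
  rw [← eδ ht, ← eδ' ht]
  exact this ⟨by linarith [ht.1], by linarith [ht.2]⟩

/-- The flow of a smooth vector field near a compact set, for a uniform short time. -/
lemma exists_flow_near_compact (hX : SmoothField X) {K : Set M} (hK : IsCompact K) :
    ∃ ε > 0, ∃ V : Set M, IsOpen V ∧ K ⊆ V ∧ ∃ Φ : ℝ → M → M,
      (∀ z ∈ V, Φ 0 z = z ∧ IsMIntegralCurveOn (fun t => Φ t z) X (Ioo (-ε) ε)) ∧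
      ∀ t ∈ Ioo (-ε) ε, ContMDiffOn (𝓡 3) (𝓡 3) 1 (Φ t) V := by
  choose ε hε V hVo hxV Φ hΦ hΦC using fun x : M => exists_local_flow_manifold hX x
  obtain ⟨s, -, hs⟩ := hK.elim_nhds_subcover V fun x _ => (hVo x).mem_nhds (hxV x)
  obtain ⟨ε₀, hε₀, hle⟩ : ∃ ε₀ > 0, ∀ x ∈ s, ε₀ ≤ ε x := by
    clear hs
    classical
    induction s using Finset.induction_on with
    | empty => exact ⟨1, one_pos, by simp⟩
    | insert a s _ ih =>
      obtain ⟨e, he, h⟩ := ih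
      refine ⟨min e (ε a), lt_min he (hε a), fun x hx => ?_⟩
      rcases Finset.mem_insert.1 hx with rfl | hx
      · exact min_le_right _ _
      · exact (min_le_left _ _).trans (h x hx)
  classical
  -- By uniqueness the local flows agree for times below `ε₀`, so the value does not depend on which
  -- of the finitely many neighbourhoods of `z` is chosen.
  set Ψ : ℝ → M → M := fun t z => if h : ∃ x ∈ s, z ∈ V x then Φ h.choose t z else z with hΨ
  have key : ∀ x ∈ s, ∀ z ∈ V x, ∀ t ∈ Ioo (-ε₀) ε₀, Ψ t z = Φ x t z := by
    intro x hx z hz t ht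
    have h : ∃ x ∈ s, z ∈ V x := ⟨x, hx, hz⟩
    have hc := h.choose_spec
    simp only [hΨ, dif_pos h]
    refine isMIntegralCurveOn_Ioo_eqOn_of_contMDiff_boundaryless (I := 𝓡 3)
      (γ := fun t => Φ h.choose t z) (γ' := fun t => Φ x t z) (a := -ε₀) (b := ε₀) (t₀ := 0)
      ⟨by linarith, hε₀⟩ (smoothField_one hX)
      ((hΦ _ z hc.2).2.mono (Ioo_subset_Ioo (neg_le_neg (hle _ hc.1)) (hle _ hc.1)))
      ((hΦ x z hz).2.mono (Ioo_subset_Ioo (neg_le_neg (hle _ hx)) (hle _ hx))) ?_ ht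
    simp only [(hΦ x z hz).1, (hΦ _ z hc.2).1]
  refine ⟨ε₀, hε₀, ⋃ x ∈ s, V x, isOpen_biUnion fun x _ => hVo x, hs, Ψ, fun z hz => ?_,
    fun t ht z hz => ?_⟩
  · obtain ⟨x, hx, hz⟩ := mem_iUnion₂.1 hz
    refine ⟨by rw [key x hx z hz 0 ⟨by linarith, hε₀⟩, (hΦ x z hz).1], ?_⟩
    exact isMIntegralCurveOn_congr
      ((hΦ x z hz).2.mono (Ioo_subset_Ioo (neg_le_neg (hle _ hx)) (hle _ hx)))
      fun t ht => key x hx z hz t ht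
  · obtain ⟨x, hx, hz⟩ := mem_iUnion₂.1 hz
    have h1 : ContMDiffAt (𝓡 3) (𝓡 3) 1 (Φ x t) z :=
      (hΦC x t (Ioo_subset_Ioo (neg_le_neg (hle _ hx)) (hle _ hx) ht)).contMDiffAt
        ((hVo x).mem_nhds hz)
    refine (h1.congr_of_eventuallyEq ?_).contMDiffWithinAt
    filter_upwards [(hVo x).mem_nhds hz] with y hy using key x hx y hy t ht

end SaddleConn

/-! ### Charts that conjugate a vector field to a model flow -/

namespace SaddleConn

/-- Coordinates `(x, y)` for the model saddles: `x` stable, `y` unstable. -/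
abbrev Z : Type := ℝ × ℂ

/-- Two maps, continuous on open sets and inverse to each other wherever both composites make
sense, form a partial homeomorphism. -/
def partialHomeo {X Y : Type*} [TopologicalSpace X] [TopologicalSpace Y] (f : X → Y) (g : Y → X)
    (A : Set X) (B : Set Y) (hA : IsOpen A) (hB : IsOpen B) (hf : ContinuousOn f A)
    (hg : ContinuousOn g B) (hgf : ∀ x ∈ A, f x ∈ B → g (f x) = x)
    (hfg : ∀ y ∈ B, g y ∈ A → f (g y) = y) : OpenPartialHomeomorph X Y where
  toFun := f
  invFun := g
  source := A ∩ f ⁻¹' B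
  target := B ∩ g ⁻¹' A
  map_source' x hx := ⟨hx.2, by rw [mem_preimage, hgf x hx.1 hx.2]; exact hx.1⟩
  map_target' y hy := ⟨hy.2, by rw [mem_preimage, hfg y hy.1 hy.2]; exact hy.1⟩
  left_inv' x hx := hgf x hx.1 hx.2
  right_inv' y hy := hfg y hy.1 hy.2
  open_source := hf.isOpen_inter_preimage hA hB
  open_target := hg.isOpen_inter_preimage hB hA
  continuousOn_toFun := hf.mono inter_subset_left
  continuousOn_invFun := hg.mono inter_subset_left

/-- A continuous flow. -/
structure IsFlow (G : ℝ → Z → Z) : Prop where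
  zero : ∀ z, G 0 z = z
  add : ∀ s t z, G (s + t) z = G s (G t z)
  cont : Continuous fun w : ℝ × Z => G w.1 w.2

namespace IsFlow

variable {G : ℝ → Z → Z}

lemma neg_apply (h : IsFlow G) (t : ℝ) (z : Z) : G (-t) (G t z) = z := by
  rw [← h.add, neg_add_cancel, h.zero]

lemma apply_neg (h : IsFlow G) (t : ℝ) (z : Z) : G t (G (-t) z) = z := by
  rw [← h.add, add_neg_cancel, h.zero]

lemma cont_apply (h : IsFlow G) (t : ℝ) : Continuous (G t) :=
  h.cont.comp (Continuous.prodMk continuous_const continuous_id)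

lemma cont_time (h : IsFlow G) (z : Z) : Continuous fun t => G t z :=
  h.cont.comp (Continuous.prodMk continuous_id continuous_const)

/-- The time `t` map of a flow. -/
def homeo (h : IsFlow G) (t : ℝ) : Z ≃ₜ Z where
  toFun := G t
  invFun := G (-t)
  left_inv := h.neg_apply t
  right_inv := h.apply_neg t
  continuous_toFun := h.cont_apply t
  continuous_invFun := h.cont_apply (-t)

end IsFlow

variable {M : Type*} [TopologicalSpace M] [ChartedSpace E3 M]

/-- `φ` conjugates the local flow of `X` to the flow `G`. -/
structure Conj (X : (x : M) → TangentSpace (𝓡 3) x) (φ : OpenPartialHomeomorph M Z)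
    (G : ℝ → Z → Z) : Prop where
  fwd : ∀ (γ : ℝ → M) (a b : ℝ), IsMIntegralCurveOn γ X (Icc a b) →
    (∀ t ∈ Icc a b, γ t ∈ φ.source) → ∀ t ∈ Icc a b, φ (γ t) = G (t - a) (φ (γ a))
  bwd : ∀ (z : Z) (a b : ℝ), (∀ t ∈ Icc a b, G t z ∈ φ.target) →
    IsMIntegralCurveOn (fun t => φ.symm (G t z)) X (Icc a b)

lemma Conj.fwd' {X : (x : M) → TangentSpace (𝓡 3) x} {φ : OpenPartialHomeomorph M Z}
    {G : ℝ → Z → Z} (h : Conj X φ G) (hG : IsFlow G) {γ : ℝ → M} {a b : ℝ}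
    (hγ : IsMIntegralCurveOn γ X (Icc a b)) (hs : ∀ t ∈ Icc a b, γ t ∈ φ.source)
    {s t : ℝ} (hs' : s ∈ Icc a b) (ht : t ∈ Icc a b) : φ (γ t) = G (t - s) (φ (γ s)) := by
  rw [h.fwd γ a b hγ hs t ht, h.fwd γ a b hγ hs s hs', ← hG.add]
  congr 1; ring

/-- Composition of a conjugation with a global change of coordinates. -/
lemma Conj.post {X : (x : M) → TangentSpace (𝓡 3) x} {φ : OpenPartialHomeomorph M Z}
    {G G' : ℝ → Z → Z} (h : Conj X φ G) (e : Z ≃ₜ Z) (he : ∀ t z, e (G t z) = G' t (e z)) :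
    Conj X (φ.transHomeomorph e) G' where
  fwd γ a b hγ hs t ht := by
    simp only [OpenPartialHomeomorph.transHomeomorph_apply, Function.comp_apply] at *
    rw [h.fwd γ a b hγ hs t ht, he]
  bwd z a b hz := by
    have he' : ∀ t, e.symm (G' t z) = G t (e.symm z) := fun t => by
      rw [e.symm_apply_eq, he, e.apply_symm_apply]
    have : (fun t => (φ.transHomeomorph e).symm (G' t z)) = fun t => φ.symm (G t (e.symm z)) := by
      funext t
      simp only [OpenPartialHomeomorph.transHomeomorph_symm_apply, Function.comp_apply, he']
    rw [this]
    refine h.bwd _ a b fun t ht => ?_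
    have := hz t ht
    rw [OpenPartialHomeomorph.transHomeomorph_target, mem_preimage, he'] at this
    exact this

/-- A `C¹` chart that conjugates the local flow of `X` to the flow `G`. -/
structure FlowChart (X : (x : M) → TangentSpace (𝓡 3) x) (φ : OpenPartialHomeomorph M Z)
    (G : ℝ → Z → Z) : Prop extends Conj X φ G where
  contMDiffOn : ContMDiffOn (𝓡 3) 𝓘(ℝ, Z) 1 φ φ.source
  contMDiffOn_symm : ContMDiffOn 𝓘(ℝ, Z) (𝓡 3) 1 φ.symm φ.target

section LinearCharts

variable {X : (x : M) → TangentSpace (𝓡 3) x}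

lemma hasDerivWithinAt_of_chart {F : Type*} [NormedAddCommGroup F] [NormedSpace ℝ F]
    {φ : M → F} {γ : ℝ → M} {s : Set ℝ} {t : ℝ} {D : E3 →L[ℝ] F} {v : E3}
    (hφ : HasMFDerivAt (𝓡 3) 𝓘(ℝ, F) φ (γ t) D)
    (hγ : HasMFDerivWithinAt 𝓘(ℝ, ℝ) (𝓡 3) γ s t ((1 : ℝ →L[ℝ] ℝ).smulRight v)) :
    HasDerivWithinAt (fun u => φ (γ u)) (D v) s t := by
  have h : HasFDerivWithinAt (φ ∘ γ) (D.comp ((1 : ℝ →L[ℝ] ℝ).smulRight v)) s t :=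
    hasMFDerivWithinAt_iff_hasFDerivWithinAt.1 (hφ.comp_hasMFDerivWithinAt t hγ)
  have h3 := h.hasDerivWithinAt
  simpa [Function.comp_def] using h3

lemma smulRight_eq_comp {D : E3 →L[ℝ] E3} {u v : E3} (h : D v = u) :
    ((1 : ℝ →L[ℝ] ℝ).smulRight u) = D.comp (ContinuousLinearMap.toSpanSingleton ℝ v) := by
  refine ContinuousLinearMap.ext_ring ?_
  simp [h]

/-- In the chart an integral curve solves the linear equation `z' = A z`, whose solutions are
unique, so it follows `G`. Conversely the derivative of the inverse chart, being inverse to that of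
the chart, carries solutions of the linear equation to integral curves. -/
lemma IsLinearizingChart.flowChart {p : M} {φ : OpenPartialHomeomorph M E3}
    (hφ : IsLinearizingChart X p φ) (L : E3 ≃L[ℝ] Z) (A : Z →L[ℝ] Z)
    (hLA : ∀ v, L (linearPart X p v) = A (L v)) {G : ℝ → Z → Z} (hG : IsFlow G)
    (hGA : ∀ z t, HasDerivAt (fun t => G t z) (A (G t z)) t) :
    FlowChart X (φ.transHomeomorph L.toHomeomorph) G where
  contMDiffOn := by
    simp only [OpenPartialHomeomorph.transHomeomorph_source]
    exact (L.contDiff (n := 1)).contMDiff.comp_contMDiffOn hφ.contMDiffOn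
  contMDiffOn_symm := by
    refine hφ.contMDiffOn_symm.comp (L.symm.contDiff (n := 1)).contMDiff.contMDiffOn fun z hz => hz
  fwd γ a b hγ hs t ht := by
    simp only [OpenPartialHomeomorph.transHomeomorph_apply, Function.comp_apply,
      OpenPartialHomeomorph.transHomeomorph_source] at *
    have hd : ∀ u ∈ Icc a b, HasDerivWithinAt (fun u => L (φ (γ u))) (A (L (φ (γ u))))
        (Icc a b) u := by
      intro u hu
      have h1 : MDifferentiableAt (𝓡 3) 𝓘(ℝ, E3) φ (γ u) :=
        (hφ.contMDiffOn.contMDiffAt (φ.open_source.mem_nhds (hs u hu))).mdifferentiableAt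
          (by simp)
      have h2 := hasDerivWithinAt_of_chart h1.hasMFDerivAt (hγ u hu)
      have h3 := (L : E3 →L[ℝ] Z).hasFDerivAt.comp_hasDerivWithinAt u h2
      have h4 := hφ.map_field _ (hs u hu)
      rw [coordDeriv] at h4
      rw [h4] at h3
      have h5 := hLA (φ (γ u))
      simp only [ContinuousLinearEquiv.coe_coe, h5] at h3
      exact h3
    have := ODE_solution_unique_of_mem_Icc_right (v := fun _ => A) (K := ‖A‖₊)
      (s := fun _ => univ) (f := fun u => L (φ (γ u)))
      (g := fun u => G (u - a) (L (φ (γ a)))) (a := a) (b := b)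
      (fun t _ => (A.lipschitz).lipschitzOnWith)
      (fun u hu => (hd u hu).continuousWithinAt)
      (fun u hu => (hd u (Ico_subset_Icc_self hu)).mono_of_mem_nhdsWithin
        (Icc_mem_nhdsGE_of_mem hu)) (fun _ _ => mem_univ _)
      (fun u hu => ((hG.cont_time _).comp (continuous_id.sub continuous_const)).continuousWithinAt)
      (fun u hu => by
        have := (hGA (L (φ (γ a))) (u - a)).scomp u ((hasDerivAt_id u).sub_const a)
        rw [one_smul] at this
        exact this.hasDerivWithinAt) (fun _ _ => mem_univ _)
      (by simp [hG.zero])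
    exact this ht
  bwd z a b hz := by
    intro t ht
    have hz' := hz t ht
    have h1 : MDifferentiableAt 𝓘(ℝ, E3) (𝓡 3) φ.symm (L.symm (G t z)) :=
      (hφ.contMDiffOn_symm.contMDiffAt (φ.open_target.mem_nhds hz')).mdifferentiableAt (by simp)
    set w : E3 := L.symm (G t z) with hw
    have hx : φ.symm w ∈ φ.source := φ.map_target hz'
    have hr : φ (φ.symm w) = w := φ.right_inv hz'
    have h2 : MDifferentiableAt (𝓡 3) 𝓘(ℝ, E3) φ (φ.symm w) :=
      (hφ.contMDiffOn.contMDiffAt (φ.open_source.mem_nhds hx)).mdifferentiableAt (by simp)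
    have h3 : HasDerivAt (fun t => L.symm (G t z)) (linearPart X p w) t := by
      have := (L.symm : Z →L[ℝ] E3).hasFDerivAt.comp_hasDerivAt t (hGA z t)
      have e : L.symm (A (G t z)) = linearPart X p w := by
        rw [L.symm_apply_eq, hLA, hw, L.apply_symm_apply]
      simp only [ContinuousLinearEquiv.coe_coe, e] at this
      exact this
    have h4 := h1.hasMFDerivAt.comp t (hasMFDerivAt_iff_hasFDerivAt.2 h3.hasFDerivAt)
    have h5 : mfderiv 𝓘(ℝ, E3) (𝓡 3) φ.symm w (linearPart X p w) = X (φ.symm w) := by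
      have h6 := hφ.map_field _ hx
      rw [hr] at h6
      rw [← h6, coordDeriv]
      have h1' : MDifferentiableAt 𝓘(ℝ, E3) (𝓡 3) φ.symm (φ (φ.symm w)) := by
        rwa [hr]
      have h7 := (h1'.hasMFDerivAt.comp (φ.symm w) h2.hasMFDerivAt)
      have h8 : HasMFDerivAt (𝓡 3) (𝓡 3) (φ.symm ∘ φ) (φ.symm w)
          (ContinuousLinearMap.id ℝ (TangentSpace (𝓡 3) (φ.symm w))) := by
        refine (hasMFDerivAt_id (φ.symm w)).congr_of_eventuallyEq ?_
        filter_upwards [φ.open_source.mem_nhds hx] with y hy using φ.left_inv hy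
      have h9 := hasMFDerivAt_unique h7 h8
      rw [hr] at h9
      exact DFunLike.congr_fun h9 (X (φ.symm w))
    refine HasMFDerivAt.hasMFDerivWithinAt ?_
    have h10 : ((1 : ℝ →L[ℝ] ℝ).smulRight (X (φ.symm w) : E3)) =
        (mfderiv 𝓘(ℝ, E3) (𝓡 3) φ.symm w : E3 →L[ℝ] E3).comp
          (ContinuousLinearMap.toSpanSingleton ℝ (linearPart X p w)) := smulRight_eq_comp h5
    change HasMFDerivAt 𝓘(ℝ, ℝ) (𝓡 3) (φ.symm ∘ fun t => L.symm (G t z)) t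
      ((1 : ℝ →L[ℝ] ℝ).smulRight (X (φ.symm w) : E3))
    rw [h10]
    exact h4

end LinearCharts

end SaddleConn

/-! ### Extension of flow charts along an orbit -/

namespace SaddleConn

variable {M : Type*} [TopologicalSpace M] [ChartedSpace E3 M]

/-- `Φ` is the flow of `X` on the open set `V` for times in `(-ε, ε)`. -/
structure LocalFlowOn (X : (x : M) → TangentSpace (𝓡 3) x) (ε : ℝ) (V : Set M)
    (Φ : ℝ → M → M) : Prop where
  pos : 0 < ε
  isOpen : IsOpen V
  init : ∀ z ∈ V, Φ 0 z = z
  curve : ∀ z ∈ V, IsMIntegralCurveOn (fun t => Φ t z) X (Ioo (-ε) ε)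
  contMDiffOn : ∀ t ∈ Ioo (-ε) ε, ContMDiffOn (𝓡 3) (𝓡 3) 1 (Φ t) V

variable [IsManifold (𝓡 3) ∞ M] [T2Space M] {X : (x : M) → TangentSpace (𝓡 3) x}

namespace LocalFlowOn

variable {ε : ℝ} {V : Set M} {Φ : ℝ → M → M}

lemma comp_apply (h : LocalFlowOn X ε V Φ) (hX : SmoothField X) {z : M} (hz : z ∈ V) {s τ : ℝ}
    (hs : s ∈ Ioo (-ε) ε) (hsz : Φ s z ∈ V) (hτ : τ ∈ Ioo (-ε) ε) (hsτ : τ + s ∈ Ioo (-ε) ε) :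
    Φ τ (Φ s z) = Φ (τ + s) z := by
  have hpos := h.pos
  refine integralCurve_unique_Icc hX (γ := fun t => Φ t (Φ s z)) (γ' := fun t => Φ (t + s) z)
    (a := min 0 τ) (b := max 0 τ) (t₀ := 0) ⟨min_le_left _ _, le_max_left _ _⟩
    ((h.curve _ hsz).mono fun t ht => ?_)
    (isMIntegralCurveOn_shift (h.curve z hz) s fun t ht => ?_) ?_
    ⟨min_le_right _ _, le_max_right _ _⟩
  · exact ⟨(lt_min (by linarith) hτ.1).trans_le ht.1, ht.2.trans_lt (max_lt hpos hτ.2)⟩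
  · rcases le_total 0 τ with h0 | h0
    · rw [min_eq_left h0, max_eq_right h0] at ht
      exact ⟨by linarith [ht.1, hs.1], by linarith [ht.2, hsτ.2]⟩
    · rw [min_eq_right h0, max_eq_left h0] at ht
      exact ⟨by linarith [ht.1, hsτ.1], by linarith [ht.2, hs.2]⟩
  · simp only [zero_add]; rw [h.init _ hsz]

lemma eq_of_curve (h : LocalFlowOn X ε V Φ) (hX : SmoothField X) {γ : ℝ → M} {a b t u : ℝ}
    (hγ : IsMIntegralCurveOn γ X (Icc a b)) (ht : t ∈ Icc a b) (hu : u ∈ Icc a b)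
    (htV : γ t ∈ V) (htu : |u - t| < ε) : γ u = Φ (u - t) (γ t) := by
  refine integralCurve_unique_Icc hX (γ := γ) (γ' := fun v => Φ (v + -t) (γ t))
    (a := min t u) (b := max t u) (t₀ := t) ⟨min_le_left _ _, le_max_left _ _⟩
    (hγ.mono fun v hv => ⟨(le_min ht.1 hu.1).trans hv.1, hv.2.trans (max_le ht.2 hu.2)⟩)
    (isMIntegralCurveOn_shift (h.curve _ htV) _ fun v hv => ?_) ?_
    ⟨min_le_right _ _, le_max_right _ _⟩
  · have := abs_lt.1 htu
    rcases le_total t u with h0 | h0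
    · rw [min_eq_left h0, max_eq_right h0] at hv
      exact ⟨by linarith [hv.1, h.pos], by linarith [hv.2]⟩
    · rw [min_eq_right h0, max_eq_left h0] at hv
      exact ⟨by linarith [hv.1], by linarith [hv.2, h.pos]⟩
  · simp only [add_neg_cancel]; rw [h.init _ htV]

/-- Time-`τ` maps commute with the flow: near a parameter `t` the image curve is `u ↦ Φ (u + (τ -
t)) (γ t)`, again an arc of orbit. -/
lemma comp_curve (h : LocalFlowOn X ε V Φ) (hX : SmoothField X) {γ : ℝ → M} {a b τ : ℝ}
    (hγ : IsMIntegralCurveOn γ X (Icc a b)) (hV : ∀ t ∈ Icc a b, γ t ∈ V)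
    (hτ : τ ∈ Ioo (-ε) ε) : IsMIntegralCurveOn (fun t => Φ τ (γ t)) X (Icc a b) := by
  intro t ht
  have h1 : IsMIntegralCurveOn (fun u => Φ (u + (τ - t)) (γ t)) X
      (Ioo (-ε - (τ - t)) (ε - (τ - t))) :=
    isMIntegralCurveOn_shift (h.curve _ (hV t ht)) _ fun u hu =>
      ⟨by linarith [hu.1], by linarith [hu.2]⟩
  have h2 := (h1 t ⟨by linarith [hτ.1], by linarith [hτ.2]⟩).hasMFDerivAt
    (Ioo_mem_nhds (by linarith [hτ.1]) (by linarith [hτ.2]))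
  have e0 : t + (τ - t) = τ := by ring
  have h3 : HasMFDerivAt 𝓘(ℝ, ℝ) (𝓡 3) (fun u => Φ (u + (τ - t)) (γ t)) t
      ((1 : ℝ →L[ℝ] ℝ).smulRight (X (Φ τ (γ t)))) := by
    have key : ∀ r, r = τ → HasMFDerivAt 𝓘(ℝ, ℝ) (𝓡 3) (fun u => Φ (u + (τ - t)) (γ t)) t
        ((1 : ℝ →L[ℝ] ℝ).smulRight (X (Φ r (γ t)))) →
        HasMFDerivAt 𝓘(ℝ, ℝ) (𝓡 3) (fun u => Φ (u + (τ - t)) (γ t)) t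
        ((1 : ℝ →L[ℝ] ℝ).smulRight (X (Φ τ (γ t)))) := by
      rintro _ rfl h; exact h
    exact key _ e0 h2
  refine h3.hasMFDerivWithinAt.congr_of_eventuallyEq ?_ (by simp only [e0])
  have hη : 0 < ε - |τ| := by linarith [abs_lt.2 hτ]
  filter_upwards [self_mem_nhdsWithin,
    mem_nhdsWithin_of_mem_nhds (Metric.ball_mem_nhds t hη)] with u hu hu'
  rw [Metric.mem_ball, Real.dist_eq] at hu'
  have hut : |u - t| < ε := by linarith [abs_nonneg τ]
  have e1 := h.eq_of_curve hX hγ ht hu (hV t ht) hut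
  have h3 : |τ + (u - t)| < ε := by linarith [abs_add_le τ (u - t)]
  have e2 := h.comp_apply hX (hV t ht) (abs_lt.1 hut) (e1 ▸ hV u hu) hτ (abs_lt.1 h3)
  change Φ τ (γ u) = Φ (u + (τ - t)) (γ t)
  rw [e1, e2]
  congr 1; ring

/-- The time `τ` map of a local flow. -/
def timeMap (h : LocalFlowOn X ε V Φ) (hX : SmoothField X) (τ : ℝ) (hτ : τ ∈ Ioo (-ε) ε) :
    OpenPartialHomeomorph M M :=
  have hτ' : -τ ∈ Ioo (-ε) ε := ⟨by linarith [hτ.2], by linarith [hτ.1]⟩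
  have h0 : (0 : ℝ) ∈ Ioo (-ε) ε := ⟨by linarith [h.pos], h.pos⟩
  partialHomeo (Φ τ) (Φ (-τ)) V V h.isOpen h.isOpen (h.contMDiffOn τ hτ).continuousOn
    (h.contMDiffOn (-τ) hτ').continuousOn
    (fun z hz hz' => by
      rw [h.comp_apply hX hz hτ hz' hτ' (by simpa using h0), neg_add_cancel, h.init z hz])
    (fun z hz hz' => by
      rw [h.comp_apply hX hz hτ' hz' hτ (by simpa using h0), add_neg_cancel, h.init z hz])

end LocalFlowOn

/-- A flow by `C¹` maps fixing the origin. -/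
structure IsC1Flow (G : ℝ → Z → Z) : Prop extends IsFlow G where
  contDiff : ∀ t, ContDiff ℝ 1 (G t)
  map_zero : ∀ t, G t 0 = 0

/-- `G (-τ) ∘ φ ∘ Φ τ` conjugates to the same flow `G`, since each time map commutes with its own
flow. Up to the domain of the local flow, its source is that of `φ` carried back by time `τ`; for
negative `τ` the chart thus advances along orbits. -/
lemma FlowChart.comp_timeMap {ε : ℝ} {V : Set M} {Φ : ℝ → M → M} (h : LocalFlowOn X ε V Φ)
    (hX : SmoothField X) {τ : ℝ} (hτ : τ ∈ Ioo (-ε) ε) {φ : OpenPartialHomeomorph M Z}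
    {G : ℝ → Z → Z} (hG : IsC1Flow G) (hφ : FlowChart X φ G) :
    FlowChart X (((h.timeMap hX τ hτ).trans φ).transHomeomorph (hG.homeo (-τ))) G := by
  have hτ' : -τ ∈ Ioo (-ε) ε := ⟨by linarith [hτ.2], by linarith [hτ.1]⟩
  have hsrc : ∀ z, z ∈ ((h.timeMap hX τ hτ).trans φ).source →
      z ∈ V ∧ Φ τ z ∈ V ∧ Φ τ z ∈ φ.source := by
    intro z hz
    rw [OpenPartialHomeomorph.trans_source] at hz
    exact ⟨hz.1.1, hz.1.2, hz.2⟩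
  have htgt : ∀ z, z ∈ ((h.timeMap hX τ hτ).trans φ).target →
      z ∈ φ.target ∧ φ.symm z ∈ V ∧ Φ (-τ) (φ.symm z) ∈ V := by
    intro z hz
    rw [OpenPartialHomeomorph.trans_target] at hz
    exact ⟨hz.1, hz.2.1, hz.2.2⟩
  constructor
  · constructor
    · intro γ a b hγ hs t ht
      have hδ := h.comp_curve hX hγ (fun t ht => (hsrc _ (hs t ht)).1) hτ
      have := hφ.fwd _ a b hδ (fun t ht => (hsrc _ (hs t ht)).2.2) t ht
      change G (-τ) (φ (Φ τ (γ t))) = G (t - a) (G (-τ) (φ (Φ τ (γ a))))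
      rw [this, ← hG.add, ← hG.add]
      congr 1; ring
    · intro z a b hz
      have hz' : ∀ t ∈ Icc a b, G τ (G t z) ∈ ((h.timeMap hX τ hτ).trans φ).target := by
        intro t ht
        have h1 : G (- -τ) (G t z) ∈ ((h.timeMap hX τ hτ).trans φ).target := hz t ht
        rwa [neg_neg] at h1
      have hcomm : ∀ t, G τ (G t z) = G t (G τ z) := fun t => by
        rw [← hG.add, ← hG.add, add_comm]
      have h1 := hφ.bwd (G τ z) a b fun t ht => by
        rw [← hcomm]; exact (htgt _ (hz' t ht)).1
      have h2 := h.comp_curve hX h1 (fun t ht => by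
        rw [← hcomm]; exact (htgt _ (hz' t ht)).2.1) hτ'
      refine isMIntegralCurveOn_congr h2 fun t ht => ?_
      change Φ (-τ) (φ.symm (G (- -τ) (G t z))) = _
      rw [neg_neg, hcomm]
  · have h1 : ContMDiffOn (𝓡 3) 𝓘(ℝ, Z) 1 (fun z => φ (Φ τ z))
        ((h.timeMap hX τ hτ).trans φ).source :=
      hφ.contMDiffOn.comp ((h.contMDiffOn τ hτ).mono fun z hz => (hsrc z hz).1)
        fun z hz => (hsrc z hz).2.2
    exact (hG.contDiff (-τ)).contMDiff.comp_contMDiffOn h1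
  · have h1 : ContMDiffOn 𝓘(ℝ, Z) (𝓡 3) 1 (fun z => Φ (-τ) (φ.symm z))
        ((h.timeMap hX τ hτ).trans φ).target :=
      (h.contMDiffOn (-τ) hτ').comp (hφ.contMDiffOn_symm.mono fun z hz => (htgt z hz).1)
        fun z hz => (htgt z hz).2.1
    refine h1.comp (hG.contDiff (- -τ)).contMDiff.contMDiffOn fun z hz => hz

/-- Extension of a flow chart along an orbit that leaves its base point. -/
lemma FlowChart.exists_extension (hX : SmoothField X) {φ : OpenPartialHomeomorph M Z}
    {G : ℝ → Z → Z} (hG : IsC1Flow G) (hφ : FlowChart X φ G) {p : M} (hp : p ∈ φ.source)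
    (hp0 : φ p = 0) (hXp : X p = 0) {Γ : ℝ → M} (hΓ : IsMIntegralCurve Γ X) {K : Set M}
    (hK : IsCompact K) (hpK : p ∈ K) (hΓK : ∀ t, Γ t ∈ K) {t₀ : ℝ}
    (hsrc : ∀ t ≤ t₀, Γ t ∈ φ.source) (T : ℝ) :
    ∃ φ' : OpenPartialHomeomorph M Z, FlowChart X φ' G ∧ p ∈ φ'.source ∧ φ' p = 0 ∧
      ∀ t ≤ T, Γ t ∈ φ'.source := by
  obtain ⟨ε, hε, V, hV, hKV, Φ, hΦ, hΦC⟩ := exists_flow_near_compact hX hK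
  have h : LocalFlowOn X ε V Φ := ⟨hε, hV, fun z hz => (hΦ z hz).1, fun z hz => (hΦ z hz).2, hΦC⟩
  have hτ : -(ε / 2) ∈ Ioo (-ε) ε := ⟨by linarith, by linarith⟩
  have hΦp : ∀ τ ∈ Ioo (-ε) ε, Φ τ p = p := by
    intro τ hτ
    have := h.eq_of_curve hX (γ := fun _ => p) (a := -ε) (b := ε) (t := 0) (u := τ)
      ((isMIntegralCurve_const hXp).isMIntegralCurveOn _) ⟨by linarith, hε.le⟩
      ⟨hτ.1.le, hτ.2.le⟩ (hKV hpK) (by simpa using abs_lt.2 hτ)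
    simpa using this.symm
  have hΦΓ : ∀ τ ∈ Ioo (-ε) ε, ∀ t, Φ τ (Γ t) = Γ (t + τ) := by
    intro τ hτ t
    have := h.eq_of_curve hX (γ := Γ) (a := t - ε) (b := t + ε) (t := t) (u := t + τ)
      (hΓ.isMIntegralCurveOn _) ⟨by linarith, by linarith⟩
      ⟨by linarith [hτ.1], by linarith [hτ.2]⟩ (hKV (hΓK t)) (by simpa using abs_lt.2 hτ)
    simpa using this.symm
  -- Each composition with the time `-ε/2` map gains `ε/2` along the orbit and keeps the chart
  -- centred at `p`. The step size is uniform because `K` is compact, so finitely many steps reach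
  -- `T`.
  have step : ∀ n : ℕ, ∃ φ' : OpenPartialHomeomorph M Z, FlowChart X φ' G ∧ p ∈ φ'.source ∧
      φ' p = 0 ∧ ∀ t ≤ t₀ + n * (ε / 2), Γ t ∈ φ'.source := by
    intro n
    induction n with
    | zero => exact ⟨φ, hφ, hp, hp0, fun t ht => hsrc t (by simpa using ht)⟩
    | succ n ih =>
      obtain ⟨φ', h1, h2, h3, h4⟩ := ih
      refine ⟨_, h1.comp_timeMap h hX hτ hG, ?_, ?_, fun t ht => ?_⟩
      · refine ⟨⟨hKV hpK, ?_⟩, ?_⟩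
        · rw [mem_preimage, hΦp _ hτ]; exact hKV hpK
        · change Φ _ p ∈ φ'.source
          rwa [hΦp _ hτ]
      · change G _ (φ' (Φ _ p)) = 0
        rw [hΦp _ hτ, h3, hG.map_zero]
      · refine ⟨⟨hKV (hΓK t), ?_⟩, ?_⟩
        · rw [mem_preimage, hΦΓ _ hτ]; exact hKV (hΓK _)
        · change Φ _ (Γ t) ∈ φ'.source
          rw [hΦΓ _ hτ]
          refine h4 _ ?_
          push_cast at ht
          linarith
  obtain ⟨n, hn⟩ := exists_nat_gt ((T - t₀) / (ε / 2))
  obtain ⟨φ', h1, h2, h3, h4⟩ := step n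
  refine ⟨φ', h1, h2, h3, fun t ht => h4 t ?_⟩
  rw [div_lt_iff₀ (by positivity)] at hn
  linarith

end SaddleConn

/-! ### Linear algebra of saddles with one stable eigenvalue -/

namespace SaddleConn

section LinearAlgebra

open Polynomial Module

/-- Spectral data of a linear saddle of `ℝ³` with one stable and two unstable eigenvalues. -/
structure SpectralSplit (T : E3 →ₗ[ℝ] E3) (a τ D : ℝ) : Prop where
  stable_neg : a < 0
  trace_pos : 0 < τ
  det_pos : 0 < D
  charpoly_eq : T.charpoly = (X - C a) * (X ^ 2 - C τ * X + C D)
  unstable_roots : (T.charpoly.aroots ℂ).filter (fun z => 0 < z.re) =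
    (X ^ 2 - C τ * X + C D : ℝ[X]).aroots ℂ

lemma quadratic_ne_zero (τ D : ℝ) : (X ^ 2 - C τ * X + C D : ℝ[X]) ≠ 0 := by
  intro h
  have := congrArg (fun q => q.coeff 2) h
  simp at this

lemma mem_aroots_quadratic {τ D : ℝ} {z : ℂ} :
    z ∈ (X ^ 2 - C τ * X + C D : ℝ[X]).aroots ℂ ↔ z ^ 2 - τ * z + D = 0 := by
  rw [mem_aroots]
  simp [quadratic_ne_zero τ D]

/-- The only stable eigenvalue is real because its conjugate is stable too. The complementary
quadratic factor has its roots in the right half plane, which makes its trace and determinant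
positive. -/
lemma exists_spectralSplit {T : E3 →ₗ[ℝ] E3}
    (hyp : ∀ z ∈ T.charpoly.aroots ℂ, z.re ≠ 0)
    (hcard : Multiset.card ((T.charpoly.aroots ℂ).filter (fun z => z.re < 0)) = 1) :
    ∃ a τ D, SpectralSplit T a τ D := by
  have hmon : T.charpoly.Monic := T.charpoly_monic
  have hne : T.charpoly ≠ 0 := hmon.ne_zero
  have hdeg : T.charpoly.natDegree = 3 := by
    rw [LinearMap.charpoly_natDegree]; simp
  obtain ⟨s, hs⟩ := Multiset.card_eq_one.1 hcard
  have hsmem : s ∈ (T.charpoly.aroots ℂ).filter (fun z => z.re < 0) := by rw [hs]; simp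
  rw [Multiset.mem_filter] at hsmem
  have hconj : (starRingEnd ℂ) s = s := by
    have h1 : (starRingEnd ℂ) s ∈ T.charpoly.aroots ℂ := by
      rw [mem_aroots] at hsmem ⊢
      exact ⟨hne, by rw [aeval_conj, hsmem.1.2, map_zero]⟩
    have h2 : (starRingEnd ℂ) s ∈ (T.charpoly.aroots ℂ).filter (fun z => z.re < 0) :=
      Multiset.mem_filter.2 ⟨h1, by simpa using hsmem.2⟩
    rw [hs] at h2
    simpa using h2
  obtain ⟨a, rfl⟩ := Complex.conj_eq_iff_real.1 hconj
  have ha : a < 0 := by simpa using hsmem.2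
  have hroot : T.charpoly.IsRoot a := by
    have h1 := (mem_aroots.1 hsmem.1).2
    have h2 : aeval (algebraMap ℝ ℂ a) T.charpoly = 0 := h1
    rw [aeval_algebraMap_apply] at h2
    have h3 : (algebraMap ℝ ℂ) (eval a T.charpoly) = 0 := by simpa using h2
    exact (map_eq_zero _).1 h3
  obtain ⟨g, hg⟩ := dvd_iff_isRoot.2 hroot
  have hgm : g.Monic := (monic_X_sub_C a).of_mul_monic_left (hg ▸ hmon)
  have hgd : g.natDegree = 2 := by
    have := congrArg natDegree hg
    rw [hdeg, (monic_X_sub_C a).natDegree_mul hgm, natDegree_X_sub_C] at this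
    omega
  have hgeq : g = X ^ 2 - C (-g.coeff 1) * X + C (g.coeff 0) := by
    have := g.as_sum_range_C_mul_X_pow
    rw [hgd, Finset.sum_range_succ, Finset.sum_range_succ, Finset.sum_range_one] at this
    have h2 : g.coeff 2 = 1 := by rw [← hgd]; exact hgm.coeff_natDegree
    rw [h2] at this
    rw [this]
    simp [coeff_X, coeff_C]
    ring
  set τ := -g.coeff 1
  set D := g.coeff 0
  have hprod : T.charpoly.aroots ℂ = {(a : ℂ)} + g.aroots ℂ := by
    rw [hg, aroots_mul (hg ▸ hne), aroots_X_sub_C]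
    rfl
  have hpos : ∀ z ∈ g.aroots ℂ, 0 < z.re := by
    intro z hz
    have h1 : z.re ≠ 0 := hyp z (by rw [hprod]; exact Multiset.mem_add.2 (Or.inr hz))
    by_contra hle
    have h2 : z.re < 0 := lt_of_le_of_ne (not_lt.1 hle) h1
    rw [hprod, Multiset.filter_add, Multiset.card_add, Multiset.filter_singleton,
      if_pos (by simpa using ha), Multiset.card_singleton] at hcard
    have h3 : (g.aroots ℂ).filter (fun z => z.re < 0) = 0 := by
      rw [← Multiset.card_eq_zero]; omega
    have h4 : z ∈ (g.aroots ℂ).filter (fun z => z.re < 0) := Multiset.mem_filter.2 ⟨hz, h2⟩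
    rw [h3] at h4
    simp at h4
  have hun : (T.charpoly.aroots ℂ).filter (fun z => 0 < z.re) = g.aroots ℂ := by
    rw [hprod, Multiset.filter_add, Multiset.filter_singleton,
      if_neg (by simpa using ha.le), Multiset.filter_eq_self.2 hpos]
    simp
  rw [hgeq] at hpos hun hg
  -- Only one explicit root is tested: the smaller one if both are real, the one with imaginary part
  -- `r / 2 ≥ 0` otherwise. Positivity of its real part gives both signs.
  have key : 0 < τ ∧ 0 < D := by
    rcases le_total 0 (τ ^ 2 - 4 * D) with hd | hd
    · have hsq := Real.sq_sqrt hd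
      have h1 := hpos (((τ - √(τ ^ 2 - 4 * D)) / 2 : ℝ) : ℂ) (by
        rw [mem_aroots_quadratic]
        norm_cast
        nlinarith)
      rw [Complex.ofReal_re] at h1
      have h2 := Real.sqrt_nonneg (τ ^ 2 - 4 * D)
      exact ⟨by linarith, by nlinarith⟩
    · have hd' : 0 ≤ -(τ ^ 2 - 4 * D) := by linarith
      have hsq := Real.sq_sqrt hd'
      generalize √(-(τ ^ 2 - 4 * D)) = r at hsq
      have h1 := hpos ⟨τ / 2, r / 2⟩ (by
        rw [mem_aroots_quadratic]
        apply Complex.ext <;> simp [pow_two] <;> nlinarith)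
      simp only at h1
      have hτ : 0 < τ := by linarith
      exact ⟨hτ, by nlinarith⟩
  exact ⟨a, τ, D, ha, key.1, key.2, hg, hun⟩

variable {T : E3 →ₗ[ℝ] E3} {a τ D : ℝ}

/-- The two factors of the characteristic polynomial are coprime, so by Cayley–Hamilton the space is
the direct sum of their kernels, of dimensions 1 and 2 since `a` is a simple root. The plane part
`B` is recorded only through its quadratic equation, so that Jordan blocks and all other cases at
`p` are treated at once. -/
lemma SpectralSplit.exists_coordinates (h : SpectralSplit T a τ D) :
    ∃ (L : E3 ≃L[ℝ] Z) (B : ℂ →L[ℝ] ℂ), (∀ y, B (B y) - τ • B y + D • y = 0) ∧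
      ∀ v, L (T v) = (a * (L v).1, B (L v).2) := by
  set g : ℝ[X] := X ^ 2 - C τ * X + C D with hgdef
  have hga : g.eval a ≠ 0 := by
    have : g.eval a = a ^ 2 - τ * a + D := by simp [hgdef]
    rw [this]
    have := h.stable_neg; have := h.trace_pos; have := h.det_pos
    nlinarith [mul_pos h.trace_pos (neg_pos.2 h.stable_neg)]
  have hcop : IsCoprime (X - C a) g := by
    refine (irreducible_X_sub_C a).isCoprime_or_dvd g |>.resolve_right ?_
    rw [dvd_iff_isRoot]
    exact hga
  set P := LinearMap.ker (aeval T (X - C a)) with hP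
  set Q := LinearMap.ker (aeval T g) with hQ
  have hcompl : IsCompl P Q := by
    refine ⟨disjoint_ker_aeval_of_isCoprime T hcop, codisjoint_iff.2 ?_⟩
    rw [sup_ker_aeval_eq_ker_aeval_mul_of_coprime T hcop, hgdef, ← h.charpoly_eq,
      LinearMap.aeval_self_charpoly, LinearMap.ker_zero]
  have hPe : P = End.eigenspace T a := by
    rw [hP, End.eigenspace_def]
    simp [Algebra.algebraMap_eq_smul_one]
  have hP1 : finrank ℝ P = 1 := by
    have hroot : T.charpoly.IsRoot a := by rw [h.charpoly_eq]; simp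
    have hlow : 0 < finrank ℝ P := by
      rw [hPe, finrank_pos_iff, Submodule.nontrivial_iff_ne_bot]
      exact (End.hasEigenvalue_iff_isRoot_charpoly T a).2 hroot
    have hup : finrank ℝ P ≤ 1 := by
      have h1 : T.charpoly.rootMultiplicity a = 1 := by
        rw [h.charpoly_eq, rootMultiplicity_mul (h.charpoly_eq ▸ T.charpoly_monic.ne_zero),
          rootMultiplicity_X_sub_C_self, rootMultiplicity_eq_zero hga]
      rw [← h1, ← LinearMap.finrank_maxGenEigenspace_eq, hPe]
      exact Submodule.finrank_mono (by
        simpa using (End.genEigenspace T a).monotone (le_top : (1 : ℕ∞) ≤ ⊤))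
    omega
  have hQ2 : finrank ℝ Q = 2 := by
    have := Submodule.finrank_add_eq_of_isCompl hcompl
    simp at this
    omega
  let eP : P ≃ₗ[ℝ] ℝ := LinearEquiv.ofFinrankEq _ _ (by rw [hP1]; simp)
  let eQ : Q ≃ₗ[ℝ] ℂ := LinearEquiv.ofFinrankEq _ _ (by rw [hQ2]; simp)
  let e := Submodule.prodEquivOfIsCompl P Q hcompl
  have hTP : ∀ v : P, T v = a • (v : E3) := fun v => by
    have hv : (v : E3) ∈ End.eigenspace T a := hPe ▸ v.2
    exact End.mem_eigenspace_iff.1 hv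
  have hTQ : ∀ v ∈ Q, T v ∈ Q := fun v hv => by
    rw [hQ, LinearMap.mem_ker] at hv ⊢
    have : aeval T g (T v) = T (aeval T g v) := by
      have h1 : aeval T g * T = T * aeval T g := by
        have := Algebra.commutes (A := ℝ[X]) (1 : ℝ) g
        have h2 : aeval T (g * X) = aeval T (X * g) := by rw [mul_comm]
        simpa using h2
      exact LinearMap.congr_fun h1 v
    rw [this, hv, map_zero]
  let BQ : Q →ₗ[ℝ] Q := T.restrict hTQ
  let B : ℂ →ₗ[ℝ] ℂ := eQ.toLinearMap ∘ₗ BQ ∘ₗ eQ.symm.toLinearMap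
  let L : E3 ≃ₗ[ℝ] Z := e.symm.trans (eP.prodCongr eQ)
  refine ⟨L.toContinuousLinearEquiv, LinearMap.toContinuousLinearMap B, fun y => ?_, fun v => ?_⟩
  · have h1 : ∀ u : Q, BQ (BQ u) - τ • BQ u + D • u = 0 := fun u => by
      have := LinearMap.mem_ker.1 (show (u : E3) ∈ LinearMap.ker (aeval T g) from u.2)
      apply Subtype.ext
      simpa [hgdef, pow_two, BQ] using this
    have h2 := congrArg eQ (h1 (eQ.symm y))
    simpa [B] using h2
  · obtain ⟨⟨x, y⟩, rfl⟩ := e.surjective v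
    have h1 : T (e (x, y)) = e (a • x, BQ y) := by
      simp only [e, Submodule.coe_prodEquivOfIsCompl', map_add, hTP]
      rfl
    rw [h1]
    simp [L, B]

/-- With `α = τ/2` and `β² = D - α² > 0`, the map `J = (B - α)/β` squares to `-1`. Identifying `J`
with multiplication by `i` turns `B` into multiplication by `α + βi`. -/
lemma SpectralSplit.exists_coordinates_complex (h : SpectralSplit T a τ D)
    (him : ∀ z ∈ (T.charpoly.aroots ℂ).filter (fun z => 0 < z.re), z.im ≠ 0) :
    ∃ (L : E3 ≃L[ℝ] Z) (α β : ℝ), 0 < α ∧ β ≠ 0 ∧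
      ∀ v, L (T v) = (a * (L v).1, ((α : ℂ) + β * Complex.I) * (L v).2) := by
  obtain ⟨L, B, hB, hL⟩ := h.exists_coordinates
  have hd : τ ^ 2 - 4 * D < 0 := by
    by_contra hd
    rw [not_lt] at hd
    have hsq := Real.sq_sqrt hd
    refine him (((τ - √(τ ^ 2 - 4 * D)) / 2 : ℝ) : ℂ) ?_ (Complex.ofReal_im _)
    rw [h.unstable_roots, mem_aroots_quadratic]
    norm_cast
    nlinarith
  set α := τ / 2 with hα
  set β := √(D - α ^ 2) with hβ
  have hβ2 : β ^ 2 = D - α ^ 2 := Real.sq_sqrt (by rw [hα]; nlinarith)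
  have hβ0 : 0 < β := Real.sqrt_pos.2 (by rw [hα]; nlinarith)
  have hτ : τ = 2 * α := by rw [hα]; ring
  let J : ℂ →ₗ[ℝ] ℂ := β⁻¹ • ((B : ℂ →ₗ[ℝ] ℂ) - α • LinearMap.id)
  have hBJ : ∀ y, B y = α • y + β • J y := fun y => by
    simp [J, hβ0.ne']
  have hJJ : ∀ y, J (J y) = -y := fun y => by
    have h1 := hB y
    have h2 : β ^ 2 • J (J y) = -(β ^ 2 • y) := by
      have e1 : β • J (J y) = B (J y) - α • J y := by rw [hBJ]; abel
      have e2 : β • J y = B y - α • y := by rw [hBJ]; abel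
      have e3 : β ^ 2 • J (J y) = B (β • J y) - α • (β • J y) := by
        rw [pow_two, mul_smul, e1, smul_sub, map_smul, smul_comm β α]
      rw [e3, e2, map_sub, map_smul, smul_sub, hβ2]
      rw [hτ] at h1
      have e4 : B (B y) = (2 * α) • B y - D • y := by linear_combination h1
      rw [e4]
      simp only [Complex.real_smul]
      push_cast
      ring
    have h3 : β ^ 2 • (J (J y) + y) = 0 := by rw [smul_add, h2]; abel
    rcases smul_eq_zero.1 h3 with h4 | h4
    · exact absurd h4 (by positivity)
    · exact eq_neg_of_add_eq_zero_left h4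
  let E : ℂ →ₗ[ℝ] ℂ :=
    { toFun := fun z => z.re • (1 : ℂ) + z.im • J 1
      map_add' := fun x y => by simp only [Complex.add_re, Complex.add_im, add_smul]; abel
      map_smul' := fun c x => by
        simp only [Complex.smul_re, Complex.smul_im, smul_eq_mul, mul_smul, smul_add,
          RingHom.id_apply] }
  have hEI : ∀ z, E (Complex.I * z) = J (E z) := fun z => by
    simp only [E, LinearMap.coe_mk, AddHom.coe_mk, map_add, map_smul, hJJ]
    simp only [Complex.mul_re, Complex.mul_im, Complex.I_re, Complex.I_im]
    simp [add_comm]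
  have hinj : Function.Injective E := by
    rw [← LinearMap.ker_eq_bot, LinearMap.ker_eq_bot']
    intro z hz
    have h1 : z.re • (1 : ℂ) + z.im • J 1 = 0 := hz
    have h2 : z.re • J 1 - z.im • (1 : ℂ) = 0 := by
      have := congrArg J h1
      simp only [map_add, map_smul, hJJ, map_zero, smul_neg] at this
      rw [sub_eq_add_neg]; exact this
    have h3 : (z.re ^ 2 + z.im ^ 2) • (1 : ℂ) = 0 := by
      have : (z.re ^ 2 + z.im ^ 2) • (1 : ℂ) =
        z.re • (z.re • (1 : ℂ) + z.im • J 1) - z.im • (z.re • J 1 - z.im • (1 : ℂ)) := by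
        simp only [Complex.real_smul]; push_cast; ring
      rw [this, h1, h2, smul_zero, smul_zero, sub_zero]
    have h4 : z.re ^ 2 + z.im ^ 2 = 0 := by
      have h5 := congrArg Complex.re h3
      rw [Complex.smul_re, Complex.one_re, Complex.zero_re, smul_eq_mul, mul_one] at h5
      exact h5
    apply Complex.ext
    · simp only [Complex.zero_re]; nlinarith [sq_nonneg z.re, sq_nonneg z.im]
    · simp only [Complex.zero_im]; nlinarith [sq_nonneg z.re, sq_nonneg z.im]
  let e : ℂ ≃ₗ[ℝ] ℂ := LinearEquiv.ofInjectiveEndo E hinj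
  have hee : ∀ z, e z = E z := fun z => rfl
  let e' : Z ≃L[ℝ] Z := ((LinearEquiv.refl ℝ ℝ).prodCongr e.symm).toContinuousLinearEquiv
  refine ⟨L.trans e', α, β, by rw [hα]; have := h.trace_pos; positivity, hβ0.ne', fun v => ?_⟩
  have e1 : ∀ w : Z, e' w = (w.1, e.symm w.2) := fun w => rfl
  simp only [ContinuousLinearEquiv.trans_apply, hL, e1]
  refine Prod.ext rfl ?_
  simp only
  rw [LinearEquiv.symm_apply_eq]
  obtain ⟨y, hy⟩ := e.surjective (L v).2
  rw [← hy, e.symm_apply_apply, hBJ, hee, ← hEI]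
  have : ((α : ℂ) + β * Complex.I) * y = α • y + β • (Complex.I * y) := by
    simp only [Complex.real_smul]; ring
  rw [this, hee, map_add, map_smul, map_smul]

/-- Distinct real roots provide an eigenbasis. It is ordered so that the real axis of the plane is
the weak and the imaginary axis the strong unstable direction. -/
lemma SpectralSplit.exists_coordinates_real (h : SpectralSplit T a τ D)
    (him : ∀ z ∈ (T.charpoly.aroots ℂ).filter (fun z => 0 < z.re), z.im = 0)
    (hnd : ((T.charpoly.aroots ℂ).filter (fun z => 0 < z.re)).Nodup) :
    ∃ (L : E3 ≃L[ℝ] Z) (μ₁ μ₂ : ℝ), 0 < μ₁ ∧ μ₁ < μ₂ ∧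
      (μ₁ : ℂ) ∈ (T.charpoly.aroots ℂ).filter (fun z => 0 < z.re) ∧
      ∀ v, L (T v) = (a * (L v).1, ⟨μ₁ * (L v).2.re, μ₂ * (L v).2.im⟩) := by
  have hd : 0 < τ ^ 2 - 4 * D := by
    rcases lt_trichotomy (τ ^ 2 - 4 * D) 0 with hd | hd | hd
    · exfalso
      have hd' : 0 ≤ -(τ ^ 2 - 4 * D) := by linarith
      have hsq := Real.sq_sqrt hd'
      have hpos : 0 < √(-(τ ^ 2 - 4 * D)) := Real.sqrt_pos.2 (by linarith)
      generalize √(-(τ ^ 2 - 4 * D)) = r at hsq hpos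
      have := him ⟨τ / 2, r / 2⟩ (by
        rw [h.unstable_roots, mem_aroots_quadratic]
        apply Complex.ext <;> simp [pow_two] <;> nlinarith)
      simp only at this
      linarith
    · exfalso
      rw [h.unstable_roots] at hnd
      have h1 : (X ^ 2 - C τ * X + C D : ℝ[X]) = (X - C (τ / 2)) * (X - C (τ / 2)) := by
        have : D = (τ / 2) * (τ / 2) := by nlinarith
        rw [this, C_mul]
        have h2 : C τ = C (τ / 2) + C (τ / 2) := by rw [← C_add]; congr 1; ring
        rw [h2]; ring
      rw [h1, aroots_mul (by rw [← h1]; exact quadratic_ne_zero τ D), aroots_X_sub_C] at hnd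
      rw [Multiset.singleton_add, Multiset.nodup_cons] at hnd
      exact hnd.1 (Multiset.mem_singleton_self _)
    · exact hd
  have hsq := Real.sq_sqrt hd.le
  have hr : 0 < √(τ ^ 2 - 4 * D) := Real.sqrt_pos.2 hd
  generalize √(τ ^ 2 - 4 * D) = r at hsq hr
  have hτ := h.trace_pos
  have hD := h.det_pos
  have hrτ : r < τ := by nlinarith
  have hroot : ∀ μ : ℝ, μ ^ 2 - τ * μ + D = 0 → ∃ v, End.HasEigenvector T μ v := fun μ hμ => by
    refine End.HasEigenvalue.exists_hasEigenvector ?_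
    rw [End.hasEigenvalue_iff_isRoot_charpoly, h.charpoly_eq]
    simp [hμ]
  obtain ⟨v₁, hv₁⟩ := hroot ((τ - r) / 2) (by nlinarith)
  obtain ⟨v₂, hv₂⟩ := hroot ((τ + r) / 2) (by nlinarith)
  obtain ⟨v₀, hv₀⟩ : ∃ v, End.HasEigenvector T a v := by
    refine End.HasEigenvalue.exists_hasEigenvector ?_
    rw [End.hasEigenvalue_iff_isRoot_charpoly, h.charpoly_eq]
    simp
  have ha := h.stable_neg
  have hli := End.eigenvectors_linearIndependent' T ![a, (τ - r) / 2, (τ + r) / 2]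
    (by
      intro i j hij
      fin_cases i <;> fin_cases j <;> simp at hij ⊢ <;> linarith) ![v₀, v₁, v₂]
    (by intro i; fin_cases i <;> simpa)
  let b := basisOfLinearIndependentOfCardEqFinrank hli (by simp)
  have hb : ∀ i, b i = ![v₀, v₁, v₂] i := fun i => by simp [b]
  let e : (Fin 3 → ℝ) ≃ₗ[ℝ] Z :=
    { toFun := fun c => (c 0, ⟨c 1, c 2⟩)
      invFun := fun z => ![z.1, z.2.re, z.2.im]
      map_add' := fun x y => rfl
      map_smul' := fun c x => by
        refine Prod.ext rfl (Complex.ext ?_ ?_) <;> simp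
      left_inv := fun c => by funext i; fin_cases i <;> rfl
      right_inv := fun z => rfl }
  let L : E3 ≃ₗ[ℝ] Z := b.equivFun.trans e
  refine ⟨L.toContinuousLinearEquiv, (τ - r) / 2, (τ + r) / 2, by linarith, by linarith, ?_, ?_⟩
  · rw [h.unstable_roots, mem_aroots_quadratic]
    norm_cast
    nlinarith
  · let S : Z →ₗ[ℝ] Z :=
      { toFun := fun z => (a * z.1, ⟨(τ - r) / 2 * z.2.re, (τ + r) / 2 * z.2.im⟩)
        map_add' := fun x y => by
          refine Prod.ext ?_ (Complex.ext ?_ ?_) <;> simp [mul_add]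
        map_smul' := fun c x => by
          refine Prod.ext ?_ (Complex.ext ?_ ?_) <;> simp [mul_left_comm] }
    have he : ∀ c, e c = (c 0, ⟨c 1, c 2⟩) := fun _ => rfl
    have hS : ∀ z, S z = (a * z.1, ⟨(τ - r) / 2 * z.2.re, (τ + r) / 2 * z.2.im⟩) := fun _ => rfl
    have key : L.toLinearMap ∘ₗ T = S ∘ₗ L.toLinearMap := by
      refine b.ext fun i => ?_
      have hLb : ∀ i, L (b i) = e (Pi.single i 1) := fun i => by
        have h0 : b.equivFun (b i) = Pi.single i 1 := by
          rw [Module.Basis.equivFun_apply, Module.Basis.repr_self, Finsupp.single_eq_pi_single]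
        rw [← h0]; rfl
      simp only [LinearMap.comp_apply, LinearEquiv.coe_coe]
      have hT : T (b i) = (![a, (τ - r) / 2, (τ + r) / 2] i) • b i := by
        rw [hb]
        fin_cases i
        · exact hv₀.apply_eq_smul
        · exact hv₁.apply_eq_smul
        · exact hv₂.apply_eq_smul
      rw [hT, map_smul, hLb]
      fin_cases i <;> refine Prod.ext ?_ (Complex.ext ?_ ?_) <;> simp [he, hS]
    intro v
    exact LinearMap.congr_fun key v

end LinearAlgebra

end SaddleConn

/-! ### Linear flows of the plane and a Lyapunov form -/

namespace SaddleConn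

/-- `P` is the flow of the linear vector field `B` on the plane. -/
structure IsLinFlow (B : ℂ →L[ℝ] ℂ) (P : ℝ → ℂ →L[ℝ] ℂ) : Prop where
  zero : ∀ y, P 0 y = y
  add : ∀ s t y, P (s + t) y = P s (P t y)
  deriv : ∀ y t, HasDerivAt (fun t => P t y) (B (P t y)) t
  cont : Continuous P

lemma isLinFlow_exp (B : ℂ →L[ℝ] ℂ) : IsLinFlow B fun t => NormedSpace.exp (t • B) where
  zero y := by
    let _ : NormedAlgebra ℚ (ℂ →L[ℝ] ℂ) := NormedAlgebra.restrictScalars ℚ ℝ _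
    have h : (0 : ℝ) • B = 0 := zero_smul ℝ B
    rw [h, NormedSpace.exp_zero]; rfl
  add s t y := by
    let _ : NormedAlgebra ℚ (ℂ →L[ℝ] ℂ) := NormedAlgebra.restrictScalars ℚ ℝ _
    have h : (s + t) • B = s • B + t • B := add_smul s t B
    have hc : Commute (s • B) (t • B) := by
      refine ContinuousLinearMap.ext fun y => ?_
      change s • B (t • B y) = t • B (s • B y)
      rw [map_smul, map_smul, smul_comm]
    rw [h, NormedSpace.exp_add_of_commute hc]
    rfl
  deriv y t := by
    have h := hasDerivAt_exp_smul_const' (𝕂 := ℝ) B t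
    have h1 := h.hasFDerivAt.clm_apply (hasFDerivAt_const y t)
    have := h1.hasDerivAt
    simpa using this
  cont := by
    let _ : NormedAlgebra ℚ (ℂ →L[ℝ] ℂ) := NormedAlgebra.restrictScalars ℚ ℝ _
    exact NormedSpace.exp_continuous.comp (continuous_id.smul continuous_const)

/-- Multiplication by a complex number as a real linear map. -/
def mulC (w : ℂ) : ℂ →L[ℝ] ℂ := (ContinuousLinearMap.mul ℝ ℂ) w

@[simp] lemma mulC_apply (w y : ℂ) : mulC w y = w * y := rfl

lemma isLinFlow_mulC (w : ℂ) : IsLinFlow (mulC w) fun t => mulC (Complex.exp (w * t)) where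
  zero y := by simp
  add s t y := by
    simp only [mulC_apply]
    rw [← mul_assoc, ← Complex.exp_add, Complex.ofReal_add, mul_add]
  deriv y t := by
    simp only [mulC_apply]
    have h1 : HasDerivAt (fun t : ℝ => w * (t : ℂ)) w t := by
      simpa using ((hasDerivAt_id t).ofReal_comp).const_mul w
    have h2 := (h1.cexp).mul_const y
    exact h2.congr_deriv (by ring)
  cont := by
    refine (ContinuousLinearMap.mul ℝ ℂ).continuous.comp ?_
    fun_prop

/-- The diagonal real linear map with entries `m₁`, `m₂`. -/
def diagC (m₁ m₂ : ℝ) : ℂ →L[ℝ] ℂ :=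
  m₁ • (Complex.ofRealCLM.comp Complex.reCLM) +
    m₂ • ((mulC Complex.I).comp (Complex.ofRealCLM.comp Complex.imCLM))

@[simp] lemma diagC_apply (m₁ m₂ : ℝ) (y : ℂ) : diagC m₁ m₂ y = ⟨m₁ * y.re, m₂ * y.im⟩ := by
  apply Complex.ext <;> simp [diagC]

lemma isLinFlow_diagC (m₁ m₂ : ℝ) :
    IsLinFlow (diagC m₁ m₂) fun t => diagC (Real.exp (m₁ * t)) (Real.exp (m₂ * t)) where
  zero y := by simp
  add s t y := by
    apply Complex.ext <;> simp [mul_add, Real.exp_add, mul_assoc]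
  deriv y t := by
    have h1 : ∀ m u : ℝ, HasDerivAt (fun t : ℝ => Real.exp (m * t) * u)
        (m * (Real.exp (m * t) * u)) t := fun m u => by
      have h := (((hasDerivAt_id t).const_mul m).exp).mul_const u
      simp only [id, mul_one] at h
      exact h.congr_deriv (by ring)
    have h2 := ((h1 m₁ y.re).ofReal_comp).add (((h1 m₂ y.im).ofReal_comp).mul_const Complex.I)
    have e : (fun t : ℝ => diagC (Real.exp (m₁ * t)) (Real.exp (m₂ * t)) y) = fun t : ℝ =>
        ((Real.exp (m₁ * t) * y.re : ℝ) : ℂ) + ((Real.exp (m₂ * t) * y.im : ℝ) : ℂ) * Complex.I := by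
      funext t
      rw [diagC_apply, Complex.mk_eq_add_mul_I]
    rw [e]
    refine h2.congr_deriv ?_
    rw [diagC_apply, diagC_apply, Complex.mk_eq_add_mul_I]
  cont := by unfold diagC; fun_prop

namespace IsLinFlow

variable {B : ℂ →L[ℝ] ℂ} {P : ℝ → ℂ →L[ℝ] ℂ}

lemma neg_apply (h : IsLinFlow B P) (t : ℝ) (y : ℂ) : P (-t) (P t y) = y := by
  rw [← h.add, neg_add_cancel, h.zero]

lemma apply_neg (h : IsLinFlow B P) (t : ℝ) (y : ℂ) : P t (P (-t) y) = y := by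
  rw [← h.add, add_neg_cancel, h.zero]

lemma eq_zero_iff (h : IsLinFlow B P) (t : ℝ) (y : ℂ) : P t y = 0 ↔ y = 0 :=
  ⟨fun e => by rw [← h.neg_apply t y, e, map_zero], fun e => by rw [e, map_zero]⟩

end IsLinFlow

/-- The linear flow with stable rate `a` on the line and `P` on the plane. -/
def saddleFlow (a : ℝ) (P : ℝ → ℂ →L[ℝ] ℂ) (t : ℝ) (z : Z) : Z := (Real.exp (a * t) * z.1, P t z.2)

lemma isC1Flow_saddleFlow {B : ℂ →L[ℝ] ℂ} {P : ℝ → ℂ →L[ℝ] ℂ} (h : IsLinFlow B P) (a : ℝ) :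
    IsC1Flow (saddleFlow a P) where
  zero z := by simp [saddleFlow, h.zero]
  add s t z := by simp [saddleFlow, h.add, mul_add, Real.exp_add, mul_assoc]
  cont := by
    unfold saddleFlow
    refine Continuous.prodMk (by fun_prop) ?_
    exact (h.cont.comp continuous_fst).clm_apply (continuous_snd.comp continuous_snd)
  contDiff t := by unfold saddleFlow; fun_prop
  map_zero t := by simp [saddleFlow]

lemma hasDerivAt_saddleFlow {B : ℂ →L[ℝ] ℂ} {P : ℝ → ℂ →L[ℝ] ℂ} (h : IsLinFlow B P) (a : ℝ)
    (z : Z) (t : ℝ) : HasDerivAt (fun t => saddleFlow a P t z)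
      (((a • ContinuousLinearMap.id ℝ ℝ).prodMap B) (saddleFlow a P t z)) t := by
  refine HasDerivAt.prodMk ?_ (h.deriv z.2 t)
  have h := (((hasDerivAt_id t).const_mul a).exp).mul_const z.1
  simp only [id, mul_one] at h
  refine h.congr_deriv ?_
  change _ = a * (Real.exp (a * t) * z.1)
  ring

section Lyapunov

variable {B : ℂ →L[ℝ] ℂ} {P : ℝ → ℂ →L[ℝ] ℂ} {τ D : ℝ}

/-- A quadratic form that increases along an expanding planar linear flow. -/
def lyapunov (B : ℂ →L[ℝ] ℂ) (τ D : ℝ) (y : ℂ) : ℝ := D * ‖y‖ ^ 2 + ‖τ • y - B y‖ ^ 2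

lemma continuous_lyapunov : Continuous (lyapunov B τ D) := by unfold lyapunov; fun_prop

lemma lyapunov_smul (r : ℝ) (y : ℂ) : lyapunov B τ D (r • y) = r ^ 2 * lyapunov B τ D y := by
  have : τ • r • y - B (r • y) = r • (τ • y - B y) := by
    rw [map_smul, smul_sub, smul_comm]
  simp only [lyapunov, this, norm_smul, mul_pow, Real.norm_eq_abs, sq_abs]
  ring

lemma le_lyapunov (y : ℂ) : D * ‖y‖ ^ 2 ≤ lyapunov B τ D y := by
  unfold lyapunov; nlinarith [sq_nonneg ‖τ • y - B y‖]

lemma lyapunov_pos (hD : 0 < D) {y : ℂ} (hy : y ≠ 0) : 0 < lyapunov B τ D y :=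
  lt_of_lt_of_le (by have := norm_pos_iff.2 hy; positivity) (le_lyapunov y)

lemma lyapunov_le (hτ : 0 < τ) (y : ℂ) :
    lyapunov B τ D y ≤ (D + (τ + ‖B‖) ^ 2) * ‖y‖ ^ 2 := by
  have h1 : ‖τ • y - B y‖ ≤ (τ + ‖B‖) * ‖y‖ := by
    refine (norm_sub_le _ _).trans ?_
    rw [norm_smul, Real.norm_of_nonneg hτ.le, add_mul]
    gcongr
    exact B.le_opNorm y
  have h2 : ‖τ • y - B y‖ ^ 2 ≤ ((τ + ‖B‖) * ‖y‖) ^ 2 := by gcongr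
  unfold lyapunov
  nlinarith

/-- This identity explains the choice of the form. By the equation of `B`, the vector `w = τy - By`
satisfies `w' = Dy`, so the derivative is `2D(⟨y, By⟩ + ⟨w, y⟩) = 2Dτ‖y‖²`. -/
lemma hasDerivAt_lyapunov (hP : IsLinFlow B P) (hB : ∀ y, B (B y) - τ • B y + D • y = 0)
    (y : ℂ) (t : ℝ) :
    HasDerivAt (fun t => lyapunov B τ D (P t y)) (2 * D * τ * ‖P t y‖ ^ 2) t := by
  have h1 := hP.deriv y t
  have h2 : HasDerivAt (fun t => τ • P t y - B (P t y)) (D • P t y) t := by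
    have := (h1.const_smul τ).sub (B.hasFDerivAt.comp_hasDerivAt t h1)
    refine this.congr_deriv ?_
    rw [← sub_eq_zero, ← neg_eq_zero, ← hB (P t y)]; abel
  have h3 := (h1.norm_sq.const_mul D).add h2.norm_sq
  refine h3.congr_deriv ?_
  generalize P t y = u
  rw [inner_smul_right]
  have : inner ℝ u (B u) + inner ℝ (τ • u - B u) u = τ * ‖u‖ ^ 2 := by
    rw [inner_sub_left, real_inner_smul_left, real_inner_self_eq_norm_sq, real_inner_comm]; ring
  linear_combination 2 * D * this

/-- The form is at most `C‖y‖²`, so its derivative `2Dτ‖y‖²` is at least `k` times the form, and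
`exp (-k t)` times the form is nondecreasing along orbits. -/
lemma exists_lyapunov_growth (hP : IsLinFlow B P) (hB : ∀ y, B (B y) - τ • B y + D • y = 0)
    (hτ : 0 < τ) (hD : 0 < D) : ∃ k > 0, ∀ y t, 0 ≤ t →
      Real.exp (k * t) * lyapunov B τ D y ≤ lyapunov B τ D (P t y) := by
  set C := D + (τ + ‖B‖) ^ 2 with hC
  have hCpos : 0 < C := by positivity
  refine ⟨2 * D * τ / C, by positivity, fun y t ht => ?_⟩
  set k := 2 * D * τ / C with hk
  have hmono : Monotone fun t => Real.exp (-k * t) * lyapunov B τ D (P t y) := by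
    have hd : ∀ t, HasDerivAt (fun t => Real.exp (-k * t) * lyapunov B τ D (P t y))
        (Real.exp (-k * t) * (2 * D * τ * ‖P t y‖ ^ 2 - k * lyapunov B τ D (P t y))) t := by
      intro t
      have h1 := (((hasDerivAt_id t).const_mul (-k)).exp).mul (hasDerivAt_lyapunov hP hB y t)
      simp only [id, mul_one] at h1
      exact h1.congr_deriv (by ring)
    refine monotone_of_deriv_nonneg (fun t => (hd t).differentiableAt) fun t => ?_
    rw [(hd t).deriv]
    refine mul_nonneg (Real.exp_pos _).le ?_
    have h2 := lyapunov_le (B := B) (D := D) hτ (P t y)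
    have h3 : k * lyapunov B τ D (P t y) ≤ k * (C * ‖P t y‖ ^ 2) := by
      gcongr
    have h4 : k * (C * ‖P t y‖ ^ 2) = 2 * D * τ * ‖P t y‖ ^ 2 := by
      rw [hk]; field_simp
    linarith
  have := hmono ht
  simp only [mul_zero, Real.exp_zero, one_mul, hP.zero] at this
  calc Real.exp (k * t) * lyapunov B τ D y
      ≤ Real.exp (k * t) * (Real.exp (-k * t) * lyapunov B τ D (P t y)) := by gcongr
    _ = lyapunov B τ D (P t y) := by
        rw [← mul_assoc, ← Real.exp_add]; simp

end Lyapunov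

end SaddleConn

/-! ### Conjugacy of an expanding planar flow to a dilation -/

namespace SaddleConn

section

variable {B : ℂ →L[ℝ] ℂ} {P : ℝ → ℂ →L[ℝ] ℂ} {τ D : ℝ}

/-- An expanding planar linear flow is conjugate to a dilation. -/
lemma exists_homeo_dilation (hP : IsLinFlow B P) (hB : ∀ y, B (B y) - τ • B y + D • y = 0)
    (hτ : 0 < τ) (hD : 0 < D) {c : ℝ} (hc : 0 < c) :
    ∃ e : ℂ ≃ₜ ℂ, e 0 = 0 ∧ ∀ t y, e (P t y) = Real.exp (c * t) • e y := by
  obtain ⟨k, hk, hgrow⟩ := exists_lyapunov_growth hP hB hτ hD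
  set Q := lyapunov B τ D with hQ
  have hQc : Continuous Q := continuous_lyapunov
  have hQ0 : Q 0 = 0 := by simp [hQ, lyapunov]
  have hQpos : ∀ y, y ≠ 0 → 0 < Q y := fun y hy => lyapunov_pos hD hy
  have hPc : ∀ y, Continuous fun t => P t y := fun y => hP.cont.clm_apply continuous_const
  have hdec : ∀ y t, 0 ≤ t → Q (P (-t) y) ≤ Real.exp (-(k * t)) * Q y := fun y t ht => by
    have := hgrow (P (-t) y) t ht
    rw [hP.apply_neg] at this
    rw [Real.exp_neg, ← div_eq_inv_mul, le_div_iff₀ (Real.exp_pos _)]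
    linarith
  have hmono : ∀ y, y ≠ 0 → StrictMono fun t => Q (P t y) := fun y hy s t hst => by
    have h1 := hgrow (P s y) (t - s) (by linarith)
    rw [← hP.add, sub_add_cancel] at h1
    have h2 := hQpos (P s y) (by rwa [Ne, hP.eq_zero_iff])
    have h3 : 1 < Real.exp (k * (t - s)) := Real.one_lt_exp_iff.2 (mul_pos hk (by linarith))
    have h4 : Q (P s y) < Real.exp (k * (t - s)) * Q (P s y) := by nlinarith
    exact h4.trans_le h1
  have htop : ∀ y, y ≠ 0 → Tendsto (fun t => Q (P t y)) atTop atTop := fun y hy => by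
    have h1 : Tendsto (fun t => Real.exp (k * t) * Q y) atTop atTop :=
      (Real.tendsto_exp_atTop.comp (tendsto_id.const_mul_atTop hk)).atTop_mul_const (hQpos y hy)
    refine tendsto_atTop_mono' _ ?_ h1
    filter_upwards [eventually_ge_atTop 0] with t ht using hgrow y t ht
  have hbot : ∀ y, Tendsto (fun t => Q (P (-t) y)) atTop (𝓝 0) := fun y => by
    have h1 : Tendsto (fun t => Real.exp (-(k * t)) * Q y) atTop (𝓝 (0 * Q y)) :=
      ((Real.tendsto_exp_neg_atTop_nhds_zero).comp (tendsto_id.const_mul_atTop hk)).mul_const _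
    rw [zero_mul] at h1
    refine squeeze_zero' (Eventually.of_forall fun t => ?_) ?_ h1
    · exact (mul_nonneg hD.le (sq_nonneg _)).trans (le_lyapunov _)
    · filter_upwards [eventually_ge_atTop 0] with t ht using hdec y t ht
  have hex : ∀ y, y ≠ 0 → ∃ t, Q (P (-t) y) = 1 := fun y hy => by
    obtain ⟨t₁, h1⟩ := ((htop y hy).eventually (eventually_ge_atTop 1)).exists
    obtain ⟨t₂, h2⟩ := ((hbot y).eventually (gt_mem_nhds one_pos)).exists
    have hcont : Continuous fun t => Q (P t y) := hQc.comp (hPc y)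
    obtain ⟨t, ht⟩ := mem_range_of_exists_le_of_exists_ge hcont ⟨-t₂, h2.le⟩ ⟨t₁, h1⟩
    exact ⟨-t, by rwa [neg_neg]⟩
  -- Each nonzero orbit crosses the level `Q = 1` exactly once; `T y` is the time elapsed since that
  -- crossing.
  choose! T hT using hex
  have hTuniq : ∀ y, y ≠ 0 → ∀ t, Q (P (-t) y) = 1 → T y = t := fun y hy t ht => by
    have := (hmono y hy).injective ((hT y hy).trans ht.symm)
    linarith
  have hTlt : ∀ y, y ≠ 0 → ∀ s, T y < s ↔ Q (P (-s) y) < 1 := fun y hy s => by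
    rw [← hT y hy, (hmono y hy).lt_iff_lt, neg_lt_neg_iff]
  have hTgt : ∀ y, y ≠ 0 → ∀ s, s < T y ↔ 1 < Q (P (-s) y) := fun y hy s => by
    rw [← hT y hy, (hmono y hy).lt_iff_lt, neg_lt_neg_iff]
  have hQP : ∀ s, Continuous fun y => Q (P s y) := fun s => hQc.comp (P s).continuous
  have hTc : ∀ y, y ≠ 0 → ContinuousAt T y := fun y hy => by
    refine tendsto_order.2 ⟨fun s hs => ?_, fun s hs => ?_⟩
    · filter_upwards [isOpen_ne.mem_nhds hy, (hQP (-s)).continuousAt.eventually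
        (lt_mem_nhds ((hTgt y hy s).1 hs))] with z hz hz' using (hTgt z hz s).2 hz'
    · filter_upwards [isOpen_ne.mem_nhds hy, (hQP (-s)).continuousAt.eventually
        (gt_mem_nhds ((hTlt y hy s).1 hs))] with z hz hz' using (hTlt z hz s).2 hz'
  -- the direction of the point of the orbit on the unit level
  have hdir : ∀ y, y ≠ 0 → P (-T y) y ≠ 0 := fun y hy => by rwa [Ne, hP.eq_zero_iff]
  let u : ℂ → ℂ := fun y => (‖P (-T y) y‖⁻¹ : ℝ) • P (-T y) y
  have hu : ∀ y, y ≠ 0 → ‖u y‖ = 1 := fun y hy => norm_smul_inv_norm (𝕜 := ℝ) (hdir y hy)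
  -- The conjugacy in polar coordinates: the direction of the crossing point becomes the angle and
  -- `exp (c T)` the radius. The inverse `g` first places `w` on the level `Q = 1` of its ray and
  -- then follows the flow for time `log ‖w‖ / c`.
  let f : ℂ → ℂ := fun y => if y = 0 then 0 else Real.exp (c * T y) • u y
  let g : ℂ → ℂ := fun w => P (Real.log ‖w‖ / c) ((√(Q w))⁻¹ • w)
  have hg0 : g 0 = 0 := by simp [g]
  have hgQ : ∀ w, w ≠ 0 → Q ((√(Q w))⁻¹ • w) = 1 := fun w hw => by
    rw [hQ, lyapunov_smul, ← hQ, inv_pow, Real.sq_sqrt (hQpos w hw).le,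
      inv_mul_cancel₀ (hQpos w hw).ne']
  have hgne : ∀ w, w ≠ 0 → g w ≠ 0 := fun w hw => by
    rw [Ne, hP.eq_zero_iff, smul_eq_zero, not_or]
    exact ⟨inv_ne_zero (Real.sqrt_ne_zero'.2 (hQpos w hw)), hw⟩
  have hTg : ∀ w, w ≠ 0 → T (g w) = Real.log ‖w‖ / c := fun w hw =>
    hTuniq _ (hgne w hw) _ (by rw [hP.neg_apply, hgQ w hw])
  have hfn : ∀ y, y ≠ 0 → f y = Real.exp (c * T y) • u y := fun y hy => if_neg hy
  have hfnorm : ∀ y, y ≠ 0 → ‖f y‖ = Real.exp (c * T y) := fun y hy => by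
    rw [hfn y hy, norm_smul, hu y hy, mul_one, Real.norm_of_nonneg (Real.exp_pos _).le]
  have hgf : ∀ y, g (f y) = y := fun y => by
    by_cases hy : y = 0
    · simp [f, hy, hg0]
    · have h1 : Real.log ‖f y‖ / c = T y := by
        rw [hfnorm y hy, Real.log_exp, mul_div_cancel_left₀ _ hc.ne']
      have hr : 0 < Real.exp (c * T y) * ‖P (-T y) y‖⁻¹ :=
        mul_pos (Real.exp_pos _) (inv_pos.2 (norm_pos_iff.2 (hdir y hy)))
      have h2 : f y = (Real.exp (c * T y) * ‖P (-T y) y‖⁻¹) • P (-T y) y := by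
        rw [hfn y hy, mul_smul]
      change P (Real.log ‖f y‖ / c) ((√(Q (f y)))⁻¹ • f y) = y
      rw [h1, h2, hQ, lyapunov_smul, ← hQ, hT y hy, mul_one, Real.sqrt_sq hr.le, smul_smul,
        inv_mul_cancel₀ hr.ne', one_smul, hP.apply_neg]
  have hfg : ∀ w, f (g w) = w := fun w => by
    by_cases hw : w = 0
    · simp [f, hw, hg0]
    · have hs : 0 < (√(Q w))⁻¹ := inv_pos.2 (Real.sqrt_pos.2 (hQpos w hw))
      rw [hfn _ (hgne w hw)]
      simp only [u]
      rw [hTg w hw]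
      simp only [g]
      rw [hP.neg_apply, norm_smul, Real.norm_of_nonneg hs.le, smul_smul, smul_smul,
        mul_div_cancel₀ _ hc.ne', Real.exp_log (norm_pos_iff.2 hw)]
      have hw' := norm_pos_iff.2 hw
      have hs' : 0 < √(Q w) := inv_pos.1 hs
      have : ‖w‖ * ((√(Q w))⁻¹ * ‖w‖)⁻¹ * (√(Q w))⁻¹ = 1 := by
        field_simp
      rw [this, one_smul]
  have hfc : Continuous f := by
    rw [continuous_iff_continuousAt]
    intro y
    by_cases hy : y = 0
    · subst hy
      have hf0 : f 0 = 0 := if_pos rfl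
      rw [ContinuousAt, hf0, tendsto_zero_iff_norm_tendsto_zero, tendsto_order]
      refine ⟨fun s hs => Eventually.of_forall fun y => hs.trans_le (norm_nonneg _),
        fun s hs => ?_⟩
      have h1 : ∀ᶠ y in 𝓝 (0 : ℂ), Q (P (-(Real.log s / c)) y) < 1 :=
        (hQP _).continuousAt.eventually (gt_mem_nhds (by simp [hQ0]))
      filter_upwards [h1] with y hy
      by_cases hy0 : y = 0
      · simpa [hy0, hf0]
      · rw [hfnorm y hy0, ← Real.lt_log_iff_exp_lt hs]
        have := (hTlt y hy0 _).2 hy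
        rw [lt_div_iff₀ hc] at this
        linarith
    · have h1 : ContinuousAt (fun y => P (-T y) y) y :=
        (hP.cont.continuousAt.comp (hTc y hy).neg).clm_apply continuousAt_id
      have h2 : ContinuousAt u y := (h1.norm.inv₀ (norm_ne_zero_iff.2 (hdir y hy))).smul h1
      have h3 : ContinuousAt (fun y => Real.exp (c * T y) • u y) y :=
        ((Real.continuous_exp.continuousAt.comp ((hTc y hy).const_mul c))).smul h2
      refine h3.congr ?_
      filter_upwards [isOpen_ne.mem_nhds hy] with z hz using (hfn z hz).symm
  have hgc : Continuous g := by
    rw [continuous_iff_continuousAt]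
    intro w
    by_cases hw : w = 0
    · subst hw
      -- Near the origin the time is very negative, and the decay of `Q` backward in time yields
      -- continuity of `g` at `0`.
      have key : ∀ w, w ≠ 0 → ‖w‖ ≤ 1 → D * ‖g w‖ ^ 2 ≤ Real.exp (k * (Real.log ‖w‖ / c)) := by
        intro w hw h1
        have hl : 0 ≤ -(Real.log ‖w‖ / c) := by
          rw [neg_nonneg]
          exact div_nonpos_of_nonpos_of_nonneg (Real.log_nonpos (norm_nonneg _) h1) hc.le
        have h2 := hdec ((√(Q w))⁻¹ • w) _ hl
        rw [neg_neg, hgQ w hw, mul_one, mul_neg, neg_neg] at h2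
        exact (le_lyapunov _).trans h2
      have hlim : Tendsto (fun w : ℂ => Real.exp (k * (Real.log ‖w‖ / c))) (𝓝[≠] 0) (𝓝 0) := by
        refine Real.tendsto_exp_atBot.comp (Tendsto.const_mul_atBot hk
          (Tendsto.atBot_div_const hc (Real.tendsto_log_nhdsNE_zero.comp ?_)))
        refine tendsto_nhdsWithin_iff.2 ⟨?_, ?_⟩
        · have : Tendsto (fun w : ℂ => ‖w‖) (𝓝 0) (𝓝 ‖(0 : ℂ)‖) := continuous_norm.tendsto 0
          rw [norm_zero] at this
          exact this.mono_left nhdsWithin_le_nhds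
        · filter_upwards [self_mem_nhdsWithin] with w hw using norm_ne_zero_iff.2 hw
      rw [continuousAt_iff_punctured_nhds, hg0, tendsto_zero_iff_norm_tendsto_zero]
      have h3 : Tendsto (fun w => D * ‖g w‖ ^ 2) (𝓝[≠] 0) (𝓝 0) := by
        refine squeeze_zero' (Eventually.of_forall fun w => by positivity) ?_ hlim
        filter_upwards [self_mem_nhdsWithin,
          mem_nhdsWithin_of_mem_nhds (Metric.closedBall_mem_nhds (0 : ℂ) one_pos)] with w hw h1
        exact key w hw (by simpa using h1)
      have h4 := ((h3.const_mul D⁻¹).sqrt)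
      simp only [mul_zero, Real.sqrt_zero] at h4
      refine h4.congr fun w => ?_
      rw [inv_mul_cancel_left₀ hD.ne', Real.sqrt_sq (norm_nonneg _)]
    · have h1 : ContinuousAt (fun w => (√(Q w))⁻¹ • w) w :=
        ((hQc.sqrt.continuousAt).inv₀ (Real.sqrt_ne_zero'.2 (hQpos w hw))).smul continuousAt_id
      have h2 : ContinuousAt (fun w : ℂ => Real.log ‖w‖ / c) w :=
        (continuous_norm.continuousAt.log (norm_ne_zero_iff.2 hw)).div_const c
      exact (hP.cont.continuousAt.comp h2).clm_apply h1
  refine ⟨⟨⟨f, g, hgf, hfg⟩, hfc, hgc⟩, if_pos rfl, fun t y => ?_⟩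
  change f (P t y) = Real.exp (c * t) • f y
  by_cases hy : y = 0
  · simp [hy, f]
  · have hne : P t y ≠ 0 := by rwa [Ne, hP.eq_zero_iff]
    have e1 : T (P t y) = T y + t := hTuniq _ hne _ (by
      rw [← hP.add, neg_add_rev, neg_add_cancel_comm, hT y hy])
    have e2 : P (-(T y + t)) (P t y) = P (-T y) y := by
      rw [← hP.add, neg_add_rev, neg_add_cancel_comm]
    have e3 : u (P t y) = u y := by simp only [u, e1, e2]
    rw [hfn _ hne, hfn y hy, e3, smul_smul (Real.exp (c * t)), ← Real.exp_add, e1]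
    congr 2; ring

end

end SaddleConn

/-! ### Topology of a connection and its two halves -/

namespace SaddleConn

/-- The disjoint compact sets `A \ W` and `B` have disjoint neighbourhoods; adding `W` to the first
gives a neighbourhood of `A` that meets the second only inside `W`. -/
lemma exists_open_inter_subset {Y : Type*} [TopologicalSpace Y] [T2Space Y] {A B W : Set Y}
    (hA : IsCompact A) (hB : IsCompact B) (hW : IsOpen W) (h : A ∩ B ⊆ W) :
    ∃ O R : Set Y, IsOpen O ∧ IsOpen R ∧ A ⊆ O ∧ B ⊆ R ∧ O ∩ R ⊆ W := by
  obtain ⟨O, R, hO, hR, hAO, hBR, hd⟩ := SeparatedNhds.of_isCompact_isCompact (hA.diff hW) hB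
    (disjoint_left.2 fun x hx hxB => hx.2 (h ⟨hx.1, hxB⟩))
  refine ⟨O ∪ W, R, hO.union hW, hR, fun x hx => ?_, hBR, fun x hx => ?_⟩
  · by_cases hxW : x ∈ W
    · exact Or.inr hxW
    · exact Or.inl (hAO ⟨hx, hxW⟩)
  · exact hx.1.elim (fun h1 => absurd hx.2 (disjoint_left.1 hd h1)) id

variable {M : Type*} [TopologicalSpace M] [ChartedSpace E3 M] [IsManifold (𝓡 3) ∞ M]

namespace SaddleConnection

variable (Γ : SaddleConnection M)

lemma continuous_orbit : Continuous Γ.orbit := by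
  rw [continuous_iff_continuousAt]
  exact fun t => (Γ.isMIntegralCurve t).continuousAt

/-- The closure of the negative half orbit ending at time `s`. -/
def head (s : ℝ) : Set M := insert Γ.p (Γ.orbit '' Iic s)

/-- The closure of the positive half orbit starting at time `s`. -/
def tail (s : ℝ) : Set M := insert Γ.q (Γ.orbit '' Ici s)

/-- The half orbit is the image of the line under `u ↦ Γ(s - |u|)`, which tends to `p` at both ends,
so adding the point `p` makes it compact. -/
lemma isCompact_head (s : ℝ) : IsCompact (Γ.head s) := by
  have h : Γ.head s = insert Γ.p (range fun u : ℝ => Γ.orbit (s - |u|)) := by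
    rw [head]
    congr 1
    ext z
    constructor
    · rintro ⟨t, ht, rfl⟩
      exact ⟨s - t, by simp only; rw [abs_of_nonneg (sub_nonneg.2 ht)]; congr 1; ring⟩
    · rintro ⟨u, rfl⟩
      exact ⟨_, by simp, rfl⟩
  rw [h]
  refine Filter.Tendsto.isCompact_insert_range_of_cocompact ?_ (Γ.continuous_orbit.comp (by fun_prop))
  refine Γ.tendsto_p.comp ?_
  have h1 : Tendsto (fun u : ℝ => |u|) (cocompact ℝ) atTop := by
    exact tendsto_norm_cocompact_atTop (E := ℝ)
  exact tendsto_atBot_add_const_left _ s (tendsto_neg_atTop_atBot.comp h1)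

lemma isCompact_tail (s : ℝ) : IsCompact (Γ.tail s) := by
  have h : Γ.tail s = insert Γ.q (range fun u : ℝ => Γ.orbit (s + |u|)) := by
    rw [tail]
    congr 1
    ext z
    constructor
    · rintro ⟨t, ht, rfl⟩
      exact ⟨t - s, by simp only; rw [abs_of_nonneg (sub_nonneg.2 ht)]; congr 1; ring⟩
    · rintro ⟨u, rfl⟩
      exact ⟨_, by simp, rfl⟩
  rw [h]
  refine Filter.Tendsto.isCompact_insert_range_of_cocompact ?_ (Γ.continuous_orbit.comp (by fun_prop))
  refine Γ.tendsto_q.comp ?_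
  have h1 : Tendsto (fun u : ℝ => |u|) (cocompact ℝ) atTop := by
    exact tendsto_norm_cocompact_atTop (E := ℝ)
  exact tendsto_atTop_add_const_left _ s h1

lemma orbit_mem_carrier (t : ℝ) : Γ.orbit t ∈ Γ.carrier := subset_closure (mem_range_self t)

lemma p_mem_carrier : Γ.p ∈ Γ.carrier :=
  mem_closure_of_tendsto Γ.tendsto_p (Eventually.of_forall fun t => mem_range_self t)

lemma q_mem_carrier : Γ.q ∈ Γ.carrier :=
  mem_closure_of_tendsto Γ.tendsto_q (Eventually.of_forall fun t => mem_range_self t)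

variable [T2Space M]

lemma carrier_eq (s : ℝ) : Γ.carrier = Γ.head s ∪ Γ.tail s := by
  apply Subset.antisymm
  · refine closure_minimal ?_ ((Γ.isCompact_head s).union (Γ.isCompact_tail s)).isClosed
    rintro _ ⟨t, rfl⟩
    rcases le_total t s with h | h
    · exact Or.inl (Or.inr ⟨t, h, rfl⟩)
    · exact Or.inr (Or.inr ⟨t, h, rfl⟩)
  · rintro z ((rfl | ⟨t, -, rfl⟩) | (rfl | ⟨t, -, rfl⟩))
    · exact Γ.p_mem_carrier
    · exact Γ.orbit_mem_carrier t
    · exact Γ.q_mem_carrier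
    · exact Γ.orbit_mem_carrier t

lemma isCompact_carrier : IsCompact Γ.carrier := by
  rw [Γ.carrier_eq 0]
  exact (Γ.isCompact_head 0).union (Γ.isCompact_tail 0)

lemma orbit_unique {γ : ℝ → M} (hγ : IsMIntegralCurve γ Γ.X) {t₀ : ℝ}
    (h : γ t₀ = Γ.orbit t₀) (t : ℝ) : γ t = Γ.orbit t :=
  integralCurve_unique_Icc Γ.smooth (a := min t t₀) (b := max t t₀) (t₀ := t₀)
    ⟨min_le_right _ _, le_max_right _ _⟩ (hγ.isMIntegralCurveOn _)
    (Γ.isMIntegralCurve.isMIntegralCurveOn _) h ⟨min_le_left _ _, le_max_left _ _⟩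

lemma orbit_ne_p (t : ℝ) : Γ.orbit t ≠ Γ.p := fun h => by
  have h1 := Γ.orbit_unique (isMIntegralCurve_const Γ.saddle_p.zero) h.symm
  have h2 : Tendsto (fun _ : ℝ => Γ.p) atTop (𝓝 Γ.q) :=
    Γ.tendsto_q.congr fun u => (h1 u).symm
  exact Γ.p_ne_q (tendsto_nhds_unique tendsto_const_nhds h2)

lemma orbit_ne_q (t : ℝ) : Γ.orbit t ≠ Γ.q := fun h => by
  have h1 := Γ.orbit_unique (isMIntegralCurve_const Γ.saddle_q.zero) h.symm
  have h2 : Tendsto (fun _ : ℝ => Γ.q) atBot (𝓝 Γ.p) :=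
    Γ.tendsto_p.congr fun u => (h1 u).symm
  exact Γ.p_ne_q (tendsto_nhds_unique tendsto_const_nhds h2).symm

/-- A repeated value would make the orbit periodic; since it converges to `q`, it would then pass
through the zero `q`, which uniqueness forbids. -/
lemma orbit_injective : Function.Injective Γ.orbit := by
  have key : ∀ s t, s < t → Γ.orbit s ≠ Γ.orbit t := by
    intro s t hst h
    have h1 : ∀ u, Γ.orbit (u + (t - s)) = Γ.orbit u :=
      Γ.orbit_unique (Γ.isMIntegralCurve.comp_add (t - s)) (t₀ := s) (by simp [h])
    have h2 : ∀ n : ℕ, Γ.orbit (s + n * (t - s)) = Γ.orbit s := by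
      intro n
      induction n with
      | zero => simp
      | succ n ih => rw [← ih, ← h1 (s + n * (t - s))]; push_cast; ring_nf
    have h3 : Tendsto (fun n : ℕ => s + n * (t - s)) atTop atTop :=
      tendsto_atTop_add_const_left _ s
        (tendsto_natCast_atTop_atTop.atTop_mul_const (sub_pos.2 hst))
    have h4 := (Γ.tendsto_q.comp h3).congr (f₂ := fun _ => Γ.orbit s) fun n => h2 n
    exact Γ.orbit_ne_q s (tendsto_nhds_unique tendsto_const_nhds h4)
  intro s t h
  rcases lt_trichotomy s t with hst | hst | hst
  · exact absurd h (key s t hst)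
  · exact hst
  · exact absurd h.symm (key t s hst)

lemma head_inter_tail (s : ℝ) : Γ.head s ∩ Γ.tail s = {Γ.orbit s} := by
  ext z
  constructor
  · rintro ⟨rfl | ⟨t, ht, rfl⟩, h | ⟨u, hu, h⟩⟩
    · exact absurd h Γ.p_ne_q
    · exact absurd h (Γ.orbit_ne_p u)
    · exact absurd h (Γ.orbit_ne_q t)
    · obtain rfl := Γ.orbit_injective h
      obtain rfl := le_antisymm (mem_Iic.1 ht) (mem_Ici.1 hu)
      rfl
  · rintro rfl
    exact ⟨Or.inr ⟨s, self_mem_Iic, rfl⟩, Or.inr ⟨s, self_mem_Ici, rfl⟩⟩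

/-- Neighbourhoods of the two halves of a connection that overlap only near the cut. -/
lemma exists_split (s : ℝ) {A W C : Set M} (hA : IsOpen A) (hW : IsOpen W) (hC : IsOpen C)
    (hhA : Γ.head s ⊆ A) (hsW : Γ.orbit s ∈ W) (htC : Γ.tail s ⊆ C) :
    ∃ O R : Set M, IsOpen O ∧ IsOpen R ∧ Γ.head s ⊆ O ∧ Γ.tail s ⊆ R ∧ O ⊆ A ∧ R ⊆ C ∧
      O ∩ R ⊆ W := by
  obtain ⟨O, R, hO, hR, hhO, htR, hOR⟩ := exists_open_inter_subset (Γ.isCompact_head s)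
    (Γ.isCompact_tail s) hW (by rw [Γ.head_inter_tail, singleton_subset_iff]; exact hsW)
  exact ⟨O ∩ A, R ∩ C, hO.inter hA, hR.inter hC, subset_inter hhO hhA, subset_inter htR htC,
    inter_subset_right, inter_subset_right, fun z hz => hOR ⟨hz.1.1, hz.2.1⟩⟩

end SaddleConnection

end SaddleConn

/-! ### Model saddle flow and charts around the head and the tail -/

namespace SaddleConn

/-- The model saddle flow with one stable and two unstable dimensions and rotation rate `b`. -/
def modelFlow (b : ℝ) : ℝ → Z → Z :=
  saddleFlow (-1) fun t => mulC (Complex.exp ((1 + b * Complex.I) * t))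

lemma modelFlow_apply (b t : ℝ) (z : Z) :
    modelFlow b t z = (Real.exp (-t) * z.1, Complex.exp ((1 + b * Complex.I) * t) * z.2) := by
  simp [modelFlow, saddleFlow]

lemma isFlow_modelFlow (b : ℝ) : IsFlow (modelFlow b) :=
  (isC1Flow_saddleFlow (isLinFlow_mulC _) (-1)).toIsFlow

lemma IsFlow.rescale {G : ℝ → Z → Z} (h : IsFlow G) (c : ℝ) : IsFlow fun t => G (c * t) where
  zero z := by simp [h.zero]
  add s t z := by rw [mul_add, h.add]
  cont := h.cont.comp ((continuous_const.mul continuous_fst).prodMk continuous_snd)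

lemma modelFlow_zero_apply (t : ℝ) (z : Z) :
    modelFlow 0 t z = (Real.exp (-t) * z.1, Real.exp t • z.2) := by
  simp [modelFlow_apply]

lemma transHomeomorph_clm_zero {Y : Type*} [TopologicalSpace Y] {p : Y}
    {φ : OpenPartialHomeomorph Y E3} (h : φ p = 0)
    (L : E3 ≃L[ℝ] Z) : (φ.transHomeomorph L.toHomeomorph) p = 0 := by
  change L (φ p) = 0
  rw [h, map_zero]

variable {M : Type*} [TopologicalSpace M] [ChartedSpace E3 M] [IsManifold (𝓡 3) ∞ M]

/-- A `C¹` chart around the half orbit `Γ(-∞, s]` in which the flow is a linear saddle flow. -/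
structure SmoothHead (Γ : SaddleConnection M) (a : ℝ) (P : ℝ → ℂ →L[ℝ] ℂ) (s : ℝ)
    (φ : OpenPartialHomeomorph M Z) : Prop extends FlowChart Γ.X φ (saddleFlow a P) where
  base_mem : Γ.p ∈ φ.source
  base : φ Γ.p = 0
  orbit_mem : ∀ t ≤ s, Γ.orbit t ∈ φ.source

/-- A `C¹` chart around the half orbit `Γ[s, ∞)` in which the flow is a linear saddle flow. -/
structure SmoothTail (Γ : SaddleConnection M) (a : ℝ) (P : ℝ → ℂ →L[ℝ] ℂ) (s : ℝ)
    (ψ : OpenPartialHomeomorph M Z) : Prop extends FlowChart Γ.X ψ (saddleFlow a P) where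
  base_mem : Γ.q ∈ ψ.source
  base : ψ Γ.q = 0
  orbit_mem : ∀ t ≥ s, Γ.orbit t ∈ ψ.source

variable {Γ : SaddleConnection M} {a s : ℝ} {P : ℝ → ℂ →L[ℝ] ℂ} {B : ℂ →L[ℝ] ℂ}
  {φ : OpenPartialHomeomorph M Z}

/-- The linearizing chart reaches only a short way from `p`; it is transported by the flow to cover
the orbit up to an arbitrary cut time. -/
lemma exists_smoothHead [T2Space M] {φ₀ : OpenPartialHomeomorph M E3}
    (hφ₀ : IsLinearizingChart Γ.X Γ.p φ₀) (hP : IsLinFlow B P) (L : E3 ≃L[ℝ] Z)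
    (hL : ∀ v, L (linearPart Γ.X Γ.p v) = (a * (L v).1, B (L v).2)) (s : ℝ) :
    ∃ φ, SmoothHead Γ a P s φ := by
  have hG := isC1Flow_saddleFlow hP a
  have h := hφ₀.flowChart L ((a • ContinuousLinearMap.id ℝ ℝ).prodMap B) hL hG.toIsFlow
    (hasDerivAt_saddleFlow hP a)
  have h1 : ∀ᶠ t in atBot, Γ.orbit t ∈ φ₀.source :=
    Γ.tendsto_p.eventually (φ₀.open_source.mem_nhds hφ₀.mem_source)
  obtain ⟨t₀, ht₀⟩ := eventually_atBot.1 h1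
  obtain ⟨φ, h1, h2, h3, h4⟩ := h.exists_extension Γ.smooth hG hφ₀.mem_source
    (transHomeomorph_clm_zero hφ₀.map_base L) Γ.saddle_p.zero Γ.isMIntegralCurve
    Γ.isCompact_carrier Γ.p_mem_carrier Γ.orbit_mem_carrier ht₀ s
  exact ⟨φ, h1, h2, h3, h4⟩

/-- At `q` the cut is instead placed so late that the tail lies in the linearizing chart itself, the
chart in which transversality is formulated. -/
lemma exists_smoothTail {φ₀ : OpenPartialHomeomorph M E3}
    (hφ₀ : IsLinearizingChart Γ.X Γ.q φ₀) (hP : IsLinFlow B P) (L : E3 ≃L[ℝ] Z)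
    (hL : ∀ v, L (linearPart Γ.X Γ.q v) = (a * (L v).1, B (L v).2)) :
    ∃ s₀, ∀ s ≥ s₀, SmoothTail Γ a P s (φ₀.transHomeomorph L.toHomeomorph) := by
  have hG := isC1Flow_saddleFlow hP a
  have h := hφ₀.flowChart L ((a • ContinuousLinearMap.id ℝ ℝ).prodMap B) hL hG.toIsFlow
    (hasDerivAt_saddleFlow hP a)
  have h1 : ∀ᶠ t in atTop, Γ.orbit t ∈ φ₀.source :=
    Γ.tendsto_q.eventually (φ₀.open_source.mem_nhds hφ₀.mem_source)
  obtain ⟨t₀, ht₀⟩ := eventually_atTop.1 h1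
  exact ⟨t₀, fun s hs => ⟨h, hφ₀.mem_source, transHomeomorph_clm_zero hφ₀.map_base L,
    fun t ht => ht₀ t (hs.trans ht)⟩⟩

namespace SmoothHead

variable {φ : OpenPartialHomeomorph M Z}

lemma orbit_flow (h : SmoothHead Γ a P s φ) {t u : ℝ} (hut : u ≤ t) (hts : t ≤ s) :
    φ (Γ.orbit t) = saddleFlow a P (t - u) (φ (Γ.orbit u)) :=
  h.fwd Γ.orbit u t (Γ.isMIntegralCurve.isMIntegralCurveOn _)
    (fun v hv => h.orbit_mem v (hv.2.trans hts)) t ⟨hut, le_rfl⟩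

lemma orbit_ne_zero [T2Space M] (h : SmoothHead Γ a P s φ) {t : ℝ} (hts : t ≤ s) :
    φ (Γ.orbit t) ≠ 0 := fun e =>
  Γ.orbit_ne_p t (φ.injOn (h.orbit_mem t hts) h.base_mem (by rw [e, h.base]))

/-- The stable coordinate at an earlier time is multiplied by a factor tending to 0, and it tends to
0 itself as the orbit approaches `p` backward in time. -/
lemma orbit_fst (h : SmoothHead Γ a P s φ) (ha : a < 0) {t : ℝ} (hts : t ≤ s) :
    (φ (Γ.orbit t)).1 = 0 := by
  have h1 : Tendsto (fun u => (φ (Γ.orbit u)).1) atBot (𝓝 0) := by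
    have h2 := (φ.continuousAt h.base_mem).tendsto.comp Γ.tendsto_p
    rw [h.base] at h2
    exact (continuous_fst.tendsto (0 : Z)).comp h2
  have h2 : Tendsto (fun u => Real.exp (a * (t - u)) * (φ (Γ.orbit u)).1) atBot (𝓝 0) := by
    have h3 : Tendsto (fun u => Real.exp (a * (t - u))) atBot (𝓝 0) := by
      refine Real.tendsto_exp_atBot.comp ((tendsto_const_mul_atBot_of_neg ha).2 ?_)
      exact tendsto_atTop_add_const_left _ t tendsto_neg_atBot_atTop
    simpa using h3.mul h1
  refine tendsto_nhds_unique (tendsto_const_nhds.congr' ?_) h2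
  filter_upwards [eventually_le_atBot t] with u hu
  rw [h.orbit_flow hu hts]; rfl

lemma orbit_snd [T2Space M] (h : SmoothHead Γ a P s φ) (ha : a < 0) {t : ℝ} (hts : t ≤ s) :
    (φ (Γ.orbit t)).2 ≠ 0 := fun e => h.orbit_ne_zero hts (Prod.ext (h.orbit_fst ha hts) e)

end SmoothHead

namespace SmoothTail

variable {φ : OpenPartialHomeomorph M Z}

lemma orbit_flow (h : SmoothTail Γ a P s φ) {t u : ℝ} (hut : u ≤ t) (hts : s ≤ u) :
    φ (Γ.orbit t) = saddleFlow a P (t - u) (φ (Γ.orbit u)) :=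
  h.fwd Γ.orbit u t (Γ.isMIntegralCurve.isMIntegralCurveOn _)
    (fun v hv => h.orbit_mem v (hts.trans hv.1)) t ⟨hut, le_rfl⟩

lemma orbit_ne_zero [T2Space M] (h : SmoothTail Γ a P s φ) {t : ℝ} (hts : s ≤ t) :
    φ (Γ.orbit t) ≠ 0 := fun e =>
  Γ.orbit_ne_q t (φ.injOn (h.orbit_mem t hts) h.base_mem (by rw [e, h.base]))

/-- The unstable coordinate does not decrease in modulus forward in time, yet it tends to 0 at `q`.
-/
lemma orbit_snd (h : SmoothTail Γ a P s φ) (hexp : ∀ t ≥ 0, ∀ y, ‖y‖ ≤ ‖P t y‖) {t : ℝ}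
    (hts : s ≤ t) : (φ (Γ.orbit t)).2 = 0 := by
  have h1 : Tendsto (fun u => ‖(φ (Γ.orbit u)).2‖) atTop (𝓝 0) := by
    have h2 := (φ.continuousAt h.base_mem).tendsto.comp Γ.tendsto_q
    rw [h.base] at h2
    have h3 := ((continuous_norm.comp continuous_snd).tendsto (0 : Z)).comp h2
    simp only [Function.comp_apply, Prod.snd_zero, norm_zero] at h3
    exact h3
  rw [← norm_eq_zero]
  refine le_antisymm (ge_of_tendsto h1 ?_) (norm_nonneg _)
  filter_upwards [eventually_ge_atTop t] with u hu
  rw [h.orbit_flow hu hts]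
  exact hexp _ (sub_nonneg.2 hu) _

lemma orbit_fst [T2Space M] (h : SmoothTail Γ a P s φ) (hexp : ∀ t ≥ 0, ∀ y, ‖y‖ ≤ ‖P t y‖) {t : ℝ}
    (hts : s ≤ t) : (φ (Γ.orbit t)).1 ≠ 0 :=
  fun e => h.orbit_ne_zero hts (Prod.ext e (h.orbit_snd hexp hts))

end SmoothTail

/-- A chart around `Γ(-∞, s]` that conjugates the flow to the model flow without rotation. -/
structure HeadChart (Γ : SaddleConnection M) (c s : ℝ) (φ : OpenPartialHomeomorph M Z) : Prop where
  pos : 0 < c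
  conj : Conj Γ.X φ fun t => modelFlow 0 (c * t)
  base_mem : Γ.p ∈ φ.source
  base : φ Γ.p = 0
  orbit_mem : ∀ t ≤ s, Γ.orbit t ∈ φ.source
  orbit : ∀ t ≤ s, φ (Γ.orbit t) = (0, (Real.exp (c * (t - s)) : ℂ))

/-- A chart around `Γ[s, ∞)` that conjugates the flow to the model flow with rotation `b`. -/
structure TailChart (Γ : SaddleConnection M) (b c s : ℝ) (ψ : OpenPartialHomeomorph M Z) :
    Prop where
  pos : 0 < c
  conj : Conj Γ.X ψ fun t => modelFlow b (c * t)
  base_mem : Γ.q ∈ ψ.source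
  base : ψ Γ.q = 0
  orbit_mem : ∀ t ≥ s, Γ.orbit t ∈ ψ.source
  orbit : ∀ t ≥ s, ψ (Γ.orbit t) = (Real.exp (-(c * (t - s))), 0)

/-- The odd power function `sign x |x| ^ r`. -/
def oddPow (r x : ℝ) : ℝ := SignType.sign x * |x| ^ r

lemma oddPow_zero {r : ℝ} : oddPow r 0 = 0 := by simp [oddPow]

lemma sign_oddPow (r x : ℝ) : SignType.sign (oddPow r x) = SignType.sign x := by
  rcases lt_trichotomy x 0 with h | h | h
  · have := Real.rpow_pos_of_pos (abs_pos.2 h.ne) r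
    rw [oddPow, sign_neg h]; exact sign_neg (by simpa using this)
  · simp [h, oddPow]
  · have := Real.rpow_pos_of_pos (abs_pos.2 h.ne') r
    rw [oddPow, sign_pos h]; exact sign_pos (by simpa using this)

lemma abs_oddPow {r : ℝ} (hr : 0 < r) (x : ℝ) : |oddPow r x| = |x| ^ r := by
  rcases eq_or_ne x 0 with h | h
  · simp [h, oddPow, hr.ne']
  · have := Real.rpow_pos_of_pos (abs_pos.2 h) r
    rw [oddPow, abs_mul, abs_of_pos this]
    rcases h.lt_or_gt with h | h
    · simp [sign_neg h]
    · simp [sign_pos h]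

lemma oddPow_of_pos {r x : ℝ} (hx : 0 < x) : oddPow r x = x ^ r := by
  rw [oddPow, sign_pos hx, abs_of_pos hx]; simp

lemma oddPow_mul_of_pos {r x y : ℝ} (hx : 0 < x) : oddPow r (x * y) = x ^ r * oddPow r y := by
  rw [oddPow, oddPow, sign_mul, sign_pos hx, one_mul, abs_mul, abs_of_pos hx,
    Real.mul_rpow hx.le (abs_nonneg y)]
  ring

lemma oddPow_oddPow {r s : ℝ} (hr : 0 < r) (x : ℝ) : oddPow s (oddPow r x) = oddPow (r * s) x := by
  rw [oddPow, sign_oddPow, abs_oddPow hr, ← Real.rpow_mul (abs_nonneg x), oddPow]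

lemma oddPow_one (x : ℝ) : oddPow 1 x = x := by simp [oddPow]

lemma continuous_oddPow {r : ℝ} (hr : 0 < r) : Continuous (oddPow r) := by
  rw [continuous_iff_continuousAt]
  intro x
  rcases lt_trichotomy x 0 with h | h | h
  · have h1 : ContinuousAt (fun x : ℝ => -|x| ^ r) x :=
      (continuous_abs.continuousAt.rpow_const (Or.inr hr.le)).neg
    refine h1.congr ?_
    filter_upwards [gt_mem_nhds h] with y hy
    simp [oddPow, sign_neg hy]
  · subst h
    rw [ContinuousAt, oddPow_zero, tendsto_zero_iff_abs_tendsto_zero]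
    have h1 : Tendsto (fun x : ℝ => |x| ^ r) (𝓝 0) (𝓝 (|0| ^ r)) :=
      (continuous_abs.rpow_const fun _ => Or.inr hr.le).tendsto 0
    rw [abs_zero, Real.zero_rpow hr.ne'] at h1
    exact h1.congr fun x => (abs_oddPow hr x).symm
  · have h1 : ContinuousAt (fun x : ℝ => |x| ^ r) x :=
      (continuous_abs.continuousAt.rpow_const (Or.inr hr.le))
    refine h1.congr ?_
    filter_upwards [lt_mem_nhds h] with y hy
    simp [oddPow, sign_pos hy]

/-- The odd power function as a homeomorphism. -/
def oddPowHomeo (r : ℝ) (hr : 0 < r) : ℝ ≃ₜ ℝ where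
  toFun := oddPow r
  invFun := oddPow r⁻¹
  left_inv x := by rw [oddPow_oddPow hr, mul_inv_cancel₀ hr.ne', oddPow_one]
  right_inv x := by rw [oddPow_oddPow (inv_pos.2 hr), inv_mul_cancel₀ hr.ne', oddPow_one]
  continuous_toFun := continuous_oddPow hr
  continuous_invFun := continuous_oddPow (inv_pos.2 hr)

/-- What odd powers are for: they conjugate a contraction of the line to the one with its rate
multiplied by `r`, preserving signs. -/
lemma oddPow_exp_mul (r u x : ℝ) : oddPow r (Real.exp u * x) = Real.exp (r * u) * oddPow r x := by
  rw [oddPow_mul_of_pos (Real.exp_pos u), ← Real.exp_mul, mul_comm u]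

end SaddleConn

/-! ### Trapping of orbits and the tangent space of the unstable manifold -/

namespace SaddleConn

section Trap

variable {Y : Type*} [TopologicalSpace Y] {γ : ℝ → Y} {a b : ℝ} {O R : Set Y}

/-- A curve in `O ∪ R` that ends in `O` stays in `O` if it cannot be in `R` as long as its
remaining part runs in `O`. -/
lemma trap_backward (hγ : ContinuousOn γ (Icc a b)) (hO : IsOpen O) (hR : IsOpen R)
    (hcov : ∀ t ∈ Icc a b, γ t ∈ O ∪ R) (hb : γ b ∈ O)
    (hno : ∀ u ∈ Icc a b, (∀ v ∈ Icc u b, γ v ∈ O) → γ u ∉ R) : ∀ t ∈ Icc a b, γ t ∈ O := by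
  by_contra! hcon
  obtain ⟨t₁, ht₁, htO⟩ := hcon
  have hK : IsCompact (Icc a b ∩ γ ⁻¹' Oᶜ) :=
    isCompact_Icc.of_isClosed_subset
      (hγ.preimage_isClosed_of_isClosed isClosed_Icc hO.isClosed_compl) inter_subset_left
  -- `t₀` is the last time outside `O`. The curve is in the open set `R` there, hence still in `R`
  -- slightly later, when all of its remaining part is in `O`.
  obtain ⟨t₀, ⟨ht₀, h0⟩, hmax⟩ := hK.exists_isGreatest ⟨t₁, ht₁, htO⟩
  have hlt : t₀ < b := lt_of_le_of_ne ht₀.2 fun e => h0 (e ▸ hb)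
  have hR0 : γ t₀ ∈ R := (hcov t₀ ht₀).resolve_left h0
  have h1 : ∀ᶠ u in 𝓝[Icc a b] t₀, γ u ∈ R := (hγ t₀ ht₀).eventually (hR.mem_nhds hR0)
  have hsub : Ioc t₀ b ⊆ Icc a b := fun u hu => ⟨ht₀.1.trans hu.1.le, hu.2⟩
  have h2 : ∀ᶠ u in 𝓝[Ioc t₀ b] t₀, γ u ∈ R :=
    h1.filter_mono (nhdsWithin_mono _ hsub)
  rw [nhdsWithin_Ioc_eq_nhdsGT hlt] at h2
  obtain ⟨u, hu, hut⟩ := (h2.and (Ioc_mem_nhdsGT hlt)).exists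
  refine hno u ⟨ht₀.1.trans hut.1.le, hut.2⟩ (fun v hv => ?_) hu
  by_contra hvO
  have hmem : v ∈ Icc a b ∩ γ ⁻¹' Oᶜ := ⟨⟨(ht₀.1.trans hut.1.le).trans hv.1, hv.2⟩, hvO⟩
  exact absurd (hmax hmem) (not_le.2 (hut.1.trans_le hv.1))

lemma trap_forward (hγ : ContinuousOn γ (Icc a b)) (hO : IsOpen O) (hR : IsOpen R)
    (hcov : ∀ t ∈ Icc a b, γ t ∈ O ∪ R) (ha : γ a ∈ O)
    (hno : ∀ u ∈ Icc a b, (∀ v ∈ Icc a u, γ v ∈ O) → γ u ∉ R) : ∀ t ∈ Icc a b, γ t ∈ O := by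
  have hneg : ∀ c d, MapsTo (fun t : ℝ => -t) (Icc c d) (Icc (-d) (-c)) := fun c d t ht =>
    ⟨neg_le_neg ht.2, neg_le_neg ht.1⟩
  have hneg' : MapsTo (fun t : ℝ => -t) (Icc (-b) (-a)) (Icc a b) := fun t ht =>
    ⟨by linarith [ht.2], by linarith [ht.1]⟩
  have := trap_backward (γ := fun t => γ (-t)) (a := -b) (b := -a) (O := O) (R := R)
    (hγ.comp continuous_neg.continuousOn hneg') hO hR (fun t ht => hcov _ (hneg' ht))
    (by simpa using ha) (fun u hu hv => hno _ (hneg' hu) fun v hv' => by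
      simpa using hv (-v) ⟨by linarith [hv'.2], by linarith [hv'.1]⟩)
  intro t ht
  simpa using this (-t) (hneg a b ht)

end Trap

variable {M : Type*} [TopologicalSpace M] [ChartedSpace E3 M] [IsManifold (𝓡 3) ∞ M] [T2Space M]
  {Γ : SaddleConnection M} {a s : ℝ} {P : ℝ → ℂ →L[ℝ] ℂ} {B : ℂ →L[ℝ] ℂ}
  {φ : OpenPartialHomeomorph M Z}

/-- An odd power adjusts the stable rate, the conjugacy to a dilation removes all traces of the
unstable eigenvalues at `p`, and division by `w` moves `Γ(s)` to `(0, 1)`. The first coordinate is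
kept explicit because its zero set is the unstable manifold of `p` and its sign tells the sides
apart. -/
lemma SmoothHead.exists_headChart (h : SmoothHead Γ a P s φ) (ha : a < 0) (hP : IsLinFlow B P)
    {τ D : ℝ} (hB : ∀ y, B (B y) - τ • B y + D • y = 0) (hτ : 0 < τ) (hD : 0 < D) {c : ℝ}
    (hc : 0 < c) : ∃ e : Z ≃ₜ Z, HeadChart Γ c s (φ.transHomeomorph e) ∧
      ∀ z, (e z).1 = oddPow (c / -a) z.1 := by
  obtain ⟨Λ, hΛ0, hΛ⟩ := exists_homeo_dilation hP hB hτ hD hc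
  have hr : 0 < c / -a := div_pos hc (neg_pos.2 ha)
  set w := Λ (φ (Γ.orbit s)).2 with hw
  have hw0 : w ≠ 0 := fun e => h.orbit_snd ha le_rfl (Λ.injective (by rw [← hw, e, hΛ0]))
  set e : Z ≃ₜ Z := (oddPowHomeo _ hr).prodCongr (Λ.trans (Homeomorph.mulLeft₀ w⁻¹ (inv_ne_zero hw0)))
  have he : ∀ z : Z, e z = (oddPow (c / -a) z.1, w⁻¹ * Λ z.2) := fun z => rfl
  refine ⟨e, ⟨hc, h.post e fun t z => ?_, h.base_mem, ?_, h.orbit_mem, fun t ht => ?_⟩,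
    fun z => rfl⟩
  · rw [modelFlow_zero_apply, he, he]
    simp only [saddleFlow]
    rw [oddPow_exp_mul, hΛ, mul_smul_comm]
    have h1 : c / -a * (a * t) = -(c * t) := by
      have := ha.ne
      field_simp
    rw [h1]
  · change e (φ Γ.p) = 0
    rw [h.base, he]
    simp [oddPow_zero, hΛ0]
  · change e (φ (Γ.orbit t)) = _
    rw [he, h.orbit_fst ha ht, oddPow_zero]
    have h1 := h.orbit_flow ht le_rfl
    have h2 : Λ (φ (Γ.orbit t)).2 = Real.exp (c * (t - s)) • w := by
      rw [hw, h1]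
      simp only [saddleFlow]
      rw [hΛ, smul_smul, ← Real.exp_add]
      have : c * (t - s) + c * (s - t) = 0 := by ring
      rw [this, Real.exp_zero, one_smul]
    rw [h2, mul_smul_comm, inv_mul_cancel₀ hw0]
    simp

lemma isMIntegralCurveOn_continuousOn {X : (x : M) → TangentSpace (𝓡 3) x} {γ : ℝ → M}
    {S : Set ℝ} (h : IsMIntegralCurveOn γ X S) : ContinuousOn γ S :=
  fun t ht => (h t ht).continuousWithinAt

namespace HeadChart

variable {c : ℝ}

lemma flow (h : HeadChart Γ c s φ) {γ : ℝ → M} {a b : ℝ}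
    (hγ : IsMIntegralCurveOn γ Γ.X (Icc a b)) (hs : ∀ t ∈ Icc a b, γ t ∈ φ.source) {u v : ℝ}
    (hu : u ∈ Icc a b) (hv : v ∈ Icc a b) :
    φ (γ v) = (Real.exp (-(c * (v - u))) * (φ (γ u)).1, Real.exp (c * (v - u)) • (φ (γ u)).2) := by
  rw [h.conj.fwd' ((isFlow_modelFlow 0).rescale c) hγ hs hu hv, modelFlow_zero_apply]

lemma head_subset (h : HeadChart Γ c s φ) : Γ.head s ⊆ φ.source := by
  rintro z (rfl | ⟨t, ht, rfl⟩)
  · exact h.base_mem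
  · exact h.orbit_mem t ht

/-- Neighbourhoods of the halves of a connection such that orbits cannot enter the first one
from the second one close to its core. -/
lemma exists_trap (h : HeadChart Γ c s φ) {m : ℝ} (hm : m < 1) {A W C : Set M} (hA : IsOpen A)
    (hhA : Γ.head s ⊆ A) (hW : IsOpen W) (hsW : Γ.orbit s ∈ W) (hC : IsOpen C)
    (htC : Γ.tail s ⊆ C) :
    ∃ O R : Set M, IsOpen O ∧ IsOpen R ∧ Γ.head s ⊆ O ∧ Γ.tail s ⊆ R ∧ O ⊆ φ.source ∧ O ⊆ A ∧
      R ⊆ C ∧ O ∩ R ⊆ W ∧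
      ∀ (γ : ℝ → M) (a b : ℝ), IsMIntegralCurveOn γ Γ.X (Icc a b) →
        (∀ t ∈ Icc a b, γ t ∈ O ∪ R) → γ b ∈ O → ‖(φ (γ b)).2‖ ≤ m → ∀ t ∈ Icc a b, γ t ∈ O := by
  -- The overlap of the two neighbourhoods is forced into `‖y‖ > m`. Since `‖y‖` grows forward in
  -- time, an arc that is once in the overlap and then remains in `O` ends with `‖y‖ > m`.
  have hW' : IsOpen (W ∩ (φ.source ∩ φ ⁻¹' {z | m < ‖z.2‖})) :=
    hW.inter (φ.isOpen_inter_preimage (isOpen_lt continuous_const (by fun_prop)))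
  obtain ⟨O, R, hO, hR, hhO, htR, hOA, hRC, hOR⟩ := Γ.exists_split s (hA.inter φ.open_source) hW'
    hC (subset_inter hhA h.head_subset) ⟨hsW, h.orbit_mem s le_rfl, by
      simp [h.orbit s le_rfl, hm]⟩ htC
  refine ⟨O, R, hO, hR, hhO, htR, fun z hz => (hOA hz).2, fun z hz => (hOA hz).1, hRC,
    fun z hz => (hOR hz).1, fun γ a b hγ hcov hb hbm => ?_⟩
  refine trap_backward (isMIntegralCurveOn_continuousOn hγ) hO hR hcov hb fun u hu hv huR => ?_
  have h1 := (hOR ⟨hv u ⟨le_rfl, hu.2⟩, huR⟩).2.2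
  have h2 := h.flow (hγ.mono (Icc_subset_Icc_left hu.1)) (fun t ht => (hOA (hv t ht)).2)
    (left_mem_Icc.2 hu.2) (right_mem_Icc.2 hu.2)
  rw [h2, norm_smul, Real.norm_of_nonneg (Real.exp_pos _).le] at hbm
  have h3 : 1 ≤ Real.exp (c * (b - u)) :=
    Real.one_le_exp (mul_nonneg h.pos.le (sub_nonneg.2 hu.2))
  have h4 : m < ‖(φ (γ u)).2‖ := h1
  nlinarith [norm_nonneg (φ (γ u)).2]

/-- Near `Γ`, the unstable set of `p` in small neighbourhoods of `Γ` is the plane `x = 0`. -/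
lemma exists_unstableSet_fst (h : HeadChart Γ c s φ) {t : ℝ} (ht : t < s) :
    ∃ U : Set M, IsOpen U ∧ Γ.carrier ⊆ U ∧
      ∀ᶠ z in 𝓝 (Γ.orbit t), z ∈ unstableSet Γ.X U Γ.p → (φ z).1 = 0 := by
  -- The trap level is the radius at the midpoint time, strictly between the radius at `Γ(t)` and
  -- the radius 1 at the cut.
  have hmid : Real.exp (c * ((t + s) / 2 - s)) < 1 := by
    rw [Real.exp_lt_one_iff]; nlinarith [h.pos]
  obtain ⟨O, R, hO, hR, hhO, htR, hOφ, -, -, -, htrap⟩ := h.exists_trap hmid isOpen_univ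
    (subset_univ _) isOpen_univ (mem_univ _) isOpen_univ (subset_univ _)
  refine ⟨O ∪ R, hO.union hR, ?_, ?_⟩
  · rw [Γ.carrier_eq s]; exact union_subset_union hhO htR
  have htO : Γ.orbit t ∈ O := hhO (Or.inr ⟨t, ht.le, rfl⟩)
  have hn : ∀ᶠ z in 𝓝 (Γ.orbit t), ‖(φ z).2‖ < Real.exp (c * ((t + s) / 2 - s)) := by
    have h1 : ContinuousAt (fun z => ‖(φ z).2‖) (Γ.orbit t) :=
      (continuous_norm.comp continuous_snd).continuousAt.comp
        (φ.continuousAt (h.orbit_mem t ht.le))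
    refine h1.eventually (gt_mem_nhds ?_)
    simp only [h.orbit t ht.le]
    rw [Complex.norm_real, Real.norm_of_nonneg (Real.exp_pos _).le, Real.exp_lt_exp]
    nlinarith [h.pos]
  filter_upwards [hO.mem_nhds htO, hn] with z hzO hz
  rintro ⟨γ, rfl, hγ, hγU, hγp⟩
  have hin : ∀ u ≤ 0, γ u ∈ O := fun u hu =>
    htrap γ u 0 (hγ.mono fun v hv => hv.2) (fun v hv => hγU v hv.2) hzO hz.le u ⟨le_rfl, hu⟩
  have hflow : ∀ u ≤ 0, (φ (γ 0)).1 = Real.exp (-(c * (0 - u))) * (φ (γ u)).1 := fun u hu => by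
    rw [h.flow (hγ.mono fun v hv => hv.2) (fun v hv => hOφ (hin v hv.2))
      (left_mem_Icc.2 hu) (right_mem_Icc.2 hu)]
  have h1 : Tendsto (fun u => (φ (γ u)).1) atBot (𝓝 0) := by
    have h2 := (φ.continuousAt h.base_mem).tendsto.comp hγp
    rw [h.base] at h2
    exact (continuous_fst.tendsto (0 : Z)).comp h2
  have h2 : Tendsto (fun u => Real.exp (-(c * (0 - u)))) atBot (𝓝 0) := by
    refine Real.tendsto_exp_atBot.comp ?_
    have : (fun u => -(c * (0 - u))) = fun u => c * u := by funext u; ring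
    rw [this]
    exact tendsto_id.const_mul_atBot h.pos
  have h3 := h2.mul h1
  rw [zero_mul] at h3
  refine tendsto_nhds_unique (tendsto_const_nhds.congr' ?_) h3
  filter_upwards [eventually_le_atBot 0] with u hu using hflow u hu

end HeadChart

lemma oddPow_eq_zero {r : ℝ} {x : ℝ} : oddPow r x = 0 ↔ x = 0 := by
  rw [← sign_eq_zero_iff, sign_oddPow, sign_eq_zero_iff]

/-- The unstable manifold of `p` is tangent to the kernel of the stable coordinate at `p`. -/
lemma SmoothHead.unstableTangent_fst (h : SmoothHead Γ a P s φ) (ha : a < 0) (hP : IsLinFlow B P)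
    {τ D : ℝ} (hB : ∀ y, B (B y) - τ • B y + D • y = 0) (hτ : 0 < τ) (hD : 0 < D) {t : ℝ}
    (ht : t < s) {v : E3} (hv : v ∈ Γ.unstableTangent (Γ.orbit t)) :
    (mfderiv (𝓡 3) 𝓘(ℝ, Z) φ (Γ.orbit t) v : Z).1 = 0 := by
  -- The head chart is only a homeomorphism, but it shows that the curve runs in the unstable plane.
  -- Its first coordinate is an odd power of that of the `C¹` chart `φ`, so both have the same zeros
  -- and the derivative can be taken in `φ`.
  obtain ⟨e, he, he1⟩ := h.exists_headChart ha hP hB hτ hD one_pos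
  obtain ⟨U, hU, hΓU, hev⟩ := he.exists_unstableSet_fst ht
  obtain ⟨γ, h0, hγU, hγ⟩ := hv U hU hΓU
  have hd : MDifferentiableAt (𝓡 3) 𝓘(ℝ, Z) φ (γ 0) :=
    (h.contMDiffOn.contMDiffAt (φ.open_source.mem_nhds
      (h0 ▸ h.orbit_mem t ht.le))).mdifferentiableAt (by simp)
  have h1 := (hasDerivWithinAt_of_chart hd.hasMFDerivAt
    (hγ.hasMFDerivWithinAt (s := univ))).hasDerivAt univ_mem
  have h2 : HasDerivAt (fun u => (φ (γ u)).1) ((mfderiv (𝓡 3) 𝓘(ℝ, Z) φ (γ 0) v : Z).1) 0 :=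
    (ContinuousLinearMap.fst ℝ ℝ ℂ).hasFDerivAt.comp_hasDerivAt 0 h1
  have h3 : ∀ᶠ u in 𝓝 (0 : ℝ), (φ (γ u)).1 = 0 := by
    rw [← h0] at hev
    filter_upwards [hγU, hγ.continuousAt.eventually hev] with u hu hu'
    have := hu' hu
    rw [OpenPartialHomeomorph.transHomeomorph_apply, Function.comp_apply, he1, oddPow_eq_zero]
      at this
    exact this
  have h4 : HasDerivAt (fun u => (φ (γ u)).1) 0 0 := (hasDerivAt_const 0 (0 : ℝ)).congr_of_eventuallyEq h3
  rw [h0] at h2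
  exact h2.unique h4

end SaddleConn

/-! ### The stable coordinate of `p` on a section near `q` -/

namespace SaddleConn

variable {M : Type*} [TopologicalSpace M] [ChartedSpace E3 M]

/-- The derivative of a chart. -/
def chartDeriv (φ : OpenPartialHomeomorph M Z) (x : M) : E3 →L[ℝ] Z :=
  mfderiv (𝓡 3) 𝓘(ℝ, Z) φ x

/-- The derivative of the inverse of a chart. -/
def chartDerivSymm (φ : OpenPartialHomeomorph M Z) (z : Z) : Z →L[ℝ] E3 :=
  mfderiv 𝓘(ℝ, Z) (𝓡 3) φ.symm z

section ChartDeriv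

variable {X : (x : M) → TangentSpace (𝓡 3) x} {φ ψ : OpenPartialHomeomorph M Z}
  {G G' : ℝ → Z → Z} {x : M}

lemma FlowChart.hasMFDerivAt (h : FlowChart X φ G) (hx : x ∈ φ.source) :
    HasMFDerivAt (𝓡 3) 𝓘(ℝ, Z) φ x (chartDeriv φ x) :=
  ((h.contMDiffOn.contMDiffAt (φ.open_source.mem_nhds hx)).mdifferentiableAt
    (by simp)).hasMFDerivAt

lemma FlowChart.hasMFDerivAt_symm (h : FlowChart X φ G) {z : Z} (hz : z ∈ φ.target) :
    HasMFDerivAt 𝓘(ℝ, Z) (𝓡 3) φ.symm z (chartDerivSymm φ z) :=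
  ((h.contMDiffOn_symm.contMDiffAt (φ.open_target.mem_nhds hz)).mdifferentiableAt
    (by simp)).hasMFDerivAt

lemma FlowChart.hasFDerivAt_transition (h : FlowChart X φ G) (h' : FlowChart X ψ G')
    (hx : x ∈ φ.source) (hx' : x ∈ ψ.source) :
    HasFDerivAt (fun z => φ (ψ.symm z)) ((chartDeriv φ x).comp (chartDerivSymm ψ (ψ x)))
      (ψ x) := by
  have h1 := h'.hasMFDerivAt_symm (ψ.map_source hx')
  have hleft := ψ.left_inv hx'
  have h2 : HasMFDerivAt (𝓡 3) 𝓘(ℝ, Z) φ (ψ.symm (ψ x)) (chartDeriv φ (ψ.symm (ψ x))) :=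
    h.hasMFDerivAt (by rwa [hleft])
  have h3 := h2.comp (ψ x) h1
  rw [hleft] at h3
  exact hasMFDerivAt_iff_hasFDerivAt.1 h3

lemma FlowChart.contDiffAt_transition (h : FlowChart X φ G) (h' : FlowChart X ψ G')
    (hx : x ∈ φ.source) (hx' : x ∈ ψ.source) :
    ContDiffAt ℝ 1 (fun z => φ (ψ.symm z)) (ψ x) := by
  rw [← contMDiffAt_iff_contDiffAt]
  have h1 := h'.contMDiffOn_symm.contMDiffAt (ψ.open_target.mem_nhds (ψ.map_source hx'))
  have h2 : ContMDiffAt (𝓡 3) 𝓘(ℝ, Z) 1 φ (ψ.symm (ψ x)) :=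
    h.contMDiffOn.contMDiffAt (φ.open_source.mem_nhds (by rwa [ψ.left_inv hx']))
  exact h2.comp (ψ x) h1

lemma FlowChart.chartDeriv_symm_apply (h : FlowChart X φ G) (hx : x ∈ φ.source) (w : Z) :
    chartDeriv φ x (chartDerivSymm φ (φ x) w) = w := by
  have h1 := h.hasFDerivAt_transition h hx hx
  have h2 : HasFDerivAt (fun z => φ (φ.symm z)) (ContinuousLinearMap.id ℝ Z) (φ x) := by
    refine (hasFDerivAt_id _).congr_of_eventuallyEq ?_
    filter_upwards [φ.open_target.mem_nhds (φ.map_source hx)] with z hz using φ.right_inv hz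
  exact DFunLike.congr_fun (h1.unique h2) w

lemma FlowChart.chartDerivSymm_apply (h : FlowChart X φ G) (hx : x ∈ φ.source) (v : E3) :
    chartDerivSymm φ (φ x) (chartDeriv φ x v) = v := by
  have hs : Function.Surjective (chartDeriv φ x : E3 →ₗ[ℝ] Z) := fun w =>
    ⟨_, h.chartDeriv_symm_apply hx w⟩
  have hi : Function.Injective (chartDeriv φ x : E3 →ₗ[ℝ] Z) :=
    (LinearMap.injective_iff_surjective_of_finrank_eq_finrank (by simp)).2 hs
  exact hi (h.chartDeriv_symm_apply hx _)

end ChartDeriv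

variable [IsManifold (𝓡 3) ∞ M] [T2Space M] {Γ : SaddleConnection M} {a a' s₀ s s₁ : ℝ}
  {P P' : ℝ → ℂ →L[ℝ] ℂ} {φ ψ : OpenPartialHomeomorph M Z}

/-- The stable coordinate at `p` on a section to `Γ` near `q` has nonzero derivative. -/
lemma SmoothHead.exists_section_deriv (hφ : SmoothHead Γ a P s₁ φ)
    (hψ : SmoothTail Γ a' P' s₀ ψ) (ha : a < 0) (ha' : a' < 0)
    (hexp : ∀ t ≥ 0, ∀ y, ‖y‖ ≤ ‖P' t y‖) (h0 : s₀ < s) (h1 : s < s₁) :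
    ∃ ξ' : ℂ →L[ℝ] ℝ,
      ContDiffAt ℝ 1 (fun y : ℂ => (φ (ψ.symm ((ψ (Γ.orbit s)).1, y))).1) 0 ∧
      HasFDerivAt (fun y : ℂ => (φ (ψ.symm ((ψ (Γ.orbit s)).1, y))).1) ξ' 0 ∧ ξ' ≠ 0 ∧
      ∀ v, (chartDeriv φ (Γ.orbit s) v).1 = ξ' (chartDeriv ψ (Γ.orbit s) v).2 := by
  set x := Γ.orbit s with hx
  have hxφ : x ∈ φ.source := hφ.orbit_mem s h1.le
  have hxψ : x ∈ ψ.source := hψ.orbit_mem s h0.le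
  have hψx : ψ x = ((ψ x).1, 0) := Prod.ext rfl (hψ.orbit_snd hexp h0.le)
  set D := (chartDeriv φ x).comp (chartDerivSymm ψ (ψ x)) with hD
  have hDv : ∀ v, chartDeriv φ x v = D (chartDeriv ψ x v) := fun v => by
    rw [hD, ContinuousLinearMap.comp_apply, hψ.chartDerivSymm_apply hxψ]
  -- the flow direction
  have hflow : (D ((1 : ℝ), (0 : ℂ))).1 = 0 := by
    obtain ⟨V, hγ⟩ : ∃ V : E3, HasMFDerivWithinAt 𝓘(ℝ, ℝ) (𝓡 3) Γ.orbit univ s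
        ((1 : ℝ →L[ℝ] ℝ).smulRight V) :=
      ⟨Γ.X (Γ.orbit s), (Γ.isMIntegralCurve s).hasMFDerivWithinAt⟩
    have e1 := (hasDerivWithinAt_of_chart (hφ.hasMFDerivAt hxφ) hγ).hasDerivAt univ_mem
    have e2 := (hasDerivWithinAt_of_chart (hψ.hasMFDerivAt hxψ) hγ).hasDerivAt univ_mem
    have f1 : HasDerivAt (fun u => (φ (Γ.orbit u)).1) (chartDeriv φ x V).1 s :=
      (ContinuousLinearMap.fst ℝ ℝ ℂ).hasFDerivAt.comp_hasDerivAt s e1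
    have f2 : (chartDeriv φ x V).1 = 0 := by
      refine f1.unique ((hasDerivAt_const s (0 : ℝ)).congr_of_eventuallyEq ?_)
      filter_upwards [gt_mem_nhds h1] with u hu using hφ.orbit_fst ha hu.le
    have f3 : chartDeriv ψ x V = (a' * (ψ x).1, (0 : ℂ)) := by
      refine e2.unique ?_
      have h2 : HasDerivAt (fun u => (Real.exp (a' * (u - s)) * (ψ x).1, (0 : ℂ)))
          (a' * (ψ x).1, (0 : ℂ)) s := by
        refine HasDerivAt.prodMk ?_ (hasDerivAt_const s 0)
        have := (((((hasDerivAt_id s).sub_const s).const_mul a').exp).mul_const (ψ x).1)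
        simpa using this
      refine h2.congr_of_eventuallyEq ?_
      filter_upwards [lt_mem_nhds h0] with u hu
      have e3 := hψ.orbit_flow (t := u) (u := s₀) hu.le le_rfl
      have e4 := hψ.orbit_flow (t := s) (u := s₀) h0.le le_rfl
      refine Prod.ext ?_ (hψ.orbit_snd hexp hu.le)
      rw [e3, hx, e4]
      simp only [saddleFlow]
      rw [← mul_assoc, ← Real.exp_add]
      congr 2; ring
    rw [hDv, f3] at f2
    have h3 : (a' * (ψ x).1, (0 : ℂ)) = (a' * (ψ x).1) • ((1 : ℝ), (0 : ℂ)) := by simp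
    rw [h3, map_smul, Prod.smul_fst, smul_eq_mul] at f2
    exact (mul_eq_zero.1 f2).resolve_left
      (mul_ne_zero ha'.ne (hψ.orbit_fst hexp h0.le))
  -- The first component of `D` vanishes on the flow direction `(1, 0)`, so it is determined by its
  -- restriction `ξ'` to the section. This restriction cannot vanish, because the derivative of the
  -- chart `φ` is onto.
  set ξ' : ℂ →L[ℝ] ℝ := (ContinuousLinearMap.fst ℝ ℝ ℂ).comp
    (D.comp (ContinuousLinearMap.inr ℝ ℝ ℂ)) with hξ'
  have hDξ : ∀ w : Z, (D w).1 = ξ' w.2 := fun w => by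
    have h3 : w = w.1 • ((1 : ℝ), (0 : ℂ)) + ((0 : ℝ), w.2) := by
      refine Prod.ext ?_ ?_ <;> simp
    have h4 : (D w).1 = w.1 • (D ((1 : ℝ), (0 : ℂ))).1 + (D ((0 : ℝ), w.2)).1 := by
      conv_lhs => rw [h3, map_add, map_smul]
      rfl
    rw [h4, hflow, smul_zero, zero_add]; rfl
  refine ⟨ξ', ?_, ?_, ?_, fun v => by rw [hDv, hDξ]⟩
  · have h2 := hφ.contDiffAt_transition hψ.toFlowChart hxφ hxψ
    rw [hψx] at h2
    have h3 : ContDiffAt ℝ 1 (fun y : ℂ => ((ψ x).1, y)) 0 :=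
      contDiffAt_const.prodMk contDiffAt_id
    exact contDiffAt_fst.comp (0 : ℂ) (h2.comp (0 : ℂ) h3)
  · have h2 := hφ.hasFDerivAt_transition hψ.toFlowChart hxφ hxψ
    rw [hψx] at h2
    have h3 : HasFDerivAt (fun y : ℂ => ((ψ x).1, y)) (ContinuousLinearMap.inr ℝ ℝ ℂ) 0 :=
      (hasFDerivAt_const _ _).prodMk (hasFDerivAt_id _)
    have h4 := (ContinuousLinearMap.fst ℝ ℝ ℂ).hasFDerivAt.comp (0 : ℂ) (h2.comp (0 : ℂ) h3)
    rw [← hψx] at h4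
    exact h4
  · intro h2
    have h3 := hDv (chartDerivSymm φ (φ x) ((1 : ℝ), (0 : ℂ)))
    rw [hφ.chartDeriv_symm_apply hxφ] at h3
    have h4 := congrArg Prod.fst h3
    rw [hDξ, h2] at h4
    simp at h4

/-- If the unstable manifold of `p` is transverse to a plane at `q` that lies in `im y = 0`, then
the stable coordinate at `p` has nonzero derivative in the direction of the first unstable
coordinate. -/
lemma section_deriv_one_ne_zero {a : ℝ} {P : ℝ → ℂ →L[ℝ] ℂ} {B : ℂ →L[ℝ] ℂ}
    (hφ : SmoothHead Γ a P s₁ φ) (ha : a < 0) (hP : IsLinFlow B P) {τ D : ℝ}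
    (hB : ∀ y, B (B y) - τ • B y + D • y = 0) (hτ : 0 < τ) (hD : 0 < D) (h1 : s < s₁)
    {ψ₀ : OpenPartialHomeomorph M E3} {L : E3 ≃L[ℝ] Z}
    (hψ : SmoothTail Γ a' P' s₀ (ψ₀.transHomeomorph L.toHomeomorph)) (h0 : s₀ < s)
    (hψ₀ : IsLinearizingChart Γ.X Γ.q ψ₀)
    {ξ' : ℂ →L[ℝ] ℝ} (hne : ξ' ≠ 0) (hξ : ∀ v, (chartDeriv φ (Γ.orbit s) v).1 =
      ξ' (chartDeriv (ψ₀.transHomeomorph L.toHomeomorph) (Γ.orbit s) v).2)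
    {F : Submodule ℝ E3} (hF : ∀ v ∈ F, (L v).2.im = 0)
    (htr : Submodule.span ℝ (Γ.unstableTangent (Γ.orbit s)) ⊔
      F.comap (coordDeriv ψ₀ (Γ.orbit s) : E3 →ₗ[ℝ] E3) = ⊤) : ξ' 1 ≠ 0 := by
  intro hone
  set ψ := ψ₀.transHomeomorph L.toHomeomorph with hψdef
  set x := Γ.orbit s
  have hxψ : x ∈ ψ.source := hψ.orbit_mem s h0.le
  have hd : chartDeriv ψ x = (L : E3 →L[ℝ] Z).comp (coordDeriv ψ₀ x) := by
    have e1 : MDifferentiableAt (𝓡 3) 𝓘(ℝ, E3) ψ₀ x :=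
      (hψ₀.contMDiffOn.contMDiffAt (ψ₀.open_source.mem_nhds hxψ)).mdifferentiableAt (by simp)
    have e2 : HasMFDerivAt 𝓘(ℝ, E3) 𝓘(ℝ, Z) L (ψ₀ x) (L : E3 →L[ℝ] Z) :=
      hasMFDerivAt_iff_hasFDerivAt.2 (L : E3 →L[ℝ] Z).hasFDerivAt
    exact (e2.comp x e1.hasMFDerivAt).mfderiv
  set ℓ : E3 →ₗ[ℝ] ℝ := (LinearMap.fst ℝ ℝ ℂ).comp (chartDeriv φ x : E3 →ₗ[ℝ] Z)
  have hℓ : ∀ v, ℓ v = (chartDeriv φ x v).1 := fun v => rfl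
  -- If `ξ' 1 = 0`, the differential of the stable coordinate vanishes on the tangent vectors of the
  -- unstable manifold and also on the invariant plane, whose unstable part is real. By
  -- transversality these span everything.
  have htop : (⊤ : Submodule ℝ E3) ≤ LinearMap.ker ℓ := by
    rw [← htr, sup_le_iff, Submodule.span_le]
    refine ⟨fun v hv => ?_, fun v hv => ?_⟩
    · exact hφ.unstableTangent_fst ha hP hB hτ hD h1 hv
    · rw [LinearMap.mem_ker, hℓ, hξ, hd]
      have h2 := hF _ hv
      have h3 : (L (coordDeriv ψ₀ x v)).2 = (L (coordDeriv ψ₀ x v)).2.re • (1 : ℂ) := by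
        apply Complex.ext
        · simp
        · simpa using h2
      change ξ' (L (coordDeriv ψ₀ x v)).2 = 0
      rw [h3, map_smul, hone, smul_zero]
  refine hne (ContinuousLinearMap.ext fun y => ?_)
  have h4 := htop (Submodule.mem_top (x := chartDerivSymm ψ (ψ x) ((0 : ℝ), y)))
  rw [LinearMap.mem_ker, hℓ, hξ, hψ.chartDeriv_symm_apply hxψ] at h4
  exact h4

end SaddleConn

/-! ### The trace of the unstable manifold as a graph -/

namespace SaddleConn

/-- Near a regular point with `∂ξ/∂(re y) > 0`, the sign of `ξ` is that of `re y - g (im y)`. -/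
lemma exists_sign_graph {ξ : ℂ → ℝ} (hξ : ContDiffAt ℝ 1 ξ 0) (h0 : ξ 0 = 0) {ξ' : ℂ →L[ℝ] ℝ}
    (hd : HasFDerivAt ξ ξ' 0) (hpos : 0 < ξ' 1) :
    ∃ g : ℝ → ℝ, Continuous g ∧ g 0 = 0 ∧ (∃ C, ∀ σ, |g σ| ≤ C * |σ|) ∧
      (ξ' Complex.I = 0 → g =o[𝓝 0] (fun σ : ℝ => σ)) ∧
      ∀ᶠ y in 𝓝 (0 : ℂ), SignType.sign (ξ y) = SignType.sign (y.re - g y.im) := by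
  have hs : HasStrictFDerivAt ξ ξ' 0 := hξ.hasStrictFDerivAt' hd (by simp)
  -- strict monotonicity in the real direction
  have hε : 0 < ξ' 1 / 2 := by positivity
  have hmono : ∀ᶠ w : ℂ × ℂ in 𝓝 (0, 0), ‖ξ w.1 - ξ w.2 - ξ' (w.1 - w.2)‖ ≤
      ξ' 1 / 2 * ‖w.1 - w.2‖ := hs.isLittleO.def hε
  have hsign : ∀ w : ℂ × ℂ, ‖ξ w.1 - ξ w.2 - ξ' (w.1 - w.2)‖ ≤ ξ' 1 / 2 * ‖w.1 - w.2‖ →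
      w.1.im = w.2.im → ξ w.2 = 0 → SignType.sign (ξ w.1) = SignType.sign (w.1.re - w.2.re) := by
    intro w hw him hz
    have e : w.1 - w.2 = (w.1.re - w.2.re) • (1 : ℂ) := by
      apply Complex.ext <;> simp [him]
    rw [hz, e, map_smul, norm_smul, norm_one, mul_one, sub_zero, smul_eq_mul, Real.norm_eq_abs,
      Real.norm_eq_abs] at hw
    have h1 := abs_le.1 hw
    generalize w.1.re - w.2.re = r at *
    rcases lt_trichotomy r 0 with hr | hr | hr
    · rw [abs_of_neg hr] at h1
      rw [sign_neg hr, sign_neg (by nlinarith)]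
    · subst hr
      simp at h1
      have : ξ w.1 = 0 := by linarith [h1.1, h1.2]
      simp [this]
    · rw [abs_of_pos hr] at h1
      rw [sign_pos hr, sign_pos (by nlinarith)]
  -- the coordinates `(ξ, im)`
  let F : ℂ → ℂ := fun y => ξ y + y.im * Complex.I
  let A : ℂ →L[ℝ] ℂ := Complex.ofRealCLM.comp ξ' +
    (mulC Complex.I).comp (Complex.ofRealCLM.comp Complex.imCLM)
  have hA : ∀ y, A y = ξ' y + y.im * Complex.I := fun y => by simp [A, mul_comm]
  have hξr : ∀ r : ℝ, ξ' (r : ℂ) = r * ξ' 1 := fun r => by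
    have : (r : ℂ) = r • (1 : ℂ) := by simp
    rw [this, map_smul, smul_eq_mul]
  have hAinj : Function.Injective (A : ℂ →ₗ[ℝ] ℂ) := by
    rw [← LinearMap.ker_eq_bot, LinearMap.ker_eq_bot']
    intro y hy
    have hy' : (ξ' y : ℂ) + y.im * Complex.I = 0 := by rw [← hA]; exact hy
    have h1 : ξ' y = 0 := by simpa using congrArg Complex.re hy'
    have h2 : y.im = 0 := by simpa using congrArg Complex.im hy'
    have h3 : y = (y.re : ℂ) := by apply Complex.ext <;> simp [h2]
    rw [h3, hξr] at h1
    rw [h3, (mul_eq_zero.1 h1).resolve_right hpos.ne']; simp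
  let A' : ℂ ≃L[ℝ] ℂ := (LinearEquiv.ofInjectiveEndo (A : ℂ →ₗ[ℝ] ℂ) hAinj).toContinuousLinearEquiv
  have hA' : (A' : ℂ →L[ℝ] ℂ) = A := by ext <;> rfl
  have hF : HasStrictFDerivAt F (A' : ℂ →L[ℝ] ℂ) 0 := by
    rw [hA']
    have h1 : HasStrictFDerivAt (fun y => (ξ y : ℂ)) (Complex.ofRealCLM.comp ξ') 0 :=
      Complex.ofRealCLM.hasStrictFDerivAt.comp 0 hs
    have h2 := ((mulC Complex.I).comp (Complex.ofRealCLM.comp Complex.imCLM)).hasStrictFDerivAt (x := (0 : ℂ))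
    have h3 := h1.add h2
    refine h3.congr_of_eventuallyEq (Eventually.of_forall fun y => ?_)
    simp [F, mul_comm]
  have hF0 : F 0 = 0 := by simp [F, h0]
  set e := hF.toOpenPartialHomeomorph F with he
  have he0 : (0 : ℂ) ∈ e.source := hF.mem_toOpenPartialHomeomorph_source
  have heF : ∀ y, e y = F y := fun y => rfl
  have ht0 : (0 : ℂ) ∈ e.target := by
    have := e.map_source he0
    rwa [heF, hF0] at this
  have hsymm0 : e.symm 0 = 0 := by
    have := e.left_inv he0
    rwa [heF, hF0] at this
  have hsd : HasStrictFDerivAt e.symm (A'.symm : ℂ →L[ℝ] ℂ) 0 := by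
    have := hF.to_localInverse
    rw [hF0] at this
    exact this
  let ι : ℝ → ℂ := fun σ => σ * Complex.I
  have hι : Continuous ι := by fun_prop
  have hι0 : ι 0 = 0 := by simp [ι]
  -- The point over `iσ` of the local inverse of `y ↦ ξ(y) + i im y` is the zero of `ξ` with
  -- imaginary part `σ`; its real part is the graph.
  let g₀ : ℝ → ℝ := fun σ => (e.symm (ι σ)).re
  have hg₀ : HasDerivAt g₀ (A'.symm Complex.I).re 0 := by
    have h1 : HasDerivAt ι Complex.I 0 := by
      simpa using ((hasDerivAt_id (0 : ℝ)).ofReal_comp).mul_const Complex.I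
    have h2 : HasFDerivAt e.symm (A'.symm : ℂ →L[ℝ] ℂ) (ι 0) := by
      rw [hι0]; exact hsd.hasFDerivAt
    exact Complex.reCLM.hasFDerivAt.comp_hasDerivAt 0 (h2.comp_hasDerivAt 0 h1)
  have hg₀0 : g₀ 0 = 0 := by simp [g₀, hι0, hsymm0]
  obtain ⟨δ₁, hδ₁, hT⟩ : ∃ δ > 0, ∀ σ : ℝ, |σ| ≤ δ → ι σ ∈ e.target := by
    have : ∀ᶠ σ in 𝓝 (0 : ℝ), ι σ ∈ e.target :=
      hι.continuousAt.eventually (e.open_target.mem_nhds (by rwa [hι0]))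
    obtain ⟨δ, hδ, h⟩ := Metric.eventually_nhds_iff.1 this
    exact ⟨δ / 2, by positivity, fun σ hσ => h (by rw [Real.dist_eq, sub_zero]; linarith)⟩
  have hbig : ∃ C > 0, ∃ δ > 0, ∀ σ : ℝ, |σ| ≤ δ → |g₀ σ| ≤ C * |σ| := by
    have h1 := hg₀.isBigO_sub
    obtain ⟨C, hC, h2⟩ := h1.exists_pos
    obtain ⟨δ, hδ, h⟩ := Metric.eventually_nhds_iff.1 h2.bound
    refine ⟨C, hC, δ / 2, by positivity, fun σ hσ => ?_⟩
    have := h (y := σ) (by rw [Real.dist_eq, sub_zero]; linarith)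
    simpa [hg₀0] using this
  obtain ⟨C, hC, δ₂, hδ₂, hbound⟩ := hbig
  set δ := min δ₁ δ₂ with hδdef
  have hδ : 0 < δ := lt_min hδ₁ hδ₂
  -- Truncating the argument turns the germ into a global continuous function, and `|cl σ| ≤ |σ|`
  -- preserves the linear bound.
  let cl : ℝ → ℝ := fun σ => max (-δ) (min δ σ)
  have hcl : Continuous cl := by fun_prop
  have hcl1 : ∀ σ, |cl σ| ≤ δ := fun σ =>
    abs_le.2 ⟨le_max_left _ _, max_le (by linarith) (min_le_left _ _)⟩
  have hcl2 : ∀ σ, |cl σ| ≤ |σ| := fun σ => by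
    refine abs_le.2 ⟨?_, max_le (by linarith [abs_nonneg σ]) ((min_le_right _ _).trans (le_abs_self σ))⟩
    rcases le_total (-δ) (-|σ|) with h | h
    · exact le_max_of_le_right (le_min (by linarith [abs_nonneg σ]) (neg_abs_le σ))
    · exact le_max_of_le_left h
  have hcl3 : ∀ σ, |σ| ≤ δ → cl σ = σ := fun σ hσ => by
    have := abs_le.1 hσ
    simp only [cl]
    rw [min_eq_right this.2, max_eq_right this.1]
  have hnear : ∀ᶠ σ : ℝ in 𝓝 0, |σ| ≤ δ := by
    filter_upwards [Metric.closedBall_mem_nhds (0 : ℝ) hδ] with σ hσ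
    simpa using hσ
  refine ⟨fun σ => g₀ (cl σ), ?_, ?_, ⟨C, fun σ => ?_⟩, fun hI => ?_, ?_⟩
  · have h1 : ContinuousOn (fun σ => e.symm (ι σ)) {σ | |σ| ≤ δ} :=
      e.continuousOn_symm.comp hι.continuousOn fun σ hσ => hT σ (hσ.trans (min_le_left _ _))
    exact (Complex.continuous_re.comp_continuousOn h1).comp_continuous hcl hcl1
  · change g₀ (cl 0) = 0
    rw [hcl3 0 (by simpa using hδ.le), hg₀0]
  · exact (hbound _ ((hcl1 σ).trans (min_le_right _ _))).trans (mul_le_mul_of_nonneg_left (hcl2 σ) hC.le)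
  -- When `ξ'` vanishes on `i`, the graph is tangent to the imaginary axis, that is, `g₀` has
  -- derivative 0.
  · have h1 : A'.symm Complex.I = Complex.I := by
      rw [ContinuousLinearEquiv.symm_apply_eq]
      have : A' Complex.I = A Complex.I := DFunLike.congr_fun hA' Complex.I
      rw [this, hA, hI]; simp
    rw [h1, Complex.I_re] at hg₀
    have h2 := hasDerivAt_iff_isLittleO.1 hg₀
    simp only [hg₀0, sub_zero, smul_zero] at h2
    refine h2.congr' ?_ EventuallyEq.rfl
    filter_upwards [hnear] with σ hσ
    rw [hcl3 σ hσ]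
  · have hlim : Tendsto (fun y : ℂ => (y, e.symm (ι y.im))) (𝓝 0) (𝓝 (0, 0)) := by
      have h1 : Tendsto (fun y : ℂ => ι y.im) (𝓝 0) (𝓝 0) := by
        have := (hι.comp Complex.continuous_im).tendsto 0
        simp only [Function.comp_apply, Complex.zero_im, hι0] at this
        exact this
      have h2 := (e.symm.continuousAt ht0).tendsto
      change Tendsto e.symm (𝓝 0) (𝓝 (e.symm 0)) at h2
      rw [hsymm0] at h2
      exact tendsto_id.prodMk_nhds (h2.comp h1)
    have hnear' : ∀ᶠ y : ℂ in 𝓝 0, |y.im| ≤ δ := by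
      have := Complex.continuous_im.tendsto 0
      rw [Complex.zero_im] at this
      exact this.eventually hnear
    filter_upwards [hlim.eventually hmono, hnear'] with y hy hyδ
    have h1 : F (e.symm (ι y.im)) = ι y.im := e.right_inv (hT _ (hyδ.trans (min_le_left _ _)))
    have h2 : ξ (e.symm (ι y.im)) = 0 := by
      have := congrArg Complex.re h1
      simpa [F, ι] using this
    have h3 : y.im = (e.symm (ι y.im)).im := by
      have := congrArg Complex.im h1
      simpa [F, ι] using this.symm
    have h4 := hsign (y, e.symm (ι y.im)) hy h3 h2
    rw [h4]
    change _ = SignType.sign (y.re - g₀ (cl y.im))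
    rw [hcl3 _ hyδ]

end SaddleConn

/-! ### Graph form of generic connections -/

namespace SaddleConn

lemma strictMono_oddPow {r : ℝ} (hr : 0 < r) : StrictMono (oddPow r) := by
  rcases (continuous_oddPow hr).strictMono_of_inj (oddPowHomeo r hr).injective with h | h
  · exact h
  · have h1 := h (zero_lt_one' ℝ)
    rw [oddPow_zero, oddPow_of_pos one_pos, Real.one_rpow] at h1
    linarith

lemma sign_sub_eq_of_strictMono {f : ℝ → ℝ} (hf : StrictMono f) (x y : ℝ) :
    SignType.sign (f x - f y) = SignType.sign (x - y) := by
  rcases lt_trichotomy x y with h | h | h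
  · rw [sign_neg (sub_neg.2 h), sign_neg (sub_neg.2 (hf h))]
  · simp [h]
  · rw [sign_pos (sub_pos.2 h), sign_pos (sub_pos.2 (hf h))]

lemma isLittleO_of_abs_le_rpow {g : ℝ → ℝ} {C k : ℝ} (hk : 1 < k)
    (hg : ∀ σ, |g σ| ≤ C * |σ| ^ k) : g =o[𝓝 0] (fun σ : ℝ => σ) := by
  have h1 : g =O[𝓝 0] fun σ : ℝ => |σ| ^ k := by
    refine Asymptotics.IsBigO.of_bound C (Eventually.of_forall fun σ => ?_)
    rw [Real.norm_eq_abs, Real.norm_of_nonneg (Real.rpow_nonneg (abs_nonneg σ) k)]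
    exact hg σ
  refine h1.trans_isLittleO ?_
  have h2 : Tendsto (fun σ : ℝ => |σ| ^ (k - 1)) (𝓝 0) (𝓝 0) := by
    have := (continuous_abs.rpow_const (p := k - 1)
      fun _ => Or.inr (by linarith : (0 : ℝ) ≤ k - 1)).tendsto (0 : ℝ)
    rwa [abs_zero, Real.zero_rpow (by linarith)] at this
  refine Asymptotics.isLittleO_iff.2 fun ε hε => ?_
  filter_upwards [h2.eventually (gt_mem_nhds hε)] with σ hσ
  rw [Real.norm_of_nonneg (Real.rpow_nonneg (abs_nonneg σ) k), Real.norm_eq_abs]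
  rcases eq_or_ne σ 0 with h | h
  · rw [h, abs_zero, Real.zero_rpow (by linarith), mul_zero]
  · have h3 : |σ| ^ k = |σ| ^ (k - 1) * |σ| := by
      conv_rhs => rw [← Real.rpow_one |σ|, ← Real.rpow_mul (abs_nonneg σ), mul_comm, one_mul]
      rw [Real.rpow_one, Real.rpow_sub_one (abs_ne_zero.2 h), mul_div_cancel₀ _ (abs_ne_zero.2 h)]
    rw [h3]
    gcongr

variable {M : Type*} [TopologicalSpace M] [ChartedSpace E3 M] [IsManifold (𝓡 3) ∞ M] [T2Space M]
  {Γ : SaddleConnection M} {a s : ℝ} {P : ℝ → ℂ →L[ℝ] ℂ} {B : ℂ →L[ℝ] ℂ}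
  {φ ψ : OpenPartialHomeomorph M Z}

/-- The counterpart of the head chart, with any conjugacy `e` on the unstable plane and with `Γ(s)`
moved to `(1, 0)`. The formula for the section `x = 1` allows the trace of the unstable manifold of
`p` to be followed through the change of coordinates. -/
lemma SmoothTail.exists_tailChart (h : SmoothTail Γ a P s ψ) (ha : a < 0)
    (hexp : ∀ t ≥ 0, ∀ y, ‖y‖ ≤ ‖P t y‖) {b c : ℝ} (hc : 0 < c) (e : ℂ ≃ₜ ℂ) (he0 : e 0 = 0)
    (he : ∀ t y, e (P t y) = Complex.exp ((1 + b * Complex.I) * (c * t : ℝ)) * e y) :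
    ∃ ψ', TailChart Γ b c s ψ' ∧ ∀ y, ψ'.symm (1, y) = ψ.symm ((ψ (Γ.orbit s)).1, e.symm y) := by
  have hr : 0 < c / -a := div_pos hc (neg_pos.2 ha)
  set x := (ψ (Γ.orbit s)).1 with hx
  have hx0 : x ≠ 0 := h.orbit_fst hexp le_rfl
  set f : Z ≃ₜ Z := ((Homeomorph.mulLeft₀ x⁻¹ (inv_ne_zero hx0)).trans
    (oddPowHomeo _ hr)).prodCongr e with hf
  have hfz : ∀ z : Z, f z = (oddPow (c / -a) (x⁻¹ * z.1), e z.2) := fun z => rfl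
  refine ⟨ψ.transHomeomorph f, ⟨hc, h.post f fun t z => ?_, h.base_mem, ?_, h.orbit_mem,
    fun t ht => ?_⟩, fun y => ?_⟩
  · rw [modelFlow_apply, hfz, hfz]
    simp only [saddleFlow]
    rw [mul_left_comm, oddPow_exp_mul, he]
    have h1 : c / -a * (a * t) = -(c * t) := by
      have := ha.ne
      field_simp
    rw [h1]
  · change f (ψ Γ.q) = 0
    rw [h.base, hfz]
    simp [oddPow_zero, he0]
  · change f (ψ (Γ.orbit t)) = _
    rw [hfz, h.orbit_snd hexp ht, he0, h.orbit_flow ht le_rfl]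
    simp only [saddleFlow]
    rw [← hx, mul_left_comm, inv_mul_cancel₀ hx0, oddPow_exp_mul, oddPow_of_pos one_pos,
      Real.one_rpow, mul_one]
    have h1 : c / -a * (a * (t - s)) = -(c * (t - s)) := by
      have := ha.ne
      field_simp
    rw [h1]
  · change ψ.symm (f.symm (1, y)) = _
    congr 1
    rw [f.symm_apply_eq, hfz]
    simp [hx0, oddPow_of_pos one_pos]

/-- Charts around the two halves of a connection in which the unstable manifold of `p` is the
graph of `g` in the section `x = 1` of the chart at `q`. -/
structure GraphForm (Γ : SaddleConnection M) (b c' c s : ℝ) (φ ψ : OpenPartialHomeomorph M Z)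
    (g : ℝ → ℝ) : Prop where
  head : HeadChart Γ c' s φ
  tail : TailChart Γ b c s ψ
  cont : Continuous g
  zero : g 0 = 0
  isLittleO : g =o[𝓝 0] (fun σ : ℝ => σ)
  sign : ∀ᶠ y in 𝓝 (0 : ℂ),
    SignType.sign (φ (ψ.symm (1, y))).1 = SignType.sign (y.re - g y.im)

lemma SaddleConnection.exists_head_data (Γ : SaddleConnection M) (h : morseIndex Γ.X Γ.p = 1) :
    ∃ (a τ D : ℝ) (B : ℂ →L[ℝ] ℂ) (P : ℝ → ℂ →L[ℝ] ℂ), a < 0 ∧ 0 < τ ∧ 0 < D ∧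
      IsLinFlow B P ∧ (∀ y, B (B y) - τ • B y + D • y = 0) ∧ ∀ s, ∃ φ, SmoothHead Γ a P s φ := by
  obtain ⟨a, τ, D, hS⟩ := exists_spectralSplit Γ.saddle_p.hyperbolic h
  obtain ⟨L, B, hB, hL⟩ := hS.exists_coordinates
  obtain ⟨φ₀, hφ₀⟩ := Γ.linearizable_p
  exact ⟨a, τ, D, B, _, hS.stable_neg, hS.trace_pos, hS.det_pos, isLinFlow_exp B, hB,
    exists_smoothHead hφ₀ (isLinFlow_exp B) L hL⟩

lemma norm_le_mulC_exp {w : ℂ} (hw : 0 ≤ w.re) (t : ℝ) (ht : t ≥ 0) (y : ℂ) :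
    ‖y‖ ≤ ‖mulC (Complex.exp (w * t)) y‖ := by
  rw [mulC_apply, norm_mul, Complex.norm_exp]
  refine le_mul_of_one_le_left (norm_nonneg _) (Real.one_le_exp ?_)
  simpa using mul_nonneg hw ht

lemma norm_le_diagC_exp {m₁ m₂ : ℝ} (h₁ : 0 ≤ m₁) (h₂ : 0 ≤ m₂) (t : ℝ) (ht : t ≥ 0) (y : ℂ) :
    ‖y‖ ≤ ‖diagC (Real.exp (m₁ * t)) (Real.exp (m₂ * t)) y‖ := by
  rw [Complex.norm_def, Complex.norm_def]
  apply Real.sqrt_le_sqrt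
  rw [Complex.normSq_apply, Complex.normSq_apply, diagC_apply]
  have k1 := Real.one_le_exp (mul_nonneg h₁ ht)
  have k2 := Real.one_le_exp (mul_nonneg h₂ ht)
  simp only
  have key : ∀ E u : ℝ, 1 ≤ E → u * u ≤ E * u * (E * u) := fun E u hE => by
    have : E * u * (E * u) = (E * E) * (u * u) := by ring
    rw [this]
    exact le_mul_of_one_le_left (mul_self_nonneg u) (by nlinarith)
  exact add_le_add (key _ _ k1) (key _ _ k2)

lemma SmoothHead.mono (h : SmoothHead Γ a P s φ) {s' : ℝ} (hs : s' ≤ s) :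
    SmoothHead Γ a P s' φ :=
  ⟨h.toFlowChart, h.base_mem, h.base, fun t ht => h.orbit_mem t (ht.trans hs)⟩

/-- Multiplication by a complex number commutes with the spiral flow, so the section may be turned
by the gradient `u` of the stable coordinate. After that the trace is tangent to the imaginary axis;
no transversality is needed. The head gets the rate `|b| c` in anticipation of `normalize_rotation`,
which brings the tail to this rate. -/
lemma SaddleConnection.Generic11Complex.exists_graphForm (h : Γ.Generic11Complex) :
    ∃ b c : ℝ, b ≠ 0 ∧ 0 < c ∧ ∃ s₀, ∀ s ≥ s₀, ∃ φ ψ g, GraphForm Γ b (|b| * c) c s φ ψ g := by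
  obtain ⟨ap, τ, D, B, P, hap, hτ, hD, hP, hB, hhead⟩ := Γ.exists_head_data h.1.1
  obtain ⟨a, τq, Dq, hS⟩ := exists_spectralSplit Γ.saddle_q.hyperbolic h.1.2
  obtain ⟨L, α, β, hα, hβ, hL⟩ := hS.exists_coordinates_complex h.2
  have ha := hS.stable_neg
  obtain ⟨ψ₀, hψ₀⟩ := Γ.linearizable_q
  set w : ℂ := α + β * Complex.I with hw
  have hwre : w.re = α := by simp [hw]
  obtain ⟨s₀, hs₀⟩ := exists_smoothTail hψ₀ (isLinFlow_mulC w) L hL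
  have hexp := norm_le_mulC_exp (w := w) (by rw [hwre]; exact hα.le)
  refine ⟨β / α, α, div_ne_zero hβ hα.ne', hα, s₀ + 1, fun s hs => ?_⟩
  obtain ⟨φ, hφ⟩ := hhead (s + 1)
  obtain ⟨ξ', hξ1, hξ2, hξ3, -⟩ := hφ.exists_section_deriv (hs₀ s₀ le_rfl) hap ha hexp
    (s := s) (by linarith) (by linarith)
  set ψ := ψ₀.transHomeomorph L.toHomeomorph
  have hψ : SmoothTail Γ a (fun t => mulC (Complex.exp (w * t))) s ψ := hs₀ s (by linarith)
  obtain ⟨f, hf, hf1⟩ := (hφ.mono (s' := s) (by linarith)).exists_headChart hap hP hB hτ hD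
    (mul_pos (abs_pos.2 (div_ne_zero hβ hα.ne')) hα)
  -- rotate the section
  set u : ℂ := ⟨ξ' 1, ξ' Complex.I⟩ with hu
  have hξu : ∀ y : ℂ, ξ' y = y.re * ξ' 1 + y.im * ξ' Complex.I := fun y => by
    have : y = y.re • (1 : ℂ) + y.im • Complex.I := by
      apply Complex.ext <;> simp
    conv_lhs => rw [this, map_add, map_smul, map_smul]
    rfl
  have hu0 : u ≠ 0 := fun e => by
    have e1 : ξ' 1 = 0 := congrArg Complex.re e
    have e2 : ξ' Complex.I = 0 := congrArg Complex.im e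
    exact hξ3 (ContinuousLinearMap.ext fun y => by rw [hξu, e1, e2]; simp)
  have hupos : 0 < ξ' 1 ^ 2 + ξ' Complex.I ^ 2 := by
    have := Complex.normSq_pos.2 hu0
    rw [Complex.normSq_apply] at this
    simp only [hu] at this
    nlinarith
  obtain ⟨ψ', hψ', hψ1⟩ := hψ.exists_tailChart ha hexp (b := β / α) hα
    (Homeomorph.mulLeft₀ u⁻¹ (inv_ne_zero hu0)) (by simp) fun t y => by
      simp only [mulC_apply, Homeomorph.coe_mulLeft₀]
      rw [mul_left_comm, hw]
      congr 2
      push_cast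
      have : (α : ℂ) ≠ 0 := by exact_mod_cast hα.ne'
      field_simp
  set ξ : ℂ → ℝ := fun y => (φ (ψ.symm ((ψ (Γ.orbit s)).1, y))).1
  have hξ0 : ξ 0 = 0 := by
    have e1 : ((ψ (Γ.orbit s)).1, (0 : ℂ)) = ψ (Γ.orbit s) :=
      Prod.ext rfl (hψ.orbit_snd hexp le_rfl).symm
    simp only [ξ]
    rw [e1, ψ.left_inv (hψ.orbit_mem s le_rfl), hφ.orbit_fst hap (by linarith)]
  obtain ⟨g, hg, hg0, -, hgo, hgs⟩ := exists_sign_graph (ξ := fun y => ξ (mulC u y))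
    (ξ' := ξ'.comp (mulC u)) (by
      refine ContDiffAt.comp (g := ξ) 0 ?_ (mulC u).contDiff.contDiffAt
      rw [map_zero]; exact hξ1) (by rw [map_zero, hξ0]) (by
      refine HasFDerivAt.comp (g := ξ) 0 ?_ (mulC u).hasFDerivAt
      rw [map_zero]; exact hξ2) (by
      rw [ContinuousLinearMap.comp_apply, mulC_apply, mul_one, hξu]
      simp only [hu]; nlinarith)
  refine ⟨_, ψ', g, hf, hψ', hg, hg0, hgo ?_, ?_⟩
  · rw [ContinuousLinearMap.comp_apply, mulC_apply, hξu]
    simp [hu]; ring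
  · filter_upwards [hgs] with y hy
    rw [← hy, hψ1]
    change SignType.sign (f (φ _)).1 = _
    rw [hf1, sign_oddPow]
    have : (Homeomorph.mulLeft₀ u⁻¹ (inv_ne_zero hu0)).symm y = mulC u y := by
      rw [Homeomorph.symm_apply_eq]
      simp [hu0]
    rw [this]

/-- Eigenvectors whose eigenvalue differs from `μ₂` have no component along the strong direction. -/
lemma SaddleConnection.planeF_le_ker {a μ₁ μ₂ : ℝ} (hμ : 0 < μ₁) (hμ' : μ₁ < μ₂) {L : E3 ≃L[ℝ] Z}
    (hL : ∀ v, L (linearPart Γ.X Γ.q v) = (a * (L v).1, ⟨μ₁ * (L v).2.re, μ₂ * (L v).2.im⟩)) :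
    ∀ v ∈ Γ.planeF μ₁, (L v).2.im = 0 := by
  have key : ∀ ν : ℝ, ν < μ₂ → ∀ v ∈ Module.End.eigenspace
      (linearPart Γ.X Γ.q : E3 →ₗ[ℝ] E3) ν, (L v).2.im = 0 := by
    intro ν hν v hv
    have h1 : linearPart Γ.X Γ.q v = ν • v := Module.End.mem_eigenspace_iff.1 hv
    have h2 := hL v
    rw [h1, map_smul] at h2
    have h3 : ν * (L v).2.im = μ₂ * (L v).2.im := by
      have := congrArg (fun z : Z => z.2.im) h2
      simpa using this
    have h4 : (μ₂ - ν) * (L v).2.im = 0 := by linarith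
    exact (mul_eq_zero.1 h4).resolve_left (by linarith)
  let ℓ : E3 →ₗ[ℝ] ℝ := Complex.imLm ∘ₗ LinearMap.snd ℝ ℝ ℂ ∘ₗ (L : E3 →ₗ[ℝ] Z)
  have : Γ.planeF μ₁ ≤ LinearMap.ker ℓ :=
    sup_le (iSup_le fun ν v hv => key ν (by linarith [ν.2]) v hv) fun v hv => key μ₁ hμ' v hv
  exact fun v hv => this hv

/-- Transversality to the plane of the stable and the weak direction makes the trace a graph `re =
g(im)` with `|g σ| ≤ C|σ|`. Odd powers `1/μ₁` and `1/μ₂` of the two coordinates make both rates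
equal to 1 and turn the bound into a multiple of `|σ|^(μ₂/μ₁)`. This is `o(σ)` because `μ₂ > μ₁`:
the gap between the eigenvalues produces the tangency. -/
lemma SaddleConnection.Generic11Real.exists_graphForm (h : Γ.Generic11Real) :
    ∃ s₀, ∀ s ≥ s₀, ∃ φ ψ g, GraphForm Γ 0 1 1 s φ ψ g := by
  obtain ⟨ap, τ, D, B, P, hap, hτ, hD, hP, hB, hhead⟩ := Γ.exists_head_data h.1.1
  obtain ⟨a, τq, Dq, hS⟩ := exists_spectralSplit Γ.saddle_q.hyperbolic h.1.2
  obtain ⟨L, μ₁, μ₂, hμ₁, hμ₁₂, hmem, hL⟩ := hS.exists_coordinates_real h.2.1 h.2.2.1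
  have ha := hS.stable_neg
  have hμ₂ : 0 < μ₂ := hμ₁.trans hμ₁₂
  obtain ⟨ψ₀, hψ₀, htr⟩ := h.2.2.2
  obtain ⟨s₂, hs₂⟩ := eventually_atTop.1 (htr μ₁ hmem)
  obtain ⟨s₀, hs₀⟩ := exists_smoothTail hψ₀ (isLinFlow_diagC μ₁ μ₂) L fun v => by
    rw [diagC_apply]; exact hL v
  have hexp := norm_le_diagC_exp hμ₁.le hμ₂.le
  refine ⟨max s₂ (s₀ + 1), fun s hs => ?_⟩
  have hss₀ : s₀ + 1 ≤ s := (le_max_right _ _).trans hs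
  obtain ⟨φ, hφ⟩ := hhead (s + 1)
  obtain ⟨ξ', hξ1, hξ2, hξ3, hξ4⟩ := hφ.exists_section_deriv (hs₀ s₀ le_rfl) hap ha hexp
    (s := s) (by linarith) (by linarith)
  have hone : ξ' 1 ≠ 0 := section_deriv_one_ne_zero hφ hap hP hB hτ hD (by linarith)
    (hs₀ s₀ le_rfl) (by linarith) hψ₀ hξ3 hξ4 (planeF_le_ker hμ₁ hμ₁₂ hL)
    (hs₂ s ((le_max_left _ _).trans hs))
  set ψ := ψ₀.transHomeomorph L.toHomeomorph
  have hψ : SmoothTail Γ a (fun t => diagC (Real.exp (μ₁ * t)) (Real.exp (μ₂ * t))) s ψ :=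
    hs₀ s (by linarith)
  obtain ⟨f, hf, hf1⟩ := (hφ.mono (s' := s) (by linarith)).exists_headChart hap hP hB hτ hD one_pos
  -- The sign `κ` orients the section so that the derivative in the real direction is positive, as
  -- `exists_sign_graph` requires.
  set κ : ℝ := ((SignType.sign (ξ' 1) : SignType) : ℝ) with hκ
  have hκξ : 0 < κ * ξ' 1 := by
    rw [hκ, sign_mul_self]; exact abs_pos.2 hone
  have hκκ : κ * κ = 1 := by
    rcases hone.lt_or_gt with h | h
    · simp [hκ, sign_neg h]
    · simp [hκ, sign_pos h]
  have hκ0 : κ ≠ 0 := fun e => by rw [e] at hκκ; simp at hκκ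
  let e : ℂ ≃ₜ ℂ :=
    { toFun := fun y => ⟨oddPow μ₁⁻¹ (κ * y.re), oddPow μ₂⁻¹ (κ * y.im)⟩
      invFun := fun y => ⟨κ * oddPow μ₁ y.re, κ * oddPow μ₂ y.im⟩
      left_inv := fun y => by
        apply Complex.ext <;> simp only
        · rw [oddPow_oddPow (inv_pos.2 hμ₁), inv_mul_cancel₀ hμ₁.ne', oddPow_one, ← mul_assoc,
            hκκ, one_mul]
        · rw [oddPow_oddPow (inv_pos.2 hμ₂), inv_mul_cancel₀ hμ₂.ne', oddPow_one, ← mul_assoc,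
            hκκ, one_mul]
      right_inv := fun y => by
        apply Complex.ext <;> simp only
        · rw [← mul_assoc, hκκ, one_mul, oddPow_oddPow hμ₁, mul_inv_cancel₀ hμ₁.ne', oddPow_one]
        · rw [← mul_assoc, hκκ, one_mul, oddPow_oddPow hμ₂, mul_inv_cancel₀ hμ₂.ne', oddPow_one]
      continuous_toFun := by
        have h1 := continuous_oddPow (inv_pos.2 hμ₁)
        have h2 := continuous_oddPow (inv_pos.2 hμ₂)
        simp only [Complex.mk_eq_add_mul_I]
        fun_prop
      continuous_invFun := by
        have h1 := continuous_oddPow hμ₁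
        have h2 := continuous_oddPow hμ₂
        simp only [Complex.mk_eq_add_mul_I]
        fun_prop }
  have heapp : ∀ y, e y = ⟨oddPow μ₁⁻¹ (κ * y.re), oddPow μ₂⁻¹ (κ * y.im)⟩ := fun _ => rfl
  obtain ⟨ψ', hψ', hψ1⟩ := hψ.exists_tailChart ha hexp (b := 0) one_pos e
    (by rw [heapp]; apply Complex.ext <;> simp [oddPow_zero]) fun t y => by
      rw [heapp, heapp, diagC_apply]
      simp only
      rw [mul_left_comm, oddPow_exp_mul, mul_left_comm κ, oddPow_exp_mul, inv_mul_cancel_left₀ hμ₁.ne',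
        inv_mul_cancel_left₀ hμ₂.ne']
      have : Complex.exp ((1 + (0 : ℝ) * Complex.I) * (1 * t : ℝ)) = (Real.exp t : ℂ) := by simp
      rw [this]
      apply Complex.ext <;> simp [Complex.exp_ofReal_re, Complex.exp_ofReal_im]
  set ξ : ℂ → ℝ := fun y => (φ (ψ.symm ((ψ (Γ.orbit s)).1, y))).1
  have hξ0 : ξ 0 = 0 := by
    have e1 : ((ψ (Γ.orbit s)).1, (0 : ℂ)) = ψ (Γ.orbit s) :=
      Prod.ext rfl (hψ.orbit_snd hexp le_rfl).symm
    simp only [ξ]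
    rw [e1, ψ.left_inv (hψ.orbit_mem s le_rfl), hφ.orbit_fst hap (by linarith)]
  obtain ⟨g, hg, hg0, ⟨C, hgC⟩, -, hgs⟩ := exists_sign_graph (ξ := fun y => ξ (mulC κ y))
    (ξ' := ξ'.comp (mulC κ)) (by
      refine ContDiffAt.comp (g := ξ) 0 ?_ (mulC κ).contDiff.contDiffAt
      rw [map_zero]; exact hξ1) (by rw [map_zero, hξ0]) (by
      refine HasFDerivAt.comp (g := ξ) 0 ?_ (mulC κ).hasFDerivAt
      rw [map_zero]; exact hξ2) (by
      have e1 : mulC κ 1 = κ • (1 : ℂ) := by simp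
      rw [ContinuousLinearMap.comp_apply, e1, map_smul]
      exact hκξ)
  have hC : 0 ≤ C := by simpa using (abs_nonneg _).trans (hgC 1)
  let D : ℂ → ℂ := fun y => ⟨oddPow μ₁ y.re, oddPow μ₂ y.im⟩
  have hDc : Continuous D := by
    have h1 := continuous_oddPow hμ₁
    have h2 := continuous_oddPow hμ₂
    simp only [D, Complex.mk_eq_add_mul_I]
    fun_prop
  have hD0 : D 0 = 0 := by apply Complex.ext <;> simp [D, oddPow_zero]
  have hDt : Tendsto D (𝓝 0) (𝓝 0) := by
    have := hDc.tendsto 0; rwa [hD0] at this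
  refine ⟨_, ψ', fun σ => oddPow μ₁⁻¹ (g (oddPow μ₂ σ)), hf, hψ', ?_, ?_,
    isLittleO_of_abs_le_rpow (C := C ^ μ₁⁻¹) (k := μ₂ * μ₁⁻¹) ?_ fun σ => ?_, ?_⟩
  · exact (continuous_oddPow (inv_pos.2 hμ₁)).comp (hg.comp (continuous_oddPow hμ₂))
  · simp [oddPow_zero, hg0]
  · rw [← div_eq_mul_inv, lt_div_iff₀ hμ₁]; linarith
  · rw [abs_oddPow (inv_pos.2 hμ₁), Real.rpow_mul (abs_nonneg σ), ← Real.mul_rpow hC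
      (Real.rpow_nonneg (abs_nonneg σ) _)]
    refine Real.rpow_le_rpow (abs_nonneg _) ?_ (inv_pos.2 hμ₁).le
    rw [← abs_oddPow hμ₂]
    exact hgC _
  · filter_upwards [hDt.eventually hgs] with y hy
    rw [hψ1]
    change SignType.sign (f (φ _)).1 = _
    rw [hf1, sign_oddPow]
    have e1 : e.symm y = mulC κ (D y) := by
      rw [Homeomorph.symm_apply_eq, heapp]
      have e2 : ∀ r u : ℝ, 0 < r → oddPow r⁻¹ (κ * (κ * oddPow r u)) = u := fun r u hr => by
        rw [← mul_assoc, hκκ, one_mul, oddPow_oddPow hr, mul_inv_cancel₀ hr.ne', oddPow_one]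
      apply Complex.ext <;> simp [D, e2, hμ₁, hμ₂]
    rw [e1]
    refine hy.trans ?_
    rw [← sign_sub_eq_of_strictMono (strictMono_oddPow (inv_pos.2 hμ₁))]
    simp only [D]
    rw [oddPow_oddPow hμ₁, mul_inv_cancel₀ hμ₁.ne', oddPow_one]

end SaddleConn

/-! ### Labels of orbits and flow-commuting homeomorphisms -/

namespace SaddleConn

/-- The factor that makes the label of an orbit of the model flow from its `y` coordinate. -/
def labelFactor (b x : ℝ) : ℂ := Complex.exp ((1 + b * Complex.I) * Real.log x)

lemma labelFactor_ne_zero (b x : ℝ) : labelFactor b x ≠ 0 := Complex.exp_ne_zero _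

@[simp] lemma labelFactor_one (b : ℝ) : labelFactor b 1 = 1 := by simp [labelFactor]

lemma norm_labelFactor {b x : ℝ} (hx : 0 < x) : ‖labelFactor b x‖ = x := by
  rw [labelFactor, Complex.norm_exp]
  simp [Real.exp_log hx]

lemma continuousAt_labelFactor {b x : ℝ} (hx : 0 < x) : ContinuousAt (labelFactor b) x := by
  unfold labelFactor
  have h := (Real.continuousAt_log hx.ne')
  have h1 : ContinuousAt (fun x : ℝ => ((Real.log x : ℝ) : ℂ)) x :=
    Complex.continuous_ofReal.continuousAt.comp h
  exact (Complex.continuous_exp.continuousAt.comp (h1.const_mul _) :)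

/-- The label of the orbit through a point in `x > 0`. -/
def label (b : ℝ) (z : Z) : ℂ := labelFactor b z.1 * z.2

lemma label_one (b : ℝ) (y : ℂ) : label b (1, y) = y := by simp [label]

lemma continuousAt_label {b : ℝ} {z : Z} (hz : 0 < z.1) : ContinuousAt (label b) z :=
  ((continuousAt_labelFactor hz).comp continuousAt_fst).mul continuousAt_snd

lemma norm_label {b : ℝ} {z : Z} (hz : 0 < z.1) : ‖label b z‖ = z.1 * ‖z.2‖ := by
  rw [label, norm_mul, norm_labelFactor hz]

lemma labelFactor_exp_mul {b t x : ℝ} (hx : 0 < x) :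
    labelFactor b (Real.exp (-t) * x) * Complex.exp ((1 + b * Complex.I) * t) =
      labelFactor b x := by
  rw [labelFactor, labelFactor, ← Complex.exp_add, Real.log_mul (Real.exp_pos _).ne' hx.ne',
    Real.log_exp]
  congr 1; push_cast; ring

lemma modelFlow_fst_pos {b t : ℝ} {z : Z} : 0 < (modelFlow b t z).1 ↔ 0 < z.1 := by
  rw [modelFlow_apply]
  exact mul_pos_iff_of_pos_left (Real.exp_pos _)

/-- The label is `x^(1+ib) y`. Along the flow the first factor changes by `e^{-(1+ib)t}` and the
second by the inverse, so the label is a first integral in `x > 0`; on the section `x = 1` it is `y`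
itself. -/
lemma label_modelFlow {b t : ℝ} {z : Z} (hz : 0 < z.1) :
    label b (modelFlow b t z) = label b z := by
  rw [modelFlow_apply, label, label]
  simp only
  rw [← mul_assoc, labelFactor_exp_mul hz]

/-- Modification of the `y` coordinate through the labels. -/
def relabel (b : ℝ) (h : ℂ → ℂ) (z : Z) : Z :=
  if 0 < z.1 then (z.1, (labelFactor b z.1)⁻¹ * h (label b z)) else z

lemma relabel_of_pos {b : ℝ} {h : ℂ → ℂ} {z : Z} (hz : 0 < z.1) :
    relabel b h z = (z.1, (labelFactor b z.1)⁻¹ * h (label b z)) := if_pos hz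

lemma relabel_of_nonpos {b : ℝ} {h : ℂ → ℂ} {z : Z} (hz : ¬0 < z.1) : relabel b h z = z :=
  if_neg hz

lemma relabel_fst (b : ℝ) (h : ℂ → ℂ) (z : Z) : (relabel b h z).1 = z.1 := by
  by_cases hz : 0 < z.1
  · rw [relabel_of_pos hz]
  · rw [relabel_of_nonpos hz]

lemma label_relabel {b : ℝ} {h : ℂ → ℂ} {z : Z} (hz : 0 < z.1) :
    label b (relabel b h z) = h (label b z) := by
  rw [relabel_of_pos hz, label, mul_inv_cancel_left₀ (labelFactor_ne_zero _ _)]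

lemma relabel_relabel {b : ℝ} {h h' : ℂ → ℂ} (hh : ∀ η, h' (h η) = η) (z : Z) :
    relabel b h' (relabel b h z) = z := by
  by_cases hz : 0 < z.1
  · have hz' : 0 < (relabel b h z).1 := by rwa [relabel_fst]
    rw [relabel_of_pos hz', label_relabel hz, hh, relabel_fst, label,
      inv_mul_cancel_left₀ (labelFactor_ne_zero _ _)]
  · rw [relabel_of_nonpos hz, relabel_of_nonpos hz]

lemma relabel_modelFlow (b : ℝ) (h : ℂ → ℂ) (t : ℝ) (z : Z) :
    relabel b h (modelFlow b t z) = modelFlow b t (relabel b h z) := by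
  by_cases hz : 0 < z.1
  · rw [relabel_of_pos (modelFlow_fst_pos.2 hz), relabel_of_pos hz, label_modelFlow hz,
      modelFlow_apply, modelFlow_apply]
    simp only
    rw [← labelFactor_exp_mul (b := b) (t := t) hz]
    refine Prod.ext rfl ?_
    simp only
    have h1 := labelFactor_ne_zero b (Real.exp (-t) * z.1)
    have h2 := Complex.exp_ne_zero ((1 + b * Complex.I) * t)
    field_simp
  · rw [relabel_of_nonpos (by rwa [modelFlow_fst_pos]), relabel_of_nonpos hz]

/-- The critical points are those with `x = 0`. A point with label `η`, where `|η| = x|y|`, has its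
coordinate `y` displaced by `|h(η) - η| / x`. This tends to 0 as `x → 0` with `y` bounded, because
`h(η) - η` is `o(η)`. -/
lemma continuous_relabel (b : ℝ) {h : ℂ → ℂ} (hc : Continuous h)
    (ho : (fun η => h η - η) =o[𝓝 0] (fun η : ℂ => η)) : Continuous (relabel b h) := by
  rw [continuous_iff_continuousAt]
  intro z
  rcases lt_trichotomy z.1 0 with hz | hz | hz
  · refine continuousAt_id.congr ?_
    filter_upwards [continuousAt_fst.eventually (gt_mem_nhds hz)] with w hw
    rw [relabel_of_nonpos hw.le.not_gt]; rfl
  · have hz' : relabel b h z = z := relabel_of_nonpos (by rw [hz]; exact lt_irrefl _)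
    rw [ContinuousAt, hz', tendsto_iff_norm_sub_tendsto_zero, tendsto_order]
    refine ⟨fun ε hε => Eventually.of_forall fun w => hε.trans_le (norm_nonneg _), fun ε hε => ?_⟩
    -- the correction is small compared with `y`
    have hN : 0 < ‖z.2‖ + 1 := by positivity
    have hδ : 0 < ε / 2 / (‖z.2‖ + 1) := by positivity
    have h1 := ho.def hδ
    obtain ⟨r, hr, h2⟩ := Metric.eventually_nhds_iff.1 h1
    have h3 : ∀ᶠ w : Z in 𝓝 z, ‖w.2‖ < ‖z.2‖ + 1 :=
      (continuous_norm.comp continuous_snd).continuousAt.eventually (gt_mem_nhds (by simp))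
    have h4 : ∀ᶠ w : Z in 𝓝 z, w.1 < r / (‖z.2‖ + 1) :=
      continuousAt_fst.eventually (gt_mem_nhds (by rw [hz]; positivity))
    have h5 : ∀ᶠ w : Z in 𝓝 z, ‖w - z‖ < ε / 2 := by
      filter_upwards [Metric.ball_mem_nhds z (half_pos hε)] with w hw
      rwa [Metric.mem_ball, dist_eq_norm] at hw
    filter_upwards [h3, h4, h5] with w hw3 hw4 hw5
    by_cases hw : 0 < w.1
    · have e1 : ‖relabel b h w - w‖ ≤ ε / 2 := by
        have hη : ‖label b w‖ < r := by
          rw [norm_label hw]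
          rw [lt_div_iff₀ hN] at hw4
          nlinarith [norm_nonneg w.2]
        have h6 := h2 (y := label b w) (by simpa using hη)
        have e2 : relabel b h w - w = (0, (labelFactor b w.1)⁻¹ * (h (label b w) - label b w)) := by
          rw [relabel_of_pos hw]
          refine Prod.ext (sub_self _) ?_
          simp only [Prod.snd_sub]
          rw [mul_sub]
          congr 1
          rw [label, inv_mul_cancel_left₀ (labelFactor_ne_zero _ _)]
        rw [e2, Prod.norm_def]
        refine max_le (by simpa using (half_pos hε).le) ?_
        simp only
        rw [norm_mul, norm_inv, norm_labelFactor hw, inv_mul_le_iff₀ hw]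
        refine h6.trans ?_
        rw [norm_label hw]
        calc ε / 2 / (‖z.2‖ + 1) * (w.1 * ‖w.2‖)
            ≤ ε / 2 / (‖z.2‖ + 1) * (w.1 * (‖z.2‖ + 1)) := by gcongr
          _ = w.1 * (ε / 2) := by field_simp
      calc ‖relabel b h w - z‖ = ‖(relabel b h w - w) + (w - z)‖ := by congr 1; abel
        _ ≤ ‖relabel b h w - w‖ + ‖w - z‖ := norm_add_le _ _
        _ < ε := by linarith
    · rw [relabel_of_nonpos hw]; linarith
  · have h1 : ContinuousAt (fun w : Z => (w.1, (labelFactor b w.1)⁻¹ * h (label b w))) z := by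
      have e1 : ContinuousAt (fun w : Z => labelFactor b w.1) z :=
        (continuousAt_labelFactor hz).comp continuousAt_fst
      exact continuousAt_fst.prodMk ((e1.inv₀ (labelFactor_ne_zero _ _)).mul
        (hc.continuousAt.comp (continuousAt_label hz)))
    refine h1.congr ?_
    filter_upwards [continuousAt_fst.eventually (lt_mem_nhds hz)] with w hw
    rw [relabel_of_pos hw]

/-- Moving points along orbits of the model flow by a time that depends on the label. -/
def timeShift (b : ℝ) (ρ : ℂ → ℝ) (z : Z) : Z :=
  if 0 < z.1 then modelFlow b (ρ (label b z)) z else z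

lemma timeShift_of_pos {b : ℝ} {ρ : ℂ → ℝ} {z : Z} (hz : 0 < z.1) :
    timeShift b ρ z = modelFlow b (ρ (label b z)) z := if_pos hz

lemma timeShift_of_nonpos {b : ℝ} {ρ : ℂ → ℝ} {z : Z} (hz : ¬0 < z.1) : timeShift b ρ z = z :=
  if_neg hz

lemma timeShift_neg (b : ℝ) (ρ : ℂ → ℝ) (z : Z) :
    timeShift b (fun η => -ρ η) (timeShift b ρ z) = z := by
  by_cases hz : 0 < z.1
  · rw [timeShift_of_pos hz, timeShift_of_pos (modelFlow_fst_pos.2 hz), label_modelFlow hz,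
      (isFlow_modelFlow b).neg_apply]
  · rw [timeShift_of_nonpos hz, timeShift_of_nonpos hz]

lemma timeShift_modelFlow (b : ℝ) (ρ : ℂ → ℝ) (t : ℝ) (z : Z) :
    timeShift b ρ (modelFlow b t z) = modelFlow b t (timeShift b ρ z) := by
  by_cases hz : 0 < z.1
  · rw [timeShift_of_pos (modelFlow_fst_pos.2 hz), timeShift_of_pos hz, label_modelFlow hz,
      ← (isFlow_modelFlow b).add, ← (isFlow_modelFlow b).add, add_comm]
  · rw [timeShift_of_nonpos (by rwa [modelFlow_fst_pos]), timeShift_of_nonpos hz]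

/-- As `x` tends to 0 from above the label tends to 0, where `ρ` vanishes, so the time shift dies
out and matches the identity on `x ≤ 0`. -/
lemma continuous_timeShift (b : ℝ) {ρ : ℂ → ℝ} (hc : Continuous ρ) (h0 : ρ 0 = 0) :
    Continuous (timeShift b ρ) := by
  have hF := (isFlow_modelFlow b).cont
  rw [continuous_iff_continuousAt]
  intro z
  rcases lt_trichotomy z.1 0 with hz | hz | hz
  · refine continuousAt_id.congr ?_
    filter_upwards [continuousAt_fst.eventually (gt_mem_nhds hz)] with w hw
    rw [timeShift_of_nonpos hw.le.not_gt]; rfl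
  · have hz' : timeShift b ρ z = z := timeShift_of_nonpos (by rw [hz]; exact lt_irrefl _)
    -- truncated labels are continuous
    let ℓ : Z → ℂ := fun w => if 0 < w.1 then label b w else 0
    have hℓ : ContinuousAt ℓ z := by
      have e0 : ℓ z = 0 := if_neg (by rw [hz]; exact lt_irrefl _)
      rw [ContinuousAt, e0]
      refine squeeze_zero_norm (a := fun w : Z => |w.1| * ‖w.2‖) (fun w => ?_) ?_
      · by_cases hw : 0 < w.1
        · simp only [ℓ, if_pos hw]
          rw [norm_label hw, abs_of_pos hw]
        · simp only [ℓ, if_neg hw, norm_zero]; positivity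
      · have : Continuous fun w : Z => |w.1| * ‖w.2‖ := by fun_prop
        have := this.tendsto z
        simpa [hz] using this
    have e1 : timeShift b ρ = fun w => modelFlow b (ρ (ℓ w)) w := by
      funext w
      by_cases hw : 0 < w.1
      · rw [timeShift_of_pos hw]; simp only [ℓ, if_pos hw]
      · rw [timeShift_of_nonpos hw]
        simp only [ℓ, if_neg hw, h0, (isFlow_modelFlow b).zero]
    rw [e1]
    exact hF.continuousAt.comp ((hc.continuousAt.comp hℓ).prodMk continuousAt_id)
  · have h1 : ContinuousAt (fun w => modelFlow b (ρ (label b w)) w) z :=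
      hF.continuousAt.comp ((hc.continuousAt.comp (continuousAt_label hz)).prodMk continuousAt_id)
    refine h1.congr ?_
    filter_upwards [continuousAt_fst.eventually (lt_mem_nhds hz)] with w hw
    rw [timeShift_of_pos hw]

/-- `timeShift` as a homeomorphism. -/
def timeShiftHomeo (b : ℝ) (ρ : ℂ → ℝ) (hc : Continuous ρ) (h0 : ρ 0 = 0) : Z ≃ₜ Z where
  toFun := timeShift b ρ
  invFun := timeShift b fun η => -ρ η
  left_inv := timeShift_neg b ρ
  right_inv z := by simpa using timeShift_neg b (fun η => -ρ η) z
  continuous_toFun := continuous_timeShift b hc h0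
  continuous_invFun := continuous_timeShift b hc.neg (by simp [h0])

/-- The homeomorphism that subtracts the graph of `g` from the labels. -/
def straightenHomeo (b : ℝ) (g : ℝ → ℝ) (hc : Continuous g)
    (ho : g =o[𝓝 0] (fun σ : ℝ => σ)) : Z ≃ₜ Z where
  toFun := relabel b fun η => η - g η.im
  invFun := relabel b fun η => η + g η.im
  left_inv := relabel_relabel fun η => by simp
  right_inv := relabel_relabel fun η => by simp
  continuous_toFun := by
    refine continuous_relabel b (by fun_prop) ?_
    have h := (isLittleO_comp_im ho).neg_left
    refine h.congr_left fun η => by ring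
  continuous_invFun := by
    refine continuous_relabel b (by fun_prop) ?_
    have h := isLittleO_comp_im ho
    refine h.congr_left fun η => by ring
where
  isLittleO_comp_im {g : ℝ → ℝ} (ho : g =o[𝓝 0] (fun σ : ℝ => σ)) :
      (fun η : ℂ => (g η.im : ℂ)) =o[𝓝 0] (fun η : ℂ => η) := by
    have h1 : Tendsto Complex.im (𝓝 0) (𝓝 0) := Complex.continuous_im.tendsto 0
    have h2 := ho.comp_tendsto h1
    refine Asymptotics.IsLittleO.of_norm_norm ?_
    have h3 : (fun η : ℂ => η.im) =O[𝓝 0] fun η : ℂ => η :=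
      Asymptotics.IsBigO.of_bound 1 (Eventually.of_forall fun η => by
        rw [one_mul]; exact Complex.abs_im_le_norm η)
    refine ((h2.trans_isBigO h3).norm_norm).congr_left fun η => ?_
    simp

end SaddleConn

/-! ### Angular homeomorphisms of the plane -/

namespace SaddleConn

/-- Rotation of every point by an angle that depends on its argument. -/
def reangle (i : ℝ → ℝ) (y : ℂ) : ℂ := y * Complex.exp ((i (Complex.arg y) - Complex.arg y : ℝ) * Complex.I)

lemma norm_reangle (i : ℝ → ℝ) (y : ℂ) : ‖reangle i y‖ = ‖y‖ := by
  rw [reangle, norm_mul, Complex.norm_exp_ofReal_mul_I, mul_one]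

lemma reangle_smul (i : ℝ → ℝ) {r : ℝ} (hr : 0 < r) (y : ℂ) :
    reangle i (r • y) = r • reangle i y := by
  rw [reangle, reangle, Complex.real_smul, Complex.arg_real_mul _ hr, Complex.real_smul, mul_assoc]

lemma reangle_eq (i : ℝ → ℝ) (y : ℂ) :
    reangle i y = ‖y‖ * Complex.exp (i (Complex.arg y) * Complex.I) := by
  conv_lhs => rw [reangle, ← Complex.norm_mul_exp_arg_mul_I y]
  rw [mul_assoc, ← Complex.exp_add, Complex.norm_mul_exp_arg_mul_I]
  congr 2; push_cast; ring

/-- A reparametrisation of the line that is the identity off `[-1, 1]`. -/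
structure IsReangle (i : ℝ → ℝ) : Prop where
  strictMono : StrictMono i
  cont : Continuous i
  eq_id : ∀ u, 1 ≤ |u| → i u = u

lemma IsReangle.mem_Ioc {i : ℝ → ℝ} (h : IsReangle i) {u : ℝ} (hu : u ∈ Ioc (-Real.pi) Real.pi) :
    i u ∈ Ioc (-Real.pi) Real.pi := by
  have hpi := Real.pi_gt_three
  have h1 : i Real.pi = Real.pi := h.eq_id _ (by rw [abs_of_pos Real.pi_pos]; linarith)
  have h2 : i (-Real.pi) = -Real.pi := h.eq_id _ (by rw [abs_neg, abs_of_pos Real.pi_pos]; linarith)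
  exact ⟨h2 ▸ h.strictMono hu.1, h1 ▸ h.strictMono.monotone hu.2⟩

lemma IsReangle.arg_reangle {i : ℝ → ℝ} (h : IsReangle i) {y : ℂ} (hy : y ≠ 0) :
    Complex.arg (reangle i y) = i (Complex.arg y) := by
  rw [reangle_eq, Complex.arg_real_mul _ (norm_pos_iff.2 hy), Complex.arg_exp_mul_I,
    toIocMod_eq_self]
  have := h.mem_Ioc (Complex.arg_mem_Ioc y)
  rw [show -Real.pi + 2 * Real.pi = Real.pi by ring]
  exact this

lemma IsReangle.reangle_reangle {i j : ℝ → ℝ} (h : IsReangle i) (hj : ∀ u, j (i u) = u) (y : ℂ) :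
    reangle j (reangle i y) = y := by
  by_cases hy : y = 0
  · simp [hy, reangle]
  · rw [reangle_eq j, h.arg_reangle hy, hj, norm_reangle, Complex.norm_mul_exp_arg_mul_I]

/-- The argument jumps on the negative axis, but in the left half plane it exceeds `π/2 > 1` in
absolute value, where the angle is not changed. -/
lemma IsReangle.continuous_reangle {i : ℝ → ℝ} (h : IsReangle i) : Continuous (reangle i) := by
  rw [continuous_iff_continuousAt]
  intro y
  by_cases hy : y = 0
  · subst hy
    have h0 : reangle i 0 = 0 := by simp [reangle]
    rw [ContinuousAt, h0, tendsto_zero_iff_norm_tendsto_zero]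
    simp only [norm_reangle]
    simpa using (continuous_norm (E := ℂ)).tendsto 0
  · have key : ContinuousAt (fun y => i (Complex.arg y) - Complex.arg y) y := by
      by_cases hs : y ∈ Complex.slitPlane
      · have h1 := Complex.continuousAt_arg hs
        exact (h.cont.continuousAt.comp h1).sub h1
      · have hre : y.re < 0 := by
          rw [Complex.mem_slitPlane_iff, not_or, not_lt, not_not] at hs
          refine lt_of_le_of_ne hs.1 fun e => hy (Complex.ext e hs.2)
        have hz : ∀ z : ℂ, z.re < 0 → i (Complex.arg z) - Complex.arg z = 0 := fun z hz => by
          rw [sub_eq_zero]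
          refine h.eq_id _ ?_
          by_contra hlt
          have : |Complex.arg z| ≤ Real.pi / 2 := by
            have := Real.pi_gt_three; linarith
          exact absurd (Complex.abs_arg_le_pi_div_two_iff.1 this) (not_le.2 hz)
        refine (continuousAt_const (y := (0 : ℝ))).congr ?_
        filter_upwards [Complex.continuous_re.continuousAt.eventually (gt_mem_nhds hre)] with z hz'
        exact (hz z hz').symm
    have h1 : ContinuousAt (fun y => ((i (Complex.arg y) - Complex.arg y : ℝ) : ℂ)) y :=
      Complex.continuous_ofReal.continuousAt.comp key
    exact continuousAt_id.mul (Complex.continuous_exp.continuousAt.comp (h1.mul_const _))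

lemma IsReangle.exists_inverse {i : ℝ → ℝ} (h : IsReangle i) :
    ∃ j, IsReangle j ∧ (∀ u, j (i u) = u) ∧ ∀ u, i (j u) = u := by
  have htop : Tendsto i atTop atTop := by
    refine tendsto_id.congr' ?_
    filter_upwards [eventually_ge_atTop 1] with u hu
    exact (h.eq_id u (hu.trans (le_abs_self u))).symm
  have hbot : Tendsto i atBot atBot := by
    refine tendsto_id.congr' ?_
    filter_upwards [eventually_le_atBot (-1)] with u hu
    exact (h.eq_id u ((by linarith : (1 : ℝ) ≤ -u).trans (neg_le_abs u))).symm
  have hsurj := h.cont.surjective htop hbot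
  set e := h.strictMono.orderIsoOfSurjective i hsurj
  have he : ∀ u, e u = i u := fun _ => rfl
  refine ⟨e.symm, ⟨e.symm.strictMono, e.symm.continuous, fun u hu => ?_⟩, fun u => ?_, fun u => ?_⟩
  · rw [OrderIso.symm_apply_eq, he, h.eq_id u hu]
  · rw [← he, e.symm_apply_apply]
  · rw [← he, e.apply_symm_apply]

/-- A continuous increasing germ on the line extends to a reparametrisation. -/
lemma exists_isReangle {θ : ℝ → ℝ} {d : ℝ} (hd : 0 < d) (hd1 : d ≤ 1)
    (hc : ContinuousOn θ (Icc (-d) d)) (hm : StrictMonoOn θ (Icc (-d) d)) (h0 : θ 0 = 0) :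
    ∃ i, IsReangle i ∧ ∀ᶠ u in 𝓝 (0 : ℝ), i u = θ u := by
  let θ' : ℝ → ℝ := fun u => θ (projIcc (-d) d (by linarith) u)
  have hθ' : Continuous θ' := by
    have : Continuous fun u : Icc (-d) d => θ u := hc.domRestrict
    exact this.comp continuous_projIcc
  have hθ'eq : ∀ u ∈ Icc (-d) d, θ' u = θ u := fun u hu => by
    simp only [θ']; rw [projIcc_of_mem _ hu]
  -- `i` will be `θ` clamped to the band `u ± e(u)` around the diagonal. The tent has slope 1/2, so
  -- both edges of the band are strictly increasing; it closes at `|u| = d`, where `i` becomes the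
  -- identity.
  let e : ℝ → ℝ := fun u => max 0 ((d - |u|) / 2)
  have he : Continuous e := by fun_prop
  have heout : ∀ u, d ≤ |u| → e u = 0 := fun u hu => max_eq_left (by linarith)
  have hlip : ∀ u v, u < v → e u - e v < v - u ∧ e v - e u < v - u := by
    intro u v huv
    have h1 : |(|u| - |v|)| ≤ |u - v| := abs_abs_sub_abs_le _ _
    rw [abs_sub_comm u v, abs_of_pos (sub_pos.2 huv)] at h1
    have h2 := abs_le.1 h1
    constructor
    · rcases max_choice 0 ((d - |u|) / 2) with h | h
      · have : 0 ≤ e v := le_max_left _ _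
        have : e u = 0 := h
        linarith
      · have : (d - |v|) / 2 ≤ e v := le_max_right _ _
        have : e u = (d - |u|) / 2 := h
        linarith
    · rcases max_choice 0 ((d - |v|) / 2) with h | h
      · have : 0 ≤ e u := le_max_left _ _
        have : e v = 0 := h
        linarith
      · have : (d - |u|) / 2 ≤ e u := le_max_right _ _
        have : e v = (d - |v|) / 2 := h
        linarith
  let i : ℝ → ℝ := fun u => max (u - e u) (min (u + e u) (θ' u))
  have hlo : ∀ u, u - e u ≤ i u := fun u => le_max_left _ _
  have henn : ∀ u, 0 ≤ e u := fun u => le_max_left _ _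
  have hhi : ∀ u, i u ≤ u + e u := fun u => max_le (by linarith [henn u]) (min_le_left _ _)
  have hid : ∀ u, d ≤ |u| → i u = u := fun u hu => by
    have h1 := hlo u; have h2 := hhi u
    rw [heout u hu] at h1 h2
    linarith
  refine ⟨i, ⟨fun u v huv => ?_, by fun_prop, fun u hu => hid u (hd1.trans hu)⟩, ?_⟩
  · have h1 := hlip u v huv
    by_cases hu : u ∈ Icc (-d) d
    · by_cases hv : v ∈ Icc (-d) d
      · have h2 : θ' u < θ' v := by rw [hθ'eq u hu, hθ'eq v hv]; exact hm hu hv huv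
        exact max_lt_max (by linarith) (min_lt_min (by linarith) h2)
      · have hv' : d ≤ |v| := by
          by_contra hlt
          exact hv (abs_le.1 (not_le.1 hlt).le)
        rw [hid v hv']
        have h3 := hhi u
        rw [heout v hv'] at h1
        linarith
    · have hu' : d ≤ |u| := by
        by_contra hlt
        exact hu (abs_le.1 (not_le.1 hlt).le)
      rw [hid u hu']
      have h3 := hlo v
      rw [heout u hu'] at h1
      linarith
  · have h0' : θ' 0 = 0 := by rw [hθ'eq 0 ⟨by linarith, hd.le⟩, h0]
    have he0 : e 0 = d / 2 := by
      simp only [e, abs_zero, sub_zero]; exact max_eq_right (by linarith)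
    have h1 : ∀ᶠ u in 𝓝 (0 : ℝ), u - e u < θ' u :=
      ContinuousAt.eventually_lt (by fun_prop) hθ'.continuousAt (by rw [h0', he0]; linarith)
    have h2 : ∀ᶠ u in 𝓝 (0 : ℝ), θ' u < u + e u :=
      ContinuousAt.eventually_lt hθ'.continuousAt (by fun_prop) (by rw [h0', he0]; linarith)
    filter_upwards [h1, h2, Icc_mem_nhds (neg_lt_zero.2 hd) hd] with u h1 h2 hu
    simp only [i]
    rw [min_eq_right h2.le, max_eq_right h1.le, hθ'eq u hu]

/-- A homeomorphism of the plane that preserves circles and turns the angle `θ σ` into `σ`. -/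
lemma exists_circle_homeo {θ : ℝ → ℝ} {d : ℝ} (hd : 0 < d) (hc : ContinuousOn θ (Icc (-d) d))
    (hinj : InjOn θ (Icc (-d) d)) (h0 : θ 0 = 0) :
    ∃ J : ℂ ≃ₜ ℂ, (∀ y, ‖J y‖ = ‖y‖) ∧ (∀ r : ℝ, 0 < r → ∀ y, J (r • y) = r • J y) ∧ J 1 = 1 ∧
      ∀ᶠ σ in 𝓝 (0 : ℝ), ∀ y : ℂ, y ≠ 0 → Complex.arg y = θ σ → Complex.arg (J y) = σ := by
  have key : ∀ θ : ℝ → ℝ, ∀ d : ℝ, 0 < d → d ≤ 1 → ContinuousOn θ (Icc (-d) d) →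
      StrictMonoOn θ (Icc (-d) d) → θ 0 = 0 →
      ∃ J : ℂ ≃ₜ ℂ, (∀ y, ‖J y‖ = ‖y‖) ∧ (∀ r : ℝ, 0 < r → ∀ y, J (r • y) = r • J y) ∧ J 1 = 1 ∧
        ∀ᶠ σ in 𝓝 (0 : ℝ), ∀ y : ℂ, y ≠ 0 → Complex.arg y = θ σ → Complex.arg (J y) = σ := by
    intro θ d hd hd1 hc hm h0
    obtain ⟨i, hi, hiθ⟩ := exists_isReangle hd hd1 hc hm h0
    obtain ⟨j, hj, hji, hij⟩ := hi.exists_inverse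
    have hi0 : i 0 = 0 := by rw [hiθ.self_of_nhds, h0]
    have hj0 : j 0 = 0 := by rw [← hi0, hji, hi0]
    refine ⟨⟨⟨reangle j, reangle i, hj.reangle_reangle hij, hi.reangle_reangle hji⟩,
      hj.continuous_reangle, hi.continuous_reangle⟩, norm_reangle j,
      fun r hr y => reangle_smul j hr y, ?_, ?_⟩
    · change reangle j 1 = 1
      simp [reangle, hj0]
    · filter_upwards [hiθ] with σ hσ y hy harg
      change Complex.arg (reangle j y) = σ
      rw [hj.arg_reangle hy, harg, ← hσ, hji]
  have hsub : Icc (-min d 1) (min d 1) ⊆ Icc (-d) d :=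
    Icc_subset_Icc (by linarith [min_le_left d 1]) (min_le_left _ _)
  have hd' : 0 < min d 1 := lt_min hd one_pos
  have h0mem : (0 : ℝ) ∈ Icc (-min d 1) (min d 1) := ⟨by linarith, hd'.le⟩
  -- A continuous injective `θ` is increasing or decreasing; in the second case complex conjugation,
  -- which reverses angles, reduces to the first.
  rcases (hc.mono hsub).strictMonoOn_of_injOn_Icc' (by linarith) (hinj.mono hsub) with hm | hm
  · exact key θ _ hd' (min_le_right _ _) (hc.mono hsub) hm h0
  · obtain ⟨J, hJ1, hJ2, hJ3, hJ4⟩ := key (fun σ => -θ σ) _ hd' (min_le_right _ _)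
      (hc.mono hsub).neg (fun u hu v hv huv => neg_lt_neg (hm hu hv huv)) (by simp [h0])
    have hsmall : ∀ᶠ σ in 𝓝 (0 : ℝ), θ σ < 1 := by
      have h1 : ContinuousAt θ 0 := hc.continuousAt (Icc_mem_nhds (neg_lt_zero.2 hd) hd)
      exact h1.eventually (gt_mem_nhds (by rw [h0]; exact one_pos))
    refine ⟨Complex.conjLIE.toHomeomorph.trans J, fun y => ?_, fun r hr y => ?_, ?_, ?_⟩
    · change ‖J ((starRingEnd ℂ) y)‖ = _
      rw [hJ1, Complex.norm_conj]
    · change J ((starRingEnd ℂ) (r • y)) = r • J ((starRingEnd ℂ) y)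
      rw [← hJ2 r hr, Complex.real_smul, map_mul, Complex.conj_ofReal, Complex.real_smul]
    · change J ((starRingEnd ℂ) 1) = 1
      rw [map_one, hJ3]
    · filter_upwards [hJ4, hsmall] with σ h1 h2 y hy harg
      change Complex.arg (J ((starRingEnd ℂ) y)) = σ
      refine h1 _ (by simpa using hy) ?_
      rw [Complex.arg_conj, if_neg, harg]
      rw [harg]
      have := Real.pi_gt_three
      linarith

end SaddleConn

/-! ### Straightening the graph and normalising the rotation -/

namespace SaddleConn

variable {M : Type*} [TopologicalSpace M] [ChartedSpace E3 M] [IsManifold (𝓡 3) ∞ M] [T2Space M]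
  {Γ : SaddleConnection M} {b c c' s : ℝ} {φ ψ : OpenPartialHomeomorph M Z} {g : ℝ → ℝ}

lemma HeadChart.post (h : HeadChart Γ c s φ) {c' : ℝ} (hc' : 0 < c') (e : Z ≃ₜ Z)
    (he : ∀ t z, e (modelFlow 0 (c * t) z) = modelFlow 0 (c' * t) (e z)) (he0 : e 0 = 0)
    (he1 : e (0, 1) = (0, 1)) : HeadChart Γ c' s (φ.transHomeomorph e) := by
  refine ⟨hc', h.conj.post e he, h.base_mem, ?_, h.orbit_mem, fun t ht => ?_⟩
  · change e (φ Γ.p) = 0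
    rw [h.base, he0]
  · change e (φ (Γ.orbit t)) = _
    have h1 : φ (Γ.orbit t) = modelFlow 0 (c * (t - s)) (0, 1) := by
      rw [h.orbit t ht, modelFlow_zero_apply]; simp
    rw [h1, he, he1, modelFlow_zero_apply]; simp

lemma TailChart.post (h : TailChart Γ b c s ψ) {b' c' : ℝ} (hc' : 0 < c') (e : Z ≃ₜ Z)
    (he : ∀ t z, e (modelFlow b (c * t) z) = modelFlow b' (c' * t) (e z)) (he0 : e 0 = 0)
    (he1 : e (1, 0) = (1, 0)) : TailChart Γ b' c' s (ψ.transHomeomorph e) := by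
  refine ⟨hc', h.conj.post e he, h.base_mem, ?_, h.orbit_mem, fun t ht => ?_⟩
  · change e (ψ Γ.q) = 0
    rw [h.base, he0]
  · change e (ψ (Γ.orbit t)) = _
    have h1 : ψ (Γ.orbit t) = modelFlow b (c * (t - s)) (1, 0) := by
      rw [h.orbit t ht, modelFlow_apply]; simp
    rw [h1, he, he1, modelFlow_apply]; simp

/-- The graph is subtracted from the labels in the tail chart. This commutes with the flow, and on
the section, where labels are the coordinate `y`, it replaces the graph by the imaginary axis. -/
lemma GraphForm.straighten (h : GraphForm Γ b c' c s φ ψ g) :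
    ∃ ψ', GraphForm Γ b c' c s φ ψ' 0 := by
  set e := straightenHomeo b g h.cont h.isLittleO
  have e0 : ∀ z : Z, e z = relabel b (fun η => η - g η.im) z := fun z => rfl
  refine ⟨_, h.head, h.tail.post h.tail.pos e (fun t z => by
    rw [e0, e0]; exact relabel_modelFlow b _ _ z) ?_ ?_,
    continuous_const, rfl, Asymptotics.isLittleO_zero _ _, ?_⟩
  · rw [e0, relabel_of_nonpos (by simp)]
  · rw [e0, relabel_of_pos (by simp)]
    simp [label_one, h.zero]
  · have h1 : Continuous fun y : ℂ => y + g y.im := by have := h.cont; fun_prop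
    have h2 := h1.tendsto 0
    simp only [Complex.zero_im, h.zero, Complex.ofReal_zero, add_zero] at h2
    filter_upwards [h2.eventually h.sign] with y hy
    have e1 : e.symm (1, y) = (1, y + g y.im) := by
      change relabel b (fun η => η + g η.im) (1, y) = _
      rw [relabel_of_pos (by simp)]
      simp [label_one]
    change SignType.sign (φ (ψ.symm (e.symm (1, y)))).1 = _
    rw [e1, hy]
    simp

/-- Radial power map of the plane. -/
def radialPow (κ : ℝ) (y : ℂ) : ℂ := (‖y‖ ^ (κ - 1) : ℝ) • y

lemma radialPow_mul {κ : ℝ} (w y : ℂ) : radialPow κ (w * y) = radialPow κ w * radialPow κ y := by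
  simp only [radialPow]
  rw [norm_mul, Real.mul_rpow (norm_nonneg _) (norm_nonneg _)]
  simp only [Complex.real_smul]; push_cast; ring

lemma norm_radialPow {κ : ℝ} (hκ : 0 < κ) (y : ℂ) : ‖radialPow κ y‖ = ‖y‖ ^ κ := by
  rw [radialPow, norm_smul, Real.norm_of_nonneg (Real.rpow_nonneg (norm_nonneg _) _)]
  rcases eq_or_ne y 0 with h | h
  · simp [h, hκ.ne']
  · rw [Real.rpow_sub_one (norm_ne_zero_iff.2 h), div_mul_cancel₀ _ (norm_ne_zero_iff.2 h)]

lemma radialPow_zero {κ : ℝ} : radialPow κ 0 = 0 := by simp [radialPow]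

lemma continuous_radialPow {κ : ℝ} (hκ : 0 < κ) : Continuous (radialPow κ) := by
  rw [continuous_iff_continuousAt]
  intro y
  rcases eq_or_ne y 0 with h | h
  · subst h
    rw [ContinuousAt, radialPow_zero, tendsto_zero_iff_norm_tendsto_zero]
    simp only [norm_radialPow hκ]
    have := ((continuous_norm (E := ℂ)).rpow_const fun _ => Or.inr hκ.le).tendsto 0
    simpa [hκ.ne'] using this
  · exact (continuous_norm.continuousAt.rpow_const (Or.inl (norm_ne_zero_iff.2 h))).smul
      continuousAt_id

lemma radialPow_radialPow {κ : ℝ} (hκ : 0 < κ) (y : ℂ) : radialPow κ⁻¹ (radialPow κ y) = y := by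
  rcases eq_or_ne y 0 with h | h
  · simp [h, radialPow_zero]
  · have h0 := norm_pos_iff.2 h
    have h1 : radialPow κ⁻¹ (radialPow κ y) =
        ((‖y‖ ^ κ) ^ (κ⁻¹ - 1) * ‖y‖ ^ (κ - 1) : ℝ) • y := by
      conv_lhs => rw [radialPow, norm_radialPow hκ]
      rw [mul_smul]; rfl
    rw [h1, ← Real.rpow_mul h0.le, ← Real.rpow_add h0]
    have : κ * (κ⁻¹ - 1) + (κ - 1) = 0 := by field_simp; ring
    rw [this, Real.rpow_zero, one_smul]

/-- The radial power map as a homeomorphism. -/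
def radialPowHomeo (κ : ℝ) (hκ : 0 < κ) : ℂ ≃ₜ ℂ where
  toFun := radialPow κ
  invFun := radialPow κ⁻¹
  left_inv := radialPow_radialPow hκ
  right_inv y := by simpa using radialPow_radialPow (inv_pos.2 hκ) y
  continuous_toFun := continuous_radialPow hκ
  continuous_invFun := continuous_radialPow (inv_pos.2 hκ)

lemma radialPow_exp (κ : ℝ) (w : ℂ) :
    radialPow κ (Complex.exp w) = Complex.exp ((κ * w.re : ℝ) + w.im * Complex.I) := by
  rw [radialPow, Complex.norm_exp, ← Real.exp_mul, Complex.real_smul, Complex.ofReal_exp,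
    ← Complex.exp_add]
  congr 1
  apply Complex.ext <;> simp; ring

lemma sign_re_radialPow {κ : ℝ} (y : ℂ) :
    SignType.sign (radialPow κ y).re = SignType.sign y.re := by
  rcases eq_or_ne y 0 with h | h
  · simp [h, radialPow_zero]
  · rw [radialPow, Complex.smul_re, smul_eq_mul, sign_mul,
      sign_pos (Real.rpow_pos_of_pos (norm_pos_iff.2 h) _), one_mul]

/-- Raising moduli to the power `|b|` changes the rates from `c` to `|b| c` but leaves the angular
speed `b c` alone; a reflection makes the latter positive. Hence the ratio of rotation to expansion
is no topological invariant. Both changes respect the sign of the real part, which describes the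
straightened trace. -/
lemma GraphForm.normalize_rotation (h : GraphForm Γ b (|b| * c) c s φ ψ 0) (hb : b ≠ 0) :
    ∃ ψ', GraphForm Γ 1 (|b| * c) (|b| * c) s φ ψ' 0 := by
  have hκ : 0 < |b| := abs_pos.2 hb
  -- a reflection in the case of negative rotation
  obtain ⟨R, hR, hRsign⟩ : ∃ R : ℂ ≃+* ℂ, Continuous R ∧ Continuous R.symm ∧ (∀ y, (R.symm y).re = y.re) ∧
      ∀ t u : ℝ, R (Complex.exp ((t : ℂ) + (b * u : ℝ) * Complex.I)) =
        Complex.exp (t + (|b| * u : ℝ) * Complex.I) := by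
    rcases hb.lt_or_gt with hb | hb
    · refine ⟨starRingAut, Complex.continuous_conj, Complex.continuous_conj, fun y => ?_, fun t u => ?_⟩
      · exact Complex.conj_re y
      · change (starRingEnd ℂ) _ = _
        rw [← Complex.exp_conj, abs_of_neg hb]
        congr 1
        apply Complex.ext <;> simp
    · exact ⟨RingEquiv.refl ℂ, continuous_id, continuous_id, fun y => rfl, fun t u => by
        rw [abs_of_pos hb]; rfl⟩
  obtain ⟨hR', hRre, hRexp⟩ := hRsign
  let e₂ : ℂ ≃ₜ ℂ := (radialPowHomeo |b| hκ).trans ⟨R.toEquiv, hR, hR'⟩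
  have he₂ : ∀ y, e₂ y = R (radialPow |b| y) := fun y => rfl
  set e : Z ≃ₜ Z := (oddPowHomeo |b| hκ).prodCongr e₂
  have he : ∀ z : Z, e z = (oddPow |b| z.1, e₂ z.2) := fun z => rfl
  refine ⟨_, h.head, h.tail.post (mul_pos hκ h.tail.pos) e (fun t z => ?_) ?_ ?_,
    continuous_const, rfl, Asymptotics.isLittleO_zero _ _, ?_⟩
  · rw [he, he, modelFlow_apply, modelFlow_apply]
    simp only
    rw [oddPow_exp_mul, he₂, he₂, radialPow_mul, map_mul, radialPow_exp]
    refine Prod.ext (by simp only; congr 2; ring) ?_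
    simp only
    congr 1
    have e1 : ((1 + b * Complex.I) * (c * t : ℝ)).re = c * t := by simp
    have e2 : ((1 + b * Complex.I) * (c * t : ℝ)).im = b * (c * t) := by simp
    rw [e1, e2, hRexp]
    congr 1
    push_cast; ring
  · rw [he, he₂]; simp [oddPow_zero, radialPow_zero]
  · rw [he, he₂]; simp [oddPow_of_pos, radialPow_zero]
  · have h2 := e₂.symm.continuous.tendsto 0
    have h3 : e₂.symm 0 = 0 := by rw [e₂.symm_apply_eq, he₂, radialPow_zero, map_zero]
    rw [h3] at h2
    filter_upwards [h2.eventually h.sign] with y hy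
    have e1 : e.symm (1, y) = (1, e₂.symm y) := by
      rw [e.symm_apply_eq, he]
      simp [oddPow_of_pos]
    change SignType.sign (φ (ψ.symm (e.symm (1, y)))).1 = _
    rw [e1, hy]
    simp only [Pi.zero_apply, sub_zero]
    have e3 : e₂.symm y = radialPow |b|⁻¹ (R.symm y) := rfl
    rw [e3, sign_re_radialPow, hRre]

/-- In charts around the two halves of a connection, the change of coordinates near the cut
commutes with the flows. -/
lemma transition_flow (hφ : HeadChart Γ c s φ) (hψ : TailChart Γ b c s ψ) :
    ∀ᶠ q : ℝ × Z in 𝓝 ((0 : ℝ), ((1 : ℝ), (0 : ℂ))),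
      φ (ψ.symm (modelFlow b q.1 q.2)) = modelFlow 0 q.1 (φ (ψ.symm q.2)) := by
  have hc := hφ.pos
  set N : Set Z := ψ.target ∩ ψ.symm ⁻¹' φ.source with hN
  have hNo : IsOpen N := ψ.isOpen_inter_preimage_symm φ.open_source
  have hψs : ψ (Γ.orbit s) = ((1 : ℝ), (0 : ℂ)) := by simpa using hψ.orbit s le_rfl
  have h1N : ((1 : ℝ), (0 : ℂ)) ∈ N := by
    have h1 := hψ.orbit_mem s le_rfl
    refine ⟨hψs ▸ ψ.map_source h1, ?_⟩
    rw [mem_preimage, ← hψs, ψ.left_inv h1]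
    exact hφ.orbit_mem s le_rfl
  have hev : ∀ᶠ q : ℝ × Z in 𝓝 ((0 : ℝ), ((1 : ℝ), (0 : ℂ))), modelFlow b q.1 q.2 ∈ N :=
    (isFlow_modelFlow b).cont.continuousAt.eventually (hNo.mem_nhds (by
      simp only; rw [(isFlow_modelFlow b).zero]; exact h1N))
  obtain ⟨r, hr, hball⟩ := Metric.eventually_nhds_iff.1 hev
  filter_upwards [Metric.ball_mem_nhds _ hr] with q hq
  rw [Metric.mem_ball, Prod.dist_eq, max_lt_iff] at hq
  obtain ⟨t, w⟩ := q
  simp only [Real.dist_eq, sub_zero] at hq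
  have hin : ∀ u : ℝ, |c * u| ≤ |t| → modelFlow b (c * u) w ∈ N := fun u hu =>
    hball (y := (c * u, w)) (by
      rw [Prod.dist_eq, max_lt_iff]
      simp only [Real.dist_eq, sub_zero]
      exact ⟨hu.trans_lt hq.1, hq.2⟩)
  set T := t / c with hT
  have htT : t = c * T := by rw [hT]; field_simp
  have hbd : ∀ u ∈ Icc (min 0 T) (max 0 T), |c * u| ≤ |t| := fun u hu => by
    rw [htT, abs_mul, abs_mul]
    refine mul_le_mul_of_nonneg_left ?_ (abs_nonneg c)
    rcases le_total 0 T with h0 | h0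
    · rw [min_eq_left h0, max_eq_right h0] at hu
      rw [abs_of_nonneg h0, abs_of_nonneg hu.1]; exact hu.2
    · rw [min_eq_right h0, max_eq_left h0] at hu
      rw [abs_of_nonpos h0, abs_of_nonpos hu.2]; linarith [hu.1]
  have hγ := hψ.conj.bwd w (min 0 T) (max 0 T) fun u hu => (hin u (hbd u hu)).1
  have := hφ.conj.fwd' ((isFlow_modelFlow 0).rescale c) hγ (fun u hu => (hin u (hbd u hu)).2)
    (s := 0) (t := T) ⟨min_le_left _ _, le_max_left _ _⟩ ⟨min_le_right _ _, le_max_right _ _⟩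
  simp only [mul_zero, sub_zero, (isFlow_modelFlow b).zero] at this
  simp only
  rw [htT]
  exact this

end SaddleConn

/-! ### Normal form of the transition at the cut -/

namespace SaddleConn

/-- Tietze's theorem on a small closed disc. -/
lemma exists_continuous_extension_of_germ {f : ℂ → ℝ} (hf : ∀ᶠ y in 𝓝 (0 : ℂ), ContinuousAt f y) :
    ∃ ρ : ℂ → ℝ, Continuous ρ ∧ ∀ᶠ y in 𝓝 (0 : ℂ), ρ y = f y := by
  obtain ⟨r, hr, h⟩ := Metric.eventually_nhds_iff.1 hf
  have hc : ContinuousOn f (Metric.closedBall 0 (r / 2)) := fun y hy =>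
    (h (lt_of_le_of_lt (Metric.mem_closedBall.1 hy) (by linarith))).continuousWithinAt
  obtain ⟨ρ, hρ⟩ := ContinuousMap.exists_restrict_eq (Metric.isClosed_closedBall)
    (⟨_, hc.domRestrict⟩ : C(Metric.closedBall (0 : ℂ) (r / 2), ℝ))
  refine ⟨ρ, ρ.continuous, ?_⟩
  filter_upwards [Metric.closedBall_mem_nhds (0 : ℂ) (half_pos hr)] with y hy
  exact DFunLike.congr_fun hρ (⟨y, hy⟩ : Metric.closedBall (0 : ℂ) (r / 2))

variable {M : Type*} [TopologicalSpace M] [ChartedSpace E3 M] [IsManifold (𝓡 3) ∞ M] [T2Space M]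
  {Γ : SaddleConnection M} {b c s : ℝ} {φ ψ : OpenPartialHomeomorph M Z}

/-- Charts around the two halves of a connection in which the transition near the cut has a
standard form. -/
structure NormalForm (Γ : SaddleConnection M) (b c s : ℝ) (φ ψ : OpenPartialHomeomorph M Z) :
    Prop where
  head : HeadChart Γ c s φ
  tail : TailChart Γ b c s ψ
  sign : ∀ᶠ z in 𝓝 (Γ.orbit s), SignType.sign (φ z).1 = SignType.sign (label b (ψ z)).re
  norm : ∀ᶠ z in 𝓝 (Γ.orbit s), ‖(φ z).2‖ * (ψ z).1 = 1
  arg : ∀ᶠ z in 𝓝 (Γ.orbit s), (φ z).1 = 0 → Complex.arg (φ z).2 = (label b (ψ z)).im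

/-- The change of coordinates near the cut is defined and continuous near `(1, 0)`. -/
lemma transition_continuousAt (hφ : HeadChart Γ c s φ) (hψ : TailChart Γ b c s ψ) :
    ∀ᶠ w in 𝓝 ((1 : ℝ), (0 : ℂ)), w ∈ ψ.target ∧ ψ.symm w ∈ φ.source ∧
      ContinuousAt (fun w => φ (ψ.symm w)) w := by
  have hψs : ψ (Γ.orbit s) = ((1 : ℝ), (0 : ℂ)) := by simpa using hψ.orbit s le_rfl
  have h1 := hψ.orbit_mem s le_rfl
  have hN := (ψ.isOpen_inter_preimage_symm φ.open_source).mem_nhds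
    (show ψ (Γ.orbit s) ∈ ψ.target ∩ ψ.symm ⁻¹' φ.source from
      ⟨ψ.map_source h1, by rw [mem_preimage, ψ.left_inv h1]; exact hφ.orbit_mem s le_rfl⟩)
  rw [hψs] at hN
  filter_upwards [hN] with w hw
  exact ⟨hw.1, hw.2, (φ.continuousAt hw.2).comp (ψ.symm.continuousAt hw.1)⟩

lemma transition_base (hφ : HeadChart Γ c s φ) (hψ : TailChart Γ b c s ψ) :
    φ (ψ.symm ((1 : ℝ), (0 : ℂ))) = ((0 : ℝ), (1 : ℂ)) := by
  have hψs : ψ (Γ.orbit s) = ((1 : ℝ), (0 : ℂ)) := by simpa using hψ.orbit s le_rfl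
  rw [← hψs, ψ.left_inv (hψ.orbit_mem s le_rfl), hφ.orbit s le_rfl]
  simp

lemma tendsto_section : Tendsto (fun y : ℂ => ((1 : ℝ), y)) (𝓝 0) (𝓝 ((1 : ℝ), (0 : ℂ))) :=
  (Continuous.prodMk_right (1 : ℝ)).tendsto 0

/-- A point of the section `x = 1` misses the cylinder `‖y‖ = 1` of the head chart by the flow time
`log ‖y‖`, a continuous function of its label. Shifting the tail chart along orbits by this time
makes the section map into the cylinder. -/
lemma GraphForm.normalize_time (h : GraphForm Γ b c c s φ ψ 0) :
    ∃ ψ', GraphForm Γ b c c s φ ψ' 0 ∧ ∀ᶠ y in 𝓝 (0 : ℂ), ‖(φ (ψ'.symm (1, y))).2‖ = 1 := by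
  have hbase := transition_base h.head h.tail
  have hcont := tendsto_section.eventually (transition_continuousAt h.head h.tail)
  let χ : ℂ → Z := fun y => φ (ψ.symm (1, y))
  have hχc : ∀ᶠ y in 𝓝 (0 : ℂ), ContinuousAt χ y := by
    filter_upwards [hcont] with y hy
    have h1 : ContinuousAt (fun y : ℂ => ((1 : ℝ), y)) y := by fun_prop
    exact ContinuousAt.comp (g := fun w : Z => φ (ψ.symm w)) hy.2.2 h1
  have hχ0 : χ 0 = ((0 : ℝ), (1 : ℂ)) := hbase
  have hχne : ∀ᶠ y in 𝓝 (0 : ℂ), (χ y).2 ≠ 0 := by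
    have h1 : ContinuousAt (fun y => (χ y).2) 0 := continuousAt_snd.comp hχc.self_of_nhds
    exact h1.eventually_ne (by rw [hχ0]; exact one_ne_zero)
  obtain ⟨ρ, hρ, hρm⟩ := exists_continuous_extension_of_germ
    (f := fun y => Real.log ‖(χ y).2‖) (by
      filter_upwards [hχc, hχne] with y h1 h2
      exact ((continuousAt_snd.comp h1).norm).log (norm_ne_zero_iff.2 h2))
  have hρ0 : ρ 0 = 0 := by rw [hρm.self_of_nhds, hχ0]; simp
  set e := timeShiftHomeo b ρ hρ hρ0
  have he : ∀ z, e z = timeShift b ρ z := fun _ => rfl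
  have hflow : ∀ᶠ y in 𝓝 (0 : ℂ), φ ((ψ.transHomeomorph e).symm (1, y)) =
      modelFlow 0 (-ρ y) (χ y) := by
    have h1 : Tendsto (fun y : ℂ => (-ρ y, ((1 : ℝ), y))) (𝓝 0)
        (𝓝 ((0 : ℝ), ((1 : ℝ), (0 : ℂ)))) := by
      refine Tendsto.prodMk_nhds ?_ tendsto_section
      have := (hρ.tendsto 0).neg
      rwa [hρ0, neg_zero] at this
    filter_upwards [h1.eventually (transition_flow h.head h.tail)] with y hy
    have e1 : e.symm (1, y) = modelFlow b (-ρ y) (1, y) := by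
      change timeShift b (fun η => -ρ η) (1, y) = _
      rw [timeShift_of_pos (by simp), label_one]
    change φ (ψ.symm (e.symm (1, y))) = _
    rw [e1]
    exact hy
  refine ⟨_, ⟨h.head, h.tail.post h.tail.pos e (fun t z => ?_) ?_ ?_,
    continuous_const, rfl, Asymptotics.isLittleO_zero _ _, ?_⟩, ?_⟩
  · rw [he, he]; exact timeShift_modelFlow b ρ _ z
  · rw [he, timeShift_of_nonpos (by simp)]
  · rw [he, timeShift_of_pos (by simp), label_one, hρ0, (isFlow_modelFlow b).zero]
  · filter_upwards [hflow, h.sign] with y h1 h2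
    rw [h1, ← h2, modelFlow_zero_apply, sign_mul, sign_pos (Real.exp_pos _), one_mul]
  · filter_upwards [hflow, hρm, hχne] with y h1 h2 h3
    rw [h1, modelFlow_zero_apply, norm_smul, Real.norm_of_nonneg (Real.exp_pos _).le, h2,
      Real.exp_neg, Real.exp_log (norm_pos_iff.2 h3), inv_mul_cancel₀ (norm_ne_zero_iff.2 h3)]

/-- Along the trace the head coordinates satisfy `x = 0` and `‖y‖ = 1`, so only an angle `θ σ` is
left, and an angular homeomorphism of the head chart straightens it to `σ`. Such a map commutes with
positive dilations; this is why the head flow was freed of rotation. -/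
lemma GraphForm.normalize_angle (h : GraphForm Γ b c c s φ ψ 0)
    (hn : ∀ᶠ y in 𝓝 (0 : ℂ), ‖(φ (ψ.symm (1, y))).2‖ = 1) :
    ∃ φ', GraphForm Γ b c c s φ' ψ 0 ∧ (∀ᶠ y in 𝓝 (0 : ℂ), ‖(φ' (ψ.symm (1, y))).2‖ = 1) ∧
      ∀ᶠ y in 𝓝 (0 : ℂ), y.re = 0 → Complex.arg (φ' (ψ.symm (1, y))).2 = y.im := by
  have hbase := transition_base h.head h.tail
  have hcont := tendsto_section.eventually (transition_continuousAt h.head h.tail)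
  let χ : ℂ → Z := fun y => φ (ψ.symm (1, y))
  have hχc : ∀ᶠ y in 𝓝 (0 : ℂ), ContinuousAt χ y := by
    filter_upwards [hcont] with y hy
    have h1 : ContinuousAt (fun y : ℂ => ((1 : ℝ), y)) y := by fun_prop
    exact ContinuousAt.comp (g := fun w : Z => φ (ψ.symm w)) hy.2.2 h1
  have hχ0 : χ 0 = ((0 : ℝ), (1 : ℂ)) := hbase
  have hslit : ∀ᶠ y in 𝓝 (0 : ℂ), (χ y).2 ∈ Complex.slitPlane := by
    have h1 : ContinuousAt (fun y => (χ y).2) 0 := continuousAt_snd.comp hχc.self_of_nhds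
    exact h1.eventually (Complex.isOpen_slitPlane.mem_nhds (by
      simp only [hχ0]; exact Complex.one_mem_slitPlane))
  have hall := hcont.and (hχc.and (hslit.and (hn.and h.sign)))
  obtain ⟨r, hr, hball⟩ := Metric.eventually_nhds_iff.1 hall
  have hσ : ∀ σ ∈ Icc (-(r / 2)) (r / 2), dist ((σ : ℂ) * Complex.I) 0 < r := fun σ hσ => by
    rw [dist_zero_right, norm_mul, Complex.norm_I, mul_one, Complex.norm_real, Real.norm_eq_abs]
    linarith [abs_le.2 hσ]
  let θ : ℝ → ℝ := fun σ => Complex.arg (χ (σ * Complex.I)).2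
  have hθ0 : θ 0 = 0 := by simp [θ, hχ0]
  have hθc : ContinuousOn θ (Icc (-(r / 2)) (r / 2)) := fun σ hs => by
    obtain ⟨-, h1, h2, -, -⟩ := hball (hσ σ hs)
    have h3 : ContinuousAt (fun σ : ℝ => (σ : ℂ) * Complex.I) σ := by fun_prop
    have h4 : ContinuousAt (fun σ : ℝ => (χ (σ * Complex.I)).2) σ :=
      continuousAt_snd.comp (ContinuousAt.comp (g := χ) h1 h3)
    have h5 : ContinuousAt Complex.arg ((fun σ : ℝ => (χ (σ * Complex.I)).2) σ) :=
      Complex.continuousAt_arg h2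
    exact (ContinuousAt.comp (f := fun σ : ℝ => (χ (σ * Complex.I)).2) h5 h4).continuousWithinAt
  -- Equal angles mean equal points of the head chart, since the stable coordinate is 0 and the
  -- modulus 1 on the trace; the transition is injective.
  have hθi : InjOn θ (Icc (-(r / 2)) (r / 2)) := fun σ hs σ' hs' heq => by
    obtain ⟨⟨t1, t2, -⟩, -, -, h1, h2⟩ := hball (hσ σ hs)
    obtain ⟨⟨t1', t2', -⟩, -, -, h1', h2'⟩ := hball (hσ σ' hs')
    have h3 : χ (σ * Complex.I) = χ (σ' * Complex.I) := by
      refine Prod.ext ?_ (Complex.ext_norm_arg (h1.trans h1'.symm) heq)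
      have k1 : (χ (σ * Complex.I)).1 = 0 := by simpa using h2
      have k2 : (χ (σ' * Complex.I)).1 = 0 := by simpa using h2'
      rw [k1, k2]
    have h4 := ψ.symm.injOn t1 t1' (φ.injOn t2 t2' h3)
    have h5 := congrArg (fun z : Z => z.2.im) h4
    simpa using h5
  obtain ⟨J, hJ1, hJ2, hJ3, hJ4⟩ := exists_circle_homeo (half_pos hr) hθc hθi hθ0
  have hJ0 : J 0 = 0 := by
    have := hJ1 0
    rwa [norm_zero, norm_eq_zero] at this
  set e : Z ≃ₜ Z := (Homeomorph.refl ℝ).prodCongr J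
  have he : ∀ z : Z, e z = (z.1, J z.2) := fun _ => rfl
  have hχ' : ∀ y : ℂ, (φ.transHomeomorph e) (ψ.symm (1, y)) = ((χ y).1, J (χ y).2) := fun y => rfl
  refine ⟨φ.transHomeomorph e, ⟨h.head.post h.head.pos e (fun t z => ?_) ?_ ?_, h.tail,
    continuous_const, rfl, Asymptotics.isLittleO_zero _ _, ?_⟩, ?_, ?_⟩
  · rw [he, he, modelFlow_zero_apply, modelFlow_zero_apply]
    simp only
    rw [hJ2 _ (Real.exp_pos _)]
  · rw [he]; simp [hJ0]
  · rw [he]; simp [hJ3]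
  · filter_upwards [h.sign] with y hy
    rw [hχ']; exact hy
  · filter_upwards [hn] with y hy
    rw [hχ', hJ1]; exact hy
  · have h1 : Tendsto Complex.im (𝓝 0) (𝓝 0) := Complex.continuous_im.tendsto 0
    filter_upwards [h1.eventually hJ4, hslit] with y h2 h3 hre
    have e1 : (y.im : ℂ) * Complex.I = y := by apply Complex.ext <;> simp [hre]
    rw [hχ']
    refine h2 _ (Complex.slitPlane_ne_zero h3) ?_
    simp only [θ, e1]

/-- The properties on the section spread to a neighbourhood of `Γ(s)`: flowing for model time `log
x` brings a point of the tail chart to `(1, label)`, and the transition commutes with the flows. -/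
lemma GraphForm.normalForm (h : GraphForm Γ b c c s φ ψ 0)
    (hn : ∀ᶠ y in 𝓝 (0 : ℂ), ‖(φ (ψ.symm (1, y))).2‖ = 1)
    (ha : ∀ᶠ y in 𝓝 (0 : ℂ), y.re = 0 → Complex.arg (φ (ψ.symm (1, y))).2 = y.im) :
    NormalForm Γ b c s φ ψ := by
  have hψs : ψ (Γ.orbit s) = ((1 : ℝ), (0 : ℂ)) := by simpa using h.tail.orbit s le_rfl
  have hsrc := h.tail.orbit_mem s le_rfl
  have hψt : Tendsto ψ (𝓝 (Γ.orbit s)) (𝓝 ((1 : ℝ), (0 : ℂ))) := by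
    rw [← hψs]; exact ψ.continuousAt hsrc
  have hlab : Tendsto (fun z => label b (ψ z)) (𝓝 (Γ.orbit s)) (𝓝 0) := by
    have h1 : ContinuousAt (label b) ((1 : ℝ), (0 : ℂ)) := continuousAt_label (by simp)
    have h2 := h1.tendsto.comp hψt
    rwa [label_one] at h2
  have hlog : Tendsto (fun z => (Real.log (ψ z).1, ψ z)) (𝓝 (Γ.orbit s))
      (𝓝 ((0 : ℝ), ((1 : ℝ), (0 : ℂ)))) := by
    refine Tendsto.prodMk_nhds ?_ hψt
    have h1 : ContinuousAt (fun w : Z => Real.log w.1) ((1 : ℝ), (0 : ℂ)) :=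
      continuousAt_fst.log (by simp)
    have h2 := h1.tendsto.comp hψt
    simpa [Function.comp_def] using h2
  have hpos : ∀ᶠ z in 𝓝 (Γ.orbit s), 0 < (ψ z).1 :=
    hψt.eventually (continuousAt_fst.eventually (lt_mem_nhds one_pos))
  have key : ∀ᶠ z in 𝓝 (Γ.orbit s), 0 < (ψ z).1 ∧
      φ (ψ.symm (1, label b (ψ z))) = ((ψ z).1⁻¹ * (φ z).1, (ψ z).1 • (φ z).2) := by
    filter_upwards [hlog.eventually (transition_flow h.head h.tail), hpos,
      ψ.open_source.mem_nhds hsrc] with z hz hp hs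
    refine ⟨hp, ?_⟩
    rw [ψ.left_inv hs, modelFlow_zero_apply, Real.exp_neg, Real.exp_log hp] at hz
    rw [← hz]
    congr 2
    rw [modelFlow_apply, Real.exp_neg, Real.exp_log hp, inv_mul_cancel₀ hp.ne']
    rfl
  refine ⟨h.head, h.tail, ?_, ?_, ?_⟩
  · filter_upwards [key, hlab.eventually h.sign] with z hz h1
    rw [hz.2, sign_mul, sign_pos (inv_pos.2 hz.1), one_mul] at h1
    simpa using h1
  · filter_upwards [key, hlab.eventually hn] with z hz h1
    rw [hz.2, norm_smul, Real.norm_of_nonneg hz.1.le] at h1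
    rw [mul_comm]; exact h1
  · filter_upwards [key, hlab.eventually h.sign, hlab.eventually ha] with z hz h1 h2 h3
    rw [hz.2, h3] at h1
    rw [hz.2] at h2
    have h4 : (label b (ψ z)).re = 0 := by
      rw [mul_zero, sign_zero, Pi.zero_apply, sub_zero] at h1
      exact sign_eq_zero_iff.1 h1.symm
    have h5 := h2 h4
    rwa [Complex.real_smul, Complex.arg_real_mul _ hz.1] at h5

lemma GraphForm.exists_normalForm (h : GraphForm Γ b c c s φ ψ 0) :
    ∃ φ' ψ', NormalForm Γ b c s φ' ψ' := by
  obtain ⟨ψ', h1, h2⟩ := h.normalize_time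
  obtain ⟨φ', h3, h4, h5⟩ := h1.normalize_angle h2
  exact ⟨φ', ψ', h3.normalForm h4 h5⟩

lemma SaddleConnection.Generic11Real.exists_normalForm (h : Γ.Generic11Real) :
    ∃ c s₀, ∀ s ≥ s₀, ∃ φ ψ, NormalForm Γ 0 c s φ ψ := by
  obtain ⟨s₀, hs⟩ := h.exists_graphForm
  refine ⟨1, s₀, fun s hs' => ?_⟩
  obtain ⟨φ, ψ, g, h1⟩ := hs s hs'
  obtain ⟨ψ', h2⟩ := h1.straighten
  exact h2.exists_normalForm

lemma SaddleConnection.Generic11Complex.exists_normalForm (h : Γ.Generic11Complex) :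
    ∃ c s₀, ∀ s ≥ s₀, ∃ φ ψ, NormalForm Γ 1 c s φ ψ := by
  obtain ⟨b, c, hb, -, s₀, hs⟩ := h.exists_graphForm
  refine ⟨|b| * c, s₀, fun s hs' => ?_⟩
  obtain ⟨φ, ψ, g, h1⟩ := hs s hs'
  obtain ⟨ψ', h2⟩ := h1.straighten
  obtain ⟨ψ'', h3⟩ := h2.normalize_rotation hb
  exact h3.exists_normalForm

end SaddleConn

/-! ### Extension of the cut germ on the space of orbits -/

namespace SaddleConn

/-- A function that decreases along the hyperbolas `|x| r = m`. -/
def height (x r : ℝ) : ℝ := max (|x| - 2 * r) (-r)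

/-- The radius at which the hyperbola `|x| r = m` has height `v`. -/
def heightRadius (v m : ℝ) : ℝ := max (-v) ((-v + √(v ^ 2 + 8 * m)) / 4)

lemma heightRadius_pos {v m : ℝ} (h : v < 0 ∨ 0 < m) : 0 < heightRadius v m := by
  rcases h with h | h
  · exact lt_max_of_lt_left (by linarith)
  · refine lt_max_of_lt_right ?_
    have h1 : |v| < √(v ^ 2 + 8 * m) := by
      rw [← Real.sqrt_sq_eq_abs]
      exact Real.sqrt_lt_sqrt (sq_nonneg v) (by linarith)
    linarith [le_abs_self v]

/-- On the hyperbola `|x| r = m` the two branches of the height give `r = -v` or `2r² + vr - m = 0`,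
and `heightRadius` is the larger solution. The height is `-r` where `|x| ≤ r`, so preserving it
keeps the radius near the unstable plane; it is `|x|` on the stable axis, so preserving it keeps the
axis fixed in the limit. -/
lemma height_heightRadius {v m : ℝ} (hm : 0 ≤ m) (h : v < 0 ∨ 0 < m) :
    height (m / heightRadius v m) (heightRadius v m) = v := by
  have hpos := heightRadius_pos h
  have hsq : √(v ^ 2 + 8 * m) ^ 2 = v ^ 2 + 8 * m := Real.sq_sqrt (by positivity)
  have hS := Real.sqrt_nonneg (v ^ 2 + 8 * m)
  rw [height, abs_of_nonneg (by positivity)]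
  rcases le_total ((-v + √(v ^ 2 + 8 * m)) / 4) (-v) with hc | hc
  · have e : heightRadius v m = -v := max_eq_left hc
    rw [e] at hpos ⊢
    rw [max_eq_right]
    · ring
    · have h1 : m / -v ≤ -v := by
        rw [div_le_iff₀ hpos]; nlinarith
      linarith
  · have e : heightRadius v m = (-v + √(v ^ 2 + 8 * m)) / 4 := max_eq_right hc
    rw [e] at hpos ⊢
    set R := (-v + √(v ^ 2 + 8 * m)) / 4 with hR
    have h1 : m / R = 2 * R + v := by
      rw [div_eq_iff hpos.ne']
      have : √(v ^ 2 + 8 * m) = 4 * R + v := by rw [hR]; ring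
      rw [this] at hsq
      nlinarith
    rw [h1, max_eq_left (by linarith)]
    ring

lemma heightRadius_height {m r : ℝ} (hm : 0 ≤ m) (hr : 0 < r) :
    heightRadius (height (m / r) r) m = r := by
  rw [height, abs_of_nonneg (by positivity), heightRadius]
  have hmr : m / r * r = m := div_mul_cancel₀ m hr.ne'
  have hmr0 : 0 ≤ m / r := by positivity
  set q := m / r
  rcases le_total (q - 2 * r) (-r) with hc | hc
  · rw [max_eq_right hc, neg_neg]
    refine max_eq_left ?_
    have : √((-r) ^ 2 + 8 * m) ≤ 3 * r := by
      rw [Real.sqrt_le_left (by positivity)]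
      nlinarith
    linarith
  · rw [max_eq_left hc]
    have : √((q - 2 * r) ^ 2 + 8 * m) = q + 2 * r := by
      rw [Real.sqrt_eq_iff_mul_self_eq (by positivity) (by positivity)]
      nlinarith
    rw [this, max_eq_right (by linarith)]
    ring

lemma continuous_height : Continuous fun q : ℝ × ℝ => height q.1 q.2 := by
  unfold height; fun_prop

lemma continuous_heightRadius : Continuous fun q : ℝ × ℝ => heightRadius q.1 q.2 := by
  unfold heightRadius; fun_prop

lemma height_strictAnti {m : ℝ} (hm : 0 ≤ m) {r r' : ℝ} (hr : 0 < r) (h : r < r') :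
    height (m / r') r' < height (m / r) r := by
  have hr' := hr.trans h
  rw [height, height, abs_of_nonneg (by positivity), abs_of_nonneg (by positivity)]
  have : m / r' ≤ m / r := by gcongr
  exact max_lt_max (by linarith) (by linarith)

/-- The point `(0, 1)` of the unstable plane through which the connection passes. -/
def cutPoint : Z := ((0 : ℝ), (1 : ℂ))

/-- A germ of a homeomorphism at `(0, 1)` as it arises from comparing two connections. -/
structure CutGerm (η : ℝ) (k k' : Z → Z) : Prop where
  pos : 0 < η
  cont : ContinuousOn k (Metric.ball cutPoint η)
  norm : ∀ w ∈ Metric.ball cutPoint η, ‖(k w).2‖ = ‖w.2‖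
  sign : ∀ w ∈ Metric.ball cutPoint η, SignType.sign (k w).1 = SignType.sign w.1
  fix : ∀ w ∈ Metric.ball cutPoint η, w.1 = 0 → k w = w
  inv : ∀ w ∈ Metric.ball cutPoint η, k w ∈ Metric.ball cutPoint η → k' (k w) = w

lemma mem_ball_cutPoint {η : ℝ} {w : Z} :
    w ∈ Metric.ball cutPoint η ↔ |w.1| < η ∧ ‖w.2 - 1‖ < η := by
  rw [Metric.mem_ball, Prod.dist_eq, max_lt_iff, Real.dist_eq, dist_eq_norm, cutPoint]
  simp

/-- The width of the region of orbits near the direction `u` that are not moved. -/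
def depth (η : ℝ) (u : ℂ) : ℝ := max (‖u - 1‖ - η / 2) 0

lemma depth_nonneg (η : ℝ) (u : ℂ) : 0 ≤ depth η u := le_max_right _ _

lemma continuous_depth (η : ℝ) : Continuous (depth η) := by unfold depth; fun_prop

lemma norm_lt_of_depth_lt {η : ℝ} {u : ℂ} (h : depth η u < η / 2) : ‖u - 1‖ < η := by
  have := (le_max_left (‖u - 1‖ - η / 2) 0).trans_lt h
  linarith

/-- Truncation of `ξ` to `[-d, d]`. -/
def clampTo (d ξ : ℝ) : ℝ := max (-d) (min d ξ)

lemma clampTo_of_abs_le {d ξ : ℝ} (h : |ξ| ≤ d) : clampTo d ξ = ξ := by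
  have := abs_le.1 h
  rw [clampTo, min_eq_right this.2, max_eq_right this.1]

lemma clampTo_of_lt_abs {d ξ : ℝ} (hd : 0 ≤ d) (h : d < |ξ|) :
    clampTo d ξ = SignType.sign ξ * d := by
  rcases lt_trichotomy ξ 0 with h0 | h0 | h0
  · rw [abs_of_neg h0] at h
    rw [clampTo, min_eq_right (by linarith), max_eq_left (by linarith), sign_neg h0]; simp
  · rw [h0, abs_zero] at h; linarith
  · rw [abs_of_pos h0] at h
    rw [clampTo, min_eq_left h.le, max_eq_right (by linarith), sign_pos h0]; simp

/-- Extension of a germ at `(0, 1)` to the orbits in all directions. -/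
def orbitMap (η : ℝ) (k : Z → Z) (w : Z) : Z :=
  if |w.1| ≤ depth η w.2 then w else
    -- The germ acts on the excess of `|ξ|` over the depth, and the depth at the new direction is
    -- added back. At zero excess `k` is the identity, so this joins the unmoved region
    -- continuously. The depth is 0 for directions near 1, where `k` is recovered, and at least
    -- `η/2` for directions outside the reach of `k`.
    let w₀ := k (w.1 - clampTo (depth η w.2) w.1, w.2)
    (w₀.1 + clampTo (depth η w.2) w.1 + SignType.sign w.1 * (depth η w₀.2 - depth η w.2), w₀.2)

section OrbitMap

variable {η : ℝ} {k k' : Z → Z}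

lemma sub_clampTo {d ξ : ℝ} (hd : 0 ≤ d) (h : d < |ξ|) :
    ξ - clampTo d ξ = SignType.sign ξ * (|ξ| - d) := by
  rw [clampTo_of_lt_abs hd h, mul_sub, sign_mul_abs]

lemma abs_sub_clampTo_le {d ξ : ℝ} (hd : 0 ≤ d) : |ξ - clampTo d ξ| ≤ |ξ| := by
  rcases le_or_gt |ξ| d with h | h
  · rw [clampTo_of_abs_le h, sub_self, abs_zero]; exact abs_nonneg _
  · rw [sub_clampTo hd h, abs_mul]
    have h1 : |((SignType.sign ξ : SignType) : ℝ)| ≤ 1 := by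
      rcases lt_trichotomy ξ 0 with h0 | h0 | h0
      · simp [sign_neg h0]
      · simp [h0]
      · simp [sign_pos h0]
    rw [abs_of_pos (sub_pos.2 h)]
    nlinarith [abs_nonneg ξ]

lemma orbitMap_of_le {w : Z} (h : |w.1| ≤ depth η w.2) : orbitMap η k w = w := if_pos h

/-- The value of `orbitMap` in the region that is moved. -/
lemma orbitMap_eq {w : Z} (h : depth η w.2 < |w.1|)
    (hw : |w.1| < η / 2) : ∃ w₀ : Z, w₀ ∈ Metric.ball cutPoint η ∧
      w₀ = (SignType.sign w.1 * (|w.1| - depth η w.2), w.2) ∧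
      orbitMap η k w = ((k w₀).1 + SignType.sign w.1 * depth η (k w₀).2, (k w₀).2) := by
  have hd := depth_nonneg η w.2
  refine ⟨(w.1 - clampTo (depth η w.2) w.1, w.2), ?_, ?_, ?_⟩
  · rw [mem_ball_cutPoint]
    exact ⟨(abs_sub_clampTo_le hd).trans_lt (by linarith [abs_nonneg w.1]),
      norm_lt_of_depth_lt (h.trans hw)⟩
  · rw [sub_clampTo hd h]
  · rw [orbitMap, if_neg (not_le.2 h)]
    simp only
    refine Prod.ext ?_ rfl
    simp only
    rw [clampTo_of_lt_abs hd h]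
    ring

lemma CutGerm.orbitMap_norm (hk : CutGerm η k k') {w : Z} (hw : |w.1| < η / 2) :
    ‖(orbitMap η k w).2‖ = ‖w.2‖ := by
  rcases le_or_gt |w.1| (depth η w.2) with h | h
  · rw [orbitMap_of_le h]
  · obtain ⟨w₀, h1, h2, h3⟩ := orbitMap_eq (k := k) h hw
    rw [h3]; simp only
    rw [hk.norm _ h1, h2]

lemma sign_coe_mul_of_pos {x r : ℝ} (hr : 0 < r) :
    SignType.sign (((SignType.sign x : SignType) : ℝ) * r) = SignType.sign x := by
  rcases lt_trichotomy x 0 with h0 | h0 | h0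
  · simp [sign_neg h0, hr]
  · simp [h0]
  · simp [sign_pos h0, hr]

/-- The moved region is mapped to itself, in shifted coordinates. -/
lemma CutGerm.orbitMap_shift (hk : CutGerm η k k') {w : Z} (h : depth η w.2 < |w.1|)
    (hw : |w.1| < η / 2) :
    SignType.sign (orbitMap η k w).1 = SignType.sign w.1 ∧
      depth η (orbitMap η k w).2 < |(orbitMap η k w).1| ∧
      k (SignType.sign w.1 * (|w.1| - depth η w.2), w.2) =
        (SignType.sign w.1 * (|(orbitMap η k w).1| - depth η (orbitMap η k w).2),
          (orbitMap η k w).2) := by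
  obtain ⟨w₀, h1, h2, h3⟩ := orbitMap_eq (k := k) h hw
  have hpos : 0 < |w.1| - depth η w.2 := sub_pos.2 h
  have hs := hk.sign w₀ h1
  rw [h2] at hs
  rw [← h2, h3]
  simp only at hs ⊢
  rw [sign_coe_mul_of_pos hpos] at hs
  rw [← h2] at hs
  have hd := depth_nonneg η (k w₀).2
  have hne : w.1 ≠ 0 := fun e => by
    rw [e, abs_zero] at h
    linarith [depth_nonneg η w.2]
  rcases hne.lt_or_gt with h0 | h0
  · rw [sign_neg h0] at hs ⊢
    have h4 : (k w₀).1 < 0 := sign_eq_neg_one_iff.1 hs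
    have h5 : (k w₀).1 + -1 * depth η (k w₀).2 < 0 := by linarith
    simp only [SignType.coe_neg, SignType.coe_one]
    refine ⟨sign_neg h5, ?_, Prod.ext ?_ rfl⟩
    · rw [abs_of_neg h5]; linarith
    · simp only; rw [abs_of_neg h5]; ring
  · rw [sign_pos h0] at hs ⊢
    have h4 : 0 < (k w₀).1 := sign_eq_one_iff.1 hs
    have h5 : 0 < (k w₀).1 + 1 * depth η (k w₀).2 := by linarith
    simp only [SignType.coe_one]
    refine ⟨sign_pos h5, ?_, Prod.ext ?_ rfl⟩
    · rw [abs_of_pos h5]; linarith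
    · simp only; rw [abs_of_pos h5]; ring

lemma CutGerm.orbitMap_sign (hk : CutGerm η k k') {w : Z} (hw : |w.1| < η / 2) :
    SignType.sign (orbitMap η k w).1 = SignType.sign w.1 := by
  rcases le_or_gt |w.1| (depth η w.2) with h | h
  · rw [orbitMap_of_le h]
  · exact (hk.orbitMap_shift h hw).1

/-- In the coordinates (signed excess, direction) the map is `k` itself and preserves the moved
region, so the inverse germ undoes it. -/
lemma CutGerm.orbitMap_orbitMap (hk : CutGerm η k k') {w : Z}
    (hw : |w.1| < η / 2) (hw' : |(orbitMap η k w).1| < η / 2) :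
    orbitMap η k' (orbitMap η k w) = w := by
  rcases le_or_gt |w.1| (depth η w.2) with h | h
  · rw [orbitMap_of_le (k := k) h, orbitMap_of_le h]
  · obtain ⟨h1, h2, h3⟩ := hk.orbitMap_shift h hw
    obtain ⟨w₀, h4, h5, -⟩ := orbitMap_eq (k := k) h hw
    obtain ⟨w₁, h6, h7, h8⟩ := orbitMap_eq (k := k') h2 hw'
    rw [h1] at h7 h8
    rw [← h5, ← h7] at h3
    have h9 : k' w₁ = w₀ := by
      rw [← h3]; exact hk.inv w₀ h4 (h3 ▸ h6)
    rw [h8, h9, h5]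
    refine Prod.ext ?_ rfl
    simp only
    rw [mul_sub, sign_mul_abs]; ring

/-- The sign factor is the only discontinuous ingredient. It jumps at `ξ = 0`, where `k` fixes the
direction and the difference of depths that it multiplies vanishes. -/
lemma CutGerm.continuousAt_orbitMap (hk : CutGerm η k k') {w : Z} (hw : |w.1| < η / 2) :
    ContinuousAt (orbitMap η k) w := by
  have hd := continuous_depth η
  by_cases hdw : depth η w.2 < η / 2
  · have hopen : IsOpen {w : Z | depth η w.2 < η / 2 ∧ |w.1| < η / 2} :=
      IsOpen.inter (s := {w : Z | depth η w.2 < η / 2}) (t := {w : Z | |w.1| < η / 2})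
        (isOpen_lt (hd.comp continuous_snd) continuous_const)
        (isOpen_lt (continuous_fst.abs) continuous_const)
    let κ : Z → Z := fun w => k (w.1 - clampTo (depth η w.2) w.1, w.2)
    have hmem : ∀ w ∈ {w : Z | depth η w.2 < η / 2 ∧ |w.1| < η / 2},
        ((w.1 - clampTo (depth η w.2) w.1, w.2) : Z) ∈ Metric.ball cutPoint η := by
      rintro w ⟨h1, h2⟩
      rw [mem_ball_cutPoint]
      exact ⟨(abs_sub_clampTo_le (depth_nonneg _ _)).trans_lt (by linarith [hk.pos]),
        norm_lt_of_depth_lt h1⟩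
    have hκ : ContinuousAt κ w := by
      have h1 : ContinuousAt (fun w : Z => ((w.1 - clampTo (depth η w.2) w.1, w.2) : Z)) w := by
        unfold clampTo
        fun_prop
      exact ContinuousAt.comp (g := k)
        (hk.cont.continuousAt (Metric.isOpen_ball.mem_nhds (hmem w ⟨hdw, hw⟩))) h1
    have hκfix : ∀ w ∈ {w : Z | depth η w.2 < η / 2 ∧ |w.1| < η / 2}, |w.1| ≤ depth η w.2 →
        κ w = (0, w.2) := by
      intro w hw h
      have e1 : w.1 - clampTo (depth η w.2) w.1 = 0 := by rw [clampTo_of_abs_le h, sub_self]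
      have := hk.fix _ (hmem w hw) e1
      rw [e1] at this
      simp only [κ, e1]
      exact this
    have hformula : ∀ w ∈ {w : Z | depth η w.2 < η / 2 ∧ |w.1| < η / 2}, orbitMap η k w =
        ((κ w).1 + clampTo (depth η w.2) w.1 +
          SignType.sign w.1 * (depth η (κ w).2 - depth η w.2), (κ w).2) := by
      intro w hw
      by_cases h : |w.1| ≤ depth η w.2
      · rw [orbitMap_of_le h, hκfix w hw h, clampTo_of_abs_le h]
        simp
      · rw [orbitMap, if_neg h]
    have hS : ContinuousAt (fun w : Z => (SignType.sign w.1 : ℝ) *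
        (depth η (κ w).2 - depth η w.2)) w := by
      have hG : ContinuousAt (fun w : Z => depth η (κ w).2 - depth η w.2) w :=
        (hd.continuousAt.comp (continuousAt_snd.comp hκ)).sub
          (hd.continuousAt.comp continuousAt_snd)
      rcases lt_trichotomy w.1 0 with h0 | h0 | h0
      · refine (hG.const_mul (-1)).congr ?_
        filter_upwards [continuousAt_fst.eventually (gt_mem_nhds h0)] with v hv
        rw [sign_neg hv]; simp
      · have e0 : depth η (κ w).2 - depth η w.2 = 0 := by
          rw [hκfix w ⟨hdw, hw⟩ (by rw [h0, abs_zero]; exact depth_nonneg _ _), sub_self]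
        rw [ContinuousAt, e0, mul_zero]
        have hG' := hG.tendsto
        rw [e0] at hG'
        refine squeeze_zero_norm (fun v => ?_) (tendsto_zero_iff_norm_tendsto_zero.1 hG')
        rw [norm_mul]
        refine mul_le_of_le_one_left (norm_nonneg _) ?_
        rcases lt_trichotomy v.1 0 with h0 | h0 | h0
        · simp [sign_neg h0]
        · simp [h0]
        · simp [sign_pos h0]
      · refine (hG.const_mul 1).congr ?_
        filter_upwards [continuousAt_fst.eventually (lt_mem_nhds h0)] with v hv
        rw [sign_pos hv]; simp
    have hC : ContinuousAt (fun w : Z => clampTo (depth η w.2) w.1) w := by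
      unfold clampTo
      fun_prop
    have hall := (((continuousAt_fst.comp hκ).add hC).add hS).prodMk (continuousAt_snd.comp hκ)
    refine hall.congr ?_
    filter_upwards [hopen.mem_nhds ⟨hdw, hw⟩] with v hv
    exact (hformula v hv).symm
  · have hlt : |w.1| < depth η w.2 := hw.trans_le (not_lt.1 hdw)
    refine continuousAt_id.congr ?_
    have hopen : IsOpen {w : Z | |w.1| < depth η w.2} := isOpen_lt (by fun_prop) (by fun_prop)
    filter_upwards [hopen.mem_nhds hlt] with v hv
    exact (orbitMap_of_le (le_of_lt hv)).symm

/-- Compactness of the circle of directions. Uniformity matters near the stable axis, where the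
direction of `y` has no limit. -/
lemma CutGerm.orbitMap_uniform (hk : CutGerm η k k') {ε : ℝ} (hε : 0 < ε) :
    ∀ᶠ ξ in 𝓝 (0 : ℝ), ∀ u ∈ Metric.sphere (0 : ℂ) 1, |(orbitMap η k (ξ, u)).1| < ε := by
  refine (isCompact_sphere (0 : ℂ) 1).eventually_forall_of_forall_eventually fun u _ => ?_
  have h1 := hk.continuousAt_orbitMap (w := ((0 : ℝ), u)) (by simpa using hk.pos)
  have h2 : orbitMap η k ((0 : ℝ), u) = ((0 : ℝ), u) :=
    orbitMap_of_le (by simpa using depth_nonneg η u)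
  have h3 : ContinuousAt (fun w => |(orbitMap η k w).1|) ((0 : ℝ), u) :=
    (continuousAt_fst.comp h1).abs
  exact h3.eventually (gt_mem_nhds (by simp only [h2]; simpa using hε))

end OrbitMap

end SaddleConn

/-! ### Extension of the cut germ to a neighbourhood of the head -/

namespace SaddleConn

/-- The point on the orbit `w` at distance `R` from the stable axis. -/
def polar (R : ℝ) (w : Z) : Z := (w.1 / R, R • w.2)

/-- The invariant of the orbit of `z`. -/
def cutParam (z : Z) : Z := (z.1 * ‖z.2‖, (‖z.2‖⁻¹ : ℝ) • z.2)

lemma polar_cutParam {z : Z} (h : z.2 ≠ 0) : polar ‖z.2‖ (cutParam z) = z := by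
  have h1 := norm_ne_zero_iff.2 h
  refine Prod.ext ?_ ?_
  · simp only [polar, cutParam]; field_simp
  · simp only [polar, cutParam]; rw [smul_smul, mul_inv_cancel₀ h1, one_smul]

lemma norm_polar {R : ℝ} {w : Z} (hR : 0 < R) (hw : ‖w.2‖ = 1) : ‖(polar R w).2‖ = R := by
  simp only [polar]; rw [norm_smul, hw, mul_one, Real.norm_of_nonneg hR.le]

lemma cutParam_polar {R : ℝ} {w : Z} (hR : 0 < R) (hw : ‖w.2‖ = 1) :
    cutParam (polar R w) = w := by
  rw [cutParam, norm_polar hR hw]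
  refine Prod.ext ?_ ?_
  · simp only [polar]; field_simp
  · simp only [polar]; rw [smul_smul, inv_mul_cancel₀ hR.ne', one_smul]

lemma modelFlow_polar (t : ℝ) (R : ℝ) (w : Z) :
    modelFlow 0 t (polar R w) = polar (Real.exp t * R) w := by
  rw [modelFlow_zero_apply, polar, polar]
  refine Prod.ext ?_ ?_
  · simp only; rw [Real.exp_neg, div_eq_mul_inv, div_eq_mul_inv, mul_inv]; ring
  · simp only; rw [smul_smul]

lemma norm_cutParam {z : Z} (h : z.2 ≠ 0) : ‖(cutParam z).2‖ = 1 := by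
  simp only [cutParam]
  rw [norm_smul, norm_inv, norm_norm, inv_mul_cancel₀ (norm_ne_zero_iff.2 h)]

lemma height_abs (x r : ℝ) : height |x| r = height x r := by rw [height, height, abs_abs]

lemma height_le {x r : ℝ} (hr : 0 ≤ r) : height x r ≤ |x| :=
  max_le (by linarith) (by linarith [abs_nonneg x])

lemma le_height (x r : ℝ) : |x| - 2 * r ≤ height x r := le_max_left _ _

lemma height_of_abs_le {x r : ℝ} (h : |x| ≤ r) : height x r = -r := max_eq_right (by linarith)

/-- The extension of a germ at `(0, 1)` to a neighbourhood of the unstable plane and the stable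
axis. -/
def cutExt (η : ℝ) (k : Z → Z) (z : Z) : Z :=
  if z.2 = 0 then z else
    -- `orbitMap` determines the image orbit; on it the point with the height of `z` is selected.
    polar (heightRadius (height z.1 ‖z.2‖) |(orbitMap η k (cutParam z)).1|)
      (orbitMap η k (cutParam z))

/-- The domain of the extension. -/
def cutDomain (η : ℝ) : Set Z := {z | |z.1| * ‖z.2‖ < η / 2}

lemma isOpen_cutDomain (η : ℝ) : IsOpen (cutDomain η) := isOpen_lt (by fun_prop) (by fun_prop)

section CutExt

variable {η : ℝ} {k k' : Z → Z}

lemma cutExt_of_eq_zero {z : Z} (h : z.2 = 0) : cutExt η k z = z := if_pos h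

lemma cutExt_of_ne_zero {z : Z} (h : z.2 ≠ 0) : cutExt η k z =
    polar (heightRadius (height z.1 ‖z.2‖) |(orbitMap η k (cutParam z)).1|)
      (orbitMap η k (cutParam z)) := if_neg h

lemma abs_cutParam_lt {z : Z} (hz : z ∈ cutDomain η) : |(cutParam z).1| < η / 2 := by
  simp only [cutParam]; rw [abs_mul, abs_norm]; exact hz

lemma sign_cutParam {z : Z} (h : z.2 ≠ 0) :
    SignType.sign (cutParam z).1 = SignType.sign z.1 := by
  simp only [cutParam]; rw [sign_mul, sign_pos (norm_pos_iff.2 h), mul_one]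

lemma CutGerm.cutRadius_pos (hk : CutGerm η k k') {z : Z} (h : z.2 ≠ 0) (hz : z ∈ cutDomain η) :
    height z.1 ‖z.2‖ < 0 ∨ 0 < |(orbitMap η k (cutParam z)).1| := by
  by_cases h0 : (orbitMap η k (cutParam z)).1 = 0
  · left
    have h1 := hk.orbitMap_sign (abs_cutParam_lt hz)
    rw [h0, sign_zero, sign_cutParam h] at h1
    rw [sign_eq_zero_iff.1 h1.symm, height_of_abs_le (by simp)]
    simpa using h
  · exact Or.inr (abs_pos.2 h0)

lemma CutGerm.cutExt_spec (hk : CutGerm η k k') {z : Z} (h : z.2 ≠ 0) (hz : z ∈ cutDomain η) :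
    ∃ R : ℝ, 0 < R ∧ R = heightRadius (height z.1 ‖z.2‖) |(orbitMap η k (cutParam z)).1| ∧
      ‖(orbitMap η k (cutParam z)).2‖ = 1 ∧
      cutExt η k z = polar R (orbitMap η k (cutParam z)) ∧
      height (cutExt η k z).1 R = height z.1 ‖z.2‖ := by
  have hc := hk.cutRadius_pos h hz
  have hpos := heightRadius_pos hc
  refine ⟨_, hpos, rfl, ?_, cutExt_of_ne_zero h, ?_⟩
  · rw [hk.orbitMap_norm (abs_cutParam_lt hz), norm_cutParam h]
  · rw [cutExt_of_ne_zero h, polar, ← height_abs, abs_div, abs_of_pos hpos]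
    exact height_heightRadius (abs_nonneg _) hc

lemma CutGerm.height_cutExt (hk : CutGerm η k k') {z : Z} (hz : z ∈ cutDomain η) :
    height (cutExt η k z).1 ‖(cutExt η k z).2‖ = height z.1 ‖z.2‖ := by
  by_cases h : z.2 = 0
  · rw [cutExt_of_eq_zero h]
  · obtain ⟨R, h1, -, h2, h3, h4⟩ := hk.cutExt_spec h hz
    rw [← h4]
    conv_lhs => rw [h3, norm_polar h1 h2]
    rw [h3]

lemma CutGerm.sign_cutExt (hk : CutGerm η k k') {z : Z} (hz : z ∈ cutDomain η) :
    SignType.sign (cutExt η k z).1 = SignType.sign z.1 := by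
  by_cases h : z.2 = 0
  · rw [cutExt_of_eq_zero h]
  · obtain ⟨R, h1, -, h2, h3, h4⟩ := hk.cutExt_spec h hz
    rw [h3, polar]
    simp only
    rw [div_eq_mul_inv, sign_mul, sign_pos (inv_pos.2 h1), mul_one,
      hk.orbitMap_sign (abs_cutParam_lt hz), sign_cutParam h]

/-- The orbit is recovered through the inverse of `orbitMap`, and the point on it through its
unchanged height. -/
lemma CutGerm.cutExt_cutExt (hk : CutGerm η k k') {z : Z}
    (hz : z ∈ cutDomain η) (hz' : cutExt η k z ∈ cutDomain η) :
    cutExt η k' (cutExt η k z) = z := by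
  by_cases h : z.2 = 0
  · rw [cutExt_of_eq_zero (k := k) h, cutExt_of_eq_zero h]
  · obtain ⟨R, h1, -, h2, h3, h4⟩ := hk.cutExt_spec h hz
    have h5 : (cutExt η k z).2 ≠ 0 := by
      rw [← norm_ne_zero_iff, h3, norm_polar h1 h2]; exact h1.ne'
    have h6 : cutParam (cutExt η k z) = orbitMap η k (cutParam z) := by
      rw [h3, cutParam_polar h1 h2]
    have h7 : orbitMap η k' (orbitMap η k (cutParam z)) = cutParam z :=
      hk.orbitMap_orbitMap (abs_cutParam_lt hz) (h6 ▸ abs_cutParam_lt hz')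
    rw [cutExt_of_ne_zero h5, hk.height_cutExt hz, h6, h7]
    have hr := norm_pos_iff.2 h
    have h8 : heightRadius (height z.1 ‖z.2‖) |(cutParam z).1| = ‖z.2‖ := by
      have := heightRadius_height (abs_nonneg (cutParam z).1) hr
      rwa [show |(cutParam z).1| / ‖z.2‖ = |z.1| by
        simp only [cutParam]; rw [abs_mul, abs_norm, mul_div_assoc, div_self hr.ne', mul_one],
        height_abs] at this
    rw [h8, polar_cutParam h]

lemma cutExt_of_fst_eq_zero {z : Z} (h : z.1 = 0) : cutExt η k z = z := by
  by_cases h0 : z.2 = 0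
  · exact cutExt_of_eq_zero h0
  · have h1 : orbitMap η k (cutParam z) = cutParam z :=
      orbitMap_of_le (by simp only [cutParam, h, zero_mul, abs_zero]; exact depth_nonneg _ _)
    rw [cutExt_of_ne_zero h0, h1]
    have := heightRadius_height (m := 0) le_rfl (norm_pos_iff.2 h0)
    rw [zero_div] at this
    rw [show |(cutParam z).1| = 0 by simp [cutParam, h], h, this, polar_cutParam h0]

/-- Off the stable axis all ingredients are continuous. At the axis the orbit parameter tends to 0
uniformly in the direction, so the radius of the image tends to `heightRadius |x| 0 = 0`; equality
of heights then gives the limit of `|x|`, and preservation of sign that of `x`. -/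
lemma CutGerm.continuousAt_cutExt (hk : CutGerm η k k') {z : Z} (hz : z ∈ cutDomain η) :
    ContinuousAt (cutExt η k) z := by
  by_cases h : z.2 = 0
  · have hd := (isOpen_cutDomain η).mem_nhds hz
    have hv : Tendsto (fun z : Z => height z.1 ‖z.2‖) (𝓝 z) (𝓝 |z.1|) := by
      have h1 : Continuous fun z : Z => height z.1 ‖z.2‖ := by unfold height; fun_prop
      have := h1.tendsto z
      rwa [show height z.1 ‖z.2‖ = |z.1| by
        rw [height, h, norm_zero, mul_zero, sub_zero, neg_zero,
          max_eq_left (abs_nonneg _)]] at this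
    have hn : Tendsto (fun z => ‖(cutExt η k z).2‖) (𝓝 z) (𝓝 0) := by
      rw [Metric.tendsto_nhds]
      intro ε hε
      have h1 : heightRadius |z.1| 0 = 0 := by
        rw [heightRadius, mul_zero, add_zero, Real.sqrt_sq (abs_nonneg _), neg_add_cancel,
          zero_div, max_eq_right (by simp)]
      have h2 : ∀ᶠ q : ℝ × ℝ in 𝓝 |z.1| ×ˢ 𝓝 0, heightRadius q.1 q.2 < ε := by
        rw [← nhds_prod_eq]
        exact continuous_heightRadius.continuousAt.eventually
          (gt_mem_nhds (by simp only [h1]; exact hε))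
      obtain ⟨Pv, hPv, Pm, hPm, hP⟩ := eventually_prod_iff.1 h2
      obtain ⟨δ, hδ, hδm⟩ := Metric.eventually_nhds_iff.1 hPm
      have h3 : Tendsto (fun z : Z => (cutParam z).1) (𝓝 z) (𝓝 0) := by
        have h4 : Continuous fun z : Z => (cutParam z).1 := by
          simp only [cutParam]; fun_prop
        simpa [cutParam, h] using h4.tendsto z
      filter_upwards [hd, hv.eventually hPv, h3.eventually (hk.orbitMap_uniform hδ)]
        with w hw h4 h5
      rw [dist_zero_right, norm_norm]
      by_cases h0 : w.2 = 0
      · rw [cutExt_of_eq_zero h0, h0, norm_zero]; exact hε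
      · obtain ⟨R, h6, h7, h8, h9, -⟩ := hk.cutExt_spec h0 hw
        rw [h9, norm_polar h6 h8, h7]
        refine hP h4 (y := |(orbitMap η k (cutParam w)).1|) (hδm ?_)
        rw [Real.dist_eq, sub_zero, abs_abs]
        exact h5 _ (mem_sphere_zero_iff_norm.2 (norm_cutParam h0))
    have ha : Tendsto (fun z => |(cutExt η k z).1|) (𝓝 z) (𝓝 |z.1|) := by
      have h1 := hv.add (hn.const_mul 2)
      rw [mul_zero, add_zero] at h1
      refine tendsto_of_tendsto_of_tendsto_of_le_of_le' hv h1 ?_ ?_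
      · filter_upwards [hd] with w hw
        rw [← hk.height_cutExt hw]
        exact height_le (norm_nonneg _)
      · filter_upwards [hd] with w hw
        rw [← hk.height_cutExt hw]
        linarith [le_height (cutExt η k w).1 ‖(cutExt η k w).2‖]
    have hx : Tendsto (fun z => (cutExt η k z).1) (𝓝 z) (𝓝 z.1) := by
      rcases lt_trichotomy z.1 0 with h0 | h0 | h0
      · have h1 := ha.neg
        rw [abs_of_neg h0, neg_neg] at h1
        refine h1.congr' ?_
        filter_upwards [hd, continuousAt_fst.eventually (gt_mem_nhds h0)] with w hw hw0
        have := hk.sign_cutExt hw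
        rw [sign_neg hw0] at this
        rw [abs_of_neg (sign_eq_neg_one_iff.1 this), neg_neg]
      · rw [h0] at ha ⊢
        rw [abs_zero] at ha
        exact (tendsto_zero_iff_abs_tendsto_zero _).2 ha
      · rw [abs_of_pos h0] at ha
        refine ha.congr' ?_
        filter_upwards [hd, continuousAt_fst.eventually (lt_mem_nhds h0)] with w hw hw0
        have := hk.sign_cutExt hw
        rw [sign_pos hw0] at this
        rw [abs_of_pos (sign_eq_one_iff.1 this)]
    rw [ContinuousAt, cutExt_of_eq_zero h]
    have hy : Tendsto (fun z => (cutExt η k z).2) (𝓝 z) (𝓝 z.2) := by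
      rw [h]
      exact tendsto_zero_iff_norm_tendsto_zero.2 hn
    exact hx.prodMk_nhds hy
  · obtain ⟨R, h1, h2, h3, h4, -⟩ := hk.cutExt_spec h hz
    have hc : ContinuousAt cutParam z := by
      have : ContinuousAt (fun z : Z => (‖z.2‖⁻¹ : ℝ)) z :=
        (continuous_snd.norm.continuousAt).inv₀ (norm_ne_zero_iff.2 h)
      unfold cutParam
      fun_prop
    have ho : ContinuousAt (fun z => orbitMap η k (cutParam z)) z :=
      ContinuousAt.comp (g := orbitMap η k) (hk.continuousAt_orbitMap (abs_cutParam_lt hz)) hc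
    have hR : ContinuousAt
        (fun z => heightRadius (height z.1 ‖z.2‖) |(orbitMap η k (cutParam z)).1|) z := by
      have h5 : Continuous fun z : Z => height z.1 ‖z.2‖ := by unfold height; fun_prop
      exact ContinuousAt.comp (g := fun q : ℝ × ℝ => heightRadius q.1 q.2)
        (f := fun z => (height z.1 ‖z.2‖, |(orbitMap η k (cutParam z)).1|))
        continuous_heightRadius.continuousAt
        (h5.continuousAt.prodMk (continuousAt_fst.comp ho).abs)
    have := ((continuousAt_fst.comp ho).div hR (by rw [← h2]; exact h1.ne')).prodMk
      (hR.smul (continuousAt_snd.comp ho))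
    refine this.congr ?_
    have hne : ∀ᶠ w : Z in 𝓝 z, w.2 ≠ 0 := continuousAt_snd.eventually (isOpen_ne.mem_nhds h)
    filter_upwards [hne] with w hw
    rw [cutExt_of_ne_zero hw]; rfl

/-- The extension maps orbits to orbits. -/
lemma CutGerm.cutExt_modelFlow (hk : CutGerm η k k') {z : Z} (hz : z ∈ cutDomain η) :
    ∃ σ : ℝ → ℝ, StrictMono σ ∧ Continuous σ ∧
      ∀ t, cutExt η k (modelFlow 0 t z) = modelFlow 0 (σ t) (cutExt η k z) := by
  by_cases h : z.2 = 0
  · refine ⟨id, strictMono_id, continuous_id, fun t => ?_⟩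
    rw [cutExt_of_eq_zero (z := z) h, cutExt_of_eq_zero, id]
    rw [modelFlow_zero_apply, h, smul_zero]
  · set w := orbitMap η k (cutParam z) with hw
    have hr := norm_pos_iff.2 h
    have hF : ∀ t, modelFlow 0 t z = polar (Real.exp t * ‖z.2‖) (cutParam z) := fun t => by
      conv_lhs => rw [← polar_cutParam h]
      rw [modelFlow_polar]
    have hpos : ∀ t, 0 < Real.exp t * ‖z.2‖ := fun t => mul_pos (Real.exp_pos t) hr
    have hcp : ∀ t, cutParam (modelFlow 0 t z) = cutParam z := fun t => by
      rw [hF, cutParam_polar (hpos t) (norm_cutParam h)]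
    have hne : ∀ t, (modelFlow 0 t z).2 ≠ 0 := fun t => by
      rw [← norm_ne_zero_iff, hF, norm_polar (hpos t) (norm_cutParam h)]; exact (hpos t).ne'
    have hdom : ∀ t, modelFlow 0 t z ∈ cutDomain η := fun t => by
      have h1 := abs_cutParam_lt hz
      rw [← hcp t] at h1
      simp only [cutParam] at h1
      rw [abs_mul, abs_norm] at h1
      exact h1
    choose R h1 h2 h3 h4 h5 using fun t => hk.cutExt_spec (hne t) (hdom t)
    simp only [hcp] at h2 h3 h4
    have hcont : Continuous R := by
      have h6 : Continuous fun t => height (modelFlow 0 t z).1 ‖(modelFlow 0 t z).2‖ := by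
        have := (isFlow_modelFlow 0).cont_time z
        exact continuous_height.comp
          ((continuous_fst.comp this).prodMk (continuous_snd.comp this).norm)
      have h7 : R = fun t => heightRadius (height (modelFlow 0 t z).1 ‖(modelFlow 0 t z).2‖)
          |(orbitMap η k (cutParam z)).1| := funext h2
      rw [h7]
      exact continuous_heightRadius.comp (h6.prodMk continuous_const)
    -- Height strictly decreases in time on the original orbit and in the radius on the image orbit.
    -- As it is preserved, the image radius increases with time, and its logarithm is the new time.
    have hmono : StrictMono R := by
      intro s t hst
      by_contra hle
      have hv : height (modelFlow 0 t z).1 ‖(modelFlow 0 t z).2‖ <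
          height (modelFlow 0 s z).1 ‖(modelFlow 0 s z).2‖ := by
        have h6 : ∀ t, height (modelFlow 0 t z).1 ‖(modelFlow 0 t z).2‖ =
            height (|(cutParam z).1| / (Real.exp t * ‖z.2‖)) (Real.exp t * ‖z.2‖) := fun t => by
          rw [hF, norm_polar (hpos t) (norm_cutParam h), polar, ← height_abs, abs_div,
            abs_of_pos (hpos t)]
        rw [h6, h6]
        exact height_strictAnti (abs_nonneg _) (hpos s)
          (mul_lt_mul_of_pos_right (Real.exp_lt_exp.2 hst) hr)
      have h7 : ∀ t, height (modelFlow 0 t z).1 ‖(modelFlow 0 t z).2‖ =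
          height (|w.1| / R t) (R t) := fun t => by
        rw [← h5, h4, polar, ← height_abs, abs_div, abs_of_pos (h1 t)]
      rw [h7, h7] at hv
      rcases (not_lt.1 hle).eq_or_lt with h8 | h8
      · rw [h8] at hv; exact lt_irrefl _ hv
      · exact absurd hv (not_lt.2 (height_strictAnti (abs_nonneg _) (h1 t) h8).le)
    have hz0 : cutExt η k z = polar (R 0) w := by
      have := h4 0
      rwa [(isFlow_modelFlow 0).zero] at this
    refine ⟨fun t => Real.log (R t / R 0), fun s t hst => ?_, ?_, fun t => ?_⟩
    · exact Real.log_lt_log (div_pos (h1 s) (h1 0)) (div_lt_div_of_pos_right (hmono hst) (h1 0))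
    · exact Continuous.log (hcont.div_const _) fun t => (div_pos (h1 t) (h1 0)).ne'
    · rw [hz0, modelFlow_polar, Real.exp_log (div_pos (h1 t) (h1 0)),
        div_mul_cancel₀ _ (h1 0).ne', h4]

/-- Near `(0, 1)` the depth vanishes, so the two maps agree on `‖y‖ = 1`. The germ commutes with the
flow and multiplies no radius, while the extension keeps `-r` because `|x| ≤ r` holds before and
after; hence they agree off that cylinder too. -/
lemma CutGerm.cutExt_eventuallyEq (hk : CutGerm η k k')
    (hflow : ∀ᶠ q : ℝ × Z in 𝓝 ((0 : ℝ), cutPoint),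
      k (modelFlow 0 q.1 q.2) = modelFlow 0 q.1 (k q.2)) :
    cutExt η k =ᶠ[𝓝 cutPoint] k := by
  have hη := hk.pos
  have hkc : ContinuousAt k cutPoint := hk.cont.continuousAt (Metric.ball_mem_nhds _ hη)
  have hke : k cutPoint = cutPoint := hk.fix _ (Metric.mem_ball_self hη) rfl
  have hc : ContinuousAt cutParam cutPoint := by
    have : ContinuousAt (fun z : Z => (‖z.2‖⁻¹ : ℝ)) cutPoint :=
      (continuous_snd.norm.continuousAt).inv₀ (by simp [cutPoint])
    unfold cutParam
    fun_prop
  have hce : cutParam cutPoint = cutPoint := by simp [cutParam, cutPoint]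
  have hball : ∀ᶠ z in 𝓝 cutPoint, z ∈ Metric.ball cutPoint (η / 2) :=
    Metric.ball_mem_nhds _ (half_pos hη)
  have hc' : Tendsto cutParam (𝓝 cutPoint) (𝓝 cutPoint) := by
    have := hc.tendsto; rwa [hce] at this
  have hkc' : Tendsto k (𝓝 cutPoint) (𝓝 cutPoint) := by
    have := hkc.tendsto; rwa [hke] at this
  have hlog : Tendsto (fun z : Z => Real.log ‖z.2‖) (𝓝 cutPoint) (𝓝 0) := by
    have h1 : ContinuousAt (fun z : Z => Real.log ‖z.2‖) cutPoint :=
      (continuous_snd.norm.continuousAt).log (by simp [cutPoint])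
    have := h1.tendsto
    rwa [show Real.log ‖cutPoint.2‖ = 0 by simp [cutPoint]] at this
  have hfl := (hlog.prodMk_nhds hc').eventually hflow
  have hle : ∀ᶠ z : Z in 𝓝 cutPoint, |z.1| < ‖z.2‖ := by
    have : IsOpen {z : Z | |z.1| < ‖z.2‖} := isOpen_lt (by fun_prop) (by fun_prop)
    exact this.mem_nhds (by simp [cutPoint])
  have hne : ∀ᶠ z : Z in 𝓝 cutPoint, z.2 ≠ 0 :=
    continuousAt_snd.eventually (isOpen_ne.mem_nhds (by simp [cutPoint]))
  filter_upwards [hfl, hle, hkc'.eventually hle, hne, hc'.eventually hball,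
    hc'.eventually (hkc'.eventually hball)] with z h1 h2 h3 h4 h5 h6
  have hr := norm_pos_iff.2 h4
  have hdepth : ∀ {w : Z}, w ∈ Metric.ball cutPoint (η / 2) → depth η w.2 = 0 := fun hw =>
    max_eq_right (by linarith [(mem_ball_cutPoint.1 hw).2])
  have hpc : modelFlow 0 (Real.log ‖z.2‖) (cutParam z) = z := by
    have e : cutParam z = polar 1 (cutParam z) := by simp [polar]
    rw [e, modelFlow_polar, Real.exp_log hr, mul_one, polar_cutParam h4]
  have ho : orbitMap η k (cutParam z) = k (cutParam z) := by
    by_cases h : |(cutParam z).1| ≤ 0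
    · rw [orbitMap_of_le (by rwa [hdepth h5]),
        hk.fix _ (Metric.ball_subset_ball (by linarith) h5) (abs_nonpos_iff.1 h)]
    · have e0 : clampTo 0 (cutParam z).1 = 0 := by
        rw [clampTo_of_lt_abs le_rfl (not_le.1 h), mul_zero]
      rw [orbitMap, hdepth h5, if_neg h, e0]
      simp only [sub_zero, add_zero]
      rw [hdepth h6, mul_zero, add_zero]
  simp only [hpc] at h1
  have e1 : k (cutParam z) = polar 1 (k (cutParam z)) := by simp [polar]
  rw [e1, modelFlow_polar, Real.exp_log hr, mul_one] at h1
  have hkn : ‖(k (cutParam z)).2‖ = 1 := by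
    rw [hk.norm _ (Metric.ball_subset_ball (by linarith) h5), norm_cutParam h4]
  rw [h1, norm_polar hr hkn] at h3
  simp only [polar] at h3
  rw [cutExt_of_ne_zero h4, ho, h1]
  congr 1
  rw [height_of_abs_le h2.le]
  have h7 := heightRadius_height (abs_nonneg (k (cutParam z)).1) hr
  rwa [height_of_abs_le] at h7
  rw [abs_div, abs_of_pos hr] at h3
  rw [abs_div, abs_abs, abs_of_pos hr]
  exact h3.le

end CutExt

end SaddleConn

/-! ### Gluing of homeomorphisms and of arcs of orbits -/

namespace SaddleConn

section Gluing

variable {A B : Type*} [TopologicalSpace A] [TopologicalSpace B]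

open Classical in
/-- The union of two partial homeomorphisms that agree, together with their inverses. -/
def unionHomeo (e₁ e₂ : OpenPartialHomeomorph A B)
    (h : EqOn e₁ e₂ (e₁.source ∩ e₂.source))
    (h' : EqOn e₁.symm e₂.symm (e₁.target ∩ e₂.target)) : OpenPartialHomeomorph A B where
  toFun x := if x ∈ e₁.source then e₁ x else e₂ x
  invFun y := if y ∈ e₁.target then e₁.symm y else e₂.symm y
  source := e₁.source ∪ e₂.source
  target := e₁.target ∪ e₂.target
  map_source' x hx := by
    by_cases h1 : x ∈ e₁.source
    · rw [if_pos h1]; exact Or.inl (e₁.map_source h1)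
    · rw [if_neg h1]; exact Or.inr (e₂.map_source (hx.resolve_left h1))
  map_target' y hy := by
    by_cases h1 : y ∈ e₁.target
    · rw [if_pos h1]; exact Or.inl (e₁.map_target h1)
    · rw [if_neg h1]; exact Or.inr (e₂.map_target (hy.resolve_left h1))
  left_inv' x hx := by
    by_cases h1 : x ∈ e₁.source
    · rw [if_pos h1, if_pos (e₁.map_source h1), e₁.left_inv h1]
    · have h2 := hx.resolve_left h1
      rw [if_neg h1]
      by_cases h3 : e₂ x ∈ e₁.target
      · rw [if_pos h3, h' ⟨h3, e₂.map_source h2⟩, e₂.left_inv h2]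
      · rw [if_neg h3, e₂.left_inv h2]
  right_inv' y hy := by
    by_cases h1 : y ∈ e₁.target
    · rw [if_pos h1, if_pos (e₁.map_target h1), e₁.right_inv h1]
    · have h2 := hy.resolve_left h1
      rw [if_neg h1]
      by_cases h3 : e₂.symm y ∈ e₁.source
      · rw [if_pos h3, h ⟨h3, e₂.map_target h2⟩, e₂.right_inv h2]
      · rw [if_neg h3, e₂.right_inv h2]
  open_source := e₁.open_source.union e₂.open_source
  open_target := e₁.open_target.union e₂.open_target
  continuousOn_toFun := by
    refine ContinuousOn.union_of_isOpen ?_ ?_ e₁.open_source e₂.open_source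
    · exact e₁.continuousOn.congr fun x hx => if_pos hx
    · refine e₂.continuousOn.congr fun x hx => ?_
      by_cases h1 : x ∈ e₁.source
      · simp only [if_pos h1]; exact h ⟨h1, hx⟩
      · exact if_neg h1
  continuousOn_invFun := by
    refine ContinuousOn.union_of_isOpen ?_ ?_ e₁.open_target e₂.open_target
    · exact e₁.continuousOn_symm.congr fun x hx => if_pos hx
    · refine e₂.continuousOn_symm.congr fun x hx => ?_
      by_cases h1 : x ∈ e₁.target
      · simp only [if_pos h1]; exact h' ⟨h1, hx⟩
      · exact if_neg h1

variable {e₁ e₂ : OpenPartialHomeomorph A B} {h : EqOn e₁ e₂ (e₁.source ∩ e₂.source)}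
  {h' : EqOn e₁.symm e₂.symm (e₁.target ∩ e₂.target)}

lemma unionHomeo_eqOn_left : EqOn (unionHomeo e₁ e₂ h h') e₁ e₁.source := fun _ hx => if_pos hx

lemma unionHomeo_eqOn_right : EqOn (unionHomeo e₁ e₂ h h') e₂ e₂.source := fun x hx => by
  by_cases h1 : x ∈ e₁.source
  · exact (unionHomeo_eqOn_left h1).trans (h ⟨h1, hx⟩)
  · exact if_neg h1

lemma unionHomeo_symm_eqOn_left : EqOn (unionHomeo e₁ e₂ h h').symm e₁.symm e₁.target :=
  fun _ hx => if_pos hx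

lemma unionHomeo_symm_eqOn_right : EqOn (unionHomeo e₁ e₂ h h').symm e₂.symm e₂.target :=
  fun x hx => by
  by_cases h1 : x ∈ e₁.target
  · exact (unionHomeo_symm_eqOn_left h1).trans (h' ⟨h1, hx⟩)
  · exact if_neg h1

end Gluing

variable {M : Type*} [TopologicalSpace M] [ChartedSpace E3 M]
variable {N : Type*} [TopologicalSpace N] [ChartedSpace E3 N]
variable {X : (x : M) → TangentSpace (𝓡 3) x} {Y : (x : N) → TangentSpace (𝓡 3) x}

/-- The map `f` takes the arc `γ` on `[a, b]` to an arc of orbit of `Y`, up to an increasing change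
of time. -/
def MapsArc (Y : (x : N) → TangentSpace (𝓡 3) x) (f : M → N) (γ : ℝ → M) (a b : ℝ) : Prop :=
  ∃ (d : ℝ → N) (σ : ℝ → ℝ), StrictMonoOn σ (Icc a b) ∧ ContinuousOn σ (Icc a b) ∧
    IsMIntegralCurveOn d Y (Icc (σ a) (σ b)) ∧ ∀ t ∈ Icc a b, f (γ t) = d (σ t)

lemma MapsArc.congr {f g : M → N} {γ : ℝ → M} {a b : ℝ} (h : MapsArc Y f γ a b)
    (e : ∀ t ∈ Icc a b, g (γ t) = f (γ t)) : MapsArc Y g γ a b := by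
  obtain ⟨d, σ, h1, h2, h3, h4⟩ := h
  exact ⟨d, σ, h1, h2, h3, fun t ht => (e t ht).trans (h4 t ht)⟩

/-- The clock of the second image arc is shifted by `δ` so as to continue that of the first. -/
lemma MapsArc.concat {f : M → N} {γ : ℝ → M} {a b c : ℝ} (hab : a ≤ b) (hbc : b ≤ c)
    (h₁ : MapsArc Y f γ a b) (h₂ : MapsArc Y f γ b c) : MapsArc Y f γ a c := by
  obtain ⟨d₁, σ₁, m₁, c₁, i₁, e₁⟩ := h₁
  obtain ⟨d₂, σ₂, m₂, c₂, i₂, e₂⟩ := h₂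
  set δ := σ₁ b - σ₂ b with hδ
  have hσ₁ : EqOn (fun t => if t ≤ b then σ₁ t else σ₂ t + δ) σ₁ (Icc a b) :=
    fun t ht => if_pos ht.2
  have hσ₂ : EqOn (fun t => if t ≤ b then σ₁ t else σ₂ t + δ) (fun t => σ₂ t + δ) (Icc b c) :=
    fun t ht => by
      rcases ht.1.eq_or_lt with h | h
      · subst h; simp [hδ]
      · exact if_neg (not_le.2 h)
  have hU : Icc a b ∪ Icc b c = Icc a c := Icc_union_Icc_eq_Icc hab hbc
  have hm₁ : σ₁ a ≤ σ₁ b := m₁.monotoneOn ⟨le_rfl, hab⟩ ⟨hab, le_rfl⟩ hab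
  have hm₂ : σ₂ b ≤ σ₂ c := m₂.monotoneOn ⟨le_rfl, hbc⟩ ⟨hbc, le_rfl⟩ hbc
  have hb : d₁ (σ₁ b) = d₂ (σ₁ b + -δ) := by
    rw [show σ₁ b + -δ = σ₂ b by rw [hδ]; ring, ← e₁ b ⟨hab, le_rfl⟩, e₂ b ⟨le_rfl, hbc⟩]
  refine ⟨fun τ => if τ ≤ σ₁ b then d₁ τ else d₂ (τ + -δ),
    fun t => if t ≤ b then σ₁ t else σ₂ t + δ, ?_, ?_, ?_, ?_⟩
  · rw [← hU]
    refine StrictMonoOn.union (c := b) (m₁.congr hσ₁.symm) ?_ (isGreatest_Icc hab) (isLeast_Icc hbc)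
    exact StrictMonoOn.congr (fun x hx y hy hxy => add_lt_add_left (m₂ hx hy hxy) δ) hσ₂.symm
  · rw [← hU]
    exact ContinuousOn.union_of_isClosed (c₁.congr hσ₁)
      ((c₂.add continuousOn_const).congr hσ₂) isClosed_Icc isClosed_Icc
  · have e1 := hσ₁ ⟨le_rfl, hab⟩
    have e2 := hσ₂ ⟨hbc, le_rfl⟩
    simp only at e1 e2 ⊢
    rw [e1, e2]
    refine isMIntegralCurveOn_concat (γ₂ := fun τ => d₂ (τ + -δ)) hm₁ (by rw [hδ]; linarith) i₁
      (isMIntegralCurveOn_shift i₂ (-δ) fun t ht => ?_) hb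
    exact ⟨by linarith [ht.1], by linarith [ht.2]⟩
  · intro t ht
    by_cases h : t ≤ b
    · have h1 : σ₁ t ≤ σ₁ b := m₁.monotoneOn ⟨ht.1, h⟩ ⟨hab, le_rfl⟩ h
      simp only [if_pos h, if_pos h1]
      exact e₁ t ⟨ht.1, h⟩
    · have h1 : ¬σ₂ t + δ ≤ σ₁ b := by
        have := m₂ ⟨le_rfl, hbc⟩ ⟨(not_le.1 h).le, ht.2⟩ (not_le.1 h)
        rw [hδ]; linarith
      simp only [if_neg h, if_neg h1, add_neg_cancel_right]
      exact e₂ t ⟨(not_le.1 h).le, ht.2⟩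

/-- Whether an arc is mapped to an arc is a local question. -/
lemma mapsArc_of_local {f : M → N} {γ : ℝ → M} {a b : ℝ} (hab : a < b)
    (hγ : ContinuousOn γ (Icc a b))
    (h : ∀ t ∈ Icc a b, ∃ U, IsOpen U ∧ γ t ∈ U ∧ ∀ u v, a ≤ u → u < v → v ≤ b →
      (∀ t ∈ Icc u v, γ t ∈ U) → MapsArc Y f γ u v) : MapsArc Y f γ a b := by
  choose! U hU hmem hloc using h
  obtain ⟨τ, h0, hmono, ⟨m, hm⟩, hcov⟩ := exists_monotone_Icc_subset_open_cover_Icc hab.le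
    (c := fun t : Icc a b => (Icc a b).domRestrict γ ⁻¹' U t)
    (fun t => (hU t t.2).preimage hγ.domRestrict) (fun t _ => mem_iUnion.2 ⟨t, hmem t t.2⟩)
  have key : ∀ n, (τ n : ℝ) = a ∨ MapsArc Y f γ a (τ n) := by
    intro n
    induction n with
    | zero => exact Or.inl (by rw [h0])
    | succ n ih =>
      have hle : (τ n : ℝ) ≤ τ (n + 1) := hmono n.le_succ
      rcases hle.eq_or_lt with h1 | h1
      · rwa [← h1]
      · obtain ⟨i, hi⟩ := hcov n
        have h2 : MapsArc Y f γ (τ n) (τ (n + 1)) := by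
          refine hloc i i.2 _ _ (τ n).2.1 h1 (τ (n + 1)).2.2 fun t ht => ?_
          have h3 : (⟨t, (τ n).2.1.trans ht.1, ht.2.trans (τ (n + 1)).2.2⟩ : Icc a b) ∈
              Icc (τ n) (τ (n + 1)) := ht
          exact hi h3
        rcases ih with h3 | h3
        · rw [h3] at h2; exact Or.inr h2
        · exact Or.inr (h3.concat (τ n).2.1 hle h2)
  rcases key m with h1 | h1
  · rw [hm m le_rfl] at h1; exact absurd h1 hab.ne'
  · rwa [hm m le_rfl] at h1

lemma mapsOrbits_of_mapsArc {h : OpenPartialHomeomorph M N}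
    (H : ∀ (γ : ℝ → M) (a b : ℝ), a < b → IsMIntegralCurveOn γ X (Icc a b) →
      (∀ t ∈ Icc a b, γ t ∈ h.source) → MapsArc Y h γ a b) : MapsOrbits X Y h := by
  intro γ a b hab hγ hs
  obtain ⟨d, σ, h1, h2, h3, h4⟩ := H γ a b hab hγ hs
  refine ⟨d, σ, h1, h2, h3, fun t ht => ?_, h4⟩
  obtain ⟨u, hu, rfl⟩ := intermediate_value_Icc hab.le h2 ht
  rw [← h4 u hu]
  exact h.map_source (hs u hu)

/-- A map that is a change of time in flow charts maps arcs to arcs. -/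
lemma mapsArc_of_conj {φ : OpenPartialHomeomorph M Z} {φ' : OpenPartialHomeomorph N Z}
    {G G' : ℝ → Z → Z} (hφ : Conj X φ G) (hφ' : Conj Y φ' G') {e : Z → Z} {γ : ℝ → M} {a b : ℝ}
    (hab : a < b) (hγ : IsMIntegralCurveOn γ X (Icc a b)) (hs : ∀ t ∈ Icc a b, γ t ∈ φ.source)
    (he : ∃ σ : ℝ → ℝ, StrictMono σ ∧ Continuous σ ∧
      ∀ t, e (G t (φ (γ a))) = G' (σ t) (e (φ (γ a))))
    (ht : ∀ t ∈ Icc a b, e (φ (γ t)) ∈ φ'.target) :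
    MapsArc Y (fun z => φ'.symm (e (φ z))) γ a b := by
  obtain ⟨σ, h1, h2, h3⟩ := he
  have h4 : ∀ t ∈ Icc a b, e (φ (γ t)) = G' (σ (t - a)) (e (φ (γ a))) := fun t ht => by
    rw [hφ.fwd γ a b hγ hs t ht, h3]
  have h5 : ContinuousOn (fun t => σ (t - a)) (Icc a b) :=
    (h2.comp (continuous_id.sub continuous_const)).continuousOn
  refine ⟨fun τ => φ'.symm (G' τ (e (φ (γ a)))), fun t => σ (t - a),
    fun s _ t _ hst => h1 (by linarith), h5, hφ'.bwd _ _ _ fun τ hτ => ?_, fun t ht => ?_⟩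
  · obtain ⟨u, hu, rfl⟩ := intermediate_value_Icc hab.le h5 hτ
    simp only
    rw [← h4 u hu]
    exact ht u hu
  · simp only
    rw [h4 t ht]

end SaddleConn

/-! ### Equivalence of connections with the same normal form -/

namespace SaddleConn

variable {M : Type*} [TopologicalSpace M] [ChartedSpace E3 M] [IsManifold (𝓡 3) ∞ M] [T2Space M]
variable {N : Type*} [TopologicalSpace N] [ChartedSpace E3 N] [IsManifold (𝓡 3) ∞ N] [T2Space N]
variable {Γ : SaddleConnection M} {Γ' : SaddleConnection N} {b c c' s s' : ℝ}
  {φ ψ : OpenPartialHomeomorph M Z} {φ' ψ' : OpenPartialHomeomorph N Z}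

lemma HeadChart.orbit_cut (h : HeadChart Γ c s φ) : φ (Γ.orbit s) = cutPoint := by
  rw [h.orbit s le_rfl]; simp [cutPoint]

lemma TailChart.orbit_cut (h : TailChart Γ b c s ψ) : ψ (Γ.orbit s) = ((1 : ℝ), (0 : ℂ)) := by
  rw [h.orbit s le_rfl]; simp

/-- The comparison of two connections near the cut, in the charts around the heads. -/
def cutMap (φ ψ : OpenPartialHomeomorph M Z) (φ' ψ' : OpenPartialHomeomorph N Z) :
    OpenPartialHomeomorph Z Z := ((φ.symm.trans ψ).trans ψ'.symm).trans φ'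

lemma cutMap_apply (w : Z) : cutMap φ ψ φ' ψ' w = φ' (ψ'.symm (ψ (φ.symm w))) := rfl

lemma tendsto_symm_cutPoint (hφ : HeadChart Γ c s φ) :
    Tendsto φ.symm (𝓝 cutPoint) (𝓝 (Γ.orbit s)) := by
  have h1 := hφ.orbit_mem s le_rfl
  have h2 := φ.symm.continuousAt (φ.map_source h1)
  rw [ContinuousAt, φ.left_inv h1, hφ.orbit_cut] at h2
  exact h2

lemma tendsto_cut_tail (hφ : HeadChart Γ c s φ) (hψ : TailChart Γ b c s ψ) :
    Tendsto (fun w => ψ (φ.symm w)) (𝓝 cutPoint) (𝓝 ((1 : ℝ), (0 : ℂ))) := by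
  have h2 := ψ.continuousAt (hψ.orbit_mem s le_rfl)
  rw [ContinuousAt, hψ.orbit_cut] at h2
  exact h2.comp (tendsto_symm_cutPoint hφ)

lemma tendsto_tail_symm (hψ : TailChart Γ b c s ψ) :
    Tendsto ψ.symm (𝓝 ((1 : ℝ), (0 : ℂ))) (𝓝 (Γ.orbit s)) := by
  have h1 := hψ.orbit_mem s le_rfl
  have h2 := ψ.symm.continuousAt (ψ.map_source h1)
  rw [ContinuousAt, ψ.left_inv h1, hψ.orbit_cut] at h2
  exact h2

lemma cutMap_mem_source (h : NormalForm Γ b c s φ ψ) (h' : NormalForm Γ' b c' s' φ' ψ') :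
    cutPoint ∈ (cutMap φ ψ φ' ψ').source := by
  have h1 := h.head.orbit_mem s le_rfl
  have h2 := h.tail.orbit_mem s le_rfl
  have h3 := h'.head.orbit_mem s' le_rfl
  have h4 := h'.tail.orbit_mem s' le_rfl
  have e1 : φ.symm cutPoint = Γ.orbit s := by rw [← h.head.orbit_cut, φ.left_inv h1]
  have e2 : ψ'.symm ((1 : ℝ), (0 : ℂ)) = Γ'.orbit s' := by
    rw [← h'.tail.orbit_cut, ψ'.left_inv h4]
  have t1 : cutPoint ∈ φ.target := by rw [← h.head.orbit_cut]; exact φ.map_source h1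
  have t2 : ((1 : ℝ), (0 : ℂ)) ∈ ψ'.target := by
    rw [← h'.tail.orbit_cut]; exact ψ'.map_source h4
  simp only [cutMap, OpenPartialHomeomorph.trans_source, mem_inter_iff, mem_preimage,
    OpenPartialHomeomorph.symm_source, OpenPartialHomeomorph.coe_trans, Function.comp_apply, e1,
    h.tail.orbit_cut, e2]
  exact ⟨⟨⟨t1, h2⟩, t2⟩, h3⟩

lemma eventually_ball {e : Z} {P : Z → Prop} (h : ∀ᶠ w in 𝓝 e, P w) :
    ∀ᶠ η in 𝓝[>] (0 : ℝ), ∀ w ∈ Metric.ball e η, P w := by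
  obtain ⟨δ, hδ, h1⟩ := Metric.eventually_nhds_iff_ball.1 h
  filter_upwards [Ioo_mem_nhdsGT hδ] with η hη w hw
  exact h1 w (Metric.ball_subset_ball hη.2.le hw)

/-- Both head charts are tied to the same tail coordinates: the modulus of `y` is the inverse of the
tail's `x`, the sign of `x` is that of the real part of the label, and on the unstable plane the
angle is its imaginary part. Comparing the two charts gives each clause. -/
lemma eventually_cutGerm (h : NormalForm Γ b c s φ ψ) (h' : NormalForm Γ' b c' s' φ' ψ') :
    ∀ᶠ η in 𝓝[>] (0 : ℝ), CutGerm η (cutMap φ ψ φ' ψ') (cutMap φ' ψ' φ ψ) := by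
  set K := cutMap φ ψ φ' ψ' with hK
  have hz := tendsto_symm_cutPoint h.head
  have hq := tendsto_cut_tail h.head h.tail
  have hz' := (tendsto_tail_symm h'.tail).comp hq
  have hφt : ∀ᶠ w in 𝓝 cutPoint, w ∈ φ.target :=
    φ.open_target.mem_nhds (by
      rw [← h.head.orbit_cut]; exact φ.map_source (h.head.orbit_mem s le_rfl))
  have hψt : ∀ᶠ w in 𝓝 ((1 : ℝ), (0 : ℂ)), w ∈ ψ'.target :=
    ψ'.open_target.mem_nhds (by
      rw [← h'.tail.orbit_cut]; exact ψ'.map_source (h'.tail.orbit_mem s' le_rfl))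
  have hpos : ∀ᶠ w : Z in 𝓝 ((1 : ℝ), (0 : ℂ)), 0 < w.1 :=
    continuousAt_fst.eventually (lt_mem_nhds one_pos)
  have hnorm : ∀ᶠ w in 𝓝 cutPoint, ‖(K w).2‖ = ‖w.2‖ := by
    filter_upwards [hz.eventually h.norm, hz'.eventually h'.norm, hφt, hq.eventually hψt,
      hq.eventually hpos] with w h1 h2 h3 h4 h5
    simp only [Function.comp_apply] at h2
    rw [φ.right_inv h3] at h1
    rw [ψ'.right_inv h4] at h2
    exact mul_right_cancel₀ h5.ne' (h2.trans h1.symm)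
  have hsign : ∀ᶠ w in 𝓝 cutPoint, SignType.sign (K w).1 = SignType.sign w.1 := by
    filter_upwards [hz.eventually h.sign, hz'.eventually h'.sign, hφt, hq.eventually hψt]
      with w h1 h2 h3 h4
    simp only [Function.comp_apply] at h2
    rw [φ.right_inv h3] at h1
    rw [ψ'.right_inv h4] at h2
    exact h2.trans h1.symm
  have hfix : ∀ᶠ w in 𝓝 cutPoint, w.1 = 0 → K w = w := by
    filter_upwards [hz.eventually h.arg, hz'.eventually h'.arg, hφt, hq.eventually hψt,
      hnorm, hsign] with w h1 h2 h3 h4 h5 h6 h7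
    simp only [Function.comp_apply] at h2
    rw [φ.right_inv h3] at h1
    rw [ψ'.right_inv h4] at h2
    rw [h7, sign_zero, sign_eq_zero_iff] at h6
    exact Prod.ext (h6.trans h7.symm) (Complex.ext_norm_arg h5 ((h2 h6).trans (h1 h7).symm))
  have hsrc : ∀ᶠ w in 𝓝 cutPoint, w ∈ K.source :=
    K.open_source.mem_nhds (cutMap_mem_source h h')
  filter_upwards [self_mem_nhdsWithin, eventually_ball hnorm, eventually_ball hsign,
    eventually_ball hfix, eventually_ball hsrc] with η h0 h1 h2 h3 h4
  exact ⟨h0, K.continuousOn.mono h4, h1, h2, h3, fun w hw _ => K.left_inv (h4 w hw)⟩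

lemma cutMap_modelFlow (h : NormalForm Γ b c s φ ψ) (h' : NormalForm Γ' b c' s' φ' ψ') :
    ∀ᶠ q : ℝ × Z in 𝓝 ((0 : ℝ), cutPoint), cutMap φ ψ φ' ψ' (modelFlow 0 q.1 q.2) =
      modelFlow 0 q.1 (cutMap φ ψ φ' ψ' q.2) := by
  have hq := tendsto_cut_tail h.head h.tail
  have hz := tendsto_symm_cutPoint h.head
  have hsnd : Tendsto (fun q : ℝ × Z => q.2) (𝓝 ((0 : ℝ), cutPoint)) (𝓝 cutPoint) :=
    continuous_snd.tendsto _
  have hfst : Tendsto (fun q : ℝ × Z => q.1) (𝓝 ((0 : ℝ), cutPoint)) (𝓝 0) :=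
    continuous_fst.tendsto _
  have hpair : Tendsto (fun q : ℝ × Z => (q.1, ψ (φ.symm q.2))) (𝓝 ((0 : ℝ), cutPoint))
      (𝓝 ((0 : ℝ), ((1 : ℝ), (0 : ℂ)))) := hfst.prodMk_nhds (hq.comp hsnd)
  have hflow : Tendsto (fun q : ℝ × Z => modelFlow b q.1 q.2) (𝓝 ((0 : ℝ), ((1 : ℝ), (0 : ℂ))))
      (𝓝 ((1 : ℝ), (0 : ℂ))) := by
    have := (isFlow_modelFlow b).cont.tendsto ((0 : ℝ), ((1 : ℝ), (0 : ℂ)))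
    simpa only [(isFlow_modelFlow b).zero] using this
  have hψs : ∀ᶠ z in 𝓝 (Γ.orbit s), z ∈ ψ.source :=
    ψ.open_source.mem_nhds (h.tail.orbit_mem s le_rfl)
  have hφs : ∀ᶠ z in 𝓝 (Γ.orbit s), z ∈ φ.source :=
    φ.open_source.mem_nhds (h.head.orbit_mem s le_rfl)
  have hφt : ∀ᶠ w in 𝓝 cutPoint, w ∈ φ.target :=
    φ.open_target.mem_nhds (by
      rw [← h.head.orbit_cut]; exact φ.map_source (h.head.orbit_mem s le_rfl))
  have hψt : ∀ᶠ w in 𝓝 ((1 : ℝ), (0 : ℂ)), w ∈ ψ.target :=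
    ψ.open_target.mem_nhds (by
      rw [← h.tail.orbit_cut]; exact ψ.map_source (h.tail.orbit_mem s le_rfl))
  filter_upwards [hpair.eventually (transition_flow h.head h.tail),
    hpair.eventually (transition_flow h'.head h'.tail), hsnd.eventually hφt,
    hsnd.eventually (hz.eventually hψs), (hflow.comp hpair).eventually hψt,
    (hflow.comp hpair).eventually ((tendsto_tail_symm h.tail).eventually hφs)]
    with q h1 h2 h3 h4 h5 h6
  simp only [Function.comp_apply] at h5 h6
  simp only [ψ.left_inv h4, φ.right_inv h3] at h1
  simp only [cutMap_apply]
  rw [← h1, φ.left_inv h6, ψ.right_inv h5, h2]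

/-- The homeomorphism between neighbourhoods of the heads. -/
def headMap (η : ℝ) (φ ψ : OpenPartialHomeomorph M Z) (φ' ψ' : OpenPartialHomeomorph N Z) (z : M) :
    N := φ'.symm (cutExt η (cutMap φ ψ φ' ψ') (φ z))

/-- A neighbourhood of the head on which `headMap` is defined. -/
def headDomain (η : ℝ) (φ ψ : OpenPartialHomeomorph M Z) (φ' ψ' : OpenPartialHomeomorph N Z) :
    Set M := φ.source ∩ φ ⁻¹' (cutDomain η ∩ cutExt η (cutMap φ ψ φ' ψ') ⁻¹'
      (φ'.target ∩ cutDomain η))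

section HeadMap

variable {η : ℝ}

lemma CutGerm.continuousOn_cutExt {k k' : Z → Z} (hk : CutGerm η k k') :
    ContinuousOn (cutExt η k) (cutDomain η) :=
  fun _ hz => (hk.continuousAt_cutExt hz).continuousWithinAt

lemma isOpen_headDomain (hk : CutGerm η (cutMap φ ψ φ' ψ') (cutMap φ' ψ' φ ψ)) :
    IsOpen (headDomain η φ ψ φ' ψ') := by
  refine φ.isOpen_inter_preimage ?_
  exact hk.continuousOn_cutExt.isOpen_inter_preimage (isOpen_cutDomain η)
    (φ'.open_target.inter (isOpen_cutDomain η))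

lemma continuousOn_headMap (hk : CutGerm η (cutMap φ ψ φ' ψ') (cutMap φ' ψ' φ ψ)) :
    ContinuousOn (headMap η φ ψ φ' ψ') (headDomain η φ ψ φ' ψ') := by
  refine φ'.continuousOn_symm.comp (t := φ'.target) ?_ fun z hz => hz.2.2.1
  exact hk.continuousOn_cutExt.comp (φ.continuousOn.mono inter_subset_left) fun z hz => hz.2.1

lemma headMap_headMap (hk : CutGerm η (cutMap φ ψ φ' ψ') (cutMap φ' ψ' φ ψ)) {z : M}
    (hz : z ∈ headDomain η φ ψ φ' ψ') :
    headMap η φ' ψ' φ ψ (headMap η φ ψ φ' ψ' z) = z := by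
  rw [headMap, headMap, φ'.right_inv hz.2.2.1, hk.cutExt_cutExt hz.2.1 hz.2.2.2,
    φ.left_inv hz.1]

lemma mapsArc_headMap (h : HeadChart Γ c s φ) (h' : HeadChart Γ' c' s' φ')
    (hk : CutGerm η (cutMap φ ψ φ' ψ') (cutMap φ' ψ' φ ψ)) {γ : ℝ → M} {u v : ℝ} (huv : u < v)
    (hγ : IsMIntegralCurveOn γ Γ.X (Icc u v)) (hs : ∀ t ∈ Icc u v, γ t ∈ headDomain η φ ψ φ' ψ') :
    MapsArc Γ'.X (headMap η φ ψ φ' ψ') γ u v := by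
  refine mapsArc_of_conj h.conj h'.conj huv hγ (fun t ht => (hs t ht).1) ?_
    fun t ht => (hs t ht).2.2.1
  obtain ⟨σ, h1, h2, h3⟩ := hk.cutExt_modelFlow (hs u ⟨le_rfl, huv.le⟩).2.1
  refine ⟨fun t => σ (c * t) / c', fun x y hxy => ?_, by fun_prop, fun t => ?_⟩
  · exact div_lt_div_of_pos_right (h1 (mul_lt_mul_of_pos_left hxy h.pos)) h'.pos
  · simp only
    rw [h3, mul_div_cancel₀ _ h'.pos.ne']

/-- The map between the heads on the connection itself. -/
lemma headMap_orbit (h : HeadChart Γ c s φ) (h' : HeadChart Γ' c' s' φ') (hη : 0 < η) {t : ℝ}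
    (ht : t ≤ s) : Γ.orbit t ∈ headDomain η φ ψ φ' ψ' ∧
      headMap η φ ψ φ' ψ' (Γ.orbit t) = Γ'.orbit (s' + c * (t - s) / c') := by
  have hc' := h'.pos
  have ht' : s' + c * (t - s) / c' ≤ s' := by
    have : c * (t - s) / c' ≤ 0 := div_nonpos_of_nonpos_of_nonneg
      (mul_nonpos_of_nonneg_of_nonpos h.pos.le (by linarith)) hc'.le
    linarith
  have e1 := h.orbit t ht
  have e2 : φ' (Γ'.orbit (s' + c * (t - s) / c')) = φ (Γ.orbit t) := by
    rw [h'.orbit _ ht', e1, add_sub_cancel_left, mul_div_cancel₀ _ hc'.ne']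
  have e3 : cutExt η (cutMap φ ψ φ' ψ') (φ (Γ.orbit t)) = φ (Γ.orbit t) :=
    cutExt_of_fst_eq_zero (by rw [e1])
  have hd : φ (Γ.orbit t) ∈ cutDomain η := by
    rw [e1, cutDomain, mem_ofPred_eq]; simpa using hη
  refine ⟨⟨h.orbit_mem t ht, hd, ?_⟩, ?_⟩
  · rw [mem_preimage, e3]
    exact ⟨by rw [← e2]; exact φ'.map_source (h'.orbit_mem _ ht'), hd⟩
  · rw [headMap, e3, ← e2, φ'.left_inv (h'.orbit_mem _ ht')]

lemma headMap_base (h : HeadChart Γ c s φ) (h' : HeadChart Γ' c' s' φ') (hη : 0 < η) :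
    Γ.p ∈ headDomain η φ ψ φ' ψ' ∧ headMap η φ ψ φ' ψ' Γ.p = Γ'.p := by
  have e3 : cutExt η (cutMap φ ψ φ' ψ') (0 : Z) = 0 := cutExt_of_eq_zero rfl
  have hd : (0 : Z) ∈ cutDomain η := by rw [cutDomain, mem_ofPred_eq]; simpa using hη
  refine ⟨⟨h.base_mem, ?_⟩, ?_⟩
  · rw [mem_preimage, h.base]
    refine ⟨hd, ?_⟩
    rw [mem_preimage, e3]
    exact ⟨by rw [← h'.base]; exact φ'.map_source h'.base_mem, hd⟩
  · rw [headMap, h.base, e3, ← h'.base, φ'.left_inv h'.base_mem]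

lemma head_subset_headDomain (h : HeadChart Γ c s φ) (h' : HeadChart Γ' c' s' φ') (hη : 0 < η) :
    Γ.head s ⊆ headDomain η φ ψ φ' ψ' := by
  rintro _ (rfl | ⟨t, ht, rfl⟩)
  · exact (headMap_base h h' hη).1
  · exact (headMap_orbit h h' hη ht).1

lemma headMap_image (h : HeadChart Γ c s φ) (h' : HeadChart Γ' c' s' φ') (hη : 0 < η) :
    headMap η φ ψ φ' ψ' '' Γ.head s = Γ'.head s' := by
  have hc := h.pos
  have hc' := h'.pos
  apply Subset.antisymm
  · rintro _ ⟨_, rfl | ⟨t, ht, rfl⟩, rfl⟩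
    · rw [(headMap_base h h' hη).2]; exact Or.inl rfl
    · rw [(headMap_orbit h h' hη ht).2]
      refine Or.inr ⟨_, ?_, rfl⟩
      have : c * (t - s) / c' ≤ 0 := div_nonpos_of_nonpos_of_nonneg
        (mul_nonpos_of_nonneg_of_nonpos hc.le (by linarith [mem_Iic.1 ht])) hc'.le
      rw [mem_Iic]; linarith
  · rintro _ (rfl | ⟨t, ht, rfl⟩)
    · exact ⟨_, Or.inl rfl, (headMap_base h h' hη).2⟩
    · have ht1 : s + c' * (t - s') / c ≤ s := by
        have : c' * (t - s') / c ≤ 0 := div_nonpos_of_nonpos_of_nonneg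
          (mul_nonpos_of_nonneg_of_nonpos hc'.le (by linarith [mem_Iic.1 ht])) hc.le
        linarith
      refine ⟨_, Or.inr ⟨s + c' * (t - s') / c, ht1, rfl⟩, ?_⟩
      rw [(headMap_orbit h h' hη ht1).2]
      congr 1
      field_simp
      ring

/-- Near the cut, the map between the heads agrees with the map between the tails. -/
lemma headMap_eventuallyEq (h : NormalForm Γ b c s φ ψ) (h' : NormalForm Γ' b c' s' φ' ψ')
    (hk : CutGerm η (cutMap φ ψ φ' ψ') (cutMap φ' ψ' φ ψ)) :
    ∀ᶠ z in 𝓝 (Γ.orbit s), headMap η φ ψ φ' ψ' z = ψ'.symm (ψ z) := by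
  have h1 : Tendsto φ (𝓝 (Γ.orbit s)) (𝓝 cutPoint) := by
    have := φ.continuousAt (h.head.orbit_mem s le_rfl)
    rwa [ContinuousAt, h.head.orbit_cut] at this
  have h2 : Tendsto (fun z => ψ'.symm (ψ z)) (𝓝 (Γ.orbit s)) (𝓝 (Γ'.orbit s')) := by
    have := ψ.continuousAt (h.tail.orbit_mem s le_rfl)
    rw [ContinuousAt, h.tail.orbit_cut] at this
    exact (tendsto_tail_symm h'.tail).comp this
  filter_upwards [h1.eventually (hk.cutExt_eventuallyEq (cutMap_modelFlow h h')),
    φ.open_source.mem_nhds (h.head.orbit_mem s le_rfl),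
    h2.eventually (φ'.open_source.mem_nhds (h'.head.orbit_mem s' le_rfl))] with z h3 h4 h5
  rw [headMap, h3, cutMap_apply, φ.left_inv h4, φ'.left_inv h5]

end HeadMap

section TailMap

lemma tailMap_orbit (h : TailChart Γ b c s ψ) (h' : TailChart Γ' b c' s' ψ') {t : ℝ}
    (ht : s ≤ t) : ψ (Γ.orbit t) ∈ ψ'.target ∧
      ψ'.symm (ψ (Γ.orbit t)) = Γ'.orbit (s' + c * (t - s) / c') := by
  have hc' := h'.pos
  have ht' : s' ≤ s' + c * (t - s) / c' := by
    have : 0 ≤ c * (t - s) / c' :=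
      div_nonneg (mul_nonneg h.pos.le (by linarith)) hc'.le
    linarith
  have e2 : ψ' (Γ'.orbit (s' + c * (t - s) / c')) = ψ (Γ.orbit t) := by
    rw [h'.orbit _ ht', h.orbit t ht, add_sub_cancel_left, mul_div_cancel₀ _ hc'.ne']
  rw [← e2]
  exact ⟨ψ'.map_source (h'.orbit_mem _ ht'), ψ'.left_inv (h'.orbit_mem _ ht')⟩

lemma tailMap_base (h : TailChart Γ b c s ψ) (h' : TailChart Γ' b c' s' ψ') :
    ψ Γ.q ∈ ψ'.target ∧ ψ'.symm (ψ Γ.q) = Γ'.q := by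
  rw [h.base, ← h'.base]
  exact ⟨ψ'.map_source h'.base_mem, ψ'.left_inv h'.base_mem⟩

lemma tail_subset_tailDomain (h : TailChart Γ b c s ψ) (h' : TailChart Γ' b c' s' ψ') :
    Γ.tail s ⊆ (ψ.trans ψ'.symm).source := by
  rintro _ (rfl | ⟨t, ht, rfl⟩)
  · exact ⟨h.base_mem, (tailMap_base h h').1⟩
  · exact ⟨h.orbit_mem t ht, (tailMap_orbit h h' ht).1⟩

lemma tailMap_image (h : TailChart Γ b c s ψ) (h' : TailChart Γ' b c' s' ψ') :
    ψ.trans ψ'.symm '' Γ.tail s = Γ'.tail s' := by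
  have hc := h.pos
  have hc' := h'.pos
  apply Subset.antisymm
  · rintro _ ⟨_, rfl | ⟨t, ht, rfl⟩, rfl⟩
    · exact Or.inl (tailMap_base h h').2
    · refine Or.inr ⟨_, ?_, (tailMap_orbit h h' ht).2.symm⟩
      have : 0 ≤ c * (t - s) / c' :=
        div_nonneg (mul_nonneg hc.le (by linarith [mem_Ici.1 ht])) hc'.le
      rw [mem_Ici]; linarith
  · rintro _ (rfl | ⟨t, ht, rfl⟩)
    · exact ⟨_, Or.inl rfl, (tailMap_base h h').2⟩
    · have ht1 : s ≤ s + c' * (t - s') / c := by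
        have : 0 ≤ c' * (t - s') / c :=
          div_nonneg (mul_nonneg hc'.le (by linarith [mem_Ici.1 ht])) hc.le
        linarith
      refine ⟨_, Or.inr ⟨s + c' * (t - s') / c, ht1, rfl⟩, ?_⟩
      refine (tailMap_orbit h h' ht1).2.trans ?_
      congr 1
      field_simp
      ring

lemma mapsArc_tailMap (h : TailChart Γ b c s ψ) (h' : TailChart Γ' b c' s' ψ') {γ : ℝ → M}
    {u v : ℝ} (huv : u < v) (hγ : IsMIntegralCurveOn γ Γ.X (Icc u v))
    (hs : ∀ t ∈ Icc u v, γ t ∈ (ψ.trans ψ'.symm).source) :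
    MapsArc Γ'.X (ψ.trans ψ'.symm) γ u v := by
  refine mapsArc_of_conj (e := id) h.conj h'.conj huv hγ (fun t ht => (hs t ht).1) ?_
    fun t ht => (hs t ht).2
  refine ⟨fun t => c * t / c', fun x y hxy => ?_, by fun_prop, fun t => ?_⟩
  · exact div_lt_div_of_pos_right (mul_lt_mul_of_pos_left hxy h.pos) h'.pos
  · simp only [id]
    rw [mul_div_cancel₀ _ h'.pos.ne']

end TailMap

/-- The extended germ on the head and the identity of the charts on the tail coincide near the cut.
In source and target alike the neighbourhoods of the halves are chosen to overlap only there, so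
both the maps and their inverses can be glued; mapping arcs to arcs is a local property. -/
lemma NormalForm.topEquiv (h : NormalForm Γ b c s φ ψ) (h' : NormalForm Γ' b c' s' φ' ψ') :
    Γ.TopEquiv Γ' := by
  obtain ⟨η, hk, hk'⟩ := ((eventually_cutGerm h h').and (eventually_cutGerm h' h)).exists
  have hη := hk.pos
  obtain ⟨W, hW, hWo, hsW⟩ := _root_.eventually_nhds_iff.1 (headMap_eventuallyEq h h' hk)
  obtain ⟨W', hW', hWo', hsW'⟩ := _root_.eventually_nhds_iff.1 (headMap_eventuallyEq h' h hk')
  set τ := ψ.trans ψ'.symm with hτ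
  obtain ⟨O, R, hO, hR, hhO, htR, hOA, hRC, hOR⟩ := Γ.exists_split s (isOpen_headDomain hk) hWo
    τ.open_source (head_subset_headDomain h.head h'.head hη) hsW
    (tail_subset_tailDomain h.tail h'.tail)
  obtain ⟨O', R', hO', hR', hhO', htR', hOA', hRC', hOR'⟩ := Γ'.exists_split s'
    (isOpen_headDomain hk') hWo' τ.open_target (head_subset_headDomain h'.head h.head hη) hsW'
    (tail_subset_tailDomain h'.tail h.tail)
  set e₁ := partialHomeo (headMap η φ ψ φ' ψ') (headMap η φ' ψ' φ ψ) O O' hO hO'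
    ((continuousOn_headMap hk).mono hOA) ((continuousOn_headMap hk').mono hOA')
    (fun x hx _ => headMap_headMap hk (hOA hx))
    (fun x hx _ => headMap_headMap hk' (hOA' hx)) with he₁
  set e₂ := partialHomeo τ τ.symm R R' hR hR' (τ.continuousOn.mono hRC)
    (τ.continuousOn_symm.mono hRC') (fun x hx _ => τ.left_inv (hRC hx))
    (fun x hx _ => τ.right_inv (hRC' hx)) with he₂
  have hE : EqOn e₁ e₂ (e₁.source ∩ e₂.source) := fun x hx => hW x (hOR ⟨hx.1.1, hx.2.1⟩)
  have hE' : EqOn e₁.symm e₂.symm (e₁.target ∩ e₂.target) :=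
    fun x hx => hW' x (hOR' ⟨hx.1.1, hx.2.1⟩)
  have hhead : Γ.head s ⊆ e₁.source := fun x hx =>
    ⟨hhO hx, hhO' ((headMap_image h.head h'.head hη).subset (mem_image_of_mem _ hx))⟩
  have htail : Γ.tail s ⊆ e₂.source := fun x hx =>
    ⟨htR hx, htR' ((tailMap_image h.tail h'.tail).subset (mem_image_of_mem _ hx))⟩
  refine ⟨unionHomeo e₁ e₂ hE hE', ?_, ?_, ?_, ?_⟩
  · rw [Γ.carrier_eq s]
    exact union_subset_union hhead htail
  · rw [Γ.carrier_eq s, Γ'.carrier_eq s', image_union,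
      (unionHomeo_eqOn_left.mono hhead).image_eq, (unionHomeo_eqOn_right.mono htail).image_eq]
    exact congrArg₂ _ (headMap_image h.head h'.head hη) (tailMap_image h.tail h'.tail)
  · refine mapsOrbits_of_mapsArc fun γ a₀ b₀ hab hγ hs =>
      mapsArc_of_local hab (isMIntegralCurveOn_continuousOn hγ) fun t ht => ?_
    rcases hs t ht with h1 | h1
    · refine ⟨_, e₁.open_source, h1, fun u v hu huv hv hUV => ?_⟩
      refine (mapsArc_headMap h.head h'.head hk huv (hγ.mono (Icc_subset_Icc hu hv))
        fun t ht => hOA (hUV t ht).1).congr fun t ht => ?_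
      exact unionHomeo_eqOn_left (hUV t ht)
    · refine ⟨_, e₂.open_source, h1, fun u v hu huv hv hUV => ?_⟩
      refine (mapsArc_tailMap h.tail h'.tail huv (hγ.mono (Icc_subset_Icc hu hv))
        fun t ht => hRC (hUV t ht).1).congr fun t ht => ?_
      exact unionHomeo_eqOn_right (hUV t ht)
  · refine mapsOrbits_of_mapsArc fun γ a₀ b₀ hab hγ hs =>
      mapsArc_of_local hab (isMIntegralCurveOn_continuousOn hγ) fun t ht => ?_
    rcases hs t ht with h1 | h1
    · refine ⟨_, e₁.open_target, h1, fun u v hu huv hv hUV => ?_⟩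
      refine (mapsArc_headMap h'.head h.head hk' huv (hγ.mono (Icc_subset_Icc hu hv))
        fun t ht => hOA' (hUV t ht).1).congr fun t ht => ?_
      exact unionHomeo_symm_eqOn_left (hUV t ht)
    · refine ⟨_, e₂.open_target, h1, fun u v hu huv hv hUV => ?_⟩
      refine (mapsArc_tailMap h'.tail h.tail huv (hγ.mono (Icc_subset_Icc hu hv))
        fun t ht => hRC' (hUV t ht).1).congr fun t ht => ?_
      exact unionHomeo_symm_eqOn_right (hUV t ht)

end SaddleConn

/-! ### A topological invariant: accumulation of orbits -/

namespace SaddleConn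

section Reach

variable {M : Type*} [TopologicalSpace M] [ChartedSpace E3 M]
variable {N : Type*} [TopologicalSpace N] [ChartedSpace E3 N]
variable {X : (x : M) → TangentSpace (𝓡 3) x} {Y : (x : N) → TangentSpace (𝓡 3) x}

/-- There is an arc of orbit of `X` in `U` from `x` to `y`. -/
def Reach (X : (x : M) → TangentSpace (𝓡 3) x) (U : Set M) (x y : M) : Prop :=
  ∃ (γ : ℝ → M) (a b : ℝ), a < b ∧ IsMIntegralCurveOn γ X (Icc a b) ∧ (∀ t ∈ Icc a b, γ t ∈ U) ∧
    γ a = x ∧ γ b = y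

/-- The points that can be reached in `U` from points arbitrarily close to `r`. -/
def reachSet (X : (x : M) → TangentSpace (𝓡 3) x) (U : Set M) (r : M) : Set M :=
  {z | ∀ V ∈ 𝓝 r, ∃ x ∈ V, Reach X U x z}

/-- The points at which the forward orbits in `U` of the points near `m` that can be reached from
`p` accumulate. -/
def accumulationSet (X : (x : M) → TangentSpace (𝓡 3) x) (U : Set M) (p m : M) : Set M :=
  {z | ∀ G ∈ 𝓝 z, ∀ D ∈ 𝓝 m, ∃ w ∈ D, w ∈ reachSet X U p ∧ ∃ g ∈ G, Reach X U w g}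

lemma Reach.trans {U : Set M} {x y z : M} (h₁ : Reach X U x y) (h₂ : Reach X U y z) :
    Reach X U x z := by
  obtain ⟨γ, a, b, hab, hγ, hU, ha, hb⟩ := h₁
  obtain ⟨δ, u, v, huv, hδ, hV, hu, hv⟩ := h₂
  have hlt : b < b + (v - u) := by linarith
  have hsh : ∀ t ∈ Icc b (b + (v - u)), t + (u - b) ∈ Icc u v :=
    fun t ht => ⟨by linarith [ht.1], by linarith [ht.2]⟩
  refine ⟨fun t => if t ≤ b then γ t else δ (t + (u - b)), a, b + (v - u), by linarith,
    isMIntegralCurveOn_concat hab.le hlt.le hγ (isMIntegralCurveOn_shift hδ _ hsh) ?_,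
    fun t ht => ?_, ?_, ?_⟩
  · rw [hb, ← hu]; congr 1; ring
  · by_cases h : t ≤ b
    · simp only [if_pos h]; exact hU t ⟨ht.1, h⟩
    · simp only [if_neg h]; exact hV _ (hsh t ⟨(not_le.1 h).le, ht.2⟩)
  · simp only [if_pos hab.le]; exact ha
  · simp only [if_neg (not_le.2 hlt)]
    rw [← hv]; congr 1; ring

lemma Reach.map {h : OpenPartialHomeomorph M N} (hm : MapsOrbits X Y h) {U : Set M}
    (hU : U ⊆ h.source) {x y : M} (H : Reach X U x y) : Reach Y (h '' U) (h x) (h y) := by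
  obtain ⟨γ, a, b, hab, hγ, hγU, rfl, rfl⟩ := H
  obtain ⟨d, σ, h1, h2, h3, -, h4⟩ := hm γ a b hab hγ fun t ht => hU (hγU t ht)
  refine ⟨d, σ a, σ b, h1 ⟨le_rfl, hab.le⟩ ⟨hab.le, le_rfl⟩ hab, h3, fun τ hτ => ?_,
    (h4 a ⟨le_rfl, hab.le⟩).symm, (h4 b ⟨hab.le, le_rfl⟩).symm⟩
  obtain ⟨u, hu, rfl⟩ := intermediate_value_Icc hab.le h2 hτ
  rw [← h4 u hu]
  exact mem_image_of_mem _ (hγU u hu)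

lemma map_mem_reachSet {h : OpenPartialHomeomorph M N} (hm : MapsOrbits X Y h) {U : Set M}
    (hU : U ⊆ h.source) {r z : M} (hr : r ∈ h.source) (hz : z ∈ reachSet X U r) :
    h z ∈ reachSet Y (h '' U) (h r) := fun V hV => by
  obtain ⟨x, hx, H⟩ := hz _ (h.continuousAt hr hV)
  exact ⟨h x, hx, H.map hm hU⟩

lemma map_mem_accumulationSet {h : OpenPartialHomeomorph M N} (hm : MapsOrbits X Y h) {U : Set M}
    (hU : U ⊆ h.source) {p m z : M} (hp : p ∈ h.source) (hms : m ∈ h.source) (hzs : z ∈ h.source)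
    (hz : z ∈ accumulationSet X U p m) :
    h z ∈ accumulationSet Y (h '' U) (h p) (h m) := fun G hG D hD => by
  obtain ⟨w, hw, hwp, g, hg, H⟩ := hz _ (h.continuousAt hzs hG) _ (h.continuousAt hms hD)
  exact ⟨h w, hw, map_mem_reachSet hm hU hp hwp, h g, hg, H.map hm hU⟩

end Reach

namespace SaddleConnection

variable {M : Type*} [TopologicalSpace M] [ChartedSpace E3 M] [IsManifold (𝓡 3) ∞ M] [T2Space M]
variable {N : Type*} [TopologicalSpace N] [ChartedSpace E3 N] [IsManifold (𝓡 3) ∞ N] [T2Space N]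
variable {Γ : SaddleConnection M} {Γ' : SaddleConnection N} {h : OpenPartialHomeomorph M N}

lemma TopEquiv.symm (H : Γ.TopEquiv Γ') : Γ'.TopEquiv Γ := by
  obtain ⟨h, h1, h2, h3, h4⟩ := H
  refine ⟨h.symm, ?_, ?_, h4, by rwa [h.symm_symm]⟩
  · rw [← h2]
    rintro _ ⟨x, hx, rfl⟩
    exact h.map_source (h1 hx)
  · rw [← h2]
    exact h.symm_image_image_of_subset_source h1

lemma eq_of_mem_carrier {x : M} (hx : x ∈ Γ.carrier) :
    x = Γ.p ∨ x = Γ.q ∨ ∃ t, x = Γ.orbit t := by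
  rw [Γ.carrier_eq 0] at hx
  rcases hx with (rfl | ⟨t, -, rfl⟩) | (rfl | ⟨t, -, rfl⟩)
  · exact Or.inl rfl
  · exact Or.inr (Or.inr ⟨t, rfl⟩)
  · exact Or.inr (Or.inl rfl)
  · exact Or.inr (Or.inr ⟨t, rfl⟩)

/-- An integral curve that meets the connection runs along it. -/
lemma eq_orbit_of_mem {d : ℝ → M} {a b u : ℝ} (hab : a ≤ b)
    (hd : IsMIntegralCurveOn d Γ.X (Icc a b)) (hu : d a = Γ.orbit u) :
    d b = Γ.orbit (u + (b - a)) := by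
  have h1 := integralCurve_unique_Icc Γ.smooth (a := a) (b := b) (t₀ := a)
    ⟨le_rfl, hab⟩ hd (isMIntegralCurveOn_shift (Γ.isMIntegralCurve.isMIntegralCurveOn univ)
      (u - a) fun t _ => mem_univ _) (by simp [hu])
  rw [h1 ⟨hab, le_rfl⟩]
  ring_nf

/-- Zeros are not mapped into the orbit. -/
lemma map_zero_ne_orbit {X : (x : M) → TangentSpace (𝓡 3) x} {h : OpenPartialHomeomorph M N}
    (hm : MapsOrbits X Γ'.X h) {x : M} (hx : x ∈ h.source) (hX : X x = 0) (u : ℝ) :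
    h x ≠ Γ'.orbit u := fun e => by
  obtain ⟨d, σ, h1, -, h3, -, h4⟩ := hm (fun _ => x) 0 1 one_pos
    ((isMIntegralCurve_const hX).isMIntegralCurveOn _) fun _ _ => hx
  have hlt : σ 0 < σ 1 := h1 ⟨le_rfl, zero_le_one⟩ ⟨zero_le_one, le_rfl⟩ one_pos
  have h5 := eq_orbit_of_mem hlt.le h3 ((h4 0 ⟨le_rfl, zero_le_one⟩).symm.trans e)
  rw [← h4 1 ⟨zero_le_one, le_rfl⟩, e] at h5
  have := Γ'.orbit_injective h5
  linarith

/-- A zero is a constant arc, which cannot be mapped onto an arc of the injective orbit. Applied to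
the inverse, this keeps points of the orbit away from the saddles, so orbit goes to orbit; the
direction of time makes the parameter change increasing. -/
lemma exists_map_orbit (hsrc : Γ.carrier ⊆ h.source) (him : h '' Γ.carrier = Γ'.carrier)
    (hm : MapsOrbits Γ.X Γ'.X h) (hm' : MapsOrbits Γ'.X Γ.X h.symm) :
    ∃ f : ℝ → ℝ, StrictMono f ∧ ∀ t, h (Γ.orbit t) = Γ'.orbit (f t) := by
  have hmem : ∀ t, Γ.orbit t ∈ h.source := fun t => hsrc (Γ.orbit_mem_carrier t)
  have hzero : ∀ r ∈ Γ'.carrier, Γ'.X r = 0 → ∀ t, h (Γ.orbit t) ≠ r := by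
    rintro r hr hr0 t rfl
    refine map_zero_ne_orbit (Γ' := Γ) hm' (h.map_source (hmem t)) hr0 t ?_
    exact h.left_inv (hmem t)
  have h1 : ∀ t, ∃ u, h (Γ.orbit t) = Γ'.orbit u := fun t => by
    rcases Γ'.eq_of_mem_carrier (him.subset (mem_image_of_mem h (Γ.orbit_mem_carrier t)))
      with h1 | h1 | h1
    · exact absurd h1 (hzero _ Γ'.p_mem_carrier Γ'.saddle_p.zero t)
    · exact absurd h1 (hzero _ Γ'.q_mem_carrier Γ'.saddle_q.zero t)
    · exact h1
  choose f hf using h1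
  refine ⟨f, fun s t hst => ?_, hf⟩
  obtain ⟨d, σ, h1, -, h3, -, h4⟩ := hm Γ.orbit s t hst
    (Γ.isMIntegralCurve.isMIntegralCurveOn _) fun u _ => hmem u
  have hlt : σ s < σ t := h1 ⟨le_rfl, hst.le⟩ ⟨hst.le, le_rfl⟩ hst
  have h5 := eq_orbit_of_mem hlt.le h3 ((h4 s ⟨le_rfl, hst.le⟩).symm.trans (hf s))
  rw [← h4 t ⟨hst.le, le_rfl⟩, hf] at h5
  have := Γ'.orbit_injective h5
  linarith

/-- The image of `p` is a limit of points of a compact head, and being the image of a zero it is not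
on the orbit, so it is the saddle of that head; likewise at `q`. -/
lemma map_endpoints (hsrc : Γ.carrier ⊆ h.source) (hm : MapsOrbits Γ.X Γ'.X h) {f : ℝ → ℝ}
    (hf : StrictMono f) (hfo : ∀ t, h (Γ.orbit t) = Γ'.orbit (f t)) :
    h Γ.p = Γ'.p ∧ h Γ.q = Γ'.q := by
  have hp := (h.continuousAt (hsrc Γ.p_mem_carrier)).tendsto.comp Γ.tendsto_p
  have hq := (h.continuousAt (hsrc Γ.q_mem_carrier)).tendsto.comp Γ.tendsto_q
  constructor
  · have h1 : h Γ.p ∈ Γ'.head (f 0) := by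
      refine (Γ'.isCompact_head (f 0)).isClosed.mem_of_tendsto hp ?_
      filter_upwards [eventually_le_atBot 0] with t ht
      exact Or.inr ⟨f t, hf.monotone ht, (hfo t).symm⟩
    rcases h1 with h1 | ⟨u, -, h1⟩
    · exact h1
    · exact absurd h1.symm (map_zero_ne_orbit hm (hsrc Γ.p_mem_carrier) Γ.saddle_p.zero u)
  · have h1 : h Γ.q ∈ Γ'.tail (f 0) := by
      refine (Γ'.isCompact_tail (f 0)).isClosed.mem_of_tendsto hq ?_
      filter_upwards [eventually_ge_atTop 0] with t ht
      exact Or.inr ⟨f t, hf.monotone ht, (hfo t).symm⟩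
    rcases h1 with h1 | ⟨u, -, h1⟩
    · exact h1
    · exact absurd h1.symm (map_zero_ne_orbit hm (hsrc Γ.q_mem_carrier) Γ.saddle_q.zero u)

lemma tendsto_map_time (hsrc : Γ.carrier ⊆ h.source) {f : ℝ → ℝ}
    (hfo : ∀ t, h (Γ.orbit t) = Γ'.orbit (f t)) (hq : h Γ.q = Γ'.q) : Tendsto f atTop atTop := by
  refine tendsto_atTop.2 fun s => ?_
  have h1 := (h.continuousAt (hsrc Γ.q_mem_carrier)).tendsto.comp Γ.tendsto_q
  rw [hq] at h1
  have h2 : Γ'.q ∉ Γ'.head s := by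
    rintro (e | ⟨u, -, e⟩)
    · exact Γ'.p_ne_q e.symm
    · exact Γ'.orbit_ne_q u e
  filter_upwards [h1.eventually ((Γ'.isCompact_head s).isClosed.isOpen_compl.mem_nhds h2)]
    with t ht
  by_contra hlt
  exact ht (Or.inr ⟨f t, (not_le.1 hlt).le, (hfo t).symm⟩)

/-- If accumulation distinguishes two connections, they are not equivalent. -/
lemma not_topEquiv_of_accumulation {s₀ s₀' : ℝ}
    (H : ∀ t ≥ s₀, ∃ U₁, IsOpen U₁ ∧ Γ.carrier ⊆ U₁ ∧ ∀ U, IsOpen U → Γ.carrier ⊆ U → U ⊆ U₁ →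
      ∀ V ∈ 𝓝 Γ.q, ∃ z ∈ V, z ∈ U ∧ z ∈ reachSet Γ.X U Γ.q ∧
        z ∉ accumulationSet Γ.X U Γ.p (Γ.orbit t))
    (H' : ∀ t ≥ s₀', ∃ U₁, IsOpen U₁ ∧ Γ'.carrier ⊆ U₁ ∧ ∀ U, IsOpen U → Γ'.carrier ⊆ U → U ⊆ U₁ →
      ∃ V ∈ 𝓝 Γ'.q, ∀ z ∈ V, z ∈ reachSet Γ'.X U Γ'.q →
        z ∈ accumulationSet Γ'.X U Γ'.p (Γ'.orbit t)) : ¬Γ.TopEquiv Γ' := by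
  rintro ⟨h, hsrc, him, hm, hm'⟩
  obtain ⟨f, hf, hfo⟩ := exists_map_orbit hsrc him hm hm'
  obtain ⟨hp, hq⟩ := map_endpoints hsrc hm hf hfo
  obtain ⟨t, ht', ht⟩ := (((tendsto_map_time hsrc hfo hq).eventually_ge_atTop s₀').and
    (eventually_ge_atTop s₀)).exists
  obtain ⟨U₁, hU₁, hΓU₁, H⟩ := H t ht
  obtain ⟨U₁', hU₁', hΓU₁', H'⟩ := H' (f t) ht'
  -- The invariant sets depend on the neighbourhood in which arcs run, so one `U` is taken that is
  -- small enough for `Γ` and has an image small enough for `Γ'`.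
  set U := (h.source ∩ h ⁻¹' U₁') ∩ U₁ with hUdef
  have hU : IsOpen U := (h.isOpen_inter_preimage hU₁').inter hU₁
  have hΓU : Γ.carrier ⊆ U := fun x hx =>
    ⟨⟨hsrc hx, hΓU₁' (him.subset (mem_image_of_mem h hx))⟩, hΓU₁ hx⟩
  have hUs : U ⊆ h.source := fun x hx => hx.1.1
  obtain ⟨V', hV', H'⟩ := H' (h '' U) (h.isOpen_image_of_subset_source hU hUs)
    (by rw [← him]; exact image_mono hΓU) (by rintro _ ⟨x, hx, rfl⟩; exact hx.1.2)
  rw [← hq] at hV'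
  obtain ⟨z, hzV, hzU, hz, hz'⟩ := H U hU hΓU inter_subset_right _
    (h.continuousAt (hsrc Γ.q_mem_carrier) hV')
  have h1 := map_mem_reachSet hm hUs (hsrc Γ.q_mem_carrier) hz
  rw [hq] at h1
  have h2 := H' (h z) hzV h1
  have hUt : h '' U ⊆ h.symm.source := by
    rintro _ ⟨x, hx, rfl⟩; exact h.map_source (hUs hx)
  have hmemt : ∀ {x}, x ∈ h.source → h x ∈ h.symm.source := fun hx => h.map_source hx
  rw [← hp, ← hfo] at h2
  have hUU : h.symm '' (h '' U) = U := h.symm_image_image_of_subset_source hUs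
  have h3 := map_mem_accumulationSet hm' hUt (hmemt (hsrc Γ.p_mem_carrier))
    (hmemt (hsrc (Γ.orbit_mem_carrier t))) (hmemt (hUs hzU)) h2
  rw [h.left_inv (hsrc Γ.p_mem_carrier), h.left_inv (hsrc (Γ.orbit_mem_carrier t)),
    h.left_inv (hUs hzU), hUU] at h3
  exact hz' h3

end SaddleConnection

end SaddleConn

/-! ### Real case: accumulation along a single line -/

namespace SaddleConn

/-- A property that is preserved along the pieces of a curve in two open sets is preserved along
the curve. -/
lemma propagate {Y : Type*} [TopologicalSpace Y] {γ : ℝ → Y} {a b : ℝ} {O R : Set Y} {P : ℝ → Prop}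
    (hab : a ≤ b) (hγ : ContinuousOn γ (Icc a b)) (hO : IsOpen O) (hR : IsOpen R)
    (hcov : ∀ t ∈ Icc a b, γ t ∈ O ∪ R)
    (hPO : ∀ u v, a ≤ u → u ≤ v → v ≤ b → (∀ t ∈ Icc u v, γ t ∈ O) → P u → P v)
    (hPR : ∀ u v, a ≤ u → u ≤ v → v ≤ b → (∀ t ∈ Icc u v, γ t ∈ R) → P u → P v)
    (h : P a) : P b := by
  obtain ⟨τ, h0, hmono, ⟨m, hm⟩, hpiece⟩ := exists_monotone_Icc_subset_open_cover_Icc hab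
    (c := fun i : Bool => (Icc a b).domRestrict γ ⁻¹' cond i O R)
    (fun i => IsOpen.preimage hγ.domRestrict (by cases i <;> assumption)) (fun t _ => by
      rcases hcov t t.2 with h | h
      · exact mem_iUnion.2 ⟨true, h⟩
      · exact mem_iUnion.2 ⟨false, h⟩)
  have key : ∀ n, P (τ n) := by
    intro n
    induction n with
    | zero => rw [h0]; exact h
    | succ n ih =>
      have hle : (τ n : ℝ) ≤ τ (n + 1) := hmono n.le_succ
      have hmem : ∀ t (ht : t ∈ Icc (τ n : ℝ) (τ (n + 1))),
          (⟨t, (τ n).2.1.trans ht.1, ht.2.trans (τ (n + 1)).2.2⟩ : Icc a b) ∈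
            Icc (τ n) (τ (n + 1)) := fun t ht => ht
      obtain ⟨i, hi⟩ := hpiece n
      cases i with
      | true => exact hPO _ _ (τ n).2.1 hle (τ (n + 1)).2.2 (fun t ht => hi (hmem t ht)) ih
      | false => exact hPR _ _ (τ n).2.1 hle (τ (n + 1)).2.2 (fun t ht => hi (hmem t ht)) ih
  have := key m
  rwa [hm m le_rfl] at this

section Model

variable {M : Type*} [TopologicalSpace M] [ChartedSpace E3 M]
variable {X : (x : M) → TangentSpace (𝓡 3) x} {χ : OpenPartialHomeomorph M Z} {b c : ℝ}

/-- Points on the unstable plane are reached from the saddle. -/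
lemma mem_reachSet_of_segment (hχ : Conj X χ fun t => modelFlow 0 (c * t)) (hc : 0 < c) {r : M}
    (hr : r ∈ χ.source) (hr0 : χ r = 0) {U : Set M} {y : ℂ}
    (hU : ∀ ρ ∈ Icc (0 : ℝ) 1, ((0 : ℝ), ρ • y) ∈ χ.target ∧ χ.symm ((0 : ℝ), ρ • y) ∈ U) :
    χ.symm ((0 : ℝ), y) ∈ reachSet X U r := by
  intro V hV
  have hflow : ∀ t, modelFlow 0 (c * t) ((0 : ℝ), y) = ((0 : ℝ), Real.exp (c * t) • y) :=
    fun t => by rw [modelFlow_zero_apply, mul_zero]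
  have hlim : Tendsto (fun t : ℝ => χ.symm ((0 : ℝ), Real.exp (c * t) • y)) atBot (𝓝 r) := by
    have h1 : Tendsto (fun t : ℝ => Real.exp (c * t) • y) atBot (𝓝 0) := by
      have : Tendsto (fun t : ℝ => Real.exp (c * t)) atBot (𝓝 0) :=
        Real.tendsto_exp_atBot.comp (tendsto_id.const_mul_atBot hc)
      simpa using this.smul_const y
    have h2 := χ.symm.continuousAt (χ.map_source hr)
    rw [ContinuousAt, χ.left_inv hr, hr0] at h2
    exact h2.comp ((tendsto_const_nhds (x := (0 : ℝ))).prodMk_nhds h1)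
  obtain ⟨T, hTV, hT⟩ := ((hlim.eventually hV).and (eventually_lt_atBot 0)).exists
  have hmem : ∀ t ∈ Icc T 0, Real.exp (c * t) ∈ Icc (0 : ℝ) 1 := fun t ht =>
    ⟨(Real.exp_pos _).le, Real.exp_le_one_iff.2 (mul_nonpos_of_nonneg_of_nonpos hc.le ht.2)⟩
  refine ⟨_, hTV, fun t => χ.symm (modelFlow 0 (c * t) ((0 : ℝ), y)), T, 0, hT,
    hχ.bwd _ _ _ fun t ht => ?_, fun t ht => ?_, ?_, ?_⟩
  · simp only [hflow]; exact (hU _ (hmem t ht)).1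
  · simp only [hflow]; exact (hU _ (hmem t ht)).2
  · simp only [hflow]
  · simp only [hflow]; simp

/-- Points that are reached from the saddle within a chart lie on the unstable plane. -/
lemma fst_eq_zero_of_mem_reachSet (hχ : Conj X χ fun t => modelFlow b (c * t)) (hc : 0 < c) {r : M}
    (hr : r ∈ χ.source) (hr0 : χ r = 0) {U V : Set M} {w : M} (hV : V ∈ 𝓝 r)
    (hstay : ∀ (γ : ℝ → M) (u v : ℝ), u < v → IsMIntegralCurveOn γ X (Icc u v) →
      (∀ t ∈ Icc u v, γ t ∈ U) → γ u ∈ V → γ v = w → ∀ t ∈ Icc u v, γ t ∈ χ.source)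
    (hw : w ∈ reachSet X U r) : (χ w).1 = 0 := by
  by_contra hne
  -- An arc may start with `|x|` smaller than at `w`, whereas `|x|` never increases along the flow.
  have hsmall : ∀ᶠ z in 𝓝 r, |(χ z).1| < |(χ w).1| := by
    have h1 : ContinuousAt (fun z => |(χ z).1|) r :=
      (continuousAt_fst.comp (χ.continuousAt hr)).abs
    refine h1.eventually (gt_mem_nhds ?_)
    simp only [hr0]
    simpa using hne
  obtain ⟨x, ⟨hxV, hx⟩, γ, u, v, huv, hγ, hγU, rfl, rfl⟩ := hw _ (inter_mem hV hsmall)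
  have h1 := hχ.fwd γ u v hγ (hstay γ u v huv hγ hγU hxV rfl) v ⟨huv.le, le_rfl⟩
  rw [modelFlow_apply] at h1
  have h2 : |(χ (γ v)).1| ≤ |(χ (γ u)).1| := by
    rw [h1, abs_mul, abs_of_pos (Real.exp_pos _)]
    refine mul_le_of_le_one_left (abs_nonneg _) (Real.exp_le_one_iff.2 ?_)
    have := mul_pos hc (sub_pos.2 huv)
    linarith
  exact absurd hx (not_lt.2 h2)

end Model

lemma labelFactor_zero {x : ℝ} (hx : 0 < x) : labelFactor 0 x = (x : ℂ) := by
  rw [labelFactor, Complex.ofReal_zero, zero_mul, add_zero, one_mul, ← Complex.ofReal_exp,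
    Real.exp_log hx]

lemma sign_label_zero {z : Z} (hz : 0 < z.1) :
    SignType.sign (label 0 z).re = SignType.sign z.2.re := by
  rw [label, labelFactor_zero hz, Complex.re_ofReal_mul, sign_mul, sign_pos hz, one_mul]

variable {M : Type*} [TopologicalSpace M] [ChartedSpace E3 M] [IsManifold (𝓡 3) ∞ M] [T2Space M]
  {Γ : SaddleConnection M} {b c s t : ℝ} {φ ψ : OpenPartialHomeomorph M Z}

lemma TailChart.tail_subset (h : TailChart Γ b c s ψ) : Γ.tail s ⊆ ψ.source := by
  rintro _ (rfl | ⟨t, ht, rfl⟩)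
  · exact h.base_mem
  · exact h.orbit_mem t ht

lemma TailChart.eventually_symm (h : TailChart Γ b c s ψ) {V : Set M} (hV : V ∈ 𝓝 Γ.q) :
    ∀ᶠ w in 𝓝 (0 : Z), w ∈ ψ.target ∧ ψ.symm w ∈ V := by
  have h1 := ψ.map_source h.base_mem
  have h2 := ψ.symm.continuousAt h1
  rw [ContinuousAt, ψ.left_inv h.base_mem, h.base] at h2
  rw [h.base] at h1
  filter_upwards [ψ.open_target.mem_nhds h1, h2 hV] with w h3 h4 using ⟨h3, h4⟩

/-- In the real case, the orbits from `p` accumulate at `q` only along one direction. -/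
lemma NormalForm.not_accumulation (h : NormalForm Γ 0 c s φ ψ) (ht : t < s) :
    ∃ U₁, IsOpen U₁ ∧ Γ.carrier ⊆ U₁ ∧ ∀ U, IsOpen U → Γ.carrier ⊆ U → U ⊆ U₁ →
      ∀ V ∈ 𝓝 Γ.q, ∃ z ∈ V, z ∈ U ∧ z ∈ reachSet Γ.X U Γ.q ∧
        z ∉ accumulationSet Γ.X U Γ.p (Γ.orbit t) := by
  have hc := h.head.pos
  -- For `b = 0` the label is `x y`, so near the cut the unstable manifold of `p` is exactly `re y =
  -- 0` in the tail chart.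
  have hW : ∀ᶠ z in 𝓝 (Γ.orbit s), 0 < (ψ z).1 ∧ ((φ z).1 = 0 ↔ (ψ z).2.re = 0) := by
    have h1 : ∀ᶠ z in 𝓝 (Γ.orbit s), 0 < (ψ z).1 := by
      have h2 : ContinuousAt (fun z => (ψ z).1) (Γ.orbit s) :=
        continuousAt_fst.comp (ψ.continuousAt (h.tail.orbit_mem s le_rfl))
      exact h2.eventually (lt_mem_nhds (by simp only [h.tail.orbit_cut]; exact one_pos))
    filter_upwards [h1, h.sign] with z h2 h3
    rw [sign_label_zero h2] at h3
    exact ⟨h2, by rw [← sign_eq_zero_iff, h3, sign_eq_zero_iff]⟩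
  obtain ⟨W, hW, hWo, hsW⟩ := _root_.eventually_nhds_iff.1 hW
  have hmid : Real.exp (c * ((t + s) / 2 - s)) < 1 := by
    rw [Real.exp_lt_one_iff]; nlinarith
  obtain ⟨O, R, hO, hR, hhO, htR, hOφ, -, hRψ, hOR, htrap⟩ := h.head.exists_trap hmid isOpen_univ
    (subset_univ _) hWo hsW ψ.open_source h.tail.tail_subset
  refine ⟨O ∪ R, hO.union hR, by rw [Γ.carrier_eq s]; exact union_subset_union hhO htR, ?_⟩
  intro U hU hΓU hUU V hV
  have hRq : R ∈ 𝓝 Γ.q := hR.mem_nhds (htR (Or.inl rfl))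
  obtain ⟨δ, hδ, hball⟩ := Metric.eventually_nhds_iff_ball.1 (h.tail.eventually_symm
    (inter_mem (inter_mem hV (hU.mem_nhds (hΓU Γ.q_mem_carrier))) hRq))
  -- The witness is a point of the unstable plane of `q` off the imaginary axis, and so close to `q`
  -- that its segment to `q` stays in all given neighbourhoods.
  set y : ℂ := ((δ / 2 : ℝ) : ℂ) with hy
  have hseg : ∀ ρ ∈ Icc (0 : ℝ) 1, ((0 : ℝ), ρ • y) ∈ Metric.ball (0 : Z) δ := by
    intro ρ hρ
    rw [mem_ball_zero_iff, Prod.norm_mk, norm_zero, norm_smul, hy, Complex.norm_real,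
      Real.norm_of_nonneg hρ.1, Real.norm_of_nonneg (by positivity)]
    refine max_lt hδ ?_
    nlinarith [hρ.2]
  have hz := hball _ (hseg 1 ⟨zero_le_one, le_rfl⟩)
  rw [one_smul] at hz
  refine ⟨ψ.symm ((0 : ℝ), y), hz.2.1.1, hz.2.1.2,
    mem_reachSet_of_segment h.tail.conj h.tail.pos h.tail.base_mem h.tail.base fun ρ hρ =>
      ⟨(hball _ (hseg ρ hρ)).1, (hball _ (hseg ρ hρ)).2.1.2⟩, fun hacc => ?_⟩
  have hG : R ∩ {z | 0 < (ψ z).2.re} ∈ 𝓝 (ψ.symm ((0 : ℝ), y)) := by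
    refine inter_mem (hR.mem_nhds hz.2.2) ?_
    have h1 : ContinuousAt (fun z => (ψ z).2.re) (ψ.symm ((0 : ℝ), y)) :=
      Complex.continuous_re.continuousAt.comp
        (continuousAt_snd.comp (ψ.continuousAt (ψ.map_target hz.1)))
    refine h1 (lt_mem_nhds ?_)
    simp only [ψ.right_inv hz.1]
    rw [hy, Complex.ofReal_re]
    exact half_pos hδ
  have hD : O ∩ {z | ‖(φ z).2‖ < Real.exp (c * ((t + s) / 2 - s))} ∈ 𝓝 (Γ.orbit t) := by
    refine inter_mem (hO.mem_nhds (hhO (Or.inr ⟨t, ht.le, rfl⟩))) ?_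
    have h1 : ContinuousAt (fun z => ‖(φ z).2‖) (Γ.orbit t) :=
      (continuousAt_snd.comp (φ.continuousAt (h.head.orbit_mem t ht.le))).norm
    refine h1 (gt_mem_nhds ?_)
    simp only [h.head.orbit t ht.le]
    rw [Complex.norm_real, Real.norm_of_nonneg (Real.exp_pos _).le, Real.exp_lt_exp]
    nlinarith
  obtain ⟨w, ⟨hwO, hwm⟩, hwp, g, ⟨hgR, hg⟩, γ, u, v, huv, hγ, hγU, rfl, rfl⟩ := hacc _ hG _ hD
  have hw0 : (φ (γ u)).1 = 0 :=
    fst_eq_zero_of_mem_reachSet h.head.conj hc h.head.base_mem h.head.base univ_mem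
      (fun δ a' b' _ hδ' hδU _ hb' τ hτ => hOφ (htrap δ a' b' hδ' (fun t ht => hUU (hδU t ht))
        (by rw [hb']; exact hwO) (by rw [hb']; exact le_of_lt hwm) τ hτ)) hwp
  -- The arc may change between the two neighbourhoods several times. The conditions `x = 0` in the
  -- head chart and `x > 0`, `re y = 0` in the tail chart are each invariant under their flow and
  -- agree on the overlap.
  have key : (γ v ∈ O → (φ (γ v)).1 = 0) ∧ (γ v ∈ R → 0 < (ψ (γ v)).1 ∧ (ψ (γ v)).2.re = 0) := by
    refine propagate
      (P := fun τ => (γ τ ∈ O → (φ (γ τ)).1 = 0) ∧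
        (γ τ ∈ R → 0 < (ψ (γ τ)).1 ∧ (ψ (γ τ)).2.re = 0)) huv.le
      (isMIntegralCurveOn_continuousOn hγ) hO hR (fun τ hτ => hUU (hγU τ hτ)) ?_ ?_ ?_
    · intro a' b' ha' hab' hb' hin hP
      have h1 := h.head.flow (hγ.mono (Icc_subset_Icc ha' hb')) (fun τ hτ => hOφ (hin τ hτ))
        ⟨le_rfl, hab'⟩ ⟨hab', le_rfl⟩
      have h2 : (φ (γ b')).1 = 0 := by
        rw [h1, hP.1 (hin a' ⟨le_rfl, hab'⟩), mul_zero]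
      refine ⟨fun _ => h2, fun hbR => ?_⟩
      have h3 := hW _ (hOR ⟨hin b' ⟨hab', le_rfl⟩, hbR⟩)
      exact ⟨h3.1, h3.2.1 h2⟩
    · intro a' b' ha' hab' hb' hin hP
      have h1 := h.tail.conj.fwd γ a' b' (hγ.mono (Icc_subset_Icc ha' hb'))
        (fun τ hτ => hRψ (hin τ hτ)) b' ⟨hab', le_rfl⟩
      simp only [modelFlow_zero_apply] at h1
      obtain ⟨h2, h3⟩ := hP.2 (hin a' ⟨le_rfl, hab'⟩)
      have h4 : 0 < (ψ (γ b')).1 ∧ (ψ (γ b')).2.re = 0 := by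
        rw [h1]
        refine ⟨mul_pos (Real.exp_pos _) h2, ?_⟩
        simp only
        rw [Complex.smul_re, h3, smul_zero]
      refine ⟨fun hbO => ?_, fun _ => h4⟩
      exact (hW _ (hOR ⟨hbO, hin b' ⟨hab', le_rfl⟩⟩)).2.2 h4.2
    · refine ⟨fun _ => hw0, fun huR => ?_⟩
      have h3 := hW _ (hOR ⟨hwO, huR⟩)
      exact ⟨h3.1, h3.2.1 hw0⟩
  exact hg.ne' (key.2 hgR).2

end SaddleConn

/-! ### Complex case: accumulation everywhere, and the classification for (1-1) -/

namespace SaddleConn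

variable {M : Type*} [TopologicalSpace M] [ChartedSpace E3 M] [IsManifold (𝓡 3) ∞ M] [T2Space M]
  {Γ : SaddleConnection M} {b c s t : ℝ} {φ ψ : OpenPartialHomeomorph M Z}

/-- A box around the tail. -/
lemma TailChart.exists_box (h : TailChart Γ b c s ψ) {U : Set M} (hU : IsOpen U)
    (hΓU : Γ.carrier ⊆ U) : ∃ r > 0, ∀ x ∈ Icc (0 : ℝ) 1, ∀ y : ℂ, ‖y‖ < r →
      (x, y) ∈ ψ.target ∧ ψ.symm (x, y) ∈ U := by
  have hB : IsOpen (ψ.target ∩ ψ.symm ⁻¹' U) := ψ.isOpen_inter_preimage_symm hU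
  have hK : Icc (0 : ℝ) 1 ×ˢ {(0 : ℂ)} ⊆ ψ.target ∩ ψ.symm ⁻¹' U := by
    rintro ⟨x, y⟩ ⟨hx, hy⟩
    simp only [mem_singleton_iff] at hx hy
    subst hy
    rcases hx.1.eq_or_lt with h0 | h0
    · subst h0
      have e : ((0 : ℝ), (0 : ℂ)) = ψ Γ.q := h.base.symm
      rw [e]
      exact ⟨ψ.map_source h.base_mem, by
        rw [mem_preimage, ψ.left_inv h.base_mem]; exact hΓU Γ.q_mem_carrier⟩
    · have ht : s ≤ s - Real.log x / c := by
        have : Real.log x / c ≤ 0 :=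
          div_nonpos_of_nonpos_of_nonneg (Real.log_nonpos h0.le hx.2) h.pos.le
        linarith
      have e : (x, (0 : ℂ)) = ψ (Γ.orbit (s - Real.log x / c)) := by
        rw [h.orbit _ ht]
        have : -(c * (s - Real.log x / c - s)) = Real.log x := by
          have := h.pos.ne'
          field_simp
          ring
        rw [this, Real.exp_log h0]
      rw [e]
      exact ⟨ψ.map_source (h.orbit_mem _ ht), by
        rw [mem_preimage, ψ.left_inv (h.orbit_mem _ ht)]; exact hΓU (Γ.orbit_mem_carrier _)⟩
  obtain ⟨u, v, -, hv, hu', hv', huv⟩ :=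
    generalized_tube_lemma isCompact_Icc isCompact_singleton hB hK
  obtain ⟨r, hr, hball⟩ := Metric.isOpen_iff.1 hv 0 (hv' rfl)
  refine ⟨r, hr, fun x hx y hy => huv ⟨hu' hx, hball ?_⟩⟩
  rwa [mem_ball_zero_iff]

/-- Segments of the unstable plane near the head. -/
lemma HeadChart.eventually_segment (h : HeadChart Γ c s φ) {U : Set M} (hU : IsOpen U)
    (hΓU : Γ.carrier ⊆ U) : ∀ᶠ u in 𝓝 (1 : ℂ), ∀ ρ ∈ Icc (0 : ℝ) 1,
      ((0 : ℝ), ρ • u) ∈ φ.target ∧ φ.symm ((0 : ℝ), ρ • u) ∈ U := by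
  have hB : IsOpen (φ.target ∩ φ.symm ⁻¹' U) := φ.isOpen_inter_preimage_symm hU
  refine isCompact_Icc.eventually_forall_of_forall_eventually fun ρ hρ => ?_
  have hmem : ((0 : ℝ), ρ • (1 : ℂ)) ∈ φ.target ∩ φ.symm ⁻¹' U := by
    rcases hρ.1.eq_or_lt with h0 | h0
    · have e : ((0 : ℝ), ρ • (1 : ℂ)) = φ Γ.p := by rw [h.base, ← h0, zero_smul]; rfl
      rw [e]
      exact ⟨φ.map_source h.base_mem, by
        rw [mem_preimage, φ.left_inv h.base_mem]; exact hΓU Γ.p_mem_carrier⟩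
    · have ht : s + Real.log ρ / c ≤ s := by
        have : Real.log ρ / c ≤ 0 :=
          div_nonpos_of_nonpos_of_nonneg (Real.log_nonpos h0.le hρ.2) h.pos.le
        linarith
      have e : ((0 : ℝ), ρ • (1 : ℂ)) = φ (Γ.orbit (s + Real.log ρ / c)) := by
        rw [h.orbit _ ht, add_sub_cancel_left, mul_div_cancel₀ _ h.pos.ne', Real.exp_log h0]
        simp
      rw [e]
      exact ⟨φ.map_source (h.orbit_mem _ ht), by
        rw [mem_preimage, φ.left_inv (h.orbit_mem _ ht)]; exact hΓU (Γ.orbit_mem_carrier _)⟩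
  have hc : Continuous fun q : ℂ × ℝ => ((0 : ℝ), q.2 • q.1) := by fun_prop
  exact hc.continuousAt.eventually (hB.mem_nhds hmem)

/-- The points of the tail chart that are reached from `q` lie on its unstable plane. -/
lemma TailChart.exists_trap (h : TailChart Γ b c s ψ) :
    ∃ U₁, IsOpen U₁ ∧ Γ.carrier ⊆ U₁ ∧ ∀ U ⊆ U₁, ∀ z ∈ reachSet Γ.X U Γ.q,
      z ∈ ψ.source ∧ (ψ z).1 = 0 := by
  -- The overlap with the head's neighbourhood lies in `x > 1/2`. Arcs from near `q` start with `|x|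
  -- < 1/2`, and `|x|` does not increase, so they never leave the tail chart.
  set W : Set M := ψ.source ∩ ψ ⁻¹' {w | 1 / 2 < w.1} with hW
  have hWo : IsOpen W := ψ.isOpen_inter_preimage (isOpen_lt continuous_const continuous_fst)
  have hsW : Γ.orbit s ∈ W := ⟨h.orbit_mem s le_rfl, by
    rw [mem_preimage, h.orbit_cut]; exact one_half_lt_one (α := ℝ)⟩
  obtain ⟨O, R, hO, hR, hhO, htR, -, hRψ, hOR⟩ := Γ.exists_split s isOpen_univ hWo ψ.open_source
    (subset_univ _) hsW h.tail_subset
  refine ⟨O ∪ R, hO.union hR, by rw [Γ.carrier_eq s]; exact union_subset_union hhO htR,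
    fun U hU z hz => ?_⟩
  have hV : R ∩ {z | |(ψ z).1| < 1 / 2} ∈ 𝓝 Γ.q := by
    refine inter_mem (hR.mem_nhds (htR (Or.inl rfl))) ?_
    have h1 : ContinuousAt (fun z => |(ψ z).1|) Γ.q :=
      (continuousAt_fst.comp (ψ.continuousAt h.base_mem)).abs
    refine h1 (gt_mem_nhds ?_)
    simp only [h.base]
    simp
  have hstay : ∀ (γ : ℝ → M) (u v : ℝ), u < v → IsMIntegralCurveOn γ Γ.X (Icc u v) →
      (∀ t ∈ Icc u v, γ t ∈ U) → γ u ∈ R ∩ {z | |(ψ z).1| < 1 / 2} →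
      ∀ t ∈ Icc u v, γ t ∈ ψ.source := by
    intro γ u v huv hγ hγU hu τ hτ
    refine hRψ (trap_forward (isMIntegralCurveOn_continuousOn hγ) hR hO
      (fun t ht => (hU (hγU t ht)).symm) hu.1 (fun τ hτ hin hτO => ?_) τ hτ)
    have h1 := h.conj.fwd γ u τ (hγ.mono (Icc_subset_Icc_right hτ.2)) (fun t ht => hRψ (hin t ht))
      τ ⟨hτ.1, le_rfl⟩
    rw [modelFlow_apply] at h1
    have h2 : |(ψ (γ τ)).1| ≤ |(ψ (γ u)).1| := by
      rw [h1, abs_mul, abs_of_pos (Real.exp_pos _)]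
      refine mul_le_of_le_one_left (abs_nonneg _) (Real.exp_le_one_iff.2 ?_)
      have := mul_nonneg h.pos.le (sub_nonneg.2 hτ.1)
      linarith
    have h3 : 1 / 2 < (ψ (γ τ)).1 := (hOR ⟨hτO, hin τ ⟨hτ.1, le_rfl⟩⟩).2
    have h4 : |(ψ (γ u)).1| < 1 / 2 := hu.2
    linarith [le_abs_self (ψ (γ τ)).1]
  refine ⟨?_, fst_eq_zero_of_mem_reachSet h.conj h.pos h.base_mem h.base hV
    (fun γ u v huv hγ hγU hu _ => hstay γ u v huv hγ hγU hu) hz⟩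
  obtain ⟨x, hx, γ, u, v, huv, hγ, hγU, rfl, rfl⟩ := hz _ hV
  exact hstay γ u v huv hγ hγU hx v ⟨huv.le, le_rfl⟩

/-- The trace of the unstable manifold of `p` in the tail chart. -/
lemma NormalForm.eventually_trace (h : NormalForm Γ 1 c s φ ψ) :
    ∀ᶠ θ : ℝ in 𝓝 0, φ.symm ((0 : ℝ), Complex.exp (θ * Complex.I)) ∈ ψ.source ∧
      ψ (φ.symm ((0 : ℝ), Complex.exp (θ * Complex.I))) = ((1 : ℝ), (θ : ℂ) * Complex.I) := by
  have hlim : Tendsto (fun θ : ℝ => ((0 : ℝ), Complex.exp (θ * Complex.I))) (𝓝 0)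
      (𝓝 cutPoint) := by
    have h1 : Continuous fun θ : ℝ => ((0 : ℝ), Complex.exp (θ * Complex.I)) := by fun_prop
    have := h1.tendsto 0
    simpa [cutPoint] using this
  have hz := (tendsto_symm_cutPoint h.head).comp hlim
  have htar : ∀ᶠ w in 𝓝 cutPoint, w ∈ φ.target :=
    φ.open_target.mem_nhds (by
      rw [← h.head.orbit_cut]; exact φ.map_source (h.head.orbit_mem s le_rfl))
  filter_upwards [hz.eventually h.norm, hz.eventually h.sign, hz.eventually h.arg,
    hlim.eventually htar, hz.eventually (ψ.open_source.mem_nhds (h.tail.orbit_mem s le_rfl)),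
    Ioo_mem_nhds (neg_neg_of_pos Real.pi_pos) Real.pi_pos] with θ h1 h2 h3 h4 h5 h6
  simp only [Function.comp_apply] at h1 h2 h3 h5
  rw [φ.right_inv h4] at h1 h2 h3
  refine ⟨h5, ?_⟩
  -- The three clauses of the normal form determine the point: modulus 1 gives `x = 1`, sign 0 gives
  -- `re y = 0`, and the angle is `im y`.
  set z := ψ (φ.symm ((0 : ℝ), Complex.exp (θ * Complex.I))) with hzdef
  rw [Complex.norm_exp_ofReal_mul_I, one_mul] at h1
  have h7 := h3 rfl
  rw [Complex.arg_exp_mul_I, toIocMod_eq_self _ |>.2 ⟨h6.1, by linarith [h6.2]⟩] at h7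
  have h8 : z = ((1 : ℝ), z.2) := Prod.ext h1 rfl
  rw [h8, label_one] at h2 h7
  rw [sign_zero] at h2
  have h9 : z.2.re = 0 := sign_eq_zero_iff.1 h2.symm
  rw [h8]
  refine Prod.ext rfl (Complex.ext ?_ ?_)
  · simpa using h9
  · simpa using h7.symm

/-- In the complex case, the orbits from `p` accumulate at all points of the unstable plane
of `q`. -/
lemma NormalForm.accumulation (h : NormalForm Γ 1 c s φ ψ) (ht : t < s) :
    ∃ U₁, IsOpen U₁ ∧ Γ.carrier ⊆ U₁ ∧ ∀ U, IsOpen U → Γ.carrier ⊆ U → U ⊆ U₁ →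
      ∃ V ∈ 𝓝 Γ.q, ∀ z ∈ V, z ∈ reachSet Γ.X U Γ.q →
        z ∈ accumulationSet Γ.X U Γ.p (Γ.orbit t) := by
  have hc := h.head.pos
  obtain ⟨U₁, hU₁, hΓU₁, htrap⟩ := h.tail.exists_trap
  refine ⟨U₁, hU₁, hΓU₁, fun U hU hΓU hUU => ?_⟩
  obtain ⟨r, hr, hbox⟩ := h.tail.exists_box hU hΓU
  have hV : {z | ‖(ψ z).2‖ < r} ∈ 𝓝 Γ.q := by
    have h1 : ContinuousAt (fun z => ‖(ψ z).2‖) Γ.q :=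
      (continuousAt_snd.comp (ψ.continuousAt h.tail.base_mem)).norm
    refine h1 (gt_mem_nhds ?_)
    simp only [h.tail.base]
    simpa using hr
  refine ⟨_, hV, fun z hz hzr G hG D hD => ?_⟩
  obtain ⟨hzs, hz0⟩ := htrap U hUU z hzr
  set y := (ψ z).2 with hy
  have hyr : ‖y‖ < r := hz
  have hψz : ψ z = ((0 : ℝ), y) := Prod.ext hz0 rfl
  -- The spiral from `(1, iθ)` hits `y` at model time `τ` when `e^{(1+i)τ} iθ = y`, that is, `τ =
  -- arg(y/i)` modulo `2π` and `θ = ‖y‖ e^{-τ}`. For large `k` the starting point tends to the cut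
  -- and the end point `(e^{-τ}, y)` to the given point of the unstable plane.
  let τ : ℕ → ℝ := fun k => Complex.arg (y / Complex.I) + k * (2 * Real.pi)
  have hτ : Tendsto τ atTop atTop := tendsto_atTop_add_const_left _ _
    (tendsto_natCast_atTop_atTop.atTop_mul_const (by positivity))
  have hexp : Tendsto (fun k => Real.exp (-τ k)) atTop (𝓝 0) :=
    Real.tendsto_exp_neg_atTop_nhds_zero.comp hτ
  let θ : ℕ → ℝ := fun k => ‖y‖ * Real.exp (-τ k)
  have hθ : Tendsto θ atTop (𝓝 0) := by simpa using hexp.const_mul ‖y‖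
  have hu : Tendsto (fun θ : ℝ => Complex.exp (θ * Complex.I)) (𝓝 0) (𝓝 1) := by
    have h1 : Continuous fun θ : ℝ => Complex.exp (θ * Complex.I) := by fun_prop
    simpa using h1.tendsto 0
  have hρ : Real.exp (c * (t - s)) ∈ Icc (0 : ℝ) 1 := ⟨(Real.exp_pos _).le,
    Real.exp_le_one_iff.2 (mul_nonpos_of_nonneg_of_nonpos hc.le (by linarith))⟩
  have hwD : ∀ᶠ u in 𝓝 (1 : ℂ), φ.symm ((0 : ℝ), Real.exp (c * (t - s)) • u) ∈ D := by
    have h1 := h.head.orbit_mem t ht.le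
    have h2 : φ (Γ.orbit t) = ((0 : ℝ), Real.exp (c * (t - s)) • (1 : ℂ)) := by
      rw [h.head.orbit t ht.le]; simp
    have h3 := φ.symm.continuousAt (φ.map_source h1)
    rw [ContinuousAt, φ.left_inv h1, h2] at h3
    have h4 : Continuous fun u : ℂ => ((0 : ℝ), Real.exp (c * (t - s)) • u) := by fun_prop
    exact (h3.comp (h4.tendsto 1)).eventually hD
  have hgG : Tendsto (fun k => ψ.symm (Real.exp (-τ k), y)) atTop (𝓝 z) := by
    have h3 := ψ.symm.continuousAt (ψ.map_source hzs)
    rw [ContinuousAt, ψ.left_inv hzs, hψz] at h3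
    exact h3.comp (hexp.prodMk_nhds tendsto_const_nhds)
  obtain ⟨k, hk0, hkG, hkD, hkseg, hktr⟩ := ((hτ.eventually_gt_atTop 0).and
    ((hgG.eventually hG).and ((hθ.eventually (hu.eventually hwD)).and
      ((hθ.eventually (hu.eventually (h.head.eventually_segment hU hΓU))).and
        (hθ.eventually h.eventually_trace))))).exists
  set u := Complex.exp ((θ k : ℂ) * Complex.I) with hudef
  obtain ⟨hm1, hm2⟩ := hktr
  have hθ0 : 0 ≤ θ k := mul_nonneg (norm_nonneg _) (Real.exp_pos _).le
  have hend : Complex.exp ((1 + (1 : ℝ) * Complex.I) * τ k) * ((θ k : ℂ) * Complex.I) = y := by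
    have e1 : Complex.exp ((1 + (1 : ℝ) * Complex.I) * τ k) =
        (Real.exp (τ k) : ℂ) * Complex.exp (Complex.arg (y / Complex.I) * Complex.I) := by
      rw [Complex.ofReal_exp, ← Complex.exp_add, Complex.exp_eq_exp_iff_exists_int]
      refine ⟨k, ?_⟩
      simp only [τ]
      push_cast
      ring
    have e2 : ((θ k : ℝ) : ℂ) = (‖y / Complex.I‖ : ℂ) * (Real.exp (τ k) : ℂ)⁻¹ := by
      rw [norm_div, Complex.norm_I, div_one, ← Complex.ofReal_inv, ← Real.exp_neg,
        ← Complex.ofReal_mul]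
    have e3 : (Real.exp (τ k) : ℂ) ≠ 0 := by exact_mod_cast (Real.exp_pos (τ k)).ne'
    have e4 := Complex.norm_mul_exp_arg_mul_I (y / Complex.I)
    rw [e1, e2]
    calc _ = ((‖y / Complex.I‖ : ℂ) * Complex.exp (Complex.arg (y / Complex.I) * Complex.I)) *
          ((Real.exp (τ k) : ℂ) * (Real.exp (τ k) : ℂ)⁻¹) * Complex.I := by ring
      _ = y := by
        rw [e4, mul_inv_cancel₀ e3, mul_one, div_mul_cancel₀ _ Complex.I_ne_zero]
  -- The arc from a point near `Γ(t)` to the given point of accumulation consists of two pieces: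
  -- inside the unstable plane of the head chart up to the section, then along the spiral in the
  -- tail chart. The latter remains in the box because its modulus increases to `‖y‖ < r`.
  have hreach1 : Reach Γ.X U (φ.symm ((0 : ℝ), Real.exp (c * (t - s)) • u))
      (φ.symm ((0 : ℝ), u)) := by
    have hflow : ∀ v, modelFlow 0 (c * v) ((0 : ℝ), u) = ((0 : ℝ), Real.exp (c * v) • u) :=
      fun v => by rw [modelFlow_zero_apply, mul_zero]
    have hmem : ∀ v ∈ Icc (t - s) 0, Real.exp (c * v) ∈ Icc (0 : ℝ) 1 := fun v hv =>
      ⟨(Real.exp_pos _).le, Real.exp_le_one_iff.2 (mul_nonpos_of_nonneg_of_nonpos hc.le hv.2)⟩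
    refine ⟨fun v => φ.symm (modelFlow 0 (c * v) ((0 : ℝ), u)), t - s, 0, by linarith,
      h.head.conj.bwd _ _ _ fun v hv => ?_, fun v hv => ?_, ?_, ?_⟩
    · simp only [hflow]; exact (hkseg _ (hmem v hv)).1
    · simp only [hflow]; exact (hkseg _ (hmem v hv)).2
    · simp only [hflow]
    · simp only [hflow]; simp
  have hreach2 : Reach Γ.X U (φ.symm ((0 : ℝ), u)) (ψ.symm (Real.exp (-τ k), y)) := by
    have hflow : ∀ v, modelFlow 1 (c * v) ((1 : ℝ), (θ k : ℂ) * Complex.I) =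
        (Real.exp (-(c * v)),
          Complex.exp ((1 + (1 : ℝ) * Complex.I) * (c * v : ℝ)) * ((θ k : ℂ) * Complex.I)) :=
      fun v => by rw [modelFlow_apply]; simp
    have hend' : c * (τ k / c) = τ k := mul_div_cancel₀ _ hc.ne'
    have hin : ∀ v ∈ Icc 0 (τ k / c), modelFlow 1 (c * v) ((1 : ℝ), (θ k : ℂ) * Complex.I) ∈
        ψ.target ∧ ψ.symm (modelFlow 1 (c * v) ((1 : ℝ), (θ k : ℂ) * Complex.I)) ∈ U := by
      intro v hv
      have hcv : 0 ≤ c * v := mul_nonneg hc.le hv.1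
      have hcv' : c * v ≤ τ k := by
        rw [← hend']; exact mul_le_mul_of_nonneg_left hv.2 hc.le
      rw [hflow]
      refine hbox _ ⟨(Real.exp_pos _).le, Real.exp_le_one_iff.2 (by linarith)⟩ _ ?_
      have hn : ∀ v : ℝ, ‖Complex.exp ((1 + (1 : ℝ) * Complex.I) * (v : ℝ)) *
          ((θ k : ℂ) * Complex.I)‖ = Real.exp v * θ k := fun v => by
        rw [norm_mul, norm_mul, Complex.norm_I, mul_one, Complex.norm_real,
          Real.norm_of_nonneg hθ0, Complex.norm_exp]
        simp
      rw [hn]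
      refine lt_of_le_of_lt ?_ hyr
      rw [← hend, hn]
      exact mul_le_mul_of_nonneg_right (Real.exp_le_exp.2 hcv') hθ0
    refine ⟨fun v => ψ.symm (modelFlow 1 (c * v) ((1 : ℝ), (θ k : ℂ) * Complex.I)), 0, τ k / c,
      div_pos hk0 hc, h.tail.conj.bwd _ _ _ fun v hv => (hin v hv).1, fun v hv => (hin v hv).2,
      ?_, ?_⟩
    · simp only
      rw [mul_zero, (isFlow_modelFlow 1).zero, ← hm2, ψ.left_inv hm1]
    · simp only
      rw [hflow, hend', hend]
  refine ⟨_, hkD, ?_, _, hkG, hreach1.trans hreach2⟩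
  refine mem_reachSet_of_segment h.head.conj hc h.head.base_mem h.head.base fun ρ hρ' => ?_
  rw [smul_smul]
  exact hkseg _ ⟨mul_nonneg hρ'.1 hρ.1, mul_le_one₀ hρ'.2 hρ.1 hρ.2⟩

namespace SaddleConnection

variable {N : Type*} [TopologicalSpace N] [ChartedSpace E3 N] [IsManifold (𝓡 3) ∞ N] [T2Space N]
  {Γ' : SaddleConnection N}

lemma Generic11Real.not_topEquiv (h : Γ.Generic11Real) (h' : Γ'.Generic11Complex) :
    ¬Γ.TopEquiv Γ' := by
  obtain ⟨c, s₀, hs⟩ := h.exists_normalForm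
  obtain ⟨c', s₀', hs'⟩ := h'.exists_normalForm
  refine not_topEquiv_of_accumulation (s₀ := s₀) (s₀' := s₀') (fun t ht => ?_) fun t ht => ?_
  · obtain ⟨φ, ψ, hn⟩ := hs (t + 1) (by linarith)
    exact hn.not_accumulation (lt_add_one t)
  · obtain ⟨φ, ψ, hn⟩ := hs' (t + 1) (by linarith)
    exact hn.accumulation (lt_add_one t)

lemma Generic11Real.topEquiv (h : Γ.Generic11Real) (h' : Γ'.Generic11Real) : Γ.TopEquiv Γ' := by
  obtain ⟨c, s₀, hs⟩ := h.exists_normalForm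
  obtain ⟨c', s₀', hs'⟩ := h'.exists_normalForm
  obtain ⟨φ, ψ, hn⟩ := hs s₀ le_rfl
  obtain ⟨φ', ψ', hn'⟩ := hs' s₀' le_rfl
  exact hn.topEquiv hn'

lemma Generic11Complex.topEquiv (h : Γ.Generic11Complex) (h' : Γ'.Generic11Complex) :
    Γ.TopEquiv Γ' := by
  obtain ⟨c, s₀, hs⟩ := h.exists_normalForm
  obtain ⟨c', s₀', hs'⟩ := h'.exists_normalForm
  obtain ⟨φ, ψ, hn⟩ := hs s₀ le_rfl
  obtain ⟨φ', ψ', hn'⟩ := hs' s₀' le_rfl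
  exact hn.topEquiv hn'

/-- The classification of the generic connections of type `(1-1)`. -/
lemma Generic11.topEquiv_iff (h : Γ.Generic11) (h' : Γ'.Generic11) : Γ.TopEquiv Γ' ↔
    (Γ.Generic11Real ∧ Γ'.Generic11Real) ∨ (Γ.Generic11Complex ∧ Γ'.Generic11Complex) := by
  constructor
  · intro H
    rcases h with h | h <;> rcases h' with h' | h'
    · exact Or.inl ⟨h, h'⟩
    · exact absurd H (h.not_topEquiv h')
    · exact absurd H.symm (h'.not_topEquiv h)
    · exact Or.inr ⟨h, h'⟩
  · rintro (⟨h1, h2⟩ | ⟨h1, h2⟩)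
    · exact h1.topEquiv h2
    · exact h1.topEquiv h2

end SaddleConnection

end SaddleConn

/-! ### Time reversal and the classification for (2-2) -/

namespace SaddleConn

section Charpoly

open Polynomial

lemma charpoly_matrix_neg {n R : Type*} [CommRing R] [DecidableEq n] [Fintype n]
    (A : Matrix n n R) : (-A).charpoly = (-1) ^ Fintype.card n * A.charpoly.comp (-X) := by
  have h : (-A).charmatrix = -(A.charmatrix.map (compRingHom (-X : R[X]))) := by
    ext1 i j
    by_cases hij : i = j
    · subst hij
      simp only [Matrix.charmatrix_apply_eq, Matrix.neg_apply, Matrix.map_apply,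
        coe_compRingHom, sub_comp, X_comp, C_comp, map_neg]
      ring
    · simp only [Matrix.charmatrix_apply_ne _ _ _ hij, Matrix.neg_apply,
        Matrix.map_apply, coe_compRingHom, neg_comp, C_comp, map_neg]
  rw [Matrix.charpoly, h, Matrix.det_neg, ← RingHom.mapMatrix_apply, ← RingHom.map_det,
    coe_compRingHom_apply, Matrix.charpoly]

lemma aroots_charpoly_neg (f : E3 →ₗ[ℝ] E3) :
    (-f).charpoly.aroots ℂ = (f.charpoly.aroots ℂ).map fun z => -z := by
  set b := Module.finBasis ℝ E3
  have h : (-f).charpoly = (-1) ^ Fintype.card (Fin (Module.finrank ℝ E3)) * f.charpoly.comp (-X) := by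
    rw [← LinearMap.charpoly_toMatrix (-f) b, ← LinearMap.charpoly_toMatrix f b, map_neg,
      charpoly_matrix_neg]
  have h1 : ((-1 : ℂ[X])) ^ Fintype.card (Fin (Module.finrank ℝ E3)) =
      C ((-1) ^ Fintype.card (Fin (Module.finrank ℝ E3))) := by simp
  rw [aroots_def, aroots_def, ← roots_comp_neg_X, h, Polynomial.map_mul, Polynomial.map_pow,
    Polynomial.map_neg, Polynomial.map_one, h1, roots_C_mul _ (by simp), map_comp,
    Polynomial.map_neg, map_X]

end Charpoly

variable {M : Type*} [TopologicalSpace M] [ChartedSpace E3 M]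
variable {N : Type*} [TopologicalSpace N] [ChartedSpace E3 N]

/-- The field with reversed time. -/
def negField (X : (x : M) → TangentSpace (𝓡 3) x) : (x : M) → TangentSpace (𝓡 3) x := fun x => -X x

section NegField

variable {X : (x : M) → TangentSpace (𝓡 3) x} {Y : (x : N) → TangentSpace (𝓡 3) x}

lemma negField_negField : negField (negField X) = X := funext fun x => neg_neg (X x)

lemma linearPart_negField (p : M) : linearPart (negField X) p = -linearPart X p := by
  let F : E3 → E3 := fun y => mfderiv (𝓡 3) 𝓘(ℝ, E3) (extChartAt (𝓡 3) p)
    ((extChartAt (𝓡 3) p).symm y) (X ((extChartAt (𝓡 3) p).symm y))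
  have h : linearPart (negField X) p = fderiv ℝ (fun y => -F y) (extChartAt (𝓡 3) p p) := by
    unfold linearPart
    congr 1
    funext y
    exact map_neg _ _
  rw [h, fderiv_fun_neg]
  rfl

lemma eigenvaluesAt_negField (p : M) :
    eigenvaluesAt (negField X) p = (eigenvaluesAt X p).map fun z => -z := by
  rw [eigenvaluesAt, linearPart_negField]
  exact aroots_charpoly_neg _

lemma stableEigenvalues_negField (p : M) :
    stableEigenvalues (negField X) p = (unstableEigenvalues X p).map fun z => -z := by
  rw [stableEigenvalues, unstableEigenvalues, eigenvaluesAt_negField, Multiset.filter_map]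
  simp

lemma unstableEigenvalues_negField (p : M) :
    unstableEigenvalues (negField X) p = (stableEigenvalues X p).map fun z => -z := by
  rw [stableEigenvalues, unstableEigenvalues, eigenvaluesAt_negField, Multiset.filter_map]
  simp

lemma IsHyperbolicSaddle.negField {p : M} (h : IsHyperbolicSaddle X p) :
    IsHyperbolicSaddle (negField X) p where
  zero := by rw [SaddleConn.negField, h.zero]; exact neg_zero
  hyperbolic z hz := by
    rw [eigenvaluesAt_negField, Multiset.mem_map] at hz
    obtain ⟨w, hw, rfl⟩ := hz
    simpa using h.hyperbolic w hw
  exists_stable := by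
    rw [stableEigenvalues_negField, Ne, Multiset.map_eq_zero]; exact h.exists_unstable
  exists_unstable := by
    rw [unstableEigenvalues_negField, Ne, Multiset.map_eq_zero]; exact h.exists_stable

lemma IsHyperbolicSaddle.card_eigenvalues {p : M} (h : IsHyperbolicSaddle X p) :
    Multiset.card (stableEigenvalues X p) + Multiset.card (unstableEigenvalues X p) = 3 := by
  have h1 : unstableEigenvalues X p = (eigenvaluesAt X p).filter fun z => ¬z.re < 0 := by
    refine Multiset.filter_congr fun z hz => ?_
    have := h.hyperbolic z hz
    exact ⟨fun h => not_lt.2 h.le, fun h => (not_lt.1 h).lt_of_ne' this⟩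
  rw [stableEigenvalues, h1, ← Multiset.card_add, Multiset.filter_add_not, eigenvaluesAt,
    Polynomial.aroots_def, IsAlgClosed.card_roots_eq_natDegree, Polynomial.natDegree_map,
    LinearMap.charpoly_natDegree]
  simp

lemma IsHyperbolicSaddle.morseIndex_negField {p : M} (h : IsHyperbolicSaddle X p) {i : ℕ}
    (hi : morseIndex X p = 3 - i) (hi3 : i ≤ 3) : morseIndex (SaddleConn.negField X) p = i := by
  have := h.card_eigenvalues
  rw [morseIndex] at hi ⊢
  rw [stableEigenvalues_negField, Multiset.card_map]
  omega

lemma IsLinearizingChart.negField {p : M} {φ : OpenPartialHomeomorph M E3}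
    (h : IsLinearizingChart X p φ) : IsLinearizingChart (negField X) p φ where
  mem_source := h.mem_source
  map_base := h.map_base
  contMDiffOn := h.contMDiffOn
  contMDiffOn_symm := h.contMDiffOn_symm
  map_field x hx := by
    rw [linearPart_negField]
    exact (map_neg (coordDeriv φ x) (X x)).trans (congrArg Neg.neg (h.map_field x hx))

lemma isMIntegralCurveOn_negField {γ : ℝ → M} {S S' : Set ℝ} (h : IsMIntegralCurveOn γ X S)
    (hS : ∀ t ∈ S', -t ∈ S) : IsMIntegralCurveOn (fun t => γ (-t)) (negField X) S' := by
  have h1 := (h.comp_mul (-1)).mono (s' := S') fun t ht => by simpa using hS t ht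
  have e1 : (γ ∘ fun t : ℝ => t * -1) = fun t => γ (-t) := by funext t; simp
  have e2 : ((-1 : ℝ) • X) = negField X := by
    funext x
    exact neg_one_smul ℝ (X x)
  rwa [e1, e2] at h1

lemma unstableSet_negField (U : Set M) (p : M) :
    unstableSet (negField X) U p = stableSet X U p := by
  ext x
  constructor
  · rintro ⟨c, h0, hc, hU, hp⟩
    refine ⟨fun t => c (-t), by simpa using h0, ?_, fun t ht => hU _ (by simpa using ht),
      hp.comp tendsto_neg_atTop_atBot⟩
    have := isMIntegralCurveOn_negField (S' := Ici 0) hc fun t ht => by simpa using ht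
    rwa [negField_negField] at this
  · rintro ⟨c, h0, hc, hU, hp⟩
    exact ⟨fun t => c (-t), by simpa using h0,
      isMIntegralCurveOn_negField hc fun t ht => by simpa using ht,
      fun t ht => hU _ (by simpa using ht), hp.comp tendsto_neg_atBot_atTop⟩

lemma MapsOrbits.negField {h : OpenPartialHomeomorph M N} (H : MapsOrbits X Y h) :
    MapsOrbits (negField X) (negField Y) h := by
  intro c a b hab hc hs
  have hneg : ∀ {a b t : ℝ}, t ∈ Icc (-b) (-a) → -t ∈ Icc a b := fun ht =>
    ⟨by linarith [ht.2], by linarith [ht.1]⟩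
  have hneg' : ∀ {t : ℝ}, t ∈ Icc a b → -t ∈ Icc (-b) (-a) := fun ht =>
    ⟨by linarith [ht.2], by linarith [ht.1]⟩
  have h1 := isMIntegralCurveOn_negField (S' := Icc (-b) (-a)) hc fun t ht => hneg ht
  rw [negField_negField] at h1
  obtain ⟨d, σ, m, ct, i, ht, e⟩ := H _ (-b) (-a) (by linarith) h1 fun t ht => hs _ (hneg ht)
  have hσ : ∀ {t : ℝ}, t ∈ Icc (-σ (-a)) (-σ (-b)) → -t ∈ Icc (σ (-b)) (σ (-a)) := fun ht =>
    ⟨by linarith [ht.2], by linarith [ht.1]⟩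
  refine ⟨fun t => d (-t), fun t => -σ (-t), fun s hs t ht hst => ?_, ?_,
    isMIntegralCurveOn_negField i fun t => hσ, fun t h => ht _ (hσ h), fun t ht => ?_⟩
  · exact neg_lt_neg (m (hneg' ht) (hneg' hs) (neg_lt_neg hst))
  · exact (ct.comp continuous_neg.continuousOn fun t => hneg').neg
  · simp only [neg_neg]
    rw [← e _ (hneg' ht), neg_neg]

end NegField

lemma smoothField_negField [IsManifold (𝓡 3) ∞ M] {X : (x : M) → TangentSpace (𝓡 3) x}
    (h : SmoothField X) : SmoothField (negField X) := by
  exact h.neg_section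

namespace SaddleConnection

variable [IsManifold (𝓡 3) ∞ M] [IsManifold (𝓡 3) ∞ N]

/-- The connection for the field with reversed time. -/
def reverse (Γ : SaddleConnection M) : SaddleConnection M where
  X := negField Γ.X
  smooth := smoothField_negField Γ.smooth
  p := Γ.q
  q := Γ.p
  p_ne_q := Γ.p_ne_q.symm
  saddle_p := Γ.saddle_q.negField
  saddle_q := Γ.saddle_p.negField
  linearizable_p := Γ.linearizable_q.imp fun _ h => h.negField
  linearizable_q := Γ.linearizable_p.imp fun _ h => h.negField
  orbit t := Γ.orbit (-t)
  isMIntegralCurve := isMIntegralCurve_iff_isMIntegralCurveOn.2 (isMIntegralCurveOn_negField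
    (Γ.isMIntegralCurve.isMIntegralCurveOn univ) fun _ _ => mem_univ _)
  tendsto_p := Γ.tendsto_q.comp tendsto_neg_atBot_atTop
  tendsto_q := Γ.tendsto_p.comp tendsto_neg_atTop_atBot

variable {Γ : SaddleConnection M} {Γ' : SaddleConnection N}

lemma carrier_reverse : Γ.reverse.carrier = Γ.carrier := by
  have h : range Γ.reverse.orbit = range Γ.orbit := neg_surjective.range_comp Γ.orbit
  rw [carrier, h, carrier]

lemma topEquiv_reverse : Γ.reverse.TopEquiv Γ'.reverse ↔ Γ.TopEquiv Γ' := by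
  constructor
  · rintro ⟨h, h1, h2, h3, h4⟩
    rw [carrier_reverse] at h1 h2
    rw [carrier_reverse] at h2
    have h5 := h3.negField
    have h6 := h4.negField
    simp only [reverse, negField_negField] at h5 h6
    exact ⟨h, h1, h2, h5, h6⟩
  · rintro ⟨h, h1, h2, h3, h4⟩
    exact ⟨h, by rwa [carrier_reverse], by rwa [carrier_reverse, carrier_reverse], h3.negField,
      h4.negField⟩

lemma HasType.reverse (h : Γ.HasType 2 2) : Γ.reverse.HasType 1 1 :=
  ⟨Γ.saddle_q.morseIndex_negField h.2 (by norm_num),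
    Γ.saddle_p.morseIndex_negField h.1 (by norm_num)⟩

lemma unstableTangent_reverse (x : M) : Γ.reverse.unstableTangent x = Γ.stableTangent x := by
  ext v
  simp only [unstableTangent, stableTangent, carrier_reverse]
  simp only [reverse, unstableSet_negField]

lemma planeF_reverse (μ : ℝ) : Γ.reverse.planeF μ = Γ.planeE (-μ) := by
  have h : ∀ ν : ℝ, Module.End.eigenspace (linearPart Γ.reverse.X Γ.reverse.q : E3 →ₗ[ℝ] E3) ν =
      Module.End.eigenspace (linearPart Γ.X Γ.p : E3 →ₗ[ℝ] E3) (-ν) := fun ν => by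
    ext v
    simp only [reverse, linearPart_negField, Module.End.mem_eigenspace_iff,
      ContinuousLinearMap.coe_coe, _root_.neg_apply, neg_smul]
    exact neg_eq_iff_eq_neg
  rw [planeF, planeE, h μ]
  congr 1
  refine le_antisymm (iSup_le fun ν => ?_) (iSup_le fun ν => ?_)
  · rw [h ν]
    exact le_iSup_of_le ⟨-ν, neg_pos.2 ν.2⟩ le_rfl
  · refine le_iSup_of_le ⟨-ν, neg_neg_of_pos ν.2⟩ ?_
    rw [h, neg_neg]

lemma Generic22Complex.reverse (h : Γ.Generic22Complex) : Γ.reverse.Generic11Complex := by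
  refine ⟨h.1.reverse, fun z hz => ?_⟩
  have e : unstableEigenvalues Γ.reverse.X Γ.reverse.q = _ := unstableEigenvalues_negField Γ.p
  rw [e, Multiset.mem_map] at hz
  obtain ⟨w, hw, rfl⟩ := hz
  simpa using h.2 w hw

lemma Generic22Real.reverse (h : Γ.Generic22Real) : Γ.reverse.Generic11Real := by
  have e : unstableEigenvalues Γ.reverse.X Γ.reverse.q = _ := unstableEigenvalues_negField Γ.p
  obtain ⟨h1, h2, h3, φ, h4, h5⟩ := h
  refine ⟨h1.reverse, fun z hz => ?_, ?_, φ, h4.negField, fun μ hμ => ?_⟩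
  · rw [e, Multiset.mem_map] at hz
    obtain ⟨w, hw, rfl⟩ := hz
    simpa using h2 w hw
  · rw [e]
    exact h3.map neg_injective
  · rw [e, Multiset.mem_map] at hμ
    obtain ⟨w, hw, hwμ⟩ := hμ
    have hw' : ((-μ : ℝ) : ℂ) ∈ stableEigenvalues Γ.X Γ.p := by
      rw [Complex.ofReal_neg, ← hwμ, neg_neg]; exact hw
    have h6 := tendsto_neg_atTop_atBot.eventually (h5 _ hw')
    rw [UnstableTransverse, planeF_reverse]
    filter_upwards [h6] with t ht
    rw [unstableTangent_reverse]
    exact ht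

variable [T2Space M] [T2Space N]

/-- The classification of the generic connections of type `(2-2)`. -/
lemma Generic22.topEquiv_iff (h : Γ.Generic22) (h' : Γ'.Generic22) : Γ.TopEquiv Γ' ↔
    (Γ.Generic22Real ∧ Γ'.Generic22Real) ∨ (Γ.Generic22Complex ∧ Γ'.Generic22Complex) := by
  rw [← topEquiv_reverse]
  constructor
  · intro H
    rcases h with h | h <;> rcases h' with h' | h'
    · exact Or.inl ⟨h, h'⟩
    · exact absurd H (h.reverse.not_topEquiv h'.reverse)
    · exact absurd H.symm (h'.reverse.not_topEquiv h.reverse)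
    · exact Or.inr ⟨h, h'⟩
  · rintro (⟨h1, h2⟩ | ⟨h1, h2⟩)
    · exact h1.reverse.topEquiv h2.reverse
    · exact h1.reverse.topEquiv h2.reverse

end SaddleConnection

end SaddleConn

end

theorem theorem2
    {M : Type*} [TopologicalSpace M] [T2Space M] [ChartedSpace SaddleConn.E3 M]
    [IsManifold (𝓡 3) ∞ M]
    {N : Type*} [TopologicalSpace N] [T2Space N] [ChartedSpace SaddleConn.E3 N]
    [IsManifold (𝓡 3) ∞ N]
    (Γ : SaddleConn.SaddleConnection M) (Γ' : SaddleConn.SaddleConnection N) :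
    (Γ.Generic11 → Γ'.Generic11 →
      (Γ.TopEquiv Γ' ↔
        (Γ.Generic11Real ∧ Γ'.Generic11Real) ∨ (Γ.Generic11Complex ∧ Γ'.Generic11Complex))) ∧
    (Γ.Generic22 → Γ'.Generic22 →
      (Γ.TopEquiv Γ' ↔
        (Γ.Generic22Real ∧ Γ'.Generic22Real) ∨ (Γ.Generic22Complex ∧ Γ'.Generic22Complex))) := by
  exact ⟨fun h h' => h.topEquiv_iff h', fun h h' => h.topEquiv_iff h'⟩
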